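/- **Theorem (Trace operator in $H^{1/2}(\Omega)$).** Let $N\ge 2$ and let $\Omega\subset\mathbb{R}^N$ be a bounded Lipschitz domain, i.e. a bounded open set (connectedness is not needed) lying, near each point of its boundary $\Gamma$ and in suitable orthonormal coordinates, on one side of the graph of a Lipschitz function. All functions are real valued. Let $$H^{1/2}(\Omega)=\Big\{v\in L^2(\Omega):\ \iint_{\Omega\times\Omega}\frac{|v(x)-v(y)|^2}{|x-y|^{N+1}}\,dx\,dy<\infty\Big\},\qquad \|v\|_{H^{1/2}(\Omega)}^2=\|v\|_{L^2(\Omega)}^2+\iint_{\Omega\times\Omega}\frac{|v(x)-v(y)|^2}{|x-y|^{N+1}}\,dx\,dy,$$ let $[H^{1/2}(\Omega)]'$ be its dual space, and, with $\varrho(x)=\operatorname{dist}(x,\Gamma)$, let $$H^{1/2}_{00}(\Omega)=\{v\in H^{1/2}(\Omega):\ \varrho^{-1/2}v\in L^2(\Omega)\}.$$ Let $$E(\nabla;\Omega)=\{v\in H^{1/2}(\Omega):\ \nabla v\in[\mathbf H^{1/2}(\Omega)]'\},\qquad \|v\|_{E(\nabla;\Omega)}=\|v\|_{H^{1/2}(\Omega)}+\sum_{i=1}^N\|\partial_i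 v\|_{[H^{1/2}(\Omega)]'},$$ where $\partial_i v\in[H^{1/2}(\Omega)]'$ means that there is $F\in[H^{1/2}(\Omega)]'$ with $\langle F,\varphi\rangle=-\int_\Omega v\,\partial_i\varphi$ for all $\varphi\in\mathscr D(\Omega)=C_c^\infty(\Omega)$, and $\|\partial_i v\|_{[H^{1/2}(\Omega)]'}$ is the (smallest) norm of such an $F$. Let $\mathscr D(\overline\Omega)$ be the space of restrictions to $\overline\Omega$ of functions of $C_c^\infty(\mathbb{R}^N)$, and let $L^2(\Gamma)$ be taken with respect to the surface measure ($(N-1)$-dimensional Hausdorff measure) on $\Gamma$. i) $\mathscr D(\overline\Omega)\subset E(\nabla;\Omega)$, and the linear mapping $u\mapsto u_{|\Gamma}$ on $\mathscr D(\overline\Omega)$ extends by continuity, that is, it has a unique continuous linear extension $$\gamma_0:\ E(\nabla;\Omega)\longrightarrow L^2(\Gamma).$$ ii) The kernel of $\gamma_0$ is equal to $H^{1/2}_{00}(\Omega)$. In particular, every $v\in H^{1/2}_{00}(\Omega)$ belongs to $E(\nabla;\Omega)$ and satisfies $v=0$ in $L^2(\Gamma)$, i.e. $\gamma_0 v=0$.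 -/

import Mathlib

open MeasureTheory Set TopologicalSpace
open scoped ENNReal NNReal Distributions ContDiff

noncomputable section

namespace HalfTrace

/-- The space `ℝ^N` with its Euclidean norm and Lebesgue measure. -/
abbrev Space (N : ℕ) : Type := EuclideanSpace ℝ (Fin N)

/-! ### Bounded Lipschitz domains -/

/-- A bounded open set whose boundary is locally the graph of a Lipschitz function, the set lying
locally on one side of it: near each boundary point there are a unit vector `ν` (the vertical
direction) and a Lipschitz function `ψ` on the hyperplane orthogonal to `ν` such that
the set is `{x | ψ x' < x_ν}`, where `x'` is the projection of `x` on the hyperplane and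
`x_ν = ⟪ν, x⟫`. -/
def IsBoundedLipschitzDomain {N : ℕ} (Ω : Opens (Space N)) : Prop :=
  Bornology.IsBounded (Ω : Set (Space N)) ∧
    ∀ p ∈ frontier (Ω : Set (Space N)), ∃ r : ℝ, 0 < r ∧ ∃ ν : Space N, ‖ν‖ = 1 ∧
      ∃ ψ : (Submodule.span ℝ {ν})ᗮ → ℝ, (∃ K : ℝ≥0, LipschitzWith K ψ) ∧
        ∀ x ∈ Metric.ball p r,
          x ∈ Ω ↔ ψ ((Submodule.span ℝ {ν})ᗮ.orthogonalProjectionOnto x) < inner ℝ ν x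

/-- Lebesgue measure on `Ω`. -/
abbrev vol {N : ℕ} (Ω : Opens (Space N)) : Measure (Space N) :=
  volume.restrict (Ω : Set (Space N))

/-- Surface measure on the boundary of `Ω`: the `(N-1)`-dimensional Hausdorff measure, normalised
as Euclidean area. -/
def surface {N : ℕ} (Ω : Opens (Space N)) : Measure (Space N) :=
  (Measure.euclideanHausdorffMeasure (N - 1) : Measure (Space N)).restrict
    (frontier (Ω : Set (Space N)))

/-- `L²(Γ)`, where `Γ` is the boundary of `Ω`. -/
abbrev L2Boundary {N : ℕ} (Ω : Opens (Space N)) : Type := Lp ℝ 2 (surface Ω)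

/-! ### The space `H^{1/2}(Ω)` -/

/-- The difference quotient `(v x - v y) / |x - y|^{(N+1)/2}`, whose square is the integrand
`|v x - v y|² / |x - y|^{N+1}` of the Gagliardo-Slobodeckij seminorm of order `1/2`. -/
def diffQuot {N : ℕ} (v : Space N → ℝ) (p : Space N × Space N) : ℝ :=
  (v p.1 - v p.2) / ‖p.1 - p.2‖ ^ (((N : ℝ) + 1) / 2)

lemma diffQuot_congr {N : ℕ} (Ω : Opens (Space N)) {f g : Space N → ℝ} (h : f =ᵐ[vol Ω] g) :
    diffQuot f =ᵐ[(vol Ω).prod (vol Ω)] diffQuot g := by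
  have h1 : ∀ᵐ p ∂((vol Ω).prod (vol Ω)), f p.1 = g p.1 :=
    Measure.quasiMeasurePreserving_fst.ae h
  have h2 : ∀ᵐ p ∂((vol Ω).prod (vol Ω)), f p.2 = g p.2 :=
    Measure.quasiMeasurePreserving_snd.ae h
  filter_upwards [h1, h2] with p hp1 hp2
  simp [diffQuot, hp1, hp2]

/-- The space `H^{1/2}(Ω)` of the `v ∈ L²(Ω)` with
`∬_{Ω×Ω} |v x - v y|² / |x - y|^{N+1} dx dy < ∞`. It is realised as the graph of `v ↦ diffQuot v`
in `L²(Ω) × L²(Ω × Ω)`, so that it carries the norm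
`(‖v‖²_{L²(Ω)} + ∬ |v x - v y|² / |x - y|^{N+1} dx dy)^{1/2}`. -/
def HHalf {N : ℕ} (Ω : Opens (Space N)) :
    Submodule ℝ (WithLp 2 (Lp ℝ 2 (vol Ω) × Lp ℝ 2 ((vol Ω).prod (vol Ω)))) where
  carrier := {w | w.snd =ᵐ[(vol Ω).prod (vol Ω)] diffQuot w.fst}
  zero_mem' := by
    have h1 := diffQuot_congr Ω (Lp.coeFn_zero ℝ 2 (vol Ω))
    have h2 := Lp.coeFn_zero ℝ 2 ((vol Ω).prod (vol Ω))
    simp only [mem_ofPred_eq, WithLp.zero_snd, WithLp.zero_fst]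
    filter_upwards [h1, h2] with p hp1 hp2
    rw [hp1, hp2]
    simp [diffQuot]
  add_mem' := by
    intro a b ha hb
    have h1 := diffQuot_congr Ω (Lp.coeFn_add a.fst b.fst)
    have h2 := Lp.coeFn_add a.snd b.snd
    simp only [mem_ofPred_eq, WithLp.add_snd, WithLp.add_fst] at *
    filter_upwards [h1, h2, ha, hb] with p hp1 hp2 hpa hpb
    rw [hp1, hp2, Pi.add_apply, hpa, hpb]
    simp only [diffQuot, Pi.add_apply]
    ring
  smul_mem' := by
    intro c a ha
    have h1 := diffQuot_congr Ω (Lp.coeFn_smul c a.fst)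
    have h2 := Lp.coeFn_smul c a.snd
    simp only [mem_ofPred_eq, WithLp.smul_snd, WithLp.smul_fst] at *
    filter_upwards [h1, h2, ha] with p hp1 hp2 hpa
    rw [hp1, hp2, Pi.smul_apply, hpa]
    simp only [diffQuot, Pi.smul_apply, smul_eq_mul]
    ring

/-- The element of `L²(Ω)` underlying an element of `H^{1/2}(Ω)`. -/
def toL2 {N : ℕ} {Ω : Opens (Space N)} (v : HHalf Ω) : Lp ℝ 2 (vol Ω) :=
  (v : WithLp 2 (Lp ℝ 2 (vol Ω) × Lp ℝ 2 ((vol Ω).prod (vol Ω)))).fst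

/-- Membership of a function of `L²(Ω)` in `H^{1/2}(Ω)`. -/
def mkHHalf {N : ℕ} (Ω : Opens (Space N)) (f : Space N → ℝ) (hf : MemLp f 2 (vol Ω))
    (hq : MemLp (diffQuot f) 2 ((vol Ω).prod (vol Ω))) : HHalf Ω :=
  ⟨WithLp.toLp 2 (hf.toLp f, hq.toLp (diffQuot f)), by
    change hq.toLp (diffQuot f) =ᵐ[(vol Ω).prod (vol Ω)] diffQuot (hf.toLp f)
    exact hq.coeFn_toLp.trans (diffQuot_congr Ω hf.coeFn_toLp.symm)⟩

lemma toL2_mkHHalf {N : ℕ} (Ω : Opens (Space N)) (f : Space N → ℝ) (hf : MemLp f 2 (vol Ω))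
    (hq : MemLp (diffQuot f) 2 ((vol Ω).prod (vol Ω))) :
    toL2 (mkHHalf Ω f hf hq) =ᵐ[vol Ω] f := hf.coeFn_toLp

/-- An element of `H^{1/2}(Ω)` is determined by the function. -/
lemma toL2_injective {N : ℕ} {Ω : Opens (Space N)} :
    Function.Injective (toL2 : HHalf Ω → Lp ℝ 2 (vol Ω)) := by
  rintro ⟨a, ha⟩ ⟨b, hb⟩ h
  have h' : a.fst = b.fst := h
  apply Subtype.ext
  apply WithLp.ofLp_injective
  refine Prod.ext h' (Lp.ext ?_)
  change a.snd =ᵐ[_] diffQuot a.fst at ha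
  change b.snd =ᵐ[_] diffQuot b.fst at hb
  rw [← h'] at hb
  exact ha.trans hb.symm

/-! ### Smooth functions belong to `H^{1/2}(Ω)` -/

lemma integrable_kernel {N : ℕ} (hN : N ≠ 0) :
    Integrable (fun z : Space N ↦ (‖z‖ ^ (N - 1))⁻¹ * ((1 + ‖z‖) ^ 2)⁻¹) := by
  have : Nontrivial (Space N) := by
    have : Nonempty (Fin N) := ⟨⟨0, Nat.pos_of_ne_zero hN⟩⟩
    infer_instance
  rw [integrable_fun_norm_addHaar volume (f := fun t ↦ (t ^ (N - 1))⁻¹ * ((1 + t) ^ 2)⁻¹)]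
  have h : IntegrableOn (fun t : ℝ ↦ ((1 + t) ^ 2)⁻¹) (Ioi 0) := by
    have h1 : Integrable (fun t : ℝ ↦ (1 + ‖t‖) ^ (-(2 : ℝ))) :=
      integrable_one_add_norm (by simp)
    refine h1.integrableOn.congr_fun (fun t ht ↦ ?_) measurableSet_Ioi
    have ht : (0 : ℝ) < t := ht
    simp only [Real.norm_eq_abs, abs_of_pos ht]
    rw [Real.rpow_neg (by positivity)]
    norm_cast
  refine h.congr_fun (fun t ht ↦ ?_) measurableSet_Ioi
  have ht : (0 : ℝ) < t := ht
  simp only [finrank_euclideanSpace, Fintype.card_fin, smul_eq_mul]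
  field_simp

lemma memLp_diffQuot {N : ℕ} (Ω : Opens (Space N)) {f : Space N → ℝ} (hf : ContDiff ℝ ∞ f)
    (hc : HasCompactSupport f) : MemLp (diffQuot f) 2 ((vol Ω).prod (vol Ω)) := by
  have hcont : Continuous f := hf.continuous
  have hmeas : Measurable (diffQuot f) := by
    unfold diffQuot
    have := hcont.measurable
    fun_prop
  rw [Measure.prod_restrict]
  apply MemLp.restrict
  rcases Nat.eq_zero_or_pos N with rfl | hN
  · have : diffQuot f = 0 := by
      funext p
      simp [diffQuot, Subsingleton.elim p.1 p.2]
    rw [this]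
    exact MemLp.zero
  obtain ⟨M, hM⟩ := hcont.bounded_above_of_compact_support hc
  obtain ⟨L, hL⟩ := ContDiff.lipschitzWith_of_hasCompactSupport hc hf (by simp)
  have hM0 : 0 ≤ M := (norm_nonneg _).trans (hM 0)
  set K := tsupport f with hK
  have hKc : IsCompact K := hc
  let k : Space N → ℝ := fun z ↦ (‖z‖ ^ (N - 1))⁻¹ * ((1 + ‖z‖) ^ 2)⁻¹
  have hk : Integrable k := integrable_kernel hN.ne'
  let ι : Space N → ℝ := K.indicator 1
  have hι : Integrable ι :=
    (integrableOn_const (by exact hKc.measure_lt_top.ne)).integrable_indicator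
      hKc.isClosed.measurableSet
  have hG1 : Integrable (fun p : Space N × Space N ↦ ι p.2 * k (p.1 - p.2))
      (volume.prod volume) :=
    hι.convolution_integrand (ContinuousLinearMap.mul ℝ ℝ) hk
  have hG2 : Integrable (fun p : Space N × Space N ↦ ι p.1 * k (p.1 - p.2))
      (volume.prod volume) := by
    refine hG1.swap.congr (Filter.Eventually.of_forall fun p ↦ ?_)
    simp [k, norm_sub_rev]
  rw [memLp_two_iff_integrable_sq hmeas.aestronglyMeasurable]
  refine Integrable.mono' ((hG1.add hG2).const_mul (4 * (L : ℝ) ^ 2 + 16 * M ^ 2))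
    (hmeas.pow_const 2).aestronglyMeasurable (Filter.Eventually.of_forall fun p ↦ ?_)
  obtain ⟨x, y⟩ := p
  simp only [Pi.add_apply, Real.norm_eq_abs, abs_sq]
  have hk0 : ∀ z, 0 ≤ k z := fun z ↦ by positivity
  have hι0 : ∀ z, 0 ≤ ι z := fun z ↦ indicator_nonneg (fun _ _ ↦ zero_le_one) _
  have hC : 0 ≤ 4 * (L : ℝ) ^ 2 + 16 * M ^ 2 := by positivity
  by_cases hxy : x = y
  · subst hxy
    simp only [diffQuot, sub_self, zero_div, ne_eq, OfNat.ofNat_ne_zero, not_false_eq_true,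
      zero_pow]
    have := mul_nonneg (hι0 x) (hk0 (x - x))
    rw [sub_self] at this
    positivity
  have ht : 0 < ‖x - y‖ := norm_pos_iff.2 (sub_ne_zero.2 hxy)
  by_cases hsupp : x ∉ K ∧ y ∉ K
  · have h1 : f x = 0 := image_eq_zero_of_notMem_tsupport hsupp.1
    have h2 : f y = 0 := image_eq_zero_of_notMem_tsupport hsupp.2
    simp only [diffQuot, h1, h2, sub_self, zero_div, ne_eq, OfNat.ofNat_ne_zero,
      not_false_eq_true, zero_pow]
    exact mul_nonneg hC (add_nonneg (mul_nonneg (hι0 _) (hk0 _)) (mul_nonneg (hι0 _) (hk0 _)))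
  have hone : k (x - y) ≤ ι y * k (x - y) + ι x * k (x - y) := by
    have : 1 ≤ ι y + ι x := by
      by_cases hx : x ∈ K
      · have : ι x = 1 := by simp [ι, hx]
        linarith [hι0 y]
      · have hy : y ∈ K := by tauto
        have : ι y = 1 := by simp [ι, hy]
        linarith [hι0 x]
    nlinarith [hk0 (x - y)]
  refine le_trans ?_ (mul_le_mul_of_nonneg_left hone hC)
  set t := ‖x - y‖ with ht_def
  have hsq : (t ^ (((N : ℝ) + 1) / 2)) ^ 2 = t ^ (N - 1) * t ^ 2 := by
    rw [← pow_add, ← Real.rpow_natCast (t ^ _) 2, ← Real.rpow_mul ht.le, ← Real.rpow_natCast t]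
    congr 1
    have : N - 1 + 2 = N + 1 := by omega
    rw [this]
    push_cast
    ring
  have hd1 : (f x - f y) ^ 2 ≤ (L : ℝ) ^ 2 * t ^ 2 := by
    have := hL.dist_le_mul x y
    rw [Real.dist_eq, dist_eq_norm] at this
    rw [← sq_abs, ← mul_pow]
    gcongr
  have hd2 : (f x - f y) ^ 2 ≤ 4 * M ^ 2 := by
    have h1 := abs_le.1 (hM x)
    have h2 := abs_le.1 (hM y)
    nlinarith [h1.1, h1.2, h2.1, h2.2]
  have hkey : (f x - f y) ^ 2 * (1 + t) ^ 2 ≤ (4 * (L : ℝ) ^ 2 + 16 * M ^ 2) * t ^ 2 := by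
    rcases le_total t 1 with h | h
    · have h4 : (1 + t) ^ 2 ≤ 4 := by nlinarith
      calc (f x - f y) ^ 2 * (1 + t) ^ 2 ≤ ((L : ℝ) ^ 2 * t ^ 2) * 4 := by gcongr
        _ ≤ _ := by nlinarith [mul_nonneg (sq_nonneg M) (sq_nonneg t)]
    · have h4 : (1 + t) ^ 2 ≤ 4 * t ^ 2 := by nlinarith
      calc (f x - f y) ^ 2 * (1 + t) ^ 2 ≤ (4 * M ^ 2) * (4 * t ^ 2) := by gcongr
        _ ≤ _ := by nlinarith [mul_nonneg (sq_nonneg (L : ℝ)) (sq_nonneg t)]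
  simp only [diffQuot, k]
  rw [div_pow, hsq, ← mul_inv, ← div_eq_mul_inv, div_le_div_iff₀ (by positivity) (by positivity)]
  have := mul_le_mul_of_nonneg_left hkey (pow_nonneg ht.le (N - 1))
  nlinarith [this]

/-- The element of `H^{1/2}(Ω)` given by the restriction to `Ω` of a smooth compactly supported
function on `ℝ^N`. -/
def smoothHHalf {N : ℕ} (Ω : Opens (Space N)) (f : Space N → ℝ) (hf : ContDiff ℝ ∞ f)
    (hc : HasCompactSupport f) : HHalf Ω :=
  mkHHalf Ω f ((hf.continuous.memLp_of_hasCompactSupport hc).restrict _) (memLp_diffQuot Ω hf hc)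

/-- The inclusion of `𝓓(Ω)` in `H^{1/2}(Ω)`. -/
def testHHalf {N : ℕ} {Ω : Opens (Space N)} (φ : 𝓓(Ω, ℝ)) : HHalf Ω :=
  smoothHHalf Ω φ φ.contDiff φ.hasCompactSupport

/-- The restriction map from `𝓓(ℝ^N)` to `H^{1/2}(Ω)`. Its range is `𝓓(Ω̄)`, seen in
`H^{1/2}(Ω)`. -/
def restrictHHalf {N : ℕ} (Ω : Opens (Space N)) (u : 𝓓((⊤ : Opens (Space N)), ℝ)) : HHalf Ω :=
  smoothHHalf Ω u u.contDiff u.hasCompactSupport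

/-! ### The space `H^{1/2}_{00}(Ω)` -/

/-- The space `H^{1/2}_{00}(Ω)` of the `v ∈ H^{1/2}(Ω)` with `v / √ϱ ∈ L²(Ω)`, where `ϱ` is the
distance to the boundary. -/
def HHalf00 {N : ℕ} (Ω : Opens (Space N)) : Submodule ℝ (HHalf Ω) where
  carrier := {v | MemLp (fun x ↦ toL2 v x / √(Metric.infDist x (frontier (Ω : Set (Space N))))) 2
    (vol Ω)}
  zero_mem' := by
    refine (MemLp.zero (p := 2) (μ := vol Ω) (ε := ℝ)).ae_eq ?_
    filter_upwards [Lp.coeFn_zero ℝ 2 (vol Ω)] with x hx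
    have : toL2 (0 : HHalf Ω) x = 0 := hx
    simp [this]
  add_mem' := by
    intro a b ha hb
    refine (MemLp.add ha hb).ae_eq ?_
    filter_upwards [Lp.coeFn_add (toL2 a) (toL2 b)] with x hx
    have : toL2 (a + b) x = toL2 a x + toL2 b x := hx
    simp [this, add_div]
  smul_mem' := by
    intro c a ha
    refine (MemLp.const_smul ha c).ae_eq ?_
    filter_upwards [Lp.coeFn_smul c (toL2 a)] with x hx
    have : toL2 (c • a) x = c * toL2 a x := hx
    simp [this, mul_div_assoc]

/-! ### The space `E(∇; Ω)` -/

/-- The functional `F ∈ [H^{1/2}(Ω)]'` represents the distributional derivative `∂ᵢ v`, that is,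
`⟨F, φ⟩ = - ∫_Ω v ∂ᵢφ` for all `φ ∈ 𝓓(Ω)`. -/
def IsDualDeriv {N : ℕ} {Ω : Opens (Space N)} (v : HHalf Ω) (i : Fin N)
    (F : StrongDual ℝ (HHalf Ω)) : Prop :=
  ∀ φ : 𝓓(Ω, ℝ), F (testHHalf φ) =
    - ∫ x in (Ω : Set (Space N)), toL2 v x * fderiv ℝ φ x (EuclideanSpace.single i 1)

lemma integrable_mul_fderiv {N : ℕ} {Ω : Opens (Space N)} (v : HHalf Ω) (i : Fin N)
    (φ : 𝓓(Ω, ℝ)) :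
    Integrable (fun x ↦ toL2 v x * fderiv ℝ φ x (EuclideanSpace.single i 1)) (vol Ω) := by
  have h1 : Continuous fun x ↦ fderiv ℝ φ x (EuclideanSpace.single i (1 : ℝ)) :=
    (φ.contDiff.continuous_fderiv (by simp)).clm_apply continuous_const
  have h2 : HasCompactSupport fun x ↦ fderiv ℝ φ x (EuclideanSpace.single i (1 : ℝ)) :=
    φ.hasCompactSupport.fderiv_apply ℝ _
  have h3 : MemLp (fun x ↦ fderiv ℝ φ x (EuclideanSpace.single i (1 : ℝ))) 2 (vol Ω) :=
    (h1.memLp_of_hasCompactSupport h2).restrict _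
  exact (Lp.memLp (toL2 v)).integrable_mul h3

lemma IsDualDeriv.zero {N : ℕ} {Ω : Opens (Space N)} (i : Fin N) :
    IsDualDeriv (0 : HHalf Ω) i 0 := by
  intro φ
  rw [integral_eq_zero_of_ae]
  · simp
  · filter_upwards [Lp.coeFn_zero ℝ 2 (vol Ω)] with x hx
    have : toL2 (0 : HHalf Ω) x = 0 := hx
    simp [this]

lemma IsDualDeriv.add {N : ℕ} {Ω : Opens (Space N)} {v w : HHalf Ω} {i : Fin N}
    {F G : StrongDual ℝ (HHalf Ω)} (hF : IsDualDeriv v i F) (hG : IsDualDeriv w i G) :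
    IsDualDeriv (v + w) i (F + G) := by
  intro φ
  rw [_root_.add_apply, hF φ, hG φ, ← neg_add,
    ← integral_add (integrable_mul_fderiv v i φ) (integrable_mul_fderiv w i φ)]
  congr 1
  refine integral_congr_ae ?_
  filter_upwards [Lp.coeFn_add (toL2 v) (toL2 w)] with x hx
  have : toL2 (v + w) x = toL2 v x + toL2 w x := hx
  rw [this, add_mul]

lemma IsDualDeriv.smul {N : ℕ} {Ω : Opens (Space N)} (c : ℝ) {v : HHalf Ω} {i : Fin N}
    {F : StrongDual ℝ (HHalf Ω)} (hF : IsDualDeriv v i F) : IsDualDeriv (c • v) i (c • F) := by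
  intro φ
  rw [_root_.smul_apply, hF φ, smul_eq_mul, mul_neg, ← integral_const_mul]
  congr 1
  refine integral_congr_ae ?_
  filter_upwards [Lp.coeFn_smul c (toL2 v)] with x hx
  have : toL2 (c • v) x = c * toL2 v x := hx
  rw [this, mul_assoc]

/-- The vector space `E(∇; Ω) = {v ∈ H^{1/2}(Ω) | ∇v ∈ [H^{1/2}(Ω)^N]'}`. -/
def EGradSub {N : ℕ} (Ω : Opens (Space N)) : Submodule ℝ (HHalf Ω) where
  carrier := {v | ∀ i : Fin N, ∃ F : StrongDual ℝ (HHalf Ω), IsDualDeriv v i F}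
  zero_mem' := fun i ↦ ⟨0, .zero i⟩
  add_mem' := fun ha hb i ↦ by
    obtain ⟨F, hF⟩ := ha i
    obtain ⟨G, hG⟩ := hb i
    exact ⟨F + G, hF.add hG⟩
  smul_mem' := fun c a ha i ↦ by
    obtain ⟨F, hF⟩ := ha i
    exact ⟨c • F, hF.smul c⟩

/-- The norm of `∂ᵢ v` in `[H^{1/2}(Ω)]'`, for `v ∈ E(∇; Ω)`. (The infimum makes sense of it on
every open set. Where `𝓓(Ω)` is dense in `H^{1/2}(Ω)`, as for bounded Lipschitz domains, there is
exactly one `F`.) -/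
def dualDerivNorm {N : ℕ} {Ω : Opens (Space N)} (v : HHalf Ω) (i : Fin N) : ℝ :=
  sInf {c : ℝ | ∃ F : StrongDual ℝ (HHalf Ω), IsDualDeriv v i F ∧ c = ‖F‖}

lemma dualDerivNorm_nonneg {N : ℕ} {Ω : Opens (Space N)} (v : HHalf Ω) (i : Fin N) :
    0 ≤ dualDerivNorm v i := by
  apply Real.sInf_nonneg
  rintro _ ⟨F, -, rfl⟩
  exact norm_nonneg F

lemma dualDerivNorm_le {N : ℕ} {Ω : Opens (Space N)} {v : HHalf Ω} {i : Fin N}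
    {F : StrongDual ℝ (HHalf Ω)} (hF : IsDualDeriv v i F) : dualDerivNorm v i ≤ ‖F‖ := by
  refine csInf_le ⟨0, ?_⟩ ⟨F, hF, rfl⟩
  rintro _ ⟨F, -, rfl⟩
  exact norm_nonneg F

lemma exists_lt_dualDerivNorm {N : ℕ} {Ω : Opens (Space N)} {v : HHalf Ω} (hv : v ∈ EGradSub Ω)
    (i : Fin N) {ε : ℝ} (hε : 0 < ε) :
    ∃ F : StrongDual ℝ (HHalf Ω), IsDualDeriv v i F ∧ ‖F‖ < dualDerivNorm v i + ε := by
  obtain ⟨F₀, hF₀⟩ := hv i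
  obtain ⟨_, ⟨F, hF, rfl⟩, hlt⟩ :=
    Real.lt_sInf_add_pos (s := {c : ℝ | ∃ F : StrongDual ℝ (HHalf Ω), IsDualDeriv v i F ∧ c = ‖F‖})
      ⟨_, F₀, hF₀, rfl⟩ hε
  exact ⟨F, hF, hlt⟩

lemma dualDerivNorm_add_le {N : ℕ} {Ω : Opens (Space N)} {v w : HHalf Ω} (hv : v ∈ EGradSub Ω)
    (hw : w ∈ EGradSub Ω) (i : Fin N) :
    dualDerivNorm (v + w) i ≤ dualDerivNorm v i + dualDerivNorm w i := by
  refine le_of_forall_pos_le_add fun ε hε ↦ ?_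
  obtain ⟨F, hF, hF'⟩ := exists_lt_dualDerivNorm hv i (half_pos hε)
  obtain ⟨G, hG, hG'⟩ := exists_lt_dualDerivNorm hw i (half_pos hε)
  linarith [dualDerivNorm_le (hF.add hG), norm_add_le F G]

lemma dualDerivNorm_smul_le {N : ℕ} {Ω : Opens (Space N)} (c : ℝ) {v : HHalf Ω}
    (hv : v ∈ EGradSub Ω) (i : Fin N) : dualDerivNorm (c • v) i ≤ ‖c‖ * dualDerivNorm v i := by
  refine le_of_forall_pos_le_add fun ε hε ↦ ?_
  have hc : 0 < ‖c‖ + 1 := by positivity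
  obtain ⟨F, hF, hF'⟩ := exists_lt_dualDerivNorm hv i (div_pos hε hc)
  have h1 := dualDerivNorm_le (hF.smul c)
  have h0 : ‖c • F‖ ≤ ‖c‖ * ‖F‖ := ContinuousLinearMap.opNorm_smul_le c F
  have h2 : ‖c‖ * ‖F‖ ≤ ‖c‖ * (dualDerivNorm v i + ε / (‖c‖ + 1)) := by gcongr
  have h3 : ‖c‖ * (ε / (‖c‖ + 1)) ≤ ε := by
    rw [mul_div_assoc', div_le_iff₀ hc]
    nlinarith
  linarith [h0, mul_add ‖c‖ (dualDerivNorm v i) (ε / (‖c‖ + 1))]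

/-- The space `E(∇; Ω)`, to be equipped with its graph norm. -/
def EGrad {N : ℕ} (Ω : Opens (Space N)) : Type := ↥(EGradSub Ω)

instance {N : ℕ} (Ω : Opens (Space N)) : AddCommGroup (EGrad Ω) :=
  inferInstanceAs (AddCommGroup ↥(EGradSub Ω))

instance {N : ℕ} (Ω : Opens (Space N)) : Module ℝ (EGrad Ω) :=
  inferInstanceAs (Module ℝ ↥(EGradSub Ω))

/-- The inclusion of `E(∇; Ω)` in `H^{1/2}(Ω)`. -/
def EGrad.incl {N : ℕ} (Ω : Opens (Space N)) : EGrad Ω →ₗ[ℝ] HHalf Ω := (EGradSub Ω).subtype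

/-- The graph norm `‖v‖_{H^{1/2}(Ω)} + ∑ᵢ ‖∂ᵢ v‖_{[H^{1/2}(Ω)]'}` of `E(∇; Ω)`. -/
instance {N : ℕ} (Ω : Opens (Space N)) : Norm (EGrad Ω) where
  norm v := ‖EGrad.incl Ω v‖ + ∑ i, dualDerivNorm (EGrad.incl Ω v) i

lemma EGrad.norm_def {N : ℕ} {Ω : Opens (Space N)} (v : EGrad Ω) :
    ‖v‖ = ‖EGrad.incl Ω v‖ + ∑ i, dualDerivNorm (EGrad.incl Ω v) i := rfl

lemma EGrad.incl_mem {N : ℕ} {Ω : Opens (Space N)} (v : EGrad Ω) :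
    EGrad.incl Ω v ∈ EGradSub Ω := v.2

lemma EGrad.norm_smul_le {N : ℕ} {Ω : Opens (Space N)} (c : ℝ) (v : EGrad Ω) :
    ‖c • v‖ ≤ ‖c‖ * ‖v‖ := by
  rw [EGrad.norm_def, EGrad.norm_def, map_smul, norm_smul, mul_add, Finset.mul_sum]
  gcongr
  exact dualDerivNorm_smul_le c v.incl_mem _

lemma EGrad.core {N : ℕ} (Ω : Opens (Space N)) : NormedSpace.Core ℝ (EGrad Ω) where
  norm_nonneg v :=
    add_nonneg (norm_nonneg _) (Finset.sum_nonneg fun i _ ↦ dualDerivNorm_nonneg _ i)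
  norm_smul c v := by
    refine le_antisymm (EGrad.norm_smul_le c v) ?_
    rcases eq_or_ne c 0 with rfl | hc
    · rw [norm_zero, zero_mul]
      exact add_nonneg (norm_nonneg _) (Finset.sum_nonneg fun i _ ↦ dualDerivNorm_nonneg _ i)
    · have h := EGrad.norm_smul_le c⁻¹ (c • v)
      rw [inv_smul_smul₀ hc, norm_inv] at h
      have hc' : 0 < ‖c‖ := norm_pos_iff.2 hc
      rwa [inv_mul_eq_div, le_div_iff₀ hc', mul_comm] at h
  norm_triangle v w := by
    rw [EGrad.norm_def, EGrad.norm_def, EGrad.norm_def, map_add]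
    have h1 := norm_add_le (EGrad.incl Ω v) (EGrad.incl Ω w)
    have h2 := Finset.sum_le_sum fun i (_ : i ∈ Finset.univ) ↦
      dualDerivNorm_add_le v.incl_mem w.incl_mem i
    rw [Finset.sum_add_distrib] at h2
    linarith
  norm_eq_zero_iff v := by
    constructor
    · intro h
      rw [EGrad.norm_def] at h
      have h2 : 0 ≤ ∑ i, dualDerivNorm (EGrad.incl Ω v) i :=
        Finset.sum_nonneg fun i _ ↦ dualDerivNorm_nonneg _ i
      have h3 : ‖EGrad.incl Ω v‖ = 0 := le_antisymm (by linarith) (norm_nonneg _)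
      exact Subtype.ext (norm_eq_zero.1 h3)
    · rintro rfl
      have h := EGrad.norm_smul_le (0 : ℝ) (0 : EGrad Ω)
      rw [norm_zero, zero_mul, zero_smul] at h
      exact le_antisymm h
        (add_nonneg (norm_nonneg _) (Finset.sum_nonneg fun i _ ↦ dualDerivNorm_nonneg _ i))

instance {N : ℕ} (Ω : Opens (Space N)) : NormedAddCommGroup (EGrad Ω) :=
  NormedAddCommGroup.ofCore (EGrad.core Ω)

instance {N : ℕ} (Ω : Opens (Space N)) : NormedSpace ℝ (EGrad Ω) :=
  NormedSpace.ofCore (EGrad.core Ω)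

/-- The linear map `γ` on `E(∇; Ω)` extends the restriction map `u ↦ u|_Γ` on `𝓓(Ω̄)`: each
`u ∈ 𝓓(Ω̄)` belongs to `E(∇; Ω)`, and `γ u = u|_Γ` almost everywhere on `Γ`. -/
def ExtendsRestriction {N : ℕ} {Ω : Opens (Space N)} (γ : EGrad Ω →L[ℝ] L2Boundary Ω) : Prop :=
  ∀ u : 𝓓((⊤ : Opens (Space N)), ℝ), ∃ w : EGrad Ω,
    EGrad.incl Ω w = restrictHHalf Ω u ∧ γ w =ᵐ[surface Ω] u

end HalfTrace

end

/-! # The trace operator on `E(∇; Ω)` and its kernel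

Half-order norms are handled through the increments `f (x + w) - f x` (`incr`, `gag`, `hsq`, with
values in `[0, ∞]`). Near a boundary point the domain lies above a Lipschitz graph, so that it has the
cone property `IsUpCone` with respect to a vertical vector `ν`. The only tool of approximation are the
averages `avg ρ ε f x = ∫ ρ(z) f(x + ε z) dz` with a weight `ρ` supported in the cone, at the dyadic
scales `ε = ± a 2^{-k}`. Upward averages (`ε > 0`) involve values inside the domain only; downward
averages of a function extended by zero have their support inside the domain; and the two are adjoint
to each other.

**Density of test functions.** A function of `H^{1/2}` has in general no half-order extension by zero,
so a single downward average at the scale `2^{-k}` may be large in `H^{1/2}`. However the mean square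
of the function over the layer of height `2^{-k}` along the boundary is at most of the order of
`k 2^{-k}` (`IsUpCone.exists_strip_bound`), and the arithmetic mean `logAvg` of the averages at `K`
successive scales is therefore bounded in `H^{1/2}`
(`IsUpCone.exists_hsq_logAvg_down_le`). As these means converge in `L²`, they converge weakly in
`H^{1/2}`, which gives the density of `𝓓(Ω)` in `H^{1/2}(Ω)` (`denseRange_testLin`). It makes the
functionals representing the derivatives unique. By duality the derivatives of the upward means are
bounded in the dual space of `H^{1/2}`, and the same weak argument in the Hilbert space formed by the
graph of the gradient gives the density of `𝓓(Ω̄)` in `E(∇; Ω)` (`denseRange_restrictLin`), hence the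
uniqueness of the trace operator.

**Continuity of the trace.** For `u ∈ 𝓓(Ω̄)` and a cut-off `η ≥ 0` in a chart, the integral of `η u²`
over the boundary is comparable to the integral over `Ω` of the vertical derivative
`∂_ν (η u²) = 2 η u ∂_ν u + u² ∂_ν η`. Since `η u` belongs to `H^{1/2}(Ω)`, the first term is a duality
product, bounded by the square of the norm of `u` in `E(∇; Ω)`
(`IsTraceChart.exists_lintegral_le`, `exists_trace_bound`).

**The kernel is contained in `H^{1/2}_{00}(Ω)`.** If the trace of `v` vanishes, Green's formula holds
without boundary term, and the vertical derivative of the extension by zero of `η v` is a bounded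
functional on `H^{1/2}(ℝ^N)` (`IsTraceChart.exists_enorm_integral_sq_le`). Testing it with a weighted
sum of second averages of this derivative bounds `∑ₖ 2^{-k} ‖gₖ‖²`, where `gₖ` is the vertical
derivative of the average of `η v` at the scale `2^{-k}`. These averages vanish just below the domain,
so the fundamental theorem of calculus turns the bound into the summability of `2ᵏ` times the squared
norms over the layers of height `2^{-k}` (`IsUpCone.sum_strip_le`), which is the integrability of
`|v|²` against the inverse distance to the boundary.

**`H^{1/2}_{00}(Ω)` is contained in the kernel.** The extension by zero of `v ∈ H^{1/2}_{00}(Ω)` belongs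
to `H^{1/2}(ℝ^N)` (`gag_univ_le`). For such functions the form `∫ v ∂_e φ` is bounded by the norms of
`v` in `H^{1/2}(ℝ^N)` and of `φ` in `H^{1/2}(Ω)`: averaging `v` downwards and `φ` upwards, the form is a
telescoping sum over the dyadic scales, whose terms are products of two square summable sequences
(`exists_enorm_integral_mul_fderiv_le`). Hence `v` belongs to `E(∇; Ω)`, its downward means are bounded
there, and `v` is in the closure of `𝓓(Ω)` (`exists_mem_closure_testEGrad`), on which the trace
vanishes.
-/

namespace HalfTrace

section

/-! ### Elementary inequalities -/

/-- The Cauchy-Schwarz inequality for finite sums in `[0, ∞]`. -/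
lemma ennreal_sum_mul_sq_le {ι : Type*} (s : Finset ι) (f g : ι → ℝ≥0∞) :
    (∑ i ∈ s, f i * g i) ^ 2 ≤ (∑ i ∈ s, f i ^ 2) * ∑ i ∈ s, g i ^ 2 := by
  have h := ENNReal.inner_le_Lp_mul_Lq s f g Real.HolderConjugate.two_two
  calc (∑ i ∈ s, f i * g i) ^ 2
      ≤ ((∑ i ∈ s, f i ^ (2 : ℝ)) ^ (1 / (2 : ℝ)) * (∑ i ∈ s, g i ^ (2 : ℝ)) ^ (1 / (2 : ℝ))) ^ 2 := by
        gcongr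
    _ = _ := by
        rw [mul_pow, ← ENNReal.rpow_natCast, ← ENNReal.rpow_natCast, ← ENNReal.rpow_mul,
          ← ENNReal.rpow_mul]
        norm_num

/-- Weighted Cauchy-Schwarz inequality: `(∑ wᵢ fᵢ)² ≤ (∑ wᵢ) (∑ wᵢ fᵢ²)`. -/
lemma ennreal_sum_weight_sq_le {ι : Type*} (s : Finset ι) (w f : ι → ℝ≥0∞) :
    (∑ i ∈ s, w i * f i) ^ 2 ≤ (∑ i ∈ s, w i) * ∑ i ∈ s, w i * f i ^ 2 := by
  have h := ENNReal.inner_le_weight_mul_Lp_of_nonneg s (p := 2) (by norm_num) w f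
  calc (∑ i ∈ s, w i * f i) ^ 2
      ≤ ((∑ i ∈ s, w i) ^ (1 - (2 : ℝ)⁻¹) * (∑ i ∈ s, w i * f i ^ (2 : ℝ)) ^ (2 : ℝ)⁻¹) ^ 2 := by
        gcongr
    _ = _ := by
        rw [mul_pow, ← ENNReal.rpow_natCast, ← ENNReal.rpow_natCast, ← ENNReal.rpow_mul,
          ← ENNReal.rpow_mul]
        norm_num

lemma ennreal_add_sq_le (a b : ℝ≥0∞) : (a + b) ^ 2 ≤ 2 * (a ^ 2 + b ^ 2) := by
  simpa [Fin.sum_univ_two, one_add_one_eq_two] using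
    ennreal_sum_weight_sq_le Finset.univ (fun _ : Fin 2 ↦ 1) ![a, b]

/-- The Cauchy-Schwarz inequality for integrals of functions with values in `[0, ∞]`. -/
lemma lintegral_mul_sq_le {α : Type*} [MeasurableSpace α] (μ : Measure α) {f g : α → ℝ≥0∞}
    (hf : AEMeasurable f μ) (hg : AEMeasurable g μ) :
    (∫⁻ x, f x * g x ∂μ) ^ 2 ≤ (∫⁻ x, f x ^ 2 ∂μ) * ∫⁻ x, g x ^ 2 ∂μ := by
  have h := ENNReal.lintegral_mul_le_Lp_mul_Lq μ Real.HolderConjugate.two_two hf hg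
  calc (∫⁻ x, f x * g x ∂μ) ^ 2
      ≤ ((∫⁻ x, f x ^ (2 : ℝ) ∂μ) ^ (1 / (2 : ℝ)) * (∫⁻ x, g x ^ (2 : ℝ) ∂μ) ^ (1 / (2 : ℝ))) ^ 2 := by
        gcongr
        exact h
    _ = _ := by
        rw [mul_pow, ← ENNReal.rpow_natCast, ← ENNReal.rpow_natCast, ← ENNReal.rpow_mul,
          ← ENNReal.rpow_mul]
        norm_num

lemma eLpNorm_two_sq {α : Type*} [MeasurableSpace α] (μ : Measure α) (f : α → ℝ) :
    eLpNorm f 2 μ ^ 2 = ∫⁻ x, ‖f x‖ₑ ^ 2 ∂μ := by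
  have := eLpNorm_nnreal_pow_eq_lintegral (f := f) (μ := μ) (p := 2) (by norm_num)
  norm_num at this
  exact_mod_cast this

lemma enorm_integral_mul_sq_le {α : Type*} [MeasurableSpace α] (μ : Measure α) {f g : α → ℝ}
    (hf : AEStronglyMeasurable f μ) (hg : AEStronglyMeasurable g μ) :
    ‖∫ x, f x * g x ∂μ‖ₑ ^ 2 ≤ eLpNorm f 2 μ ^ 2 * eLpNorm g 2 μ ^ 2 := by
  rw [eLpNorm_two_sq, eLpNorm_two_sq]
  refine le_trans ?_ (lintegral_mul_sq_le μ hf.enorm hg.enorm)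
  gcongr
  refine (enorm_integral_le_lintegral_enorm _).trans_eq ?_
  simp only [enorm_mul]

/-! ### The Gagliardo energy -/

variable {N : ℕ}

/-- The kernel `|w|^{-(N+1)}` of the Gagliardo energy of order `1/2`. -/
noncomputable def kern (w : Space N) : ℝ≥0∞ := (‖w‖ₑ ^ (N + 1))⁻¹

/-- The norm of `f` in `L²(A)`. -/
noncomputable def lTwo (A : Set (Space N)) (f : Space N → ℝ) : ℝ≥0∞ :=
  eLpNorm f 2 (volume.restrict A)

/-- The norm of the increment `x ↦ f (x + w) - f x` in `L²`, over the `x` with both `x` and `x + w`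
in `A`. -/
noncomputable def incr (A : Set (Space N)) (f : Space N → ℝ) (w : Space N) : ℝ≥0∞ :=
  eLpNorm (fun x ↦ f (x + w) - f x) 2 (volume.restrict (A ∩ (fun x ↦ x + w) ⁻¹' A))

/-- The Gagliardo energy `∬_{A×A} |f x - f y|² / |x - y|^{N+1} dx dy`, in polar form with respect to
the increment `w = y - x`. -/
noncomputable def gag (A : Set (Space N)) (f : Space N → ℝ) : ℝ≥0∞ :=
  ∫⁻ w, kern w * incr A f w ^ 2

/-- The square of the norm of `H^{1/2}(A)`. -/
noncomputable def hsq (A : Set (Space N)) (f : Space N → ℝ) : ℝ≥0∞ := lTwo A f ^ 2 + gag A f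

lemma measurable_kern : Measurable (kern : Space N → ℝ≥0∞) := by
  unfold kern; fun_prop

lemma lTwo_sq (A : Set (Space N)) (f : Space N → ℝ) : lTwo A f ^ 2 = ∫⁻ x in A, ‖f x‖ₑ ^ 2 :=
  eLpNorm_two_sq _ _

lemma incr_sq (A : Set (Space N)) (f : Space N → ℝ) (w : Space N) :
    incr A f w ^ 2 = ∫⁻ x in A ∩ (fun x ↦ x + w) ⁻¹' A, ‖f (x + w) - f x‖ₑ ^ 2 :=
  eLpNorm_two_sq _ _

lemma incr_sq' {A : Set (Space N)} (hA : MeasurableSet A) (f : Space N → ℝ) (w : Space N) :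
    incr A f w ^ 2 = ∫⁻ x, A.indicator 1 x * (A.indicator 1 (x + w) * ‖f (x + w) - f x‖ₑ ^ 2) := by
  rw [incr_sq, ← lintegral_indicator (hA.inter ((measurable_add_const w) hA))]
  congr 1 with x
  by_cases h1 : x ∈ A <;> by_cases h2 : x + w ∈ A <;> simp [h1, h2]

lemma measurable_incr {A : Set (Space N)} (hA : MeasurableSet A) {f : Space N → ℝ}
    (hf : Measurable f) : Measurable (incr A f) := by
  have h : Measurable fun w ↦ incr A f w ^ 2 := by
    simp_rw [incr_sq' hA]
    have h1 : Measurable (A.indicator (1 : Space N → ℝ≥0∞)) := measurable_one.indicator hA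
    refine Measurable.lintegral_prod_right' (f := fun p : Space N × Space N ↦
      A.indicator 1 p.2 * (A.indicator 1 (p.2 + p.1) * ‖f (p.2 + p.1) - f p.2‖ₑ ^ 2)) ?_
    fun_prop
  have h2 : incr A f = fun w ↦ (incr A f w ^ 2) ^ (1 / 2 : ℝ) := by
    ext w
    rw [← ENNReal.rpow_natCast, ← ENNReal.rpow_mul]
    norm_num
  rw [h2]
  exact h.pow_const _

lemma gag_eq {A : Set (Space N)} (hA : MeasurableSet A) {f : Space N → ℝ} (hf : Measurable f) :
    gag A f = ∫⁻ x in A, ∫⁻ y in A, kern (x - y) * ‖f x - f y‖ₑ ^ 2 := by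
  have h1 : Measurable (A.indicator (1 : Space N → ℝ≥0∞)) := measurable_one.indicator hA
  have hk := measurable_kern (N := N)
  unfold gag
  calc ∫⁻ w, kern w * incr A f w ^ 2
      = ∫⁻ w, ∫⁻ x, A.indicator 1 x * (A.indicator 1 (x + w) *
          (kern w * ‖f (x + w) - f x‖ₑ ^ 2)) := by
        congr 1 with w
        rw [incr_sq' hA, ← lintegral_const_mul _ (by fun_prop)]
        congr 1 with x
        ring
    _ = ∫⁻ x, ∫⁻ w, A.indicator 1 x * (A.indicator 1 (x + w) *
          (kern w * ‖f (x + w) - f x‖ₑ ^ 2)) := by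
        apply lintegral_lintegral_swap
        fun_prop
    _ = ∫⁻ x, A.indicator 1 x * ∫⁻ y in A, kern (x - y) * ‖f x - f y‖ₑ ^ 2 := by
        congr 1 with x
        rw [lintegral_const_mul _ (by fun_prop)]
        congr 1
        rw [← lintegral_indicator hA]
        rw [← lintegral_add_left_eq_self (fun y ↦ A.indicator (fun y ↦ kern (x - y) *
          ‖f x - f y‖ₑ ^ 2) y) x]
        congr 1 with w
        have hff : ‖f x - f (x + w)‖ₑ = ‖f (x + w) - f x‖ₑ := enorm_sub_rev _ _
        by_cases h2 : x + w ∈ A <;> simp [h2, hff, kern]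
    _ = _ := by
        rw [← lintegral_indicator hA]
        congr 1 with x
        by_cases h2 : x ∈ A <;> simp [h2]

lemma lTwo_mono {A B : Set (Space N)} (h : A ⊆ B) (f : Space N → ℝ) : lTwo A f ≤ lTwo B f :=
  eLpNorm_mono_measure _ (Measure.restrict_mono h le_rfl)

lemma lTwo_congr {A : Set (Space N)} (hA : MeasurableSet A) {f g : Space N → ℝ}
    (h : ∀ x ∈ A, f x = g x) : lTwo A f = lTwo A g :=
  eLpNorm_congr_ae ((ae_restrict_mem hA).mono h)

lemma incr_mono {A B : Set (Space N)} (h : A ⊆ B) (f : Space N → ℝ) (w : Space N) :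
    incr A f w ≤ incr B f w :=
  eLpNorm_mono_measure _ (Measure.restrict_mono (inter_subset_inter h (preimage_mono h)) le_rfl)

lemma gag_mono {A B : Set (Space N)} (h : A ⊆ B) (f : Space N → ℝ) : gag A f ≤ gag B f := by
  unfold gag
  gcongr
  exact incr_mono h f _

lemma hsq_mono {A B : Set (Space N)} (h : A ⊆ B) (f : Space N → ℝ) : hsq A f ≤ hsq B f := by
  unfold hsq
  gcongr
  exacts [lTwo_mono h f, gag_mono h f]

/-- Translation does not increase the `L²` norm, provided the translate stays in `A`. -/
lemma eLpNorm_comp_add_le {A B : Set (Space N)} {w : Space N}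
    (hB : ∀ x ∈ B, x + w ∈ A) {f : Space N → ℝ} :
    eLpNorm (fun x ↦ f (x + w)) 2 (volume.restrict B) ≤ lTwo A f := by
  have hmp : MeasurePreserving (fun x : Space N ↦ x + w) volume volume :=
    measurePreserving_add_right volume w
  have h1 := eLpNorm_mono_measure (p := 2) (fun x ↦ f (x + w))
    (Measure.restrict_mono (show B ⊆ (fun x ↦ x + w) ⁻¹' A from hB) (le_refl volume))
  refine h1.trans_eq ?_
  have h2 := hmp.restrict_preimage_emb (MeasurableEquiv.addRight w).measurableEmbedding A
  unfold lTwo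
  conv_rhs => rw [← h2.map_eq]
  exact ((MeasurableEquiv.addRight w).measurableEmbedding.eLpNorm_map_measure (g := f)).symm

lemma incr_le_two_mul {A : Set (Space N)} {f : Space N → ℝ} (hf : Measurable f) (w : Space N) :
    incr A f w ≤ 2 * lTwo A f := by
  unfold incr
  refine (eLpNorm_sub_le (Measurable.aestronglyMeasurable (by fun_prop))
    (Measurable.aestronglyMeasurable (by fun_prop)) (by norm_num)).trans ?_
  rw [two_mul]
  gcongr
  · exact eLpNorm_comp_add_le fun x hx ↦ hx.2
  · exact lTwo_mono inter_subset_left f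

lemma incr_add_le {A : Set (Space N)} {f g : Space N → ℝ} (hf : Measurable f) (hg : Measurable g)
    (w : Space N) : incr A (fun x ↦ f x + g x) w ≤ incr A f w + incr A g w := by
  unfold incr
  refine le_trans (le_of_eq ?_) (eLpNorm_add_le (f := fun x ↦ f (x + w) - f x)
    (g := fun x ↦ g (x + w) - g x) (by fun_prop) (by fun_prop) (by norm_num))
  congr 1
  ext x
  simp only [Pi.add_apply]
  ring

lemma incr_sum_le {ι : Type*} (s : Finset ι) {A : Set (Space N)} {f : ι → Space N → ℝ}
    (hf : ∀ i ∈ s, Measurable (f i)) (w : Space N) :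
    incr A (fun x ↦ ∑ i ∈ s, f i x) w ≤ ∑ i ∈ s, incr A (f i) w := by
  unfold incr
  refine le_trans (le_of_eq ?_) (eLpNorm_sum_le (f := fun i x ↦ f i (x + w) - f i x) (fun i hi ↦ ?_)
    (by norm_num))
  · congr 1
    ext x
    simp [Finset.sum_sub_distrib]
  · have := hf i hi
    fun_prop

lemma incr_const_mul (A : Set (Space N)) (c : ℝ) (f : Space N → ℝ) (w : Space N) :
    incr A (fun x ↦ c * f x) w = ‖c‖ₑ * incr A f w := by
  unfold incr
  rw [← eLpNorm_const_smul]
  congr 1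
  ext x
  simp [mul_sub]

lemma lTwo_sum_le {ι : Type*} (s : Finset ι) {A : Set (Space N)} {f : ι → Space N → ℝ}
    (hf : ∀ i ∈ s, Measurable (f i)) :
    lTwo A (fun x ↦ ∑ i ∈ s, f i x) ≤ ∑ i ∈ s, lTwo A (f i) := by
  refine le_trans (le_of_eq ?_) (eLpNorm_sum_le (f := f) (fun i hi ↦ ?_) (by norm_num))
  · unfold lTwo
    congr 1
    ext x
    simp
  · exact (hf i hi).aestronglyMeasurable

lemma lTwo_const_mul (A : Set (Space N)) (c : ℝ) (f : Space N → ℝ) :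
    lTwo A (fun x ↦ c * f x) = ‖c‖ₑ * lTwo A f :=
  eLpNorm_const_smul (c := c) (f := f) ..

/-! ### Integrals of the kernel -/

/-- The basic convergent integral: `|w|^{-(N+1/2)} min(1, |w|)` is integrable. -/
lemma lintegral_kern_lt_top (hN : N ≠ 0) :
    ∫⁻ w : Space N, kern w * (‖w‖ₑ ^ (1 / 2 : ℝ) * min 1 ‖w‖ₑ) < ⊤ := by
  have : Nontrivial (Space N) := by
    have : Nonempty (Fin N) := ⟨⟨0, Nat.pos_of_ne_zero hN⟩⟩
    infer_instance
  let g : ℝ → ℝ := fun t ↦ (t ^ (N + 1))⁻¹ * (t ^ (1 / 2 : ℝ) * min 1 t)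
  have hg : Integrable (fun w : Space N ↦ g ‖w‖) := by
    rw [integrable_fun_norm_addHaar volume (f := g)]
    have h1 : IntegrableOn (fun t : ℝ ↦ t ^ (-(1 / 2) : ℝ)) (Ioc 0 1) :=
      (intervalIntegrable_iff_integrableOn_Ioc_of_le zero_le_one).1
        (intervalIntegral.intervalIntegrable_rpow' (by norm_num))
    have h2 : IntegrableOn (fun t : ℝ ↦ t ^ (-(3 / 2) : ℝ)) (Ioi 1) :=
      integrableOn_Ioi_rpow_of_lt (by norm_num) zero_lt_one
    have key : ∀ t : ℝ, 0 < t → t ^ (N - 1) • g t = t ^ (-(3 / 2) : ℝ) * min 1 t := by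
      intro t ht
      have e1 : t ^ (N + 1) = t ^ (N - 1) * t ^ 2 := by
        rw [← pow_add]; congr 1; omega
      have e2 : t ^ (-(3 / 2) : ℝ) = (t ^ 2)⁻¹ * t ^ (1 / 2 : ℝ) := by
        rw [← Real.rpow_natCast t 2, ← Real.rpow_neg ht.le, ← Real.rpow_add ht]
        norm_num
      simp only [g, smul_eq_mul]
      rw [e1, e2]
      field_simp
    rw [← Ioc_union_Ioi_eq_Ioi (zero_le_one' ℝ)]
    refine IntegrableOn.union (h1.congr_fun (fun t ht ↦ ?_) measurableSet_Ioc)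
      (h2.congr_fun (fun t ht ↦ ?_) measurableSet_Ioi)
    · simp only [finrank_euclideanSpace, Fintype.card_fin]
      rw [key t ht.1, min_eq_right ht.2]
      nth_rw 3 [← Real.rpow_one t]
      rw [← Real.rpow_add ht.1]
      norm_num
    · simp only [finrank_euclideanSpace, Fintype.card_fin]
      have ht' : (1 : ℝ) < t := ht
      rw [key t (by linarith), min_eq_left ht'.le, mul_one]
  refine lt_of_le_of_lt (lintegral_mono_ae ?_) hg.2
  have h0 : ∀ᵐ w : Space N, w ≠ 0 := by simp [ae_iff]
  filter_upwards [h0] with w hw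
  have hw' : 0 < ‖w‖ := norm_pos_iff.2 hw
  have h1 : ‖w‖ₑ = ENNReal.ofReal ‖w‖ := (ofReal_norm w).symm
  rw [Real.enorm_of_nonneg (by positivity), kern, h1, ENNReal.ofReal_mul (by positivity),
    ENNReal.ofReal_mul (by positivity), ENNReal.ofReal_inv_of_pos (by positivity),
    ENNReal.ofReal_pow hw'.le, ENNReal.ofReal_rpow_of_pos hw', ENNReal.ofReal_min,
    ENNReal.ofReal_one]

/-- The value of the integral in `lintegral_kern_lt_top`. -/
noncomputable def kernConst (N : ℕ) : ℝ≥0∞ :=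
  ∫⁻ w : Space N, kern w * (‖w‖ₑ ^ (1 / 2 : ℝ) * min 1 ‖w‖ₑ)

lemma kernConst_ne_top (hN : N ≠ 0) : kernConst N ≠ ⊤ := (lintegral_kern_lt_top hN).ne

lemma lintegral_comp_smul {c : ℝ} (hc : 0 < c) {g : Space N → ℝ≥0∞} (hg : Measurable g) :
    ∫⁻ w, g (c • w) = ENNReal.ofReal (c ^ N)⁻¹ * ∫⁻ w, g w := by
  rw [← lintegral_map (f := g) hg (measurable_const_smul c), Measure.map_addHaar_smul _ hc.ne',
    lintegral_smul_measure]
  simp [abs_of_pos hc]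

lemma kern_smul {c : ℝ} (hc : 0 < c) (w : Space N) :
    kern (c • w) = ENNReal.ofReal (c ^ (N + 1))⁻¹ * kern w := by
  unfold kern
  rw [enorm_smul, mul_pow, ENNReal.mul_inv, ENNReal.ofReal_inv_of_pos (by positivity),
    ENNReal.ofReal_pow hc.le, Real.enorm_of_nonneg hc.le]
  · left; simp [hc.ne']
  · left; simp

/-- The scaling `w ↦ c w` multiplies integrals against the kernel by `c`. -/
lemma lintegral_kern_scale {c : ℝ} (hc : 0 < c) {g : Space N → ℝ≥0∞} (hg : Measurable g) :
    ∫⁻ w, kern w * g (c • w) = ENNReal.ofReal c * ∫⁻ w, kern w * g w := by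
  have hk := measurable_kern (N := N)
  have h := lintegral_comp_smul hc (g := fun w ↦ kern w * g w) (by fun_prop)
  simp_rw [kern_smul hc, mul_assoc] at h
  rw [lintegral_const_mul _ (by fun_prop)] at h
  have e : ENNReal.ofReal (c ^ N)⁻¹ = ENNReal.ofReal c * ENNReal.ofReal (c ^ (N + 1))⁻¹ := by
    rw [← ENNReal.ofReal_mul hc.le]
    congr 1
    field_simp
    ring
  rw [e, mul_comm (ENNReal.ofReal c), mul_assoc] at h
  refine (ENNReal.mul_right_inj ?_ ENNReal.ofReal_ne_top).1 h
  simp only [ne_eq, ENNReal.ofReal_eq_zero, not_le]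
  positivity

lemma min_sq_le_sqrt_mul_min (t : ℝ≥0∞) : (min 1 t) ^ 2 ≤ t ^ (1 / 2 : ℝ) * min 1 t := by
  rw [sq]
  gcongr
  rcases le_total t 1 with h | h
  · rw [min_eq_right h]
    calc t = t ^ (1 : ℝ) := by simp
      _ ≤ _ := ENNReal.rpow_le_rpow_of_exponent_ge h (by norm_num)
  · rw [min_eq_left h]
    exact ENNReal.one_le_rpow h (by norm_num)

lemma lintegral_kern_mul_min_sq_le :
    ∫⁻ w : Space N, kern w * (min 1 ‖w‖ₑ) ^ 2 ≤ kernConst N := by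
  unfold kernConst
  gcongr
  exact min_sq_le_sqrt_mul_min _

/-- The integral of the kernel outside the ball of radius `d` is at most a constant times `1 / d`. -/
lemma lintegral_kern_outside_le {d : ℝ} (hd : 0 < d) :
    ∫⁻ w in {w : Space N | d ≤ ‖w‖}, kern w ≤ ENNReal.ofReal d⁻¹ * kernConst N := by
  have hm : MeasurableSet {w : Space N | d ≤ ‖w‖} := measurableSet_le (by fun_prop) (by fun_prop)
  have h := lintegral_kern_scale (N := N) (inv_pos.2 hd) (g := fun w ↦ (min 1 ‖w‖ₑ) ^ 2)
    (by fun_prop)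
  calc ∫⁻ w in {w : Space N | d ≤ ‖w‖}, kern w
      ≤ ∫⁻ w, kern w * (min 1 ‖d⁻¹ • w‖ₑ) ^ 2 := by
        rw [← lintegral_indicator hm]
        refine lintegral_mono fun w ↦ ?_
        by_cases hw : d ≤ ‖w‖
        · have : (1 : ℝ≥0∞) ≤ ‖d⁻¹ • w‖ₑ := by
            rw [← ofReal_norm, ENNReal.one_le_ofReal, norm_smul, Real.norm_eq_abs,
              abs_of_pos (inv_pos.2 hd), inv_mul_eq_div, one_le_div hd]
            exact hw
          simp [hw, this]
        · simp [hw]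
    _ ≤ _ := by
        rw [h]
        gcongr
        exact lintegral_kern_mul_min_sq_le

end

section

variable {N : ℕ}

/-! ### Products, restrictions and extensions by zero -/

/-- Multiplication by a bounded Lipschitz function preserves the energy: the increment of `η f` splits
into an increment of `f` and an increment of `η`, and `min(1, |w|)²` is integrable against the kernel. -/
lemma hsq_mul_le {η : Space N → ℝ} {M : ℝ≥0∞} (h1 : ∀ x, ‖η x‖ₑ ≤ M)
    (h2 : ∀ x w, ‖η (x + w) - η x‖ₑ ≤ M * min 1 ‖w‖ₑ) {A : Set (Space N)} (hA : MeasurableSet A)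
    {f : Space N → ℝ} (hf : Measurable f) :
    hsq A (fun x ↦ η x * f x) ≤ 2 * M ^ 2 * (1 + kernConst N) * hsq A f := by
  have hk := measurable_kern (N := N)
  have hi := measurable_incr hA hf
  have hL : lTwo A (fun x ↦ η x * f x) ^ 2 ≤ M ^ 2 * lTwo A f ^ 2 := by
    rw [lTwo_sq, lTwo_sq, ← lintegral_const_mul _ (by fun_prop)]
    refine lintegral_mono fun x ↦ ?_
    rw [enorm_mul, mul_pow]
    gcongr
    exact h1 x
  have hI : ∀ w, incr A (fun x ↦ η x * f x) w ^ 2 ≤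
      2 * M ^ 2 * (incr A f w ^ 2 + (min 1 ‖w‖ₑ) ^ 2 * lTwo A f ^ 2) := by
    intro w
    calc incr A (fun x ↦ η x * f x) w ^ 2
        ≤ ∫⁻ x in A ∩ (fun x ↦ x + w) ⁻¹' A,
            2 * M ^ 2 * (‖f (x + w) - f x‖ₑ ^ 2 + (min 1 ‖w‖ₑ) ^ 2 * ‖f x‖ₑ ^ 2) := by
          rw [incr_sq]
          refine lintegral_mono fun x ↦ ?_
          have e : η (x + w) * f (x + w) - η x * f x =
            η (x + w) * (f (x + w) - f x) + (η (x + w) - η x) * f x := by ring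
          rw [e]
          calc _ ≤ (‖η (x + w)‖ₑ * ‖f (x + w) - f x‖ₑ + ‖η (x + w) - η x‖ₑ * ‖f x‖ₑ) ^ 2 := by
                gcongr
                refine (enorm_add_le _ _).trans_eq ?_
                rw [enorm_mul, enorm_mul]
            _ ≤ (M * ‖f (x + w) - f x‖ₑ + (M * min 1 ‖w‖ₑ) * ‖f x‖ₑ) ^ 2 := by
                gcongr
                exacts [h1 _, h2 _ _]
            _ ≤ _ := (ennreal_add_sq_le _ _).trans_eq (by ring)
      _ = 2 * M ^ 2 * (incr A f w ^ 2 +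
            (min 1 ‖w‖ₑ) ^ 2 * ∫⁻ x in A ∩ (fun x ↦ x + w) ⁻¹' A, ‖f x‖ₑ ^ 2) := by
          rw [lintegral_const_mul _ (by fun_prop), lintegral_add_left (by fun_prop),
            lintegral_const_mul _ (by fun_prop), incr_sq]
      _ ≤ _ := by
          rw [lTwo_sq]
          gcongr
          exact inter_subset_left
  have hG : gag A (fun x ↦ η x * f x) ≤
      2 * M ^ 2 * (gag A f + kernConst N * lTwo A f ^ 2) := by
    calc gag A (fun x ↦ η x * f x)
        ≤ ∫⁻ w, 2 * M ^ 2 * (kern w * incr A f w ^ 2 +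
            kern w * (min 1 ‖w‖ₑ) ^ 2 * lTwo A f ^ 2) := by
          refine lintegral_mono fun w ↦ ?_
          calc kern w * incr A (fun x ↦ η x * f x) w ^ 2
              ≤ kern w * (2 * M ^ 2 * (incr A f w ^ 2 + (min 1 ‖w‖ₑ) ^ 2 * lTwo A f ^ 2)) := by
                gcongr
                exact hI w
            _ = _ := by ring
      _ = 2 * M ^ 2 * (gag A f + (∫⁻ w : Space N, kern w * (min 1 ‖w‖ₑ) ^ 2) * lTwo A f ^ 2) := by
          rw [lintegral_const_mul _ (by fun_prop), lintegral_add_left (by fun_prop),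
            lintegral_mul_const _ (by fun_prop), gag]
      _ ≤ _ := by
          gcongr
          exact lintegral_kern_mul_min_sq_le
  unfold hsq
  calc _ ≤ M ^ 2 * lTwo A f ^ 2 + 2 * M ^ 2 * (gag A f + kernConst N * lTwo A f ^ 2) :=
        add_le_add hL hG
    _ ≤ 2 * M ^ 2 * lTwo A f ^ 2 + 2 * M ^ 2 * (gag A f + kernConst N * lTwo A f ^ 2)
        + 2 * M ^ 2 * kernConst N * gag A f := by
        refine le_add_right ?_
        gcongr
        exact le_mul_of_one_le_left' (by norm_num)
    _ = _ := by ring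

lemma exists_bound_of_smooth {η : Space N → ℝ} (hη : ContDiff ℝ ∞ η) (hc : HasCompactSupport η) :
    ∃ M : ℝ≥0, (∀ x, ‖η x‖ₑ ≤ M) ∧ ∀ x w, ‖η (x + w) - η x‖ₑ ≤ M * min 1 ‖w‖ₑ := by
  obtain ⟨M, hM⟩ := hη.continuous.bounded_above_of_compact_support hc
  obtain ⟨L, hL⟩ := ContDiff.lipschitzWith_of_hasCompactSupport hc hη (by simp)
  have hM0 : 0 ≤ M := (norm_nonneg _).trans (hM 0)
  have hM' : ∀ x, ‖η x‖ₑ ≤ (M.toNNReal : ℝ≥0∞) := fun x ↦ by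
    rw [← ofReal_norm]
    exact ENNReal.ofReal_le_ofReal (hM x)
  refine ⟨2 * M.toNNReal + L, fun x ↦ (hM' x).trans ?_, fun x w ↦ ?_⟩
  · push_cast
    exact le_add_right (le_mul_of_one_le_left' (by norm_num))
  rcases le_total ‖w‖ₑ 1 with h | h
  · rw [min_eq_right h]
    have := hL.edist_le_mul (x + w) x
    rw [edist_eq_enorm_sub, edist_eq_enorm_sub, add_sub_cancel_left] at this
    refine this.trans ?_
    gcongr
    exact_mod_cast le_add_self
  · rw [min_eq_left h, mul_one]
    refine (enorm_sub_le).trans ?_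
    push_cast
    rw [two_mul]
    exact le_add_right (add_le_add (hM' _) (hM' _))

/-- Multiplication by a smooth function with compact support is bounded in `H^{1/2}(A)`, uniformly
in `A`. -/
lemma exists_hsq_mul_le (hN : N ≠ 0) {η : Space N → ℝ} (hη : ContDiff ℝ ∞ η)
    (hc : HasCompactSupport η) : ∃ C : ℝ≥0, ∀ A : Set (Space N), MeasurableSet A →
      ∀ f : Space N → ℝ, Measurable f → hsq A (fun x ↦ η x * f x) ≤ C * hsq A f := by
  obtain ⟨M, h1, h2⟩ := exists_bound_of_smooth hη hc
  refine ⟨2 * M ^ 2 * (1 + (kernConst N).toNNReal), fun A hA f hf ↦ ?_⟩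
  refine (hsq_mul_le h1 h2 hA hf).trans_eq ?_
  push_cast
  rw [ENNReal.coe_toNNReal (kernConst_ne_top hN)]

lemma indicator_congr_mem {α β : Type*} [Zero β] {A A' : Set α} {x : α} (h : x ∈ A ↔ x ∈ A')
    (g : α → β) : A.indicator g x = A'.indicator g x := by
  by_cases hx : x ∈ A
  · rw [indicator_of_mem hx, indicator_of_mem (h.1 hx)]
  · rw [indicator_of_notMem hx, indicator_of_notMem (mt h.2 hx)]

/-- If `A` and `A'` coincide near the support of `f`, the energies of `f` over `A` and `A'` are
comparable. -/
lemma hsq_transfer {A A' : Set (Space N)} (hA : MeasurableSet A) (hA' : MeasurableSet A')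
    {p : Space N} {r : ℝ} (hr : 0 < r) (h : A ∩ Metric.ball p r = A' ∩ Metric.ball p r)
    {f : Space N → ℝ} (hf : Measurable f) (h0 : ∀ x ∉ Metric.ball p (r / 2), f x = 0) :
    hsq A' f ≤ (1 + 4 * (ENNReal.ofReal (r / 2)⁻¹ * kernConst N)) * hsq A f := by
  have hk := measurable_kern (N := N)
  have hi := measurable_incr hA hf
  have hmem : ∀ x ∈ Metric.ball p r, (x ∈ A ↔ x ∈ A') := fun x hx ↦ by
    have := Set.ext_iff.1 h x
    simpa only [mem_inter_iff, hx, and_true] using this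
  have hsub : Metric.ball p (r / 2) ⊆ Metric.ball p r := Metric.ball_subset_ball (by linarith)
  have hL : lTwo A' f = lTwo A f := by
    have key : ∀ B B' : Set (Space N), MeasurableSet B → MeasurableSet B' →
        (∀ x ∈ Metric.ball p r, (x ∈ B ↔ x ∈ B')) → lTwo B f ^ 2 = lTwo B' f ^ 2 := by
      intro B B' hB hB' hm
      rw [lTwo_sq, lTwo_sq, ← lintegral_indicator hB, ← lintegral_indicator hB']
      congr 1 with x
      by_cases hx : x ∈ Metric.ball p (r / 2)
      · exact indicator_congr_mem (hm x (hsub hx)) _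
      · have hx0 : ‖f x‖ₑ ^ 2 = 0 := by simp [h0 x hx]
        by_cases h1 : x ∈ B <;> by_cases h2 : x ∈ B' <;> simp [h1, h2, hx0]
    have := key A' A hA' hA fun x hx ↦ (hmem x hx).symm
    exact (ENNReal.pow_right_strictMono two_ne_zero).injective this
  -- increments of size at least `r / 2` are bounded by the `L²` norm; the smaller ones stay in the ball
  -- where `A` and `A'` coincide
  have hI : ∀ w, incr A' f w ^ 2 ≤ incr A f w ^ 2 +
      {w : Space N | r / 2 ≤ ‖w‖}.indicator 1 w * (4 * lTwo A f ^ 2) := by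
    intro w
    by_cases hw : r / 2 ≤ ‖w‖
    · have := incr_le_two_mul (A := A') hf w
      rw [hL] at this
      refine (pow_le_pow_left' this 2).trans ?_
      simp only [mem_ofPred_eq, hw, indicator_of_mem, Pi.one_apply, one_mul, mul_pow]
      norm_num
    · simp only [mem_ofPred_eq, hw, not_false_eq_true, indicator_of_notMem, zero_mul, add_zero]
      rw [incr_sq' hA', incr_sq' hA]
      refine lintegral_mono fun x ↦ ?_
      by_cases hx : x ∈ Metric.ball p r ∧ x + w ∈ Metric.ball p r
      · have e1 := hmem x hx.1
        have e2 := hmem _ hx.2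
        rw [indicator_congr_mem e1, indicator_congr_mem e2]
      · have hd : dist (x + w) x < r / 2 := by simpa [dist_eq_norm] using not_le.1 hw
        have : f (x + w) = 0 ∧ f x = 0 := by
          rcases not_and_or.1 hx with h | h
          · refine ⟨h0 _ fun h' ↦ h ?_, h0 _ fun h' ↦ h (hsub h')⟩
            rw [Metric.mem_ball] at *
            have := dist_triangle_left x p (x + w)
            linarith
          · refine ⟨h0 _ fun h' ↦ h (hsub h'), h0 _ fun h' ↦ h ?_⟩
            rw [Metric.mem_ball] at *
            have := dist_triangle (x + w) x p
            linarith
        simp [this.1, this.2]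
  have hm : MeasurableSet {w : Space N | r / 2 ≤ ‖w‖} := measurableSet_le (by fun_prop) (by fun_prop)
  have hG : gag A' f ≤ gag A f + ENNReal.ofReal (r / 2)⁻¹ * kernConst N * (4 * lTwo A f ^ 2) := by
    calc gag A' f ≤ ∫⁻ w, (kern w * incr A f w ^ 2 +
          {w : Space N | r / 2 ≤ ‖w‖}.indicator kern w * (4 * lTwo A f ^ 2)) := by
          refine lintegral_mono fun w ↦ ?_
          refine (mul_le_mul_right (hI w) (kern w)).trans_eq ?_
          by_cases hw : r / 2 ≤ ‖w‖ <;> simp [hw, mul_add]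
      _ = gag A f + (∫⁻ w in {w : Space N | r / 2 ≤ ‖w‖}, kern w) * (4 * lTwo A f ^ 2) := by
          rw [lintegral_add_left (by fun_prop), lintegral_mul_const _ (hk.indicator hm),
            lintegral_indicator hm, gag]
      _ ≤ _ := by
          gcongr
          exact lintegral_kern_outside_le (by linarith)
  unfold hsq
  rw [hL]
  refine (add_le_add le_rfl hG).trans ?_
  calc _ ≤ lTwo A f ^ 2 + (gag A f + ENNReal.ofReal (r / 2)⁻¹ * kernConst N * (4 * lTwo A f ^ 2)) +
          4 * (ENNReal.ofReal (r / 2)⁻¹ * kernConst N) * gag A f := le_self_add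
    _ = _ := by ring

/-- The energy over the whole space of a function vanishing outside `A`. -/
lemma gag_univ_le {A : Set (Space N)} (hA : MeasurableSet A) {f : Space N → ℝ} (hf : Measurable f)
    (h0 : ∀ x ∉ A, f x = 0) {d : Space N → ℝ} (hdm : Measurable d) (hd : ∀ x ∈ A, 0 < d x)
    (hd' : ∀ x ∈ A, ∀ y ∉ A, d x ≤ ‖x - y‖) :
    gag univ f ≤ gag A f +
      2 * kernConst N * ∫⁻ x in A, ENNReal.ofReal (d x)⁻¹ * ‖f x‖ₑ ^ 2 := by
  have hk := measurable_kern (N := N)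
  let F : Space N → Space N → ℝ≥0∞ := fun x y ↦ kern (x - y) * ‖f x - f y‖ₑ ^ 2
  have hF : Measurable (fun p : Space N × Space N ↦ F p.1 p.2) := by fun_prop
  have hsym : ∀ x y, F x y = F y x := fun x y ↦ by
    simp only [F, kern]
    rw [← enorm_neg (x - y), ← enorm_neg (f x - f y), neg_sub, neg_sub]
  -- for `y` outside `A` the integrand is `|f x|²` times the kernel, to be integrated over `|x - y| ≥ d x`
  have hcross : ∫⁻ x in A, ∫⁻ y in Aᶜ, F x y ≤
      kernConst N * ∫⁻ x in A, ENNReal.ofReal (d x)⁻¹ * ‖f x‖ₑ ^ 2 := by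
    refine le_trans (setLIntegral_mono' hA
      (g := fun x ↦ kernConst N * (ENNReal.ofReal (d x)⁻¹ * ‖f x‖ₑ ^ 2)) fun x hx ↦ ?_) ?_
    · have hm : MeasurableSet {w : Space N | d x ≤ ‖w‖} :=
        measurableSet_le (by fun_prop) (by fun_prop)
      calc ∫⁻ y in Aᶜ, F x y
          ≤ ∫⁻ y, {w : Space N | d x ≤ ‖w‖}.indicator kern (x - y) * ‖f x‖ₑ ^ 2 := by
            rw [← lintegral_indicator hA.compl]
            refine lintegral_mono fun y ↦ ?_
            by_cases hy : y ∈ A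
            · simp [hy]
            · simp [hy, F, h0 y hy, hd' x hx y hy]
        _ = (∫⁻ w in {w : Space N | d x ≤ ‖w‖}, kern w) * ‖f x‖ₑ ^ 2 := by
            have := hk.indicator hm
            rw [lintegral_mul_const _ (by fun_prop), ← lintegral_indicator hm]
            congr 1
            exact lintegral_sub_left_eq_self
              (fun w ↦ {w : Space N | d x ≤ ‖w‖}.indicator kern w) x
        _ ≤ ENNReal.ofReal (d x)⁻¹ * kernConst N * ‖f x‖ₑ ^ 2 := by
            gcongr
            exact lintegral_kern_outside_le (hd x hx)
        _ = _ := by ring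
    · exact (lintegral_const_mul _ (by fun_prop)).le
  have hzero : ∫⁻ x in Aᶜ, ∫⁻ y in Aᶜ, F x y = 0 := by
    rw [setLIntegral_congr_fun (g := fun _ ↦ 0) hA.compl]
    · simp
    · intro x hx
      dsimp only
      rw [setLIntegral_congr_fun (g := fun _ ↦ 0) hA.compl]
      · simp
      · intro y hy
        simp [F, h0 x hx, h0 y hy]
  have hswap : ∫⁻ x in Aᶜ, ∫⁻ y in A, F x y = ∫⁻ x in A, ∫⁻ y in Aᶜ, F x y := by
    rw [lintegral_lintegral_swap (by exact hF.aemeasurable)]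
    simp_rw [hsym]
  rw [gag_eq MeasurableSet.univ hf, gag_eq hA hf, Measure.restrict_univ]
  change ∫⁻ x, ∫⁻ y, F x y ≤ (∫⁻ x in A, ∫⁻ y in A, F x y) + _
  have hm1 : ∀ B : Set (Space N), Measurable fun x ↦ ∫⁻ y in B, F x y := fun B ↦
    Measurable.lintegral_prod_right' (f := fun p : Space N × Space N ↦ F p.1 p.2) hF
  have e : ∀ x, ∫⁻ y, F x y = (∫⁻ y in A, F x y) + ∫⁻ y in Aᶜ, F x y := fun x ↦
    (lintegral_add_compl _ hA).symm
  rw [← lintegral_add_compl _ hA]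
  simp_rw [e]
  rw [lintegral_add_left (hm1 A), lintegral_add_left (hm1 A), hzero, hswap, add_zero]
  calc _ ≤ (∫⁻ x in A, ∫⁻ y in A, F x y)
        + kernConst N * (∫⁻ x in A, ENNReal.ofReal (d x)⁻¹ * ‖f x‖ₑ ^ 2)
        + kernConst N * (∫⁻ x in A, ENNReal.ofReal (d x)⁻¹ * ‖f x‖ₑ ^ 2) := by
        gcongr
    _ = _ := by ring

/-! ### Sums over dyadic scales -/

/-- The terms `min(1, 2ᵏ x) 2^{-k/2}` increase geometrically up to `2ᵏ ≈ 1/x` and decrease geometrically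
afterwards, so that their sum is of the order of the largest one, `√x`. -/
lemma sum_min_two_pow_le (K : ℕ) (x : ℝ) (hx : 0 < x) :
    ∑ k ∈ Finset.range K, min 1 (2 ^ k * x) * (√2)⁻¹ ^ k ≤ 10 * √x := by
  have h2 : √2 ^ 2 = 2 := Real.sq_sqrt (by norm_num)
  have h20 : 0 < √2 := by positivity
  have hlo : 1.414 < √2 := Real.lt_sqrt_of_sq_lt (by norm_num)
  have hhi : √2 < 1.415 := (Real.sqrt_lt' (by norm_num)).2 (by norm_num)
  have hr : (√2)⁻¹ = √2 / 2 := by field_simp; linarith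
  have hr1 : (√2)⁻¹ < 1 := by rw [hr]; linarith
  have hall : ∀ K x, ∑ k ∈ Finset.range K, min 1 (2 ^ k * x) * (√2)⁻¹ ^ k ≤ 4 := by
    intro K x
    calc _ ≤ ∑ k ∈ Finset.range K, (√2)⁻¹ ^ k := by
          refine Finset.sum_le_sum fun k _ ↦ ?_
          exact mul_le_of_le_one_left (by positivity) (min_le_left _ _)
      _ ≤ (1 - (√2)⁻¹)⁻¹ := by
          rw [← tsum_geometric_of_lt_one (by positivity) hr1]
          exact (summable_geometric_of_lt_one (by positivity) hr1).sum_le_tsum _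
            fun _ _ ↦ by positivity
      _ ≤ 4 := by
          rw [hr]
          exact inv_le_of_inv_le₀ (by norm_num) (by linarith)
  -- the correction `-3 x` absorbs the term `k = 0`, so that the induction on `K` closes under `x ↦ 2 x`
  have hmain : ∀ K : ℕ, ∀ x : ℝ, 0 < x → x ≤ 1 →
      ∑ k ∈ Finset.range K, min 1 (2 ^ k * x) * (√2)⁻¹ ^ k ≤ 10 * √x - 3 * x := by
    intro K
    induction K with
    | zero =>
      intro x hx hx1
      have : x ≤ √x := Real.le_sqrt_of_sq_le (by nlinarith)
      simp only [Finset.range_zero, Finset.sum_empty]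
      linarith
    | succ K ih =>
      intro x hx hx1
      rcases le_or_gt x (1 / 2) with h | h
      · rw [Finset.sum_range_succ']
        have e : ∑ k ∈ Finset.range K, min 1 (2 ^ (k + 1) * x) * (√2)⁻¹ ^ (k + 1) =
            (√2)⁻¹ * ∑ k ∈ Finset.range K, min 1 (2 ^ k * (2 * x)) * (√2)⁻¹ ^ k := by
          rw [Finset.mul_sum]
          refine Finset.sum_congr rfl fun k _ ↦ ?_
          rw [pow_succ, pow_succ, mul_assoc]
          ring
        have hi := mul_le_mul_of_nonneg_left (ih (2 * x) (by linarith) (by linarith))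
          (inv_nonneg.2 h20.le)
        rw [e]
        have hm : min 1 (2 ^ 0 * x) * (√2)⁻¹ ^ 0 ≤ x := by simp
        have hs : √(2 * x) = √2 * √x := Real.sqrt_mul (by norm_num) x
        have e2 : (√2)⁻¹ * (10 * √(2 * x) - 3 * (2 * x)) = 10 * √x - 3 * √2 * x := by
          rw [hs, hr]
          linear_combination 5 * √x * h2
        nlinarith
      · have : 0.7 ≤ √x := Real.le_sqrt_of_sq_le (by linarith)
        have h4 := hall (K + 1) x
        linarith
  rcases le_total x 1 with h | h
  · linarith [hmain K x hx h]
  · have : 1 ≤ √x := Real.one_le_sqrt.2 h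
    linarith [hall K x]

/-- A Schur test over dyadic scales: increments which at scale `w` are bounded by
`∑ₖ min(1, 2ᵏ |w|) aₖ` have energy at most a constant times `∑ₖ 2ᵏ aₖ²`. -/
lemma lintegral_kern_sum_sq_le (K : ℕ) (a : ℕ → ℝ≥0∞) :
    ∫⁻ w : Space N, kern w * (∑ k ∈ Finset.range K, min 1 (2 ^ k * ‖w‖ₑ) * a k) ^ 2 ≤
      10 * kernConst N * ∑ k ∈ Finset.range K, 2 ^ k * a k ^ 2 := by
  have hk := measurable_kern (N := N)
  let s : ℝ≥0∞ := ENNReal.ofReal √2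
  have hs2 : s ^ 2 = 2 := by
    simp only [s]
    rw [← ENNReal.ofReal_pow (by positivity), Real.sq_sqrt (by norm_num)]
    simp
  have hs0 : s ≠ 0 := by simp [s]
  have hst : s ≠ ⊤ := by simp [s]
  have hss : ∀ k : ℕ, (s⁻¹) ^ k * s ^ k = 1 := fun k ↦ by
    rw [← mul_pow, ENNReal.inv_mul_cancel hs0 hst, one_pow]
  have hs2k : ∀ k : ℕ, s ^ k * s ^ k = 2 ^ k := fun k ↦ by rw [← mul_pow, ← sq, hs2]
  -- weighted Cauchy-Schwarz: the weights `2^{-k/2}` give a factor `|w|^{1/2}` by `sum_min_two_pow_le`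
  have hpt : ∀ w : Space N, w ≠ 0 →
      (∑ k ∈ Finset.range K, min 1 (2 ^ k * ‖w‖ₑ) * a k) ^ 2 ≤
      ∑ k ∈ Finset.range K, 10 * (s ^ k * a k ^ 2) * (‖w‖ₑ ^ (1 / 2 : ℝ) *
        min 1 (2 ^ k * ‖w‖ₑ)) := by
    intro w hw
    have hw' : 0 < ‖w‖ := norm_pos_iff.2 hw
    have h1 : ∑ k ∈ Finset.range K, min 1 (2 ^ k * ‖w‖ₑ) * (s⁻¹) ^ k ≤ 10 * ‖w‖ₑ ^ (1 / 2 : ℝ) := by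
      have := ENNReal.ofReal_le_ofReal (sum_min_two_pow_le K ‖w‖ hw')
      rw [ENNReal.ofReal_sum_of_nonneg (fun k _ ↦ by positivity)] at this
      rw [← ofReal_norm, ENNReal.ofReal_rpow_of_pos hw', ← Real.sqrt_eq_rpow]
      refine le_trans (Finset.sum_le_sum fun k _ ↦ ?_) (this.trans_eq ?_)
      · rw [ENNReal.ofReal_mul (by positivity), ENNReal.ofReal_min,
          ENNReal.ofReal_mul (by positivity), ENNReal.ofReal_pow (by positivity),
          ENNReal.ofReal_pow (by positivity), ENNReal.ofReal_inv_of_pos (by positivity)]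
        simp [s]
      · rw [ENNReal.ofReal_mul (by norm_num)]
        simp
    calc _ = (∑ k ∈ Finset.range K, (min 1 (2 ^ k * ‖w‖ₑ) * (s⁻¹) ^ k) * (s ^ k * a k)) ^ 2 := by
          congr 1
          refine Finset.sum_congr rfl fun k _ ↦ ?_
          rw [mul_assoc, ← mul_assoc (s⁻¹ ^ k), hss, one_mul]
      _ ≤ _ := ennreal_sum_weight_sq_le _ _ _
      _ ≤ (10 * ‖w‖ₑ ^ (1 / 2 : ℝ)) *
          ∑ k ∈ Finset.range K, min 1 (2 ^ k * ‖w‖ₑ) * (s⁻¹) ^ k * (s ^ k * a k) ^ 2 := by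
          gcongr
      _ = _ := by
          rw [Finset.mul_sum]
          refine Finset.sum_congr rfl fun k _ ↦ ?_
          calc _ = 10 * ((s⁻¹ ^ k * s ^ k) * s ^ k * a k ^ 2) *
                (‖w‖ₑ ^ (1 / 2 : ℝ) * min 1 (2 ^ k * ‖w‖ₑ)) := by ring
            _ = _ := by rw [hss, one_mul]
  -- by scaling, each remaining integral is a multiple of the constant one
  have hint : ∀ k : ℕ, ∫⁻ w : Space N, kern w * (‖w‖ₑ ^ (1 / 2 : ℝ) * min 1 (2 ^ k * ‖w‖ₑ)) =
      s ^ k * kernConst N := by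
    intro k
    have h2k : (0 : ℝ) < 2 ^ k := by positivity
    have e2 : ENNReal.ofReal (2 ^ k) = 2 ^ k := by
      rw [ENNReal.ofReal_pow (by norm_num)]; simp
    have h := lintegral_kern_scale (N := N) h2k
      (g := fun w ↦ ‖w‖ₑ ^ (1 / 2 : ℝ) * min 1 ‖w‖ₑ) (by fun_prop)
    have e3 : ∀ w : Space N, ‖(2 ^ k : ℝ) • w‖ₑ = 2 ^ k * ‖w‖ₑ := fun w ↦ by
      rw [enorm_smul, Real.enorm_of_nonneg h2k.le, e2]
    have e4 : ((2 : ℝ≥0∞) ^ k) ^ (1 / 2 : ℝ) = s ^ k := by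
      rw [← hs2k, ← sq, ← ENNReal.rpow_natCast, ← ENNReal.rpow_mul]
      norm_num
    have e5 : ∀ w : Space N, kern w * ((2 ^ k * ‖w‖ₑ) ^ (1 / 2 : ℝ) * min 1 (2 ^ k * ‖w‖ₑ)) =
        s ^ k * (kern w * (‖w‖ₑ ^ (1 / 2 : ℝ) * min 1 (2 ^ k * ‖w‖ₑ))) := fun w ↦ by
      rw [ENNReal.mul_rpow_of_nonneg _ _ (by norm_num), e4]
      ring
    simp_rw [e3, e5] at h
    rw [lintegral_const_mul _ (by fun_prop), e2, ← hs2k k, mul_assoc, hs2k k] at h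
    exact (ENNReal.mul_right_inj (pow_ne_zero _ hs0) (ENNReal.pow_ne_top hst)).1 h
  calc _ ≤ ∫⁻ w : Space N, ∑ k ∈ Finset.range K, 10 * (s ^ k * a k ^ 2) *
        (kern w * (‖w‖ₑ ^ (1 / 2 : ℝ) * min 1 (2 ^ k * ‖w‖ₑ))) := by
        refine lintegral_mono fun w ↦ ?_
        rcases eq_or_ne w 0 with rfl | hw
        · simp
        refine (mul_le_mul_right (hpt w hw) (kern w)).trans_eq ?_
        rw [Finset.mul_sum]
        refine Finset.sum_congr rfl fun k _ ↦ ?_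
        ring
    _ = ∑ k ∈ Finset.range K, 10 * (s ^ k * a k ^ 2) * (s ^ k * kernConst N) := by
        rw [lintegral_finsetSum _ (by fun_prop)]
        refine Finset.sum_congr rfl fun k _ ↦ ?_
        rw [lintegral_const_mul _ (by fun_prop), hint]
    _ = _ := by
        rw [Finset.mul_sum]
        refine Finset.sum_congr rfl fun k _ ↦ ?_
        rw [← hs2k]
        ring

/-- A geometric sum is controlled by its last term. The indicator keeps the scales `2ᵏ ≤ t` only. -/
lemma sum_pow_two_pow_le (m : ℕ) (hm : m ≠ 0) (K : ℕ) (t : ℝ) :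
    ∑ k ∈ Finset.range K, (if (2 : ℝ) ^ k ≤ t then ((2 : ℝ) ^ k) ^ m else 0) ≤
      if 1 ≤ t then 2 * t ^ m - 1 else 0 := by
  induction K generalizing t with
  | zero =>
    simp only [Finset.range_zero, Finset.sum_empty]
    split_ifs with h
    · linarith [one_le_pow₀ h (n := m)]
    · rfl
  | succ K ih =>
    rw [Finset.sum_range_succ']
    have e : ∑ k ∈ Finset.range K, (if (2 : ℝ) ^ (k + 1) ≤ t then ((2 : ℝ) ^ (k + 1)) ^ m else 0) =
        2 ^ m * ∑ k ∈ Finset.range K, (if (2 : ℝ) ^ k ≤ t / 2 then ((2 : ℝ) ^ k) ^ m else 0) := by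
      rw [Finset.mul_sum]
      refine Finset.sum_congr rfl fun k _ ↦ ?_
      have : (2 : ℝ) ^ (k + 1) ≤ t ↔ (2 : ℝ) ^ k ≤ t / 2 := by
        rw [pow_succ, le_div_iff₀ (by norm_num)]
      simp only [this]
      split_ifs
      · rw [← mul_pow, pow_succ, mul_comm]
      · simp
    rw [e]
    have h2m : (2 : ℝ) ≤ 2 ^ m := by
      calc (2 : ℝ) = 2 ^ 1 := by norm_num
        _ ≤ 2 ^ m := pow_le_pow_right₀ (by norm_num) (Nat.one_le_iff_ne_zero.2 hm)
    have := mul_le_mul_of_nonneg_left (ih (t / 2)) (by positivity : (0 : ℝ) ≤ 2 ^ m)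
    by_cases h1 : 1 ≤ t
    · simp only [pow_zero, h1, if_true, one_pow]
      by_cases h2 : 1 ≤ t / 2
      · simp only [h2, if_true] at this
        have e2 : (2 : ℝ) ^ m * (2 * (t / 2) ^ m - 1) = 2 * t ^ m - 2 ^ m := by
          rw [mul_sub, mul_one, mul_left_comm, ← mul_pow]
          congr 3
          ring
        linarith
      · simp only [h2, if_false, mul_zero] at this
        linarith [one_le_pow₀ h1 (n := m)]
    · have h2 : ¬ 1 ≤ t / 2 := by linarith
      simp only [h2, if_false, mul_zero] at this
      simpa [h1] using this

/-- Averages over balls of radius `R a 2^{-k}`, summed over `k` with the weights `2ᵏ`, are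
controlled by the integral against the kernel. -/
lemma sum_lintegral_scale_le {a R : ℝ} (ha : 0 < a) (hR : 0 < R) (K : ℕ) {g : Space N → ℝ≥0∞}
    (hg : Measurable g) :
    ∑ k ∈ Finset.range K, 2 ^ k * ∫⁻ z in Metric.closedBall (0 : Space N) R, g ((a * 2⁻¹ ^ k) • z) ≤
      ENNReal.ofReal (2 * a * R ^ (N + 1)) * ∫⁻ w, kern w * g w := by
  have hk := measurable_kern (N := N)
  have hm : ∀ ρ : ℝ, MeasurableSet {w : Space N | ‖w‖ ≤ ρ} := fun ρ ↦
    measurableSet_le (by fun_prop) (by fun_prop)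
  have hε : ∀ k : ℕ, 0 < a * 2⁻¹ ^ k := fun k ↦ by positivity
  have h2 : ∀ k : ℕ, (2 : ℝ≥0∞) ^ k = ENNReal.ofReal (2 ^ k) := fun k ↦ by
    rw [ENNReal.ofReal_pow (by norm_num)]; simp
  -- in the variable `w = a 2^{-k} z`, the scale `k` covers the ball of radius `R a 2^{-k}`
  have hterm : ∀ k : ℕ, 2 ^ k * ∫⁻ z in Metric.closedBall (0 : Space N) R, g ((a * 2⁻¹ ^ k) • z) =
      ∫⁻ w, ENNReal.ofReal (2 ^ k * ((a * 2⁻¹ ^ k) ^ N)⁻¹) *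
        {w : Space N | ‖w‖ ≤ R * (a * 2⁻¹ ^ k)}.indicator g w := by
    intro k
    have h := lintegral_comp_smul (hε k) (hg.indicator (hm (R * (a * 2⁻¹ ^ k))))
    rw [lintegral_const_mul _ (hg.indicator (hm _)), ENNReal.ofReal_mul (by positivity), mul_assoc,
      ← h, ← h2, ← lintegral_indicator measurableSet_closedBall]
    congr 2 with z
    have : z ∈ Metric.closedBall (0 : Space N) R ↔
        (a * 2⁻¹ ^ k) • z ∈ {w : Space N | ‖w‖ ≤ R * (a * 2⁻¹ ^ k)} := by
      rw [mem_closedBall_zero_iff, mem_ofPred_eq, norm_smul, Real.norm_of_nonneg (hε k).le,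
        mul_comm R, mul_le_mul_iff_right₀ (hε k)]
    by_cases hz : z ∈ Metric.closedBall (0 : Space N) R
    · rw [indicator_of_mem hz, indicator_of_mem (this.1 hz)]
    · rw [indicator_of_notMem hz, indicator_of_notMem (mt this.2 hz)]
  simp_rw [hterm]
  rw [← lintegral_finsetSum _ (fun k _ ↦ (hg.indicator (hm _)).const_mul _),
    ← lintegral_const_mul _ (by fun_prop)]
  refine lintegral_mono fun w ↦ ?_
  rcases eq_or_ne w 0 with rfl | hw
  · rcases eq_or_ne (g 0) 0 with hg0 | hg0
    · simp [indicator_apply, hg0]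
    · have : kern (0 : Space N) = ⊤ := by simp [kern]
      rw [this, ENNReal.top_mul hg0, ENNReal.mul_top]
      · exact le_top
      · simp only [ne_eq, ENNReal.ofReal_eq_zero, not_le]
        positivity
  have hw' : 0 < ‖w‖ := norm_pos_iff.2 hw
  have hkern : kern w = ENNReal.ofReal ((‖w‖ ^ (N + 1))⁻¹) := by
    rw [kern, ← ofReal_norm, ENNReal.ofReal_inv_of_pos (by positivity), ENNReal.ofReal_pow hw'.le]
  rw [hkern, ← mul_assoc, ← ENNReal.ofReal_mul (by positivity)]
  calc _ = (∑ k ∈ Finset.range K, ENNReal.ofReal ((a ^ N)⁻¹ *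
        (if (2 : ℝ) ^ k ≤ R * a / ‖w‖ then ((2 : ℝ) ^ k) ^ (N + 1) else 0))) * g w := by
        rw [Finset.sum_mul]
        refine Finset.sum_congr rfl fun k _ ↦ ?_
        have : ‖w‖ ≤ R * (a * 2⁻¹ ^ k) ↔ (2 : ℝ) ^ k ≤ R * a / ‖w‖ := by
          rw [le_div_iff₀ hw', inv_pow, ← mul_assoc, ← div_eq_mul_inv, le_div_iff₀ (by positivity),
            mul_comm]
        by_cases h : (2 : ℝ) ^ k ≤ R * a / ‖w‖
        · rw [if_pos h, indicator_of_mem (show w ∈ _ from this.2 h)]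
          congr 2
          rw [mul_pow, inv_pow, inv_pow, mul_inv, inv_inv, pow_succ]
          ring
        · rw [if_neg h, indicator_of_notMem (show w ∉ _ from mt this.1 h)]
          simp
    _ ≤ _ := by
        rw [← ENNReal.ofReal_sum_of_nonneg (fun k _ ↦ by positivity), ← Finset.mul_sum]
        refine mul_le_mul_left (ENNReal.ofReal_le_ofReal ?_) _
        refine (mul_le_mul_of_nonneg_left (sum_pow_two_pow_le (N + 1) (by omega) K (R * a / ‖w‖))
          (by positivity)).trans ?_
        split_ifs with h
        · calc (a ^ N)⁻¹ * (2 * (R * a / ‖w‖) ^ (N + 1) - 1)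
              ≤ (a ^ N)⁻¹ * (2 * (R * a / ‖w‖) ^ (N + 1)) := by
                gcongr
                linarith
            _ = _ := by
                rw [div_pow, mul_pow, pow_succ a]
                field_simp
        · rw [mul_zero]
          positivity

end

section

variable {N : ℕ}

/-! ### Averages at a given scale -/

/-- The average `x ↦ ∫ θ(z) f(x + ε z) dz` of `f` at scale `ε`, weighted by `θ`. The scale may be
negative. -/
noncomputable def avg (θ : Space N → ℝ) (ε : ℝ) (f : Space N → ℝ) (x : Space N) : ℝ :=
  ∫ z, θ z * f (x + ε • z)

lemma lintegral_comp_affine {ε : ℝ} (hε : ε ≠ 0) (x : Space N) {g : Space N → ℝ≥0∞}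
    (hg : Measurable g) :
    ∫⁻ z, g (x + ε • z) = ENNReal.ofReal |(ε ^ N)⁻¹| * ∫⁻ z, g z := by
  rw [← lintegral_map (f := fun z ↦ g (x + z)) (by fun_prop) (measurable_const_smul ε),
    Measure.map_addHaar_smul _ hε, lintegral_smul_measure, lintegral_add_left_eq_self g x]
  simp

lemma memLp_two_iff_lTwo {f : Space N → ℝ} (hf : Measurable f) :
    MemLp f 2 volume ↔ lTwo univ f < ⊤ := by
  rw [lTwo, Measure.restrict_univ]
  exact ⟨fun h ↦ h.2, fun h ↦ ⟨hf.aestronglyMeasurable, h⟩⟩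

lemma memLp_comp_affine {ε : ℝ} (hε : ε ≠ 0) (x : Space N) {f : Space N → ℝ} (hf : Measurable f)
    (hf2 : MemLp f 2) : MemLp (fun z ↦ f (x + ε • z)) 2 := by
  refine ⟨Measurable.aestronglyMeasurable (by fun_prop), ?_⟩
  have h : eLpNorm (fun z ↦ f (x + ε • z)) 2 volume ^ 2 < ⊤ := by
    rw [eLpNorm_two_sq, lintegral_comp_affine (g := fun z ↦ ‖f z‖ₑ ^ 2) hε x (by fun_prop),
      ← eLpNorm_two_sq]
    exact ENNReal.mul_lt_top ENNReal.ofReal_lt_top (ENNReal.pow_lt_top hf2.2)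
  exact (ENNReal.pow_lt_top_iff.1 h).resolve_right (by norm_num)

lemma integrable_avg {θ : Space N → ℝ} (hθ : ContDiff ℝ ∞ θ) (hc : HasCompactSupport θ) {ε : ℝ}
    (hε : ε ≠ 0) (x : Space N) {f : Space N → ℝ} (hf : Measurable f) (hf2 : MemLp f 2) :
    Integrable (fun z ↦ θ z * f (x + ε • z)) :=
  MemLp.integrable_mul (p := 2) (q := 2) (hθ.continuous.memLp_of_hasCompactSupport hc)
    (memLp_comp_affine hε x hf hf2)

lemma measurable_avg {θ : Space N → ℝ} (hθ : Measurable θ) (ε : ℝ) {f : Space N → ℝ}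
    (hf : Measurable f) : Measurable (avg θ ε f) := by
  have : Measurable fun p : Space N × Space N ↦ θ p.2 * f (p.1 + ε • p.2) := by fun_prop
  exact (this.stronglyMeasurable.integral_prod_right' (ν := volume)).measurable

/-- The kernel of the convolution operator `avg θ ε`. -/
noncomputable def scaled (θ : Space N → ℝ) (ε : ℝ) (u : Space N) : ℝ :=
  |(ε ^ N)⁻¹| * θ ((-ε⁻¹) • u)

lemma avg_eq_convolution (θ : Space N → ℝ) {ε : ℝ} (hε : ε ≠ 0) (f : Space N → ℝ) :
    avg θ ε f = convolution f (scaled θ ε) (ContinuousLinearMap.mul ℝ ℝ) volume := by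
  ext x
  have h1 := Measure.integral_comp_smul (volume : Measure (Space N))
    (fun t ↦ θ (ε⁻¹ • t) * f (x + t)) ε
  simp only [inv_smul_smul₀ hε, finrank_euclideanSpace, Fintype.card_fin] at h1
  have h2 := integral_add_left_eq_self (μ := (volume : Measure (Space N)))
    (fun t ↦ θ (ε⁻¹ • (t - x)) * f t) x
  simp only [add_sub_cancel_left] at h2
  rw [avg, h1, h2, convolution_def, ← integral_smul]
  congr 1 with t
  have : (-ε⁻¹) • (x - t) = ε⁻¹ • (t - x) := by rw [neg_smul, ← smul_neg, neg_sub]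
  simp only [scaled, ContinuousLinearMap.mul_apply', smul_eq_mul, this]
  ring

lemma contDiff_scaled {θ : Space N → ℝ} (hθ : ContDiff ℝ ∞ θ) (ε : ℝ) :
    ContDiff ℝ ∞ (scaled θ ε) := by
  unfold scaled
  fun_prop

lemma hasCompactSupport_scaled {θ : Space N → ℝ} (hc : HasCompactSupport θ) {ε : ℝ} (hε : ε ≠ 0) :
    HasCompactSupport (scaled θ ε) := by
  have : HasCompactSupport (fun u ↦ θ ((-ε⁻¹) • u)) :=
    hc.comp_homeomorph (Homeomorph.smulOfNeZero (-ε⁻¹) (by simpa using hε))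
  exact this.mul_left

lemma locallyIntegrable_of_memLp_two {f : Space N → ℝ} (hf : MemLp f 2) :
    LocallyIntegrable f volume := hf.locallyIntegrable (by norm_num)

lemma contDiff_avg {θ : Space N → ℝ} (hθ : ContDiff ℝ ∞ θ) (hc : HasCompactSupport θ) {ε : ℝ}
    (hε : ε ≠ 0) {f : Space N → ℝ} (hf : MemLp f 2) : ContDiff ℝ ∞ (avg θ ε f) := by
  rw [avg_eq_convolution θ hε]
  exact (hasCompactSupport_scaled hc hε).contDiff_convolution_right _
    (locallyIntegrable_of_memLp_two hf) (contDiff_scaled hθ ε)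

/-- The derivative of an average falls on the weight. -/
lemma fderiv_avg {θ : Space N → ℝ} (hθ : ContDiff ℝ ∞ θ) (hc : HasCompactSupport θ) {ε : ℝ}
    (hε : ε ≠ 0) {f : Space N → ℝ} (hf : MemLp f 2) (x e : Space N) :
    fderiv ℝ (avg θ ε f) x e = -ε⁻¹ * avg (fun z ↦ fderiv ℝ θ z e) ε f x := by
  have hs := contDiff_scaled hθ ε
  have hsc := hasCompactSupport_scaled hc hε
  have h := hsc.hasFDerivAt_convolution_right (ContinuousLinearMap.mul ℝ ℝ)
    (locallyIntegrable_of_memLp_two hf) (hs.of_le (by simp)) x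
  rw [avg_eq_convolution θ hε, h.fderiv, convolution_precompR_apply _
    (locallyIntegrable_of_memLp_two hf) (hsc.fderiv ℝ) (hs.continuous_fderiv (by simp)),
    avg_eq_convolution _ hε]
  rw [convolution_def, convolution_def, ← integral_const_mul]
  congr 1 with t
  have hd : ∀ u, fderiv ℝ (scaled θ ε) u e = -ε⁻¹ * scaled (fun z ↦ fderiv ℝ θ z e) ε u := by
    intro u
    have h1 : HasFDerivAt (fun u : Space N ↦ (-ε⁻¹) • u)
        ((-ε⁻¹) • ContinuousLinearMap.id ℝ (Space N)) u :=
      ((-ε⁻¹) • ContinuousLinearMap.id ℝ (Space N)).hasFDerivAt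
    have h2 : HasFDerivAt θ (fderiv ℝ θ ((-ε⁻¹) • u)) ((-ε⁻¹) • u) :=
      (hθ.differentiable (by simp) _).hasFDerivAt
    have h3 := (h2.comp u h1).const_mul |(ε ^ N)⁻¹|
    have h4 : fderiv ℝ (scaled θ ε) u = _ := h3.fderiv
    rw [h4]
    simp [scaled]
    ring
  rw [hd]
  simp only [ContinuousLinearMap.mul_apply']
  ring

/-- The derivative of an average of a smooth function is the average of the derivative. -/
lemma fderiv_avg_of_smooth {θ : Space N → ℝ} (hθ : ContDiff ℝ ∞ θ) (hc : HasCompactSupport θ)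
    {ε : ℝ} (hε : ε ≠ 0) {f : Space N → ℝ} (hf : ContDiff ℝ ∞ f) (hfc : HasCompactSupport f)
    (x e : Space N) :
    fderiv ℝ (avg θ ε f) x e = avg θ ε (fun y ↦ fderiv ℝ f y e) x := by
  rw [fderiv_avg hθ hc hε (hf.continuous.memLp_of_hasCompactSupport hfc)]
  have hF : ∀ z : Space N, fderiv ℝ (fun z ↦ f (x + ε • z)) z e = ε * fderiv ℝ f (x + ε • z) e := by
    intro z
    have h1 : HasFDerivAt (fun z : Space N ↦ x + ε • z)
        (ε • ContinuousLinearMap.id ℝ (Space N)) z := ((hasFDerivAt_id z).const_smul ε).const_add x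
    have h2 : HasFDerivAt f (fderiv ℝ f (x + ε • z)) (x + ε • z) :=
      (hf.differentiable (by simp) _).hasFDerivAt
    have h4 : fderiv ℝ (fun z ↦ f (x + ε • z)) z = _ := (h2.comp z h1).fderiv
    rw [h4]
    simp
  have hFd : ContDiff ℝ ∞ (fun z ↦ f (x + ε • z)) := by fun_prop
  have hθ' : Continuous fun z ↦ fderiv ℝ θ z e :=
    (hθ.continuous_fderiv (by simp)).clm_apply continuous_const
  have hf' : Continuous fun z ↦ fderiv ℝ f z e :=
    (hf.continuous_fderiv (by simp)).clm_apply continuous_const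
  have key := integral_mul_fderiv_eq_neg_fderiv_mul_of_integrable (μ := volume) (f := θ)
    (g := fun z ↦ f (x + ε • z)) (v := e) ?_ ?_ ?_
    (fun z _ ↦ hθ.differentiable (by simp) z) (fun z _ ↦ hFd.differentiable (by simp) z)
  · simp_rw [hF] at key
    unfold avg
    have e1 : ∫ z, θ z * (ε * fderiv ℝ f (x + ε • z) e) =
        ε * ∫ z, θ z * fderiv ℝ f (x + ε • z) e := by
      rw [← integral_const_mul]
      congr 1 with z
      ring
    rw [e1] at key
    field_simp
    linarith
  · exact Continuous.integrable_of_hasCompactSupport (by fun_prop)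
      ((hc.fderiv_apply ℝ e).mul_right)
  · simp_rw [hF]
    exact Continuous.integrable_of_hasCompactSupport (by fun_prop) hc.mul_right
  · exact Continuous.integrable_of_hasCompactSupport (by fun_prop) hc.mul_right

lemma avg_eq_zero {θ : Space N → ℝ} {ε : ℝ} {f : Space N → ℝ} {x : Space N}
    (h : ∀ z ∈ tsupport θ, f (x + ε • z) = 0) : avg θ ε f x = 0 := by
  unfold avg
  rw [integral_eq_zero_of_ae]
  refine Filter.Eventually.of_forall fun z ↦ ?_
  by_cases hz : z ∈ tsupport θ
  · simp [h z hz]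
  · simp [image_eq_zero_of_notMem_tsupport hz]

/-- The support of an average. -/
lemma tsupport_avg_subset {θ : Space N → ℝ} (hc : HasCompactSupport θ) {ε : ℝ} {f : Space N → ℝ}
    {K : Set (Space N)} (hK : IsCompact K) (h0 : ∀ x ∉ K, f x = 0) {x : Space N}
    (hx : x ∈ tsupport (avg θ ε f)) : ∃ z ∈ tsupport θ, x + ε • z ∈ K := by
  have hcl : IsClosed ((fun p : Space N × Space N ↦ p.1 - ε • p.2) '' (K ×ˢ tsupport θ)) :=
    ((hK.prod hc).image (by fun_prop)).isClosed
  have hsub : tsupport (avg θ ε f) ⊆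
      (fun p : Space N × Space N ↦ p.1 - ε • p.2) '' (K ×ˢ tsupport θ) := by
    refine closure_minimal (fun y hy ↦ ?_) hcl
    by_contra hcon
    refine hy (avg_eq_zero fun z hz ↦ h0 _ fun hzK ↦ hcon ⟨(y + ε • z, z), ⟨hzK, hz⟩, ?_⟩)
    simp
  obtain ⟨⟨k, z⟩, ⟨hk, hz⟩, rfl⟩ := hsub hx
  exact ⟨z, hz, by simpa using hk⟩

lemma hasCompactSupport_avg {θ : Space N → ℝ} (hc : HasCompactSupport θ) {ε : ℝ} {f : Space N → ℝ}
    {K : Set (Space N)} (hK : IsCompact K) (h0 : ∀ x ∉ K, f x = 0) :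
    HasCompactSupport (avg θ ε f) := by
  refine HasCompactSupport.of_support_subset_isCompact (K := (fun p : Space N × Space N ↦ p.1 - ε • p.2) ''
    (K ×ˢ tsupport θ)) ((hK.prod hc).image (by fun_prop)) fun x hx ↦ ?_
  obtain ⟨z, hz, hzK⟩ := tsupport_avg_subset hc hK h0 (subset_tsupport _ hx)
  exact ⟨(x + ε • z, z), ⟨hzK, hz⟩, by simp⟩

/-- The adjoint of `avg θ ε` is `avg θ (-ε)`. -/
lemma integral_avg_mul {θ : Space N → ℝ} (hθ : ContDiff ℝ ∞ θ) (hc : HasCompactSupport θ) (ε : ℝ)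
    {f g : Space N → ℝ} (hf : Measurable f) (hg : Measurable g) (hf2 : MemLp f 2) (hg2 : MemLp g 2) :
    ∫ x, avg θ ε f x * g x = ∫ x, f x * avg θ (-ε) g x := by
  have hθm := hθ.continuous.measurable
  have hint : ∀ (ε : ℝ) {f g : Space N → ℝ}, Measurable f → Measurable g → MemLp f 2 → MemLp g 2 →
      Integrable (fun p : Space N × Space N ↦ θ p.2 * f (p.1 + ε • p.2) * g p.1)
        (volume.prod volume) := by
    intro ε f g hf hg hf2 hg2
    refine ⟨Measurable.aestronglyMeasurable (by fun_prop), ?_⟩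
    rw [hasFiniteIntegral_iff_enorm, lintegral_prod_symm _ (by fun_prop)]
    simp only [enorm_mul, mul_assoc]
    calc ∫⁻ z, ∫⁻ x, ‖θ z‖ₑ * (‖f (x + ε • z)‖ₑ * ‖g x‖ₑ)
        ≤ ∫⁻ z, ‖θ z‖ₑ * (eLpNorm f 2 volume * eLpNorm g 2 volume) := by
          refine lintegral_mono fun z ↦ ?_
          rw [lintegral_const_mul _ (by fun_prop)]
          gcongr
          have h1 := lintegral_mul_sq_le volume (f := fun x ↦ ‖f (x + ε • z)‖ₑ)
            (g := fun x ↦ ‖g x‖ₑ) (by fun_prop) (by fun_prop)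
          rw [lintegral_add_right_eq_self (fun x ↦ ‖f x‖ₑ ^ 2) (ε • z), ← eLpNorm_two_sq,
            ← eLpNorm_two_sq, ← mul_pow] at h1
          exact (ENNReal.pow_right_strictMono two_ne_zero).le_iff_le.1 h1
      _ = (∫⁻ z, ‖θ z‖ₑ) * (eLpNorm f 2 volume * eLpNorm g 2 volume) := by
          rw [lintegral_mul_const _ (by fun_prop)]
      _ < ⊤ := by
          refine ENNReal.mul_lt_top ?_ (ENNReal.mul_lt_top hf2.2 hg2.2)
          exact (hθ.continuous.integrable_of_hasCompactSupport hc).2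
  unfold avg
  have e1 : ∀ x, (∫ z, θ z * f (x + ε • z)) * g x = ∫ z, θ z * f (x + ε • z) * g x := fun x ↦
    (integral_mul_const _ _).symm
  have e2 : ∀ x, f x * (∫ z, θ z * g (x + (-ε) • z)) = ∫ z, θ z * g (x + (-ε) • z) * f x :=
    fun x ↦ by rw [mul_comm, integral_mul_const]
  simp_rw [e1, e2]
  rw [integral_integral_swap (f := fun x z ↦ θ z * f (x + ε • z) * g x) (hint ε hf hg hf2 hg2),
    integral_integral_swap (f := fun x z ↦ θ z * g (x + (-ε) • z) * f x)
      (hint (-ε) hg hf hg2 hf2)]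
  congr 1 with z
  have h := integral_add_right_eq_self (μ := (volume : Measure (Space N)))
    (fun x ↦ θ z * g (x + (-ε) • z) * f x) (ε • z)
  rw [← h]
  congr 1 with x
  simp
  ring

/-! ### Bounds for averages -/

lemma lintegral_sq_integral_mul_le {θ : Space N → ℝ} (hθ : Measurable θ) {M : ℝ≥0∞}
    (hM : ∀ z, ‖θ z‖ₑ ≤ M) {Z : Set (Space N)} (hZ : MeasurableSet Z) (h0 : ∀ z ∉ Z, θ z = 0)
    (B : Set (Space N)) {g : Space N → Space N → ℝ}
    (hg : Measurable fun p : Space N × Space N ↦ g p.1 p.2) :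
    ∫⁻ x in B, ‖∫ z, θ z * g x z‖ₑ ^ 2 ≤ M ^ 2 * volume Z * ∫⁻ z in Z, ∫⁻ x in B, ‖g x z‖ₑ ^ 2 := by
  have hpt : ∀ x, ‖∫ z, θ z * g x z‖ₑ ^ 2 ≤ M ^ 2 * volume Z * ∫⁻ z in Z, ‖g x z‖ₑ ^ 2 := by
    intro x
    have hgx : Measurable fun z ↦ g x z := hg.comp (measurable_prodMk_left (x := x))
    calc ‖∫ z, θ z * g x z‖ₑ ^ 2 ≤ (∫⁻ z in Z, ‖θ z‖ₑ * ‖g x z‖ₑ) ^ 2 := by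
          gcongr
          refine (enorm_integral_le_lintegral_enorm _).trans ?_
          rw [← lintegral_indicator hZ]
          refine lintegral_mono fun z ↦ ?_
          by_cases hz : z ∈ Z <;> simp [hz, h0]
      _ ≤ _ := lintegral_mul_sq_le _ (by fun_prop) (by fun_prop)
      _ ≤ (∫⁻ z in Z, M ^ 2) * ∫⁻ z in Z, ‖g x z‖ₑ ^ 2 := by
          gcongr
          exact hM _
      _ = _ := by rw [setLIntegral_const]
  have hm : Measurable fun p : Space N × Space N ↦ ‖g p.1 p.2‖ₑ ^ 2 := by fun_prop
  calc _ ≤ ∫⁻ x in B, M ^ 2 * volume Z * ∫⁻ z in Z, ‖g x z‖ₑ ^ 2 := by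
        gcongr with x
        exact hpt x
    _ = M ^ 2 * volume Z * ∫⁻ x in B, ∫⁻ z in Z, ‖g x z‖ₑ ^ 2 := by
        rw [lintegral_const_mul _ (hm.lintegral_prod_right' (ν := volume.restrict Z))]
    _ = _ := by
        rw [lintegral_lintegral_swap hm.aemeasurable]

/-- The mean square oscillation of `f` at scale `ε`, over the points of `B`. -/
noncomputable def osc (B : Set (Space N)) (f : Space N → ℝ) (ε : ℝ) : ℝ≥0∞ :=
  ∫⁻ z in Metric.closedBall (0 : Space N) 3, ∫⁻ x in B, ‖f (x + ε • z) - f x‖ₑ ^ 2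

lemma osc_neg (B : Set (Space N)) {f : Space N → ℝ} (ε : ℝ) :
    osc B f (-ε) = osc B f ε := by
  unfold osc
  rw [← lintegral_indicator measurableSet_closedBall, ← lintegral_indicator measurableSet_closedBall,
    ← lintegral_neg_eq_self (fun z ↦ (Metric.closedBall (0 : Space N) 3).indicator _ z)]
  congr 1 with z
  by_cases hz : z ∈ Metric.closedBall (0 : Space N) 3
  · have hz' : -z ∈ Metric.closedBall (0 : Space N) 3 := by simpa using hz
    rw [indicator_of_mem hz, indicator_of_mem hz']
    simp
  · have hz' : -z ∉ Metric.closedBall (0 : Space N) 3 := by simpa using hz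
    rw [indicator_of_notMem hz, indicator_of_notMem hz']

end

section

variable {N : ℕ}

/-- The volume of the ball of radius `3`. -/
noncomputable def ballVol (N : ℕ) : ℝ≥0∞ := volume (Metric.closedBall (0 : Space N) 3)

lemma ballVol_ne_top : ballVol N ≠ ⊤ := measure_closedBall_lt_top.ne

lemma lTwo_avg_le {θ : Space N → ℝ} (hθ : Measurable θ) {M : ℝ≥0∞}
    (hM : ∀ z, ‖θ z‖ₑ ≤ M) {Z : Set (Space N)} (hZ : MeasurableSet Z) (h0 : ∀ z ∉ Z, θ z = 0)
    {A B : Set (Space N)} {ε : ℝ} (hBA : ∀ x ∈ B, ∀ z ∈ Z, x + ε • z ∈ A) {f : Space N → ℝ}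
    (hf : Measurable f) : lTwo B (avg θ ε f) ^ 2 ≤ (M * volume Z * lTwo A f) ^ 2 := by
  rw [lTwo_sq]
  refine (lintegral_sq_integral_mul_le hθ hM hZ h0 B (g := fun x z ↦ f (x + ε • z))
    (by fun_prop)).trans ?_
  calc _ ≤ M ^ 2 * volume Z * ∫⁻ z in Z, lTwo A f ^ 2 := by
        refine mul_le_mul_right ?_ _
        refine setLIntegral_mono' hZ fun z hz ↦ ?_
        rw [← eLpNorm_two_sq]
        gcongr
        exact eLpNorm_comp_add_le fun x hx ↦ hBA x hx z hz
    _ = _ := by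
        rw [setLIntegral_const]
        ring

lemma incr_avg_le {θ : Space N → ℝ} (hθ : ContDiff ℝ ∞ θ) (hc : HasCompactSupport θ) {M : ℝ≥0∞}
    (hM : ∀ z, ‖θ z‖ₑ ≤ M) {Z : Set (Space N)} (hZ : MeasurableSet Z) (h0 : ∀ z ∉ Z, θ z = 0)
    {A B : Set (Space N)} {ε : ℝ} (hε : ε ≠ 0) (hBA : ∀ x ∈ B, ∀ z ∈ Z, x + ε • z ∈ A)
    {f : Space N → ℝ} (hf : Measurable f) (hf2 : MemLp f 2) (w : Space N) :
    incr B (avg θ ε f) w ^ 2 ≤ (M * volume Z * incr A f w) ^ 2 := by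
  have e : ∀ x, avg θ ε f (x + w) - avg θ ε f x = ∫ z, θ z * (f (x + ε • z + w) - f (x + ε • z)) := by
    intro x
    unfold avg
    rw [← integral_sub (integrable_avg hθ hc hε _ hf hf2) (integrable_avg hθ hc hε _ hf hf2)]
    congr 1 with z
    rw [add_right_comm]
    ring
  rw [incr_sq]
  simp_rw [e]
  refine (lintegral_sq_integral_mul_le hθ.continuous.measurable hM hZ h0 _
    (g := fun x z ↦ f (x + ε • z + w) - f (x + ε • z)) (by fun_prop)).trans ?_
  calc _ ≤ M ^ 2 * volume Z * ∫⁻ z in Z, incr A f w ^ 2 := by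
        refine mul_le_mul_right ?_ _
        refine setLIntegral_mono' hZ fun z hz ↦ ?_
        rw [← eLpNorm_two_sq]
        gcongr
        refine eLpNorm_comp_add_le (A := A ∩ (fun x ↦ x + w) ⁻¹' A)
          (f := fun y ↦ f (y + w) - f y) fun x hx ↦ ⟨hBA x hx.1 z hz, ?_⟩
        have := hBA _ hx.2 z hz
        change x + ε • z + w ∈ A
        rwa [add_right_comm]
    _ = _ := by
        rw [setLIntegral_const]
        ring

lemma lTwo_avg_sub_le {θ : Space N → ℝ} (hθ : ContDiff ℝ ∞ θ) (hc : HasCompactSupport θ) {M : ℝ≥0∞}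
    (hM : ∀ z, ‖θ z‖ₑ ≤ M) (h0 : ∀ z ∉ Metric.closedBall (0 : Space N) 3, θ z = 0)
    (B : Set (Space N)) {ε : ℝ} (hε : ε ≠ 0) {f : Space N → ℝ} (hf : Measurable f)
    (hf2 : MemLp f 2) :
    lTwo B (fun x ↦ avg θ ε f x - (∫ z, θ z) * f x) ^ 2 ≤ M ^ 2 * ballVol N * osc B f ε := by
  have e : ∀ x, avg θ ε f x - (∫ z, θ z) * f x = ∫ z, θ z * (f (x + ε • z) - f x) := by
    intro x
    unfold avg
    rw [← integral_mul_const, ← integral_sub (integrable_avg hθ hc hε _ hf hf2)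
      ((hθ.continuous.integrable_of_hasCompactSupport hc).mul_const _)]
    congr 1 with z
    ring
  rw [lTwo_sq]
  simp_rw [e]
  exact lintegral_sq_integral_mul_le hθ.continuous.measurable hM measurableSet_closedBall h0 B
    (g := fun x z ↦ f (x + ε • z) - f x) (by fun_prop)

lemma integral_fderiv_eq_zero {θ : Space N → ℝ} (hθ : ContDiff ℝ ∞ θ) (hc : HasCompactSupport θ)
    (e : Space N) : ∫ z, fderiv ℝ θ z e = 0 := by
  have h1 : Integrable (fun z ↦ fderiv ℝ θ z e) :=
    ((hθ.continuous_fderiv (by simp)).clm_apply continuous_const).integrable_of_hasCompactSupport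
      (hc.fderiv_apply ℝ e)
  have := integral_mul_fderiv_eq_neg_fderiv_mul_of_integrable (μ := volume)
    (f := fun _ : Space N ↦ (1 : ℝ)) (g := θ) (v := e) (by simp) (by simpa using h1)
    (by simpa using hθ.continuous.integrable_of_hasCompactSupport hc) (by simp)
    (fun z _ ↦ hθ.differentiable (by simp) z)
  simpa using this

/-- A smooth weight supported in the ball with centre the unit vector `ν` and radius `c ≤ 1`, with
a bound `M` for its size and its increments. -/
structure IsConeKernel (θ : Space N → ℝ) (ν : Space N) (c : ℝ) (M : ℝ≥0) : Prop where
  norm_eq : ‖ν‖ = 1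
  le_one : c ≤ 1
  contDiff : ContDiff ℝ ∞ θ
  tsupport_subset : tsupport θ ⊆ Metric.ball ν c
  bound : ∀ z, ‖θ z‖ₑ ≤ M
  incr_bound : ∀ z w, ‖θ (z + w) - θ z‖ₑ ≤ M * min 1 ‖w‖ₑ

namespace IsConeKernel

variable {θ : Space N → ℝ} {ν : Space N} {c : ℝ} {M : ℝ≥0}

lemma ball_subset (h : IsConeKernel θ ν c M) :
    Metric.ball ν c ⊆ Metric.closedBall (0 : Space N) 2 := by
  intro z hz
  rw [mem_closedBall_zero_iff]
  rw [Metric.mem_ball, dist_eq_norm] at hz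
  have := norm_le_norm_add_norm_sub' z ν
  linarith [h.norm_eq, h.le_one]

lemma hasCompactSupport (h : IsConeKernel θ ν c M) : HasCompactSupport θ :=
  (isCompact_closedBall (0 : Space N) 2).of_isClosed_subset (isClosed_tsupport θ)
    (h.tsupport_subset.trans h.ball_subset)

lemma eq_zero (h : IsConeKernel θ ν c M) {z : Space N} (hz : z ∉ Metric.ball ν c) : θ z = 0 :=
  image_eq_zero_of_notMem_tsupport fun h' ↦ hz (h.tsupport_subset h')

lemma volume_ball_le (h : IsConeKernel θ ν c M) : volume (Metric.ball ν c) ≤ ballVol N :=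
  measure_mono (h.ball_subset.trans (Metric.closedBall_subset_closedBall (by norm_num)))

lemma measurable (h : IsConeKernel θ ν c M) : Measurable θ := h.contDiff.continuous.measurable

lemma lTwo_avg_le (h : IsConeKernel θ ν c M) {A B : Set (Space N)} {ε : ℝ}
    (hBA : ∀ x ∈ B, ∀ z ∈ Metric.ball ν c, x + ε • z ∈ A) {f : Space N → ℝ} (hf : Measurable f) :
    lTwo B (avg θ ε f) ≤ M * ballVol N * lTwo A f := by
  have := HalfTrace.lTwo_avg_le h.measurable h.bound Metric.isOpen_ball.measurableSet
    (fun z hz ↦ h.eq_zero hz) hBA hf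
  refine ((ENNReal.pow_right_strictMono two_ne_zero).le_iff_le.1 this).trans ?_
  gcongr
  exact h.volume_ball_le

lemma incr_avg_le (h : IsConeKernel θ ν c M) {A B : Set (Space N)} {ε : ℝ} (hε : ε ≠ 0)
    (hBA : ∀ x ∈ B, ∀ z ∈ Metric.ball ν c, x + ε • z ∈ A) {f : Space N → ℝ} (hf : Measurable f)
    (hf2 : MemLp f 2) (w : Space N) :
    incr B (avg θ ε f) w ≤ M * ballVol N * incr A f w := by
  have := HalfTrace.incr_avg_le h.contDiff h.hasCompactSupport h.bound
    Metric.isOpen_ball.measurableSet (fun z hz ↦ h.eq_zero hz) hε hBA hf hf2 w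
  refine ((ENNReal.pow_right_strictMono two_ne_zero).le_iff_le.1 this).trans ?_
  gcongr
  exact h.volume_ball_le

/-- The distance from `f` to its average is controlled by the oscillation of `f`. -/
lemma lTwo_avg_sub_le (h : IsConeKernel θ ν c M) (B : Set (Space N)) {ε : ℝ} (hε : ε ≠ 0)
    {f : Space N → ℝ} (hf : Measurable f) (hf2 : MemLp f 2) :
    lTwo B (fun x ↦ avg θ ε f x - (∫ z, θ z) * f x) ^ 2 ≤ M ^ 2 * ballVol N * osc B f ε :=
  HalfTrace.lTwo_avg_sub_le h.contDiff h.hasCompactSupport h.bound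
    (fun z hz ↦ h.eq_zero fun hz' ↦ hz ((h.ball_subset.trans
      (Metric.closedBall_subset_closedBall (by norm_num))) hz')) B hε hf hf2

/-- The weight which produces the increments of an average. -/
lemma avg_add_sub (h : IsConeKernel θ ν c M) {ε : ℝ} (hε : ε ≠ 0)
    {f : Space N → ℝ} (hf : Measurable f) (hf2 : MemLp f 2) (x w : Space N) :
    avg θ ε f (x + w) - avg θ ε f x = avg (fun z ↦ θ (z - ε⁻¹ • w) - θ z) ε f x := by
  have hs : ContDiff ℝ ∞ (fun z ↦ θ (z - ε⁻¹ • w)) := h.contDiff.comp (by fun_prop)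
  have hsc : HasCompactSupport (fun z ↦ θ (z - ε⁻¹ • w)) :=
    h.hasCompactSupport.comp_homeomorph (Homeomorph.subRight (ε⁻¹ • w))
  have e : avg θ ε f (x + w) = avg (fun z ↦ θ (z - ε⁻¹ • w)) ε f x := by
    unfold avg
    rw [← integral_add_right_eq_self (fun z ↦ θ (z - ε⁻¹ • w) * f (x + ε • z)) (ε⁻¹ • w)]
    congr 1 with z
    rw [add_sub_cancel_right, smul_add, smul_inv_smul₀ hε, add_assoc,
      add_comm w]
  rw [e]
  unfold avg
  rw [← integral_sub (integrable_avg hs hsc hε _ hf hf2)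
    (integrable_avg h.contDiff h.hasCompactSupport hε _ hf hf2)]
  congr 1 with z
  ring

lemma diff_kernel (h : IsConeKernel θ ν c M) {v : Space N} (hv : ‖v‖ ≤ 1) :
    ContDiff ℝ ∞ (fun z ↦ θ (z - v) - θ z) ∧ HasCompactSupport (fun z ↦ θ (z - v) - θ z) ∧
      (∀ z, ‖θ (z - v) - θ z‖ₑ ≤ M * ‖v‖ₑ) ∧
      (∀ z ∉ Metric.closedBall (0 : Space N) 3, θ (z - v) - θ z = 0) ∧
      ∫ z, (θ (z - v) - θ z) = 0 := by
  have hs : ContDiff ℝ ∞ (fun z ↦ θ (z - v)) := h.contDiff.comp (by fun_prop)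
  have hsc : HasCompactSupport (fun z ↦ θ (z - v)) :=
    h.hasCompactSupport.comp_homeomorph (Homeomorph.subRight v)
  refine ⟨hs.sub h.contDiff, hsc.sub h.hasCompactSupport, fun z ↦ ?_, fun z hz ↦ ?_, ?_⟩
  · have := h.incr_bound z (-v)
    rw [← sub_eq_add_neg, enorm_neg] at this
    exact this.trans (by gcongr; exact min_le_right _ _)
  · rw [mem_closedBall_zero_iff, not_le] at hz
    rw [h.eq_zero fun h' ↦ ?_, h.eq_zero fun h' ↦ ?_, sub_zero]
    · have := h.ball_subset h'
      rw [mem_closedBall_zero_iff] at this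
      linarith
    · have := h.ball_subset h'
      rw [mem_closedBall_zero_iff] at this
      linarith [norm_le_norm_add_norm_sub' z v]
  · rw [integral_sub (hs.continuous.integrable_of_hasCompactSupport hsc)
      (h.contDiff.continuous.integrable_of_hasCompactSupport h.hasCompactSupport),
      integral_sub_right_eq_self θ v, sub_self]

lemma norm_inv_smul_le {ε : ℝ} {w : Space N} (hw : ‖w‖ ≤ |ε|) : ‖ε⁻¹ • w‖ ≤ 1 := by
  rw [norm_smul, norm_inv, Real.norm_eq_abs, inv_mul_eq_div]
  exact div_le_one_of_le₀ hw (abs_nonneg _)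

lemma incr_avg_sq_le_osc (h : IsConeKernel θ ν c M) (B : Set (Space N)) {ε : ℝ} (hε : ε ≠ 0)
    {f : Space N → ℝ} (hf : Measurable f) (hf2 : MemLp f 2) {w : Space N} (hw : ‖w‖ ≤ |ε|) :
    incr B (avg θ ε f) w ^ 2 ≤ (M * ‖ε⁻¹ • w‖ₑ) ^ 2 * ballVol N * osc B f ε := by
  obtain ⟨h1, h2, h3, h4, h5⟩ := h.diff_kernel (norm_inv_smul_le hw)
  have := HalfTrace.lTwo_avg_sub_le h1 h2 h3 h4 B hε hf hf2
  rw [h5] at this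
  refine le_trans ?_ this
  simp only [zero_mul, sub_zero]
  unfold incr
  simp_rw [h.avg_add_sub hε hf hf2]
  gcongr
  exact lTwo_mono inter_subset_left _

/-- The increments of an average of a function of `L²`: the cancellation in the increments of the
weight gives the factor `min(1, |w| / ε)`. -/
lemma incr_avg_le_lTwo (h : IsConeKernel θ ν c M) {ε : ℝ} (hε : ε ≠ 0)
    {f : Space N → ℝ} (hf : Measurable f) (hf2 : MemLp f 2) (w : Space N) :
    incr univ (avg θ ε f) w ≤ 2 * M * ballVol N * min 1 ‖ε⁻¹ • w‖ₑ * lTwo univ f := by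
  rcases le_or_gt ‖w‖ |ε| with hw | hw
  · have hw1 := norm_inv_smul_le hw
    obtain ⟨h1, h2, h3, h4, h5⟩ := h.diff_kernel hw1
    have := HalfTrace.lTwo_avg_le h1.continuous.measurable h3 measurableSet_closedBall h4
      (A := univ) (B := univ) (ε := ε) (fun _ _ _ _ ↦ mem_univ _) hf
    have := (ENNReal.pow_right_strictMono two_ne_zero).le_iff_le.1 this
    have hmin : min 1 ‖ε⁻¹ • w‖ₑ = ‖ε⁻¹ • w‖ₑ := by
      refine min_eq_right ?_
      rw [← ofReal_norm]
      exact ENNReal.ofReal_le_one.2 hw1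
    unfold incr
    simp_rw [h.avg_add_sub hε hf hf2]
    refine (lTwo_mono inter_subset_left _).trans (this.trans ?_)
    rw [hmin]
    calc _ = M * ballVol N * ‖ε⁻¹ • w‖ₑ * lTwo univ f := by rw [ballVol]; ring
      _ ≤ _ := by
        gcongr
        exact le_mul_of_one_le_left' (by norm_num)
  · have hmin : min 1 ‖ε⁻¹ • w‖ₑ = 1 := by
      refine min_eq_left ?_
      rw [← ofReal_norm, ENNReal.one_le_ofReal, norm_smul, norm_inv, Real.norm_eq_abs,
        inv_mul_eq_div, one_le_div (abs_pos.2 hε)]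
      exact hw.le
    rw [hmin]
    refine (incr_le_two_mul (measurable_avg h.measurable ε hf) w).trans ?_
    have := h.lTwo_avg_le (A := univ) (B := univ) (ε := ε) (fun _ _ _ _ ↦ mem_univ _) hf
    calc _ ≤ 2 * (M * ballVol N * lTwo univ f) := by gcongr
      _ = _ := by ring

/-- Averaging at scale `ε` increases the increment at `w` by at most
`min(1, |w| / ε)` times the oscillation at scale `ε`. -/
lemma incr_avg_le_add (h : IsConeKernel θ ν c M) (h1 : ∫ z, θ z = 1) (B : Set (Space N))
    {ε : ℝ} (hε : ε ≠ 0)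
    {f : Space N → ℝ} (hf : Measurable f) (hf2 : MemLp f 2) (w : Space N) :
    incr B (avg θ ε f) w ≤ incr B f w +
      2 * M * (ballVol N) ^ (1 / 2 : ℝ) * min 1 ‖ε⁻¹ • w‖ₑ * osc B f ε ^ (1 / 2 : ℝ) := by
  have hsq : ∀ t : ℝ≥0∞, (t ^ (1 / 2 : ℝ)) ^ 2 = t := fun t ↦ by
    rw [← ENNReal.rpow_natCast, ← ENNReal.rpow_mul]; norm_num
  rcases le_or_gt ‖w‖ |ε| with hw | hw
  · have hw1 := norm_inv_smul_le hw
    have hmin : min 1 ‖ε⁻¹ • w‖ₑ = ‖ε⁻¹ • w‖ₑ := by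
      refine min_eq_right ?_
      rw [← ofReal_norm]
      exact ENNReal.ofReal_le_one.2 hw1
    rw [hmin]
    refine le_add_left ?_
    have := h.incr_avg_sq_le_osc B hε hf hf2 hw
    refine (ENNReal.pow_right_strictMono two_ne_zero).le_iff_le.1 (this.trans ?_)
    simp only [mul_pow, hsq]
    calc _ = 1 * ((M : ℝ≥0∞) ^ 2 * ballVol N * ‖ε⁻¹ • w‖ₑ ^ 2 * osc B f ε) := by ring
      _ ≤ 2 ^ 2 * ((M : ℝ≥0∞) ^ 2 * ballVol N * ‖ε⁻¹ • w‖ₑ ^ 2 * osc B f ε) := by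
        gcongr
        norm_num
      _ = _ := by ring
  · have hmin : min 1 ‖ε⁻¹ • w‖ₑ = 1 := by
      refine min_eq_left ?_
      rw [← ofReal_norm, ENNReal.one_le_ofReal, norm_smul, norm_inv, Real.norm_eq_abs,
        inv_mul_eq_div, one_le_div (abs_pos.2 hε)]
      exact hw.le
    have hm := measurable_avg h.measurable ε hf
    have h2 := h.lTwo_avg_sub_le B hε hf hf2
    rw [h1] at h2
    simp only [one_mul] at h2
    have h3 : lTwo B (fun x ↦ avg θ ε f x - f x) ≤
        M * (ballVol N) ^ (1 / 2 : ℝ) * osc B f ε ^ (1 / 2 : ℝ) := by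
      refine (ENNReal.pow_right_strictMono two_ne_zero).le_iff_le.1 (h2.trans_eq ?_)
      simp only [mul_pow, hsq]
    have e : avg θ ε f = fun x ↦ f x + (avg θ ε f x - f x) := by
      ext x; ring
    rw [hmin, e]
    refine (incr_add_le hf (hm.sub hf) w).trans ?_
    gcongr
    refine (incr_le_two_mul (hm.sub hf) w).trans ?_
    calc _ ≤ 2 * (M * (ballVol N) ^ (1 / 2 : ℝ) * osc B f ε ^ (1 / 2 : ℝ)) :=
          mul_le_mul_right h3 2
      _ = _ := by ring

/-- Directional derivatives of a cone kernel are cone kernels. -/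
lemma fderiv (h : IsConeKernel θ ν c M) (e : Space N) :
    ∃ M', IsConeKernel (fun z ↦ _root_.fderiv ℝ θ z e) ν c M' ∧
      ∫ z, _root_.fderiv ℝ θ z e = 0 := by
  have h1 : ContDiff ℝ ∞ (fun z ↦ _root_.fderiv ℝ θ z e) :=
    (h.contDiff.fderiv_right (m := ∞) (by simp)).clm_apply contDiff_const
  have h2 : HasCompactSupport (fun z ↦ _root_.fderiv ℝ θ z e) := h.hasCompactSupport.fderiv_apply ℝ e
  obtain ⟨M', hM1, hM2⟩ := exists_bound_of_smooth h1 h2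
  refine ⟨M', ⟨h.norm_eq, h.le_one, h1, (tsupport_fderiv_apply_subset ℝ e).trans h.tsupport_subset,
    hM1, hM2⟩, integral_fderiv_eq_zero h.contDiff h.hasCompactSupport e⟩

end IsConeKernel

lemma exists_isConeKernel {ν : Space N} (hν : ‖ν‖ = 1) {c : ℝ} (hc : 0 < c) (hc1 : c ≤ 1) :
    ∃ ρ : Space N → ℝ, ∃ M, IsConeKernel ρ ν c M ∧ ∫ z, ρ z = 1 := by
  let b : ContDiffBump ν := ⟨c / 4, c / 2, by positivity, by linarith⟩
  have h1 : ContDiff ℝ ∞ (b.normed volume) := b.contDiff_normed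
  have h2 : HasCompactSupport (b.normed volume) := b.hasCompactSupport_normed
  obtain ⟨M, hM1, hM2⟩ := exists_bound_of_smooth h1 h2
  refine ⟨b.normed volume, M, ⟨hν, hc1, h1, ?_, hM1, hM2⟩, b.integral_normed⟩
  rw [b.tsupport_normed_eq]
  exact Metric.closedBall_subset_ball (by change c / 2 < c; linarith)

end

section

variable {N : ℕ}

/-! ### Open sets with a uniform interior cone -/

/-- An open set such that from each point of its closure the open cone spanned by the ball with
centre the unit vector `ν` and radius `c` points into the set: a region above the graph of a
Lipschitz function, or the whole space. -/
structure IsUpCone (G : Set (Space N)) (ν : Space N) (c : ℝ) : Prop where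
  isOpen : IsOpen G
  norm_eq : ‖ν‖ = 1
  pos : 0 < c
  le_one : c ≤ 1
  mem : ∀ x ∈ closure G, ∀ z ∈ Metric.ball ν c, ∀ t : ℝ, 0 < t → x + t • z ∈ G

/-- The layer of the points of `G` which leave `G` when moved down by `h`. -/
def strip (G : Set (Space N)) (ν : Space N) (h : ℝ) : Set (Space N) := {x | x ∈ G ∧ x - h • ν ∉ G}

/-- A vector of the cone at height `t`. -/
lemma IsUpCone.add_mem {G : Set (Space N)} {ν : Space N} {c : ℝ} (hG : IsUpCone G ν c)
    {x : Space N} (hx : x ∈ closure G) {t : ℝ} (ht : 0 < t) {w : Space N}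
    (hw : ‖w - t • ν‖ < c * t) : x + w ∈ G := by
  have := hG.mem x hx (t⁻¹ • w) ?_ t ht
  · rwa [smul_inv_smul₀ ht.ne'] at this
  · have e : t⁻¹ • w - ν = t⁻¹ • (w - t • ν) := by rw [smul_sub, inv_smul_smul₀ ht.ne']
    rw [Metric.mem_ball, dist_eq_norm, e, norm_smul, norm_inv, Real.norm_of_nonneg ht.le,
      inv_mul_eq_div, div_lt_iff₀ ht]
    exact hw

lemma isUpCone_univ {ν : Space N} (hν : ‖ν‖ = 1) : IsUpCone univ ν 1 :=
  ⟨isOpen_univ, hν, one_pos, le_rfl, fun _ _ _ _ _ _ ↦ mem_univ _⟩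

namespace IsUpCone

variable {G : Set (Space N)} {ν : Space N} {c : ℝ}

lemma measurableSet (hG : IsUpCone G ν c) : MeasurableSet G := hG.isOpen.measurableSet

lemma measurableSet_strip (hG : IsUpCone G ν c) (h : ℝ) : MeasurableSet (strip G ν h) :=
  hG.measurableSet.inter ((measurable_sub_const (h • ν)) hG.measurableSet).compl

lemma vertical_mem (hG : IsUpCone G ν c) {x : Space N} (hx : x ∈ G) {t : ℝ} (ht : 0 < t) :
    x + t • ν ∈ G :=
  hG.mem x (subset_closure hx) ν (Metric.mem_ball_self hG.pos) t ht

/-- A point of `G` which a displacement of size less than `c h` takes out of `G` lies in the layer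
of height `h`. -/
lemma mem_strip (hG : IsUpCone G ν c) {x w : Space N} {h : ℝ} (hh : 0 < h) (hx : x ∈ G)
    (hw : ‖w‖ < c * h) (hxw : x + w ∉ G) : x ∈ strip G ν h := by
  refine ⟨hx, fun hmem ↦ hxw ?_⟩
  have := hG.add_mem (subset_closure hmem) hh (w := w + h • ν) (by simpa using hw)
  convert this using 1
  abel

/-- The oscillation of a function vanishing outside `G` comes from the increments inside `G` and from
the points close enough to the boundary for the other end of the increment to leave `G`. -/
lemma osc_le (hG : IsUpCone G ν c) {f : Space N → ℝ} (h0 : ∀ x ∉ G, f x = 0) {ε h : ℝ}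
    (hh : 0 < h) (hε : 3 * |ε| < c * h) :
    osc G f ε ≤ (∫⁻ z in Metric.closedBall (0 : Space N) 3, incr G f (ε • z) ^ 2) +
      ballVol N * lTwo (strip G ν h) f ^ 2 := by
  have hGm := hG.measurableSet
  have hSm := hG.measurableSet_strip h
  have hpt : ∀ z ∈ Metric.closedBall (0 : Space N) 3, ∫⁻ x in G, ‖f (x + ε • z) - f x‖ₑ ^ 2 ≤
      incr G f (ε • z) ^ 2 + lTwo (strip G ν h) f ^ 2 := by
    intro z hz
    have hz3 : ‖ε • z‖ < c * h := by
      rw [mem_closedBall_zero_iff] at hz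
      rw [norm_smul, Real.norm_eq_abs]
      nlinarith [abs_nonneg ε, norm_nonneg z]
    have hm : MeasurableSet ((fun x ↦ x + ε • z) ⁻¹' G) := (measurable_add_const _) hGm
    rw [incr_sq, lTwo_sq, ← lintegral_inter_add_sdiff _ G hm]
    refine add_le_add le_rfl ?_
    rw [← lintegral_indicator (MeasurableSet.diff hGm hm), ← lintegral_indicator hSm]
    refine lintegral_mono fun x ↦ ?_
    by_cases hx : x ∈ G \ (fun x ↦ x + ε • z) ⁻¹' G
    · have : x ∈ strip G ν h := hG.mem_strip hh hx.1 hz3 hx.2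
      rw [indicator_of_mem hx, indicator_of_mem this, h0 (x + ε • z) hx.2, zero_sub, enorm_neg]
    · rw [indicator_of_notMem hx]
      exact zero_le
  calc osc G f ε ≤ ∫⁻ z in Metric.closedBall (0 : Space N) 3,
        (incr G f (ε • z) ^ 2 + lTwo (strip G ν h) f ^ 2) := setLIntegral_mono' measurableSet_closedBall hpt
    _ = _ := by
      rw [lintegral_add_right _ measurable_const, setLIntegral_const, ballVol, mul_comm (volume _)]

/-- The layer of height `2h` contains the layer of height `h` and its translate by `h ν`, which are
disjoint and over which the norms of `f` differ at most by the norm of the vertical increment. Halving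
the height thus halves the squared norm, up to that increment. -/
lemma strip_step (hG : IsUpCone G ν c) {f : Space N → ℝ} (hf : Measurable f) {h : ℝ} (hh : 0 < h) :
    2 * (lTwo (strip G ν h) f - eLpNorm (fun x ↦ f (x + h • ν) - f x) 2
      (volume.restrict (strip G ν h))) ^ 2 ≤ lTwo (strip G ν (2 * h)) f ^ 2 := by
  set d := eLpNorm (fun x ↦ f (x + h • ν) - f x) 2 (volume.restrict (strip G ν h))
  let S : Set (Space N) := {x | x - h • ν ∈ strip G ν h}
  have hSm : MeasurableSet S := (measurable_sub_const (h • ν)) (hG.measurableSet_strip h)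
  have hsub1 : strip G ν h ⊆ strip G ν (2 * h) := fun x hx ↦ ⟨hx.1, fun hx2 ↦ hx.2 (by
    have := hG.vertical_mem hx2 hh
    convert this using 1
    rw [two_mul, add_smul]
    abel)⟩
  have hsub2 : S ⊆ strip G ν (2 * h) := fun x hx ↦ by
    refine ⟨by simpa using hG.vertical_mem hx.1 hh, fun hx2 ↦ hx.2 ?_⟩
    convert hx2 using 1
    rw [two_mul, add_smul]
    abel
  have hdisj : Disjoint (strip G ν h) S := by
    rw [Set.disjoint_left]
    exact fun x hx hxS ↦ hx.2 hxS.1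
  have hb : eLpNorm (fun x ↦ f (x + h • ν)) 2 (volume.restrict (strip G ν h)) ≤ lTwo S f :=
    eLpNorm_comp_add_le fun x hx ↦ by simpa [S] using hx
  have hle : lTwo (strip G ν h) f - d ≤ lTwo S f := by
    refine tsub_le_iff_right.2 (le_trans ?_ (add_le_add hb le_rfl))
    have e : f = (fun x ↦ f (x + h • ν)) - fun x ↦ f (x + h • ν) - f x := by
      ext x
      simp
    unfold lTwo
    nth_rw 1 [e]
    exact eLpNorm_sub_le (Measurable.aestronglyMeasurable (by fun_prop))
      (Measurable.aestronglyMeasurable (by fun_prop)) (by norm_num)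
  calc 2 * (lTwo (strip G ν h) f - d) ^ 2
      = (lTwo (strip G ν h) f - d) ^ 2 + (lTwo (strip G ν h) f - d) ^ 2 := two_mul _
    _ ≤ lTwo (strip G ν h) f ^ 2 + lTwo S f ^ 2 := by
        gcongr
        exact tsub_le_self
    _ = lTwo (strip G ν h ∪ S) f ^ 2 := by
        rw [lTwo_sq, lTwo_sq, lTwo_sq, lintegral_union hSm hdisj]
    _ ≤ _ := by
        gcongr
        exact lTwo_mono (union_subset hsub1 hsub2) f

lemma reflection_mem_ball {ν z : Space N} {c : ℝ} (hz : z ∈ Metric.ball ν c) :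
    2 • ν - z ∈ Metric.ball ν c := by
  have e : 2 • ν - z - ν = -(z - ν) := by rw [two_smul]; abel
  rw [Metric.mem_ball, dist_eq_norm] at hz ⊢
  rwa [e, norm_neg]

/-- The increment in the vertical direction, averaged over the directions of the cone. -/
lemma vertical_incr_le (hG : IsUpCone G ν c) {f : Space N → ℝ} (hf : Measurable f) {h : ℝ}
    (hh : 0 < h) :
    volume (Metric.ball ν c) *
      eLpNorm (fun x ↦ f (x + h • ν) - f x) 2 (volume.restrict (strip G ν h)) ^ 2 ≤
    4 * ∫⁻ z in Metric.closedBall (0 : Space N) 3, incr G f ((1 / 2 * h) • z) ^ 2 := by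
  have hi := measurable_incr hG.measurableSet hf
  have hi2 : Measurable fun z ↦ incr G f ((1 / 2 * h) • z) ^ 2 := by fun_prop
  have hh2 : 0 < 1 / 2 * h := by positivity
  -- the displacement `h ν` is the sum of the displacements `(h/2) z` and `(h/2) (2ν - z)`, both of
  -- which are in the cone, so that the intermediate point stays in `G`
  have hpt : ∀ z ∈ Metric.ball ν c,
      eLpNorm (fun x ↦ f (x + h • ν) - f x) 2 (volume.restrict (strip G ν h)) ^ 2 ≤
      2 * (incr G f ((1 / 2 * h) • z) ^ 2 + incr G f ((1 / 2 * h) • (2 • ν - z)) ^ 2) := by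
    intro z hz
    have hz' : 2 • ν - z ∈ Metric.ball ν c := reflection_mem_ball hz
    have e : (fun x ↦ f (x + h • ν) - f x) =
        (fun x ↦ f (x + (1 / 2 * h) • z) - f x) +
        fun x ↦ f (x + (1 / 2 * h) • z + (1 / 2 * h) • (2 • ν - z)) - f (x + (1 / 2 * h) • z) := by
      ext x
      have : x + (1 / 2 * h) • z + (1 / 2 * h) • (2 • ν - z) = x + h • ν := by
        rw [smul_sub, add_assoc, add_sub_cancel, ← Nat.cast_smul_eq_nsmul ℝ, smul_smul]
        congr 2
        push_cast
        ring
      rw [Pi.add_apply, this]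
      ring
    rw [e]
    refine (pow_le_pow_left' ((eLpNorm_add_le (Measurable.aestronglyMeasurable (by fun_prop))
      (Measurable.aestronglyMeasurable (by fun_prop)) (by norm_num)).trans (add_le_add
      ?_ ?_)) 2).trans (ennreal_add_sq_le _ _)
    · have hsub : strip G ν h ⊆ G ∩ (fun x ↦ x + (1 / 2 * h) • z) ⁻¹' G := fun x hx ↦
        ⟨hx.1, hG.mem x (subset_closure hx.1) z hz _ hh2⟩
      exact eLpNorm_mono_measure _ (Measure.restrict_mono hsub le_rfl)
    · refine eLpNorm_comp_add_le (A := G ∩ (fun x ↦ x + (1 / 2 * h) • (2 • ν - z)) ⁻¹' G)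
        (w := (1 / 2 * h) • z)
        (f := fun y ↦ f (y + (1 / 2 * h) • (2 • ν - z)) - f y) fun x hx ↦ ?_
      have h1 := hG.mem x (subset_closure hx.1) z hz _ hh2
      exact mem_inter h1 (hG.mem _ (subset_closure h1) _ hz' _ hh2)
  -- the reflection `z ↦ 2ν - z` preserves the ball
  have hrefl : ∫⁻ z in Metric.ball ν c, incr G f ((1 / 2 * h) • (2 • ν - z)) ^ 2 =
      ∫⁻ z in Metric.ball ν c, incr G f ((1 / 2 * h) • z) ^ 2 := by
    rw [← lintegral_indicator measurableSet_ball, ← lintegral_indicator measurableSet_ball,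
      ← lintegral_sub_left_eq_self ((Metric.ball ν c).indicator _) (2 • ν)]
    congr 1 with z
    by_cases hz : z ∈ Metric.ball ν c
    · have hz' : 2 • ν - z ∈ Metric.ball ν c := reflection_mem_ball hz
      rw [indicator_of_mem hz, indicator_of_mem hz']
      simp
    · have hz' : 2 • ν - z ∉ Metric.ball ν c := fun hz' ↦ hz (by
        simpa using reflection_mem_ball hz')
      rw [indicator_of_notMem hz, indicator_of_notMem hz']
  have hball : Metric.ball ν c ⊆ Metric.closedBall (0 : Space N) 3 := by
    intro z hz
    rw [mem_closedBall_zero_iff]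
    rw [Metric.mem_ball, dist_eq_norm] at hz
    have := norm_le_norm_add_norm_sub' z ν
    linarith [hG.norm_eq, hG.le_one]
  calc _ = ∫⁻ z in Metric.ball ν c, eLpNorm (fun x ↦ f (x + h • ν) - f x) 2
        (volume.restrict (strip G ν h)) ^ 2 := by rw [setLIntegral_const, mul_comm]
    _ ≤ ∫⁻ z in Metric.ball ν c, 2 * (incr G f ((1 / 2 * h) • z) ^ 2 +
        incr G f ((1 / 2 * h) • (2 • ν - z)) ^ 2) := setLIntegral_mono' measurableSet_ball hpt
    _ = 4 * ∫⁻ z in Metric.ball ν c, incr G f ((1 / 2 * h) • z) ^ 2 := by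
        rw [lintegral_const_mul _ (by fun_prop), lintegral_add_left hi2, hrefl]
        ring
    _ ≤ _ := by
        gcongr

/-- The mean square of `f` over the layer of height `2^{-k}` grows at most linearly in `k`. -/
lemma exists_strip_bound (hG : IsUpCone G ν c) : ∃ C : ℝ≥0, ∀ f : Space N → ℝ, Measurable f →
    ∀ k : ℕ, 2 ^ k * lTwo (strip G ν (2⁻¹ ^ k)) f ^ 2 ≤ C * (k + 1) * hsq G f := by
  let V : ℝ≥0∞ := volume (Metric.ball ν c)
  have hV0 : V ≠ 0 := (Metric.isOpen_ball.measure_pos _ ⟨ν, Metric.mem_ball_self hG.pos⟩).ne'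
  have hVt : V ≠ ⊤ := measure_ball_lt_top.ne
  let s : ℝ≥0∞ := ENNReal.ofReal √2
  have hs2 : s ^ 2 = 2 := by
    simp only [s]
    rw [← ENNReal.ofReal_pow (by positivity), Real.sq_sqrt (by norm_num)]
    simp
  have hsk : ∀ k : ℕ, (s ^ k) ^ 2 = 2 ^ k := fun k ↦ by rw [← pow_mul, mul_comm, pow_mul, hs2]
  let C₀ : ℝ≥0∞ := V⁻¹ * (4 * ENNReal.ofReal (2 * (1 / 2) * 3 ^ (N + 1)))
  have hC₀ : C₀ ≠ ⊤ := ENNReal.mul_ne_top (by simp [hV0]) (ENNReal.mul_ne_top (by simp) (by simp))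
  refine ⟨(2 + 2 * C₀).toNNReal, fun f hf k ↦ ?_⟩
  rw [ENNReal.coe_toNNReal (by finiteness)]
  have hi := measurable_incr hG.measurableSet hf
  let d : ℕ → ℝ≥0∞ := fun k ↦ eLpNorm (fun x ↦ f (x + (2⁻¹ ^ k : ℝ) • ν) - f x) 2
      (volume.restrict (strip G ν (2⁻¹ ^ k)))
  let n : ℕ → ℝ≥0∞ := fun k ↦ s ^ k * lTwo (strip G ν (2⁻¹ ^ k)) f
  -- averaging over directions bounds the vertical increments, at all dyadic scales, by the energy
  have hd : ∀ K, ∑ k ∈ Finset.range K, (s ^ k * d k) ^ 2 ≤ C₀ * gag G f := by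
    intro K
    have h1 : ∀ k : ℕ, (s ^ k * d k) ^ 2 ≤ V⁻¹ * (4 * (2 ^ k *
        ∫⁻ z in Metric.closedBall (0 : Space N) 3, incr G f ((1 / 2 * 2⁻¹ ^ k : ℝ) • z) ^ 2)) := by
      intro k
      have h2 := hG.vertical_incr_le hf (h := 2⁻¹ ^ k) (by positivity)
      have h3 : d k ^ 2 ≤ V⁻¹ * (4 * ∫⁻ z in Metric.closedBall (0 : Space N) 3,
          incr G f ((1 / 2 * 2⁻¹ ^ k : ℝ) • z) ^ 2) := by
        rw [← ENNReal.mul_le_iff_le_inv hV0 hVt]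
        exact h2
      calc (s ^ k * d k) ^ 2 = 2 ^ k * d k ^ 2 := by rw [mul_pow, hsk]
        _ ≤ 2 ^ k * _ := mul_le_mul_right h3 _
        _ = _ := by rw [mul_left_comm, mul_left_comm (2 ^ k)]
    refine (Finset.sum_le_sum fun k _ ↦ h1 k).trans ?_
    rw [← Finset.mul_sum, ← Finset.mul_sum]
    have h4 := sum_lintegral_scale_le (N := N) (a := 1 / 2) (R := 3) (by norm_num) (by norm_num) K
      (g := fun w ↦ incr G f w ^ 2) (by fun_prop)
    calc _ ≤ V⁻¹ * (4 * (ENNReal.ofReal (2 * (1 / 2) * 3 ^ (N + 1)) *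
          ∫⁻ w, kern w * incr G f w ^ 2)) := by gcongr
      _ = _ := by simp only [C₀, gag]; ring
  -- the normalised norms `n k` grow at each step by the square summable sequence `2^{k/2} d k`; by
  -- Cauchy-Schwarz the growth up to the step `k` is of the order of `√k`
  have hstep : ∀ k, n (k + 1) ≤ n k + s ^ (k + 1) * d (k + 1) := by
    intro k
    have h1 := hG.strip_step hf (h := 2⁻¹ ^ (k + 1)) (by positivity)
    have e : (2 : ℝ) * 2⁻¹ ^ (k + 1) = 2⁻¹ ^ k := by rw [pow_succ]; ring
    rw [e] at h1
    set L := lTwo (strip G ν (2⁻¹ ^ (k + 1))) f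
    have h2 : s * (L - d (k + 1)) ≤ lTwo (strip G ν (2⁻¹ ^ k)) f := by
      refine (ENNReal.pow_right_strictMono two_ne_zero).le_iff_le.1 ?_
      rw [mul_pow, hs2]
      exact h1
    calc n (k + 1) = s ^ (k + 1) * L := rfl
      _ ≤ s ^ (k + 1) * (L - d (k + 1) + d (k + 1)) := by
          gcongr
          exact le_tsub_add
      _ = s ^ k * (s * (L - d (k + 1))) + s ^ (k + 1) * d (k + 1) := by rw [pow_succ]; ring
      _ ≤ s ^ k * lTwo (strip G ν (2⁻¹ ^ k)) f + s ^ (k + 1) * d (k + 1) := by gcongr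
  have hn : ∀ k, n k ≤ n 0 + ∑ j ∈ Finset.range k, s ^ (j + 1) * d (j + 1) := by
    intro k
    induction k with
    | zero => simp
    | succ k ih =>
      rw [Finset.sum_range_succ, ← add_assoc]
      exact (hstep k).trans (add_le_add ih le_rfl)
  have hn0 : n 0 ≤ lTwo G f := by
    simp only [n, pow_zero, one_mul]
    exact lTwo_mono (fun x hx ↦ hx.1) f
  calc 2 ^ k * lTwo (strip G ν (2⁻¹ ^ k)) f ^ 2 = n k ^ 2 := by
        simp only [n]
        rw [mul_pow, hsk]
    _ ≤ 2 * (n 0 ^ 2 + (∑ j ∈ Finset.range k, s ^ (j + 1) * d (j + 1)) ^ 2) :=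
        (pow_le_pow_left' (hn k) 2).trans (ennreal_add_sq_le _ _)
    _ ≤ 2 * (lTwo G f ^ 2 + k * (C₀ * gag G f)) := by
        gcongr
        have := ennreal_sum_weight_sq_le (Finset.range k) (fun _ ↦ 1)
          fun j ↦ s ^ (j + 1) * d (j + 1)
        simp only [one_mul, Finset.sum_const, Finset.card_range, nsmul_eq_mul, mul_one] at this
        refine this.trans ?_
        gcongr
        refine le_trans ?_ (hd (k + 1))
        rw [Finset.sum_range_succ' (fun j ↦ (s ^ j * d j) ^ 2)]
        exact le_self_add
    _ = 2 * lTwo G f ^ 2 + 2 * C₀ * k * gag G f := by ring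
    _ ≤ (2 + 2 * C₀) * (k + 1) * lTwo G f ^ 2 + (2 + 2 * C₀) * (k + 1) * gag G f := by
        gcongr ?_ * _ + ?_ * _
        · calc (2 : ℝ≥0∞) = 2 * 1 := (mul_one 2).symm
            _ ≤ (2 + 2 * C₀) * (k + 1) := by
              gcongr
              · exact le_self_add
              · exact le_add_self
        · gcongr
          · exact le_add_self
          · exact le_self_add
    _ = _ := by rw [hsq]; ring

/-- Sums of the oscillations of a function vanishing outside `G`. -/
lemma exists_osc_bound (hG : IsUpCone G ν c) : ∃ C : ℝ≥0, ∀ f : Space N → ℝ, Measurable f →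
    (∀ x ∉ G, f x = 0) → ∀ K : ℕ,
      ∑ k ∈ Finset.range K, 2 ^ k * osc G f (c / 4 * 2⁻¹ ^ k) ≤ C * K ^ 2 * hsq G f := by
  obtain ⟨C₁, hC₁⟩ := hG.exists_strip_bound
  have hc := hG.pos
  refine ⟨(2 * (c / 4) * 3 ^ (N + 1)).toNNReal + (ballVol N).toNNReal * C₁, fun f hf h0 K ↦ ?_⟩
  push_cast
  rw [ENNReal.coe_toNNReal ballVol_ne_top]
  change _ ≤ (ENNReal.ofReal (2 * (c / 4) * 3 ^ (N + 1)) + _) * _ * _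
  have hi := measurable_incr hG.measurableSet hf
  have h1 : ∀ k : ℕ, osc G f (c / 4 * 2⁻¹ ^ k) ≤
      (∫⁻ z in Metric.closedBall (0 : Space N) 3, incr G f ((c / 4 * 2⁻¹ ^ k : ℝ) • z) ^ 2) +
      ballVol N * lTwo (strip G ν (2⁻¹ ^ k)) f ^ 2 := by
    intro k
    refine hG.osc_le h0 (by positivity) ?_
    have : (0 : ℝ) < 2⁻¹ ^ k := by positivity
    rw [abs_of_pos (by positivity)]
    nlinarith [mul_pos hc this]
  have h2 := sum_lintegral_scale_le (N := N) (a := c / 4) (R := 3) (by positivity) (by norm_num) K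
      (g := fun w ↦ incr G f w ^ 2) (by fun_prop)
  rcases Nat.eq_zero_or_pos K with rfl | hK
  · simp
  have hK1 : (1 : ℝ≥0∞) ≤ K ^ 2 := one_le_pow₀ (by exact_mod_cast hK)
  calc _ ≤ ∑ k ∈ Finset.range K, (2 ^ k *
        (∫⁻ z in Metric.closedBall (0 : Space N) 3, incr G f ((c / 4 * 2⁻¹ ^ k : ℝ) • z) ^ 2) +
        ballVol N * (2 ^ k * lTwo (strip G ν (2⁻¹ ^ k)) f ^ 2)) := by
        refine Finset.sum_le_sum fun k _ ↦ ?_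
        refine (mul_le_mul_right (h1 k) (2 ^ k)).trans_eq ?_
        ring
    _ ≤ ENNReal.ofReal (2 * (c / 4) * 3 ^ (N + 1)) * gag G f +
        ballVol N * ∑ k ∈ Finset.range K, C₁ * K * hsq G f := by
        rw [Finset.sum_add_distrib, ← Finset.mul_sum]
        refine add_le_add h2 (mul_le_mul_right (Finset.sum_le_sum fun k hk ↦ ?_) _)
        refine (hC₁ f hf k).trans ?_
        gcongr
        exact_mod_cast Finset.mem_range.1 hk
    _ = ENNReal.ofReal (2 * (c / 4) * 3 ^ (N + 1)) * 1 * gag G f +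
        ballVol N * C₁ * K ^ 2 * hsq G f := by
        rw [Finset.sum_const, Finset.card_range, nsmul_eq_mul]
        ring
    _ ≤ ENNReal.ofReal (2 * (c / 4) * 3 ^ (N + 1)) * K ^ 2 * hsq G f +
        ballVol N * C₁ * K ^ 2 * hsq G f := by
        gcongr
        exact le_add_self
    _ = _ := by ring

end IsUpCone

end

section

variable {N : ℕ}

/-! ### Logarithmic averages -/

/-- The mean of the mollifications of `f` at the `K` dyadic scales `a, a/2, …, a 2^{1-K}`. Averaging
over the scales compensates the logarithmic growth of the `H^{1/2}` norm of the mollification of a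
function which is cut off at the boundary. -/
noncomputable def logAvg (ρ : Space N → ℝ) (a : ℝ) (K : ℕ) (f : Space N → ℝ) (x : Space N) : ℝ :=
  (K : ℝ)⁻¹ * ∑ k ∈ Finset.range K, avg ρ (a * 2⁻¹ ^ k) f x

lemma scale_ne_zero {a : ℝ} (ha : a ≠ 0) (k : ℕ) : a * 2⁻¹ ^ k ≠ 0 :=
  mul_ne_zero ha (by positivity)

lemma measurable_logAvg {ρ : Space N → ℝ} (hρ : Measurable ρ) (a : ℝ) (K : ℕ) {f : Space N → ℝ}
    (hf : Measurable f) : Measurable (logAvg ρ a K f) :=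
  (Finset.measurable_fun_sum _ fun _ _ ↦ measurable_avg hρ _ hf).const_mul _

lemma contDiff_logAvg {ρ : Space N → ℝ} (hρ : ContDiff ℝ ∞ ρ) (hc : HasCompactSupport ρ) {a : ℝ}
    (ha : a ≠ 0) (K : ℕ) {f : Space N → ℝ} (hf : MemLp f 2) : ContDiff ℝ ∞ (logAvg ρ a K f) :=
  contDiff_const.mul
    (ContDiff.sum fun k _ ↦ contDiff_avg hρ hc (scale_ne_zero ha k) hf)

lemma tsupport_logAvg_subset {ρ : Space N → ℝ} (hc : HasCompactSupport ρ) {a : ℝ} (K : ℕ)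
    {f : Space N → ℝ} {S : Set (Space N)} (hS : IsCompact S) (h0 : ∀ x ∉ S, f x = 0) {x : Space N}
    (hx : x ∈ tsupport (logAvg ρ a K f)) :
    ∃ k : ℕ, ∃ z ∈ tsupport ρ, x + (a * 2⁻¹ ^ k) • z ∈ S := by
  have hcl : IsClosed (⋃ k ∈ Finset.range K, tsupport (avg ρ (a * 2⁻¹ ^ k) f)) :=
    isClosed_biUnion_finset fun _ _ ↦ isClosed_tsupport _
  have hsub : tsupport (logAvg ρ a K f) ⊆
      ⋃ k ∈ Finset.range K, tsupport (avg ρ (a * 2⁻¹ ^ k) f) := by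
    refine closure_minimal (fun y hy ↦ ?_) hcl
    by_contra hy'
    simp only [mem_iUnion, not_exists] at hy'
    refine hy ?_
    rw [logAvg, Finset.sum_eq_zero fun k hk ↦ image_eq_zero_of_notMem_tsupport (hy' k hk), mul_zero]
  obtain ⟨k, -, hk⟩ := mem_iUnion₂.1 (hsub hx)
  exact ⟨k, tsupport_avg_subset hc hS h0 hk⟩

lemma hasCompactSupport_logAvg {ρ : Space N → ℝ} (hc : HasCompactSupport ρ) (a : ℝ) (K : ℕ)
    {f : Space N → ℝ} {S : Set (Space N)} (hS : IsCompact S) (h0 : ∀ x ∉ S, f x = 0) :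
    HasCompactSupport (logAvg ρ a K f) := by
  have h1 : IsCompact (⋃ k ∈ Finset.range K, tsupport (avg ρ (a * 2⁻¹ ^ k) f)) :=
    (Finset.range K).isCompact_biUnion fun k _ ↦ hasCompactSupport_avg hc hS h0
  refine HasCompactSupport.intro h1 fun x hx ↦ ?_
  simp only [mem_iUnion, not_exists] at hx
  rw [logAvg, Finset.sum_eq_zero fun k hk ↦ image_eq_zero_of_notMem_tsupport (hx k hk), mul_zero]

lemma fderiv_logAvg_of_smooth {ρ : Space N → ℝ} (hρ : ContDiff ℝ ∞ ρ) (hc : HasCompactSupport ρ)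
    {a : ℝ} (ha : a ≠ 0) (K : ℕ) {f : Space N → ℝ} (hf : ContDiff ℝ ∞ f) (hfc : HasCompactSupport f)
    (x e : Space N) :
    fderiv ℝ (logAvg ρ a K f) x e = logAvg ρ a K (fun y ↦ fderiv ℝ f y e) x := by
  have hf2 : MemLp f 2 := hf.continuous.memLp_of_hasCompactSupport hfc
  have hd : ∀ k, DifferentiableAt ℝ (avg ρ (a * 2⁻¹ ^ k) f) x := fun k ↦
    ((contDiff_avg hρ hc (scale_ne_zero ha k) hf2).differentiable (by simp)) x
  have e1 : logAvg ρ a K f =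
      fun x ↦ (K : ℝ)⁻¹ * ∑ k ∈ Finset.range K, avg ρ (a * 2⁻¹ ^ k) f x := rfl
  rw [e1, fderiv_const_mul (DifferentiableAt.fun_sum fun k _ ↦ hd k),
    fderiv_fun_sum fun k _ ↦ hd k]
  simp only [smul_apply, sum_apply, smul_eq_mul, logAvg]
  congr 1
  exact Finset.sum_congr rfl fun k _ ↦ fderiv_avg_of_smooth hρ hc (scale_ne_zero ha k) hf hfc x e

/-- The transpose of a logarithmic average is the average in the opposite directions. -/
lemma integral_logAvg_mul {ρ : Space N → ℝ} {ν : Space N} {c : ℝ} {M : ℝ≥0}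
    (h : IsConeKernel ρ ν c M) {a : ℝ} (K : ℕ) {f g : Space N → ℝ} (hf : Measurable f)
    (hg : Measurable g) (hf2 : MemLp f 2) (hg2 : MemLp g 2) :
    ∫ x, logAvg ρ a K f x * g x = ∫ x, f x * logAvg ρ (-a) K g x := by
  have hm : ∀ ε {u : Space N → ℝ}, Measurable u → MemLp u 2 → MemLp (avg ρ ε u) 2 := by
    intro ε u hu hu2
    rw [memLp_two_iff_lTwo (measurable_avg h.measurable _ hu)]
    refine (h.lTwo_avg_le (A := univ) (fun _ _ _ _ ↦ mem_univ _) hu).trans_lt ?_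
    exact ENNReal.mul_lt_top (ENNReal.mul_lt_top (by simp) ballVol_ne_top.lt_top)
      ((memLp_two_iff_lTwo hu).1 hu2)
  simp only [logAvg, mul_assoc, Finset.sum_mul, mul_left_comm _ (K : ℝ)⁻¹, Finset.mul_sum]
  rw [integral_finsetSum, integral_finsetSum]
  · refine Finset.sum_congr rfl fun k _ ↦ ?_
    rw [integral_const_mul, integral_const_mul, neg_mul,
      integral_avg_mul h.contDiff h.hasCompactSupport _ hf hg hf2 hg2]
  · exact fun k _ ↦ (hf2.integrable_mul (hm _ hg hg2)).const_mul _
  · exact fun k _ ↦ ((hm _ hf hf2).integrable_mul hg2).const_mul _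

lemma enorm_inv_natCast_mul_le (K : ℕ) : ‖((K : ℝ)⁻¹)‖ₑ * (K : ℝ≥0∞) ≤ 1 := by
  rcases Nat.eq_zero_or_pos K with rfl | hK
  · simp
  · have : (K : ℝ≥0∞) = ‖(K : ℝ)‖ₑ := by
      rw [Real.enorm_eq_ofReal (by positivity), ENNReal.ofReal_natCast]
    rw [this, ← enorm_mul, inv_mul_cancel₀ (by positivity)]
    simp

lemma lTwo_logAvg_le {ρ : Space N → ℝ} (hρ : Measurable ρ) {a : ℝ} (K : ℕ) {f : Space N → ℝ}
    (hf : Measurable f) {B : Set (Space N)} {C : ℝ≥0∞}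
    (h : ∀ k : ℕ, lTwo B (avg ρ (a * 2⁻¹ ^ k) f) ≤ C) : lTwo B (logAvg ρ a K f) ≤ C := by
  have e1 : logAvg ρ a K f =
      fun x ↦ (K : ℝ)⁻¹ * ∑ k ∈ Finset.range K, avg ρ (a * 2⁻¹ ^ k) f x := rfl
  rw [e1, lTwo_const_mul]
  calc _ ≤ ‖((K : ℝ)⁻¹)‖ₑ * ∑ k ∈ Finset.range K, C := by
        refine mul_le_mul_right ((lTwo_sum_le _ fun k _ ↦ measurable_avg hρ _ hf).trans ?_) _
        exact Finset.sum_le_sum fun k _ ↦ h k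
    _ = ‖((K : ℝ)⁻¹)‖ₑ * K * C := by rw [Finset.sum_const, Finset.card_range, nsmul_eq_mul, mul_assoc]
    _ ≤ 1 * C := mul_le_mul_left (enorm_inv_natCast_mul_le K) _
    _ = C := one_mul C

lemma incr_logAvg_le {ρ : Space N → ℝ} (hρ : Measurable ρ) {a : ℝ} (K : ℕ) {f : Space N → ℝ}
    (hf : Measurable f) {B : Set (Space N)} {w : Space N} {b : ℝ≥0∞} {C : ℕ → ℝ≥0∞}
    (h : ∀ k : ℕ, incr B (avg ρ (a * 2⁻¹ ^ k) f) w ≤ b + C k) :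
    incr B (logAvg ρ a K f) w ≤ b + ‖((K : ℝ)⁻¹)‖ₑ * ∑ k ∈ Finset.range K, C k := by
  have e1 : logAvg ρ a K f =
      fun x ↦ (K : ℝ)⁻¹ * ∑ k ∈ Finset.range K, avg ρ (a * 2⁻¹ ^ k) f x := rfl
  rw [e1, incr_const_mul]
  calc _ ≤ ‖((K : ℝ)⁻¹)‖ₑ * ∑ k ∈ Finset.range K, (b + C k) := by
        refine mul_le_mul_right ((incr_sum_le _ (fun k _ ↦ measurable_avg hρ _ hf) w).trans ?_) _
        exact Finset.sum_le_sum fun k _ ↦ h k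
    _ = ‖((K : ℝ)⁻¹)‖ₑ * K * b + ‖((K : ℝ)⁻¹)‖ₑ * ∑ k ∈ Finset.range K, C k := by
        rw [Finset.sum_add_distrib, Finset.sum_const, Finset.card_range, nsmul_eq_mul, mul_add,
          mul_assoc]
    _ ≤ 1 * b + _ := add_le_add (mul_le_mul_left (enorm_inv_natCast_mul_le K) _) le_rfl
    _ = _ := by rw [one_mul]

lemma min_one_mul_le {a : ℝ≥0∞} (ha : 1 ≤ a) (t : ℝ≥0∞) : min 1 (a * t) ≤ a * min 1 t := by
  rcases le_total 1 t with h | h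
  · rw [min_eq_left h, mul_one]
    exact (min_le_left _ _).trans ha
  · rw [min_eq_right h]
    exact min_le_right _ _

lemma min_one_scale_le {c : ℝ} (hc : 0 < c) (hc1 : c ≤ 1) {s : ℝ} (hs : |s| = c / 4) (k : ℕ)
    (w : Space N) : min 1 ‖(s * 2⁻¹ ^ k)⁻¹ • w‖ₑ ≤ ENNReal.ofReal (c / 4)⁻¹ *
      min 1 (2 ^ k * ‖w‖ₑ) := by
  have e : ‖(s * 2⁻¹ ^ k)⁻¹ • w‖ₑ = ENNReal.ofReal (c / 4)⁻¹ * (2 ^ k * ‖w‖ₑ) := by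
    rw [enorm_smul, mul_inv, ← inv_pow, inv_inv, enorm_mul, mul_assoc]
    congr 1
    · rw [← enorm_norm, Real.enorm_eq_ofReal (norm_nonneg _), norm_inv, Real.norm_eq_abs, hs]
    · rw [enorm_pow, Real.enorm_eq_ofReal (by norm_num)]
      simp
  rw [e]
  refine min_one_mul_le ?_ _
  rw [ENNReal.one_le_ofReal, one_le_inv₀ (by positivity)]
  linarith

lemma lTwo_eq_of_zero {A : Set (Space N)} (hA : MeasurableSet A) {f : Space N → ℝ}
    (h0 : ∀ x ∉ A, f x = 0) : lTwo univ f = lTwo A f := by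
  have : f = A.indicator f := by
    ext x
    by_cases hx : x ∈ A
    · rw [indicator_of_mem hx]
    · rw [indicator_of_notMem hx, h0 x hx]
  unfold lTwo
  rw [← eLpNorm_indicator_eq_eLpNorm_restrict hA, Measure.restrict_univ, ← this]

lemma lTwo_sq_le_hsq (A : Set (Space N)) (f : Space N → ℝ) : lTwo A f ^ 2 ≤ hsq A f := le_self_add

lemma gag_le_hsq (A : Set (Space N)) (f : Space N → ℝ) : gag A f ≤ hsq A f := le_add_self

lemma lTwo_lt_top_of_hsq {A : Set (Space N)} {f : Space N → ℝ} (h : hsq A f ≠ ⊤) :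
    lTwo A f < ⊤ := by
  have h1 := (lTwo_sq_le_hsq A f).trans_lt h.lt_top
  by_contra h2
  rw [not_lt, top_le_iff] at h2
  simp [h2] at h1

lemma memLp_two_of_hsq {A : Set (Space N)} (hA : MeasurableSet A) {f : Space N → ℝ}
    (hf : Measurable f) (h0 : ∀ x ∉ A, f x = 0) (h : hsq A f ≠ ⊤) : MemLp f 2 := by
  rw [memLp_two_iff_lTwo hf, lTwo_eq_of_zero hA h0]
  exact lTwo_lt_top_of_hsq h

lemma hsq_le_of_incr_le {A : Set (Space N)} (hA : MeasurableSet A) {f g : Space N → ℝ}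
    (hf : Measurable f) {C : ℝ≥0∞} (h1 : lTwo A g ≤ C * lTwo A f)
    (h2 : ∀ w, incr A g w ≤ C * incr A f w) : hsq A g ≤ C ^ 2 * hsq A f := by
  have h3 : gag A g ≤ C ^ 2 * gag A f := by
    have hi := measurable_incr hA hf
    have hk := measurable_kern (N := N)
    unfold gag
    rw [← lintegral_const_mul _ (by fun_prop)]
    refine lintegral_mono fun w ↦ ?_
    calc kern w * incr A g w ^ 2 ≤ kern w * (C * incr A f w) ^ 2 := by
          gcongr
          exact h2 w
      _ = _ := by ring
  unfold hsq
  rw [mul_add, ← mul_pow]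
  gcongr

namespace IsUpCone
variable {G : Set (Space N)} {ν : Space N} {c : ℝ} {ρ : Space N → ℝ} {M : ℝ≥0}

/-- Upward averages only involve values in `G`, and are bounded in `H^{1/2}(G)`. -/
lemma hsq_logAvg_up_le (hG : IsUpCone G ν c) (h : IsConeKernel ρ ν c M) (K : ℕ)
    {f : Space N → ℝ} (hf : Measurable f) (hf2 : MemLp f 2) :
    hsq G (logAvg ρ (c / 4) K f) ≤ (M * ballVol N) ^ 2 * hsq G f := by
  have hc := hG.pos
  have hBA : ∀ k : ℕ, ∀ x ∈ G, ∀ z ∈ Metric.ball ν c, x + (c / 4 * 2⁻¹ ^ k) • z ∈ G :=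
    fun k x hx z hz ↦ hG.mem x (subset_closure hx) z hz _ (by positivity)
  have h1 : lTwo G (logAvg ρ (c / 4) K f) ≤ M * ballVol N * lTwo G f :=
    lTwo_logAvg_le h.measurable K hf fun k ↦ h.lTwo_avg_le (hBA k) hf
  have h2 : ∀ w, incr G (logAvg ρ (c / 4) K f) w ≤ M * ballVol N * incr G f w := fun w ↦ by
    have := incr_logAvg_le h.measurable K hf (B := G) (w := w) (b := M * ballVol N * incr G f w)
      (C := fun _ ↦ 0) (a := c / 4) fun k ↦ by
        rw [add_zero]
        exact h.incr_avg_le (by positivity) (hBA k) hf hf2 w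
    simpa using this
  exact hsq_le_of_incr_le hG.measurableSet hf h1 h2

/-- Downward averages of functions vanishing outside `G`. The oscillation at the scale `2^{-k}`
involves the values in a layer of height `2^{-k}`, which sum up to a quadratic expression in the
number of scales: the factor `1/K` of the logarithmic average compensates it. -/
lemma exists_hsq_logAvg_down_le (hN : N ≠ 0) (hG : IsUpCone G ν c) (h : IsConeKernel ρ ν c M)
    (h1 : ∫ z, ρ z = 1) : ∃ C : ℝ≥0, ∀ f : Space N → ℝ, Measurable f → (∀ x ∉ G, f x = 0) →
      MemLp f 2 → ∀ K, hsq G (logAvg ρ (-(c / 4)) K f) ≤ C * hsq G f := by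
  obtain ⟨C₀, hC₀⟩ := hG.exists_osc_bound
  have hc := hG.pos
  let D : ℝ≥0∞ := 2 * M * (ballVol N) ^ (1 / 2 : ℝ) * ENNReal.ofReal (c / 4)⁻¹
  have hD : D ≠ ⊤ := ENNReal.mul_ne_top (ENNReal.mul_ne_top (by finiteness)
    (ENNReal.rpow_ne_top_of_nonneg (by norm_num) ballVol_ne_top)) (by finiteness)
  let C : ℝ≥0∞ := (M * ballVol N) ^ 2 + 2 * (1 + D ^ 2 * (10 * kernConst N * C₀))
  have hC : C ≠ ⊤ := by
    have := kernConst_ne_top hN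
    have := ballVol_ne_top (N := N)
    finiteness
  refine ⟨C.toNNReal, fun f hf h0 hf2 K ↦ ?_⟩
  rw [ENNReal.coe_toNNReal hC]
  set κ : ℝ≥0∞ := ‖((K : ℝ)⁻¹)‖ₑ
  have hκ : κ * K ≤ 1 := enorm_inv_natCast_mul_le K
  have hs : |(-(c / 4))| = c / 4 := by rw [abs_neg, abs_of_pos (by positivity)]
  let o : ℕ → ℝ≥0∞ := fun k ↦ osc G f (c / 4 * 2⁻¹ ^ k) ^ (1 / 2 : ℝ)
  have ho : ∀ k, o k ^ 2 = osc G f (c / 4 * 2⁻¹ ^ k) := fun k ↦ by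
    simp only [o]
    rw [← ENNReal.rpow_natCast, ← ENNReal.rpow_mul]
    norm_num
  have hl : lTwo G (logAvg ρ (-(c / 4)) K f) ≤ M * ballVol N * lTwo G f := by
    rw [← lTwo_eq_of_zero hG.measurableSet h0]
    exact lTwo_logAvg_le h.measurable K hf fun k ↦
      h.lTwo_avg_le (fun _ _ _ _ ↦ mem_univ _) hf
  -- each average adds to the increment of `f` a multiple of the square root of an oscillation
  have hinc : ∀ w, incr G (logAvg ρ (-(c / 4)) K f) w ≤ incr G f w +
      κ * D * ∑ k ∈ Finset.range K, min 1 (2 ^ k * ‖w‖ₑ) * o k := by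
    intro w
    refine (incr_logAvg_le h.measurable K hf (b := incr G f w)
      (C := fun k ↦ D * (min 1 (2 ^ k * ‖w‖ₑ) * o k)) fun k ↦ ?_).trans_eq ?_
    · refine (h.incr_avg_le_add h1 G (scale_ne_zero (by linarith) k) hf hf2 w).trans ?_
      have eo : osc G f (-(c / 4) * 2⁻¹ ^ k) = osc G f (c / 4 * 2⁻¹ ^ k) := by
        rw [neg_mul, osc_neg]
      rw [eo]
      refine add_le_add le_rfl ?_
      calc _ ≤ 2 * M * (ballVol N) ^ (1 / 2 : ℝ) * (ENNReal.ofReal (c / 4)⁻¹ *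
            min 1 (2 ^ k * ‖w‖ₑ)) * o k := by
            gcongr
            exact min_one_scale_le hc hG.le_one hs k w
        _ = _ := by simp only [D]; ring
    · rw [← Finset.mul_sum, ← mul_assoc]
  have hi := measurable_incr hG.measurableSet hf
  have hk := measurable_kern (N := N)
  -- the Schur test turns the sum into `∑ 2ᵏ osc_k`, of the order of `K²`, against the factor `1/K²`
  have hgag : gag G (logAvg ρ (-(c / 4)) K f) ≤
      2 * (1 + D ^ 2 * (10 * kernConst N * C₀)) * hsq G f := by
    calc gag G (logAvg ρ (-(c / 4)) K f)
        ≤ ∫⁻ w, (2 * (kern w * incr G f w ^ 2) + 2 * (κ * D) ^ 2 *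
            (kern w * (∑ k ∈ Finset.range K, min 1 (2 ^ k * ‖w‖ₑ) * o k) ^ 2)) := by
          refine lintegral_mono fun w ↦ ?_
          refine (mul_le_mul_right ((pow_le_pow_left' (hinc w) 2).trans
            (ennreal_add_sq_le _ _)) _).trans_eq ?_
          ring
      _ = 2 * gag G f + 2 * (κ * D) ^ 2 *
            ∫⁻ w, kern w * (∑ k ∈ Finset.range K, min 1 (2 ^ k * ‖w‖ₑ) * o k) ^ 2 := by
          rw [lintegral_add_left (by fun_prop), lintegral_const_mul _ (by fun_prop),
            lintegral_const_mul _ (by fun_prop), gag]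
      _ ≤ 2 * gag G f + 2 * (κ * D) ^ 2 * (10 * kernConst N * (C₀ * K ^ 2 * hsq G f)) := by
          gcongr
          refine (lintegral_kern_sum_sq_le K o).trans ?_
          gcongr
          simp only [ho]
          exact hC₀ f hf h0 K
      _ = 2 * gag G f + 2 * (D ^ 2 * (10 * kernConst N * C₀)) * (κ * K) ^ 2 * hsq G f := by ring
      _ ≤ 2 * hsq G f + 2 * (D ^ 2 * (10 * kernConst N * C₀)) * 1 ^ 2 * hsq G f := by
          gcongr
          exact gag_le_hsq G f
      _ = _ := by ring
  calc hsq G (logAvg ρ (-(c / 4)) K f)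
      = lTwo G (logAvg ρ (-(c / 4)) K f) ^ 2 + gag G (logAvg ρ (-(c / 4)) K f) := rfl
    _ ≤ (M * ballVol N * lTwo G f) ^ 2 + _ := add_le_add (pow_le_pow_left' hl 2) hgag
    _ = (M * ballVol N) ^ 2 * lTwo G f ^ 2 + _ := by rw [mul_pow]
    _ ≤ (M * ballVol N) ^ 2 * hsq G f + _ := by
        gcongr
        exact lTwo_sq_le_hsq G f
    _ = C * hsq G f := by simp only [C]; ring

lemma tsum_inv_sq_ne_top : ∑' k : ℕ, ((k + 1 : ℝ≥0∞)⁻¹) ^ 2 ≠ ⊤ := by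
  have h : Summable fun k : ℕ ↦ (((k + 1 : ℝ≥0) ^ 2)⁻¹ : ℝ≥0) := by
    rw [← NNReal.summable_coe]
    push_cast
    have := (summable_nat_add_iff 1).2 (Real.summable_nat_pow_inv.2 one_lt_two)
    exact_mod_cast this
  convert ENNReal.tsum_coe_ne_top_iff_summable.2 h using 3 with k
  rw [ENNReal.coe_inv (by positivity), ← ENNReal.inv_pow]
  push_cast
  rfl

lemma tsum_pow_four_ne_top : ∑' k : ℕ, ((k + 1 : ℝ≥0∞) ^ 4 * 2⁻¹ ^ k) ≠ ⊤ := by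
  have h : Summable fun k : ℕ ↦ (((k + 1 : ℝ≥0) ^ 4) * 2⁻¹ ^ k : ℝ≥0) := by
    rw [← NNReal.summable_coe]
    push_cast
    have h1 := summable_pow_mul_geometric_of_norm_lt_one 4 (r := (2⁻¹ : ℝ)) (by norm_num)
    have h2 := ((summable_nat_add_iff 1).2 h1).mul_left 2
    refine h2.congr fun k ↦ ?_
    push_cast
    ring
  convert ENNReal.tsum_coe_ne_top_iff_summable.2 h using 3 with k
  simp [ENNReal.coe_inv, ENNReal.inv_pow]

/-- Logarithmic averages converge in `L²(G)`, at the rate `1/K`. -/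
lemma exists_lTwo_logAvg_sub_le (hG : IsUpCone G ν c) (h : IsConeKernel ρ ν c M)
    (h1 : ∫ z, ρ z = 1) : ∃ C : ℝ≥0, ∀ s : ℝ, |s| = c / 4 → ∀ f : Space N → ℝ, Measurable f →
      (∀ x ∉ G, f x = 0) → MemLp f 2 → ∀ K : ℕ, K ≠ 0 →
        lTwo G (fun x ↦ logAvg ρ s K f x - f x) ^ 2 ≤ ‖((K : ℝ)⁻¹)‖ₑ ^ 2 * (C * hsq G f) := by
  obtain ⟨C₀, hC₀⟩ := hG.exists_osc_bound
  have hc := hG.pos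
  let S₁ : ℝ≥0∞ := ∑' k : ℕ, ((k + 1 : ℝ≥0∞)⁻¹) ^ 2
  let S₂ : ℝ≥0∞ := ∑' k : ℕ, ((k + 1 : ℝ≥0∞) ^ 4 * 2⁻¹ ^ k)
  let C : ℝ≥0∞ := S₁ * (S₂ * (M ^ 2 * ballVol N * C₀))
  have hC : C ≠ ⊤ := by
    have h1 : S₁ ≠ ⊤ := tsum_inv_sq_ne_top
    have h2 : S₂ ≠ ⊤ := tsum_pow_four_ne_top
    have := ballVol_ne_top (N := N)
    finiteness
  refine ⟨C.toNNReal, fun s hs f hf h0 hf2 K hK ↦ ?_⟩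
  rw [ENNReal.coe_toNNReal hC]
  have hs0 : s ≠ 0 := by
    rintro rfl
    rw [abs_zero] at hs
    linarith
  have hosc : ∀ k : ℕ, osc G f (s * 2⁻¹ ^ k) = osc G f (c / 4 * 2⁻¹ ^ k) := fun k ↦ by
    rcases abs_choice s with h | h
    · rw [← hs, h]
    · rw [← hs, h, neg_mul, osc_neg]
  let b : ℕ → ℝ≥0∞ := fun k ↦ lTwo G fun x ↦ avg ρ (s * 2⁻¹ ^ k) f x - f x
  -- the oscillation bound with `k + 1` scales, restricted to its last term
  have hb : ∀ k, b k ^ 2 ≤ (k + 1) ^ 2 * 2⁻¹ ^ k * (M ^ 2 * ballVol N * C₀ * hsq G f) := by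
    intro k
    have h2 := h.lTwo_avg_sub_le G (scale_ne_zero hs0 k) hf hf2
    simp only [h1, one_mul] at h2
    refine h2.trans ?_
    have h3 : 2 ^ k * osc G f (c / 4 * 2⁻¹ ^ k) ≤ C₀ * ((k + 1 : ℕ) : ℝ≥0∞) ^ 2 * hsq G f :=
      (Finset.single_le_sum (f := fun k ↦ 2 ^ k * osc G f (c / 4 * 2⁻¹ ^ k))
        (fun _ _ ↦ zero_le) (Finset.self_mem_range_succ k)).trans (hC₀ f hf h0 (k + 1))
    have h4 : osc G f (c / 4 * 2⁻¹ ^ k) = 2⁻¹ ^ k * (2 ^ k * osc G f (c / 4 * 2⁻¹ ^ k)) := by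
      rw [← mul_assoc, ← mul_pow, ENNReal.inv_mul_cancel (by norm_num) (by norm_num), one_pow,
        one_mul]
    rw [hosc, h4]
    refine (mul_le_mul_right (mul_le_mul_right h3 _) _).trans_eq ?_
    push_cast
    ring
  have hm : ∀ k, Measurable fun x ↦ avg ρ (s * 2⁻¹ ^ k) f x - f x := fun k ↦
    (measurable_avg h.measurable _ hf).sub hf
  have e : (fun x ↦ logAvg ρ s K f x - f x) =
      fun x ↦ (K : ℝ)⁻¹ * ∑ k ∈ Finset.range K, (avg ρ (s * 2⁻¹ ^ k) f x - f x) := by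
    ext x
    have : (K : ℝ) ≠ 0 := by exact_mod_cast hK
    rw [Finset.sum_sub_distrib, Finset.sum_const, Finset.card_range, nsmul_eq_mul, mul_sub,
      inv_mul_cancel_left₀ this, logAvg]
  rw [e, lTwo_const_mul, mul_pow]
  refine mul_le_mul_right ?_ _
  have hk1 : ∀ k : ℕ, (k + 1 : ℝ≥0∞) ≠ 0 := fun k ↦ by positivity
  have hk2 : ∀ k : ℕ, (k + 1 : ℝ≥0∞) ≠ ⊤ := fun k ↦ by finiteness
  calc lTwo G (fun x ↦ ∑ k ∈ Finset.range K, (avg ρ (s * 2⁻¹ ^ k) f x - f x)) ^ 2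
      ≤ (∑ k ∈ Finset.range K, b k) ^ 2 := by
        gcongr
        exact lTwo_sum_le _ fun k _ ↦ hm k
    -- inserting the square summable weights `1 / (k + 1)`
    _ = (∑ k ∈ Finset.range K, (k + 1 : ℝ≥0∞)⁻¹ * ((k + 1) * b k)) ^ 2 := by
        congr 1
        refine Finset.sum_congr rfl fun k _ ↦ ?_
        rw [← mul_assoc, ENNReal.inv_mul_cancel (hk1 k) (hk2 k), one_mul]
    _ ≤ (∑ k ∈ Finset.range K, ((k + 1 : ℝ≥0∞)⁻¹) ^ 2) *
          ∑ k ∈ Finset.range K, ((k + 1) * b k) ^ 2 := ennreal_sum_mul_sq_le _ _ _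
    _ ≤ S₁ * ∑ k ∈ Finset.range K, ((k + 1 : ℝ≥0∞) ^ 4 * 2⁻¹ ^ k) *
          (M ^ 2 * ballVol N * C₀ * hsq G f) := by
        gcongr with k
        · exact ENNReal.sum_le_tsum _
        · rw [mul_pow]
          refine (mul_le_mul_right (hb k) _).trans_eq ?_
          ring
    _ ≤ S₁ * (S₂ * (M ^ 2 * ballVol N * C₀ * hsq G f)) := by
        rw [← Finset.sum_mul]
        gcongr
        exact ENNReal.sum_le_tsum _
    _ = _ := by simp only [C]; ring

end IsUpCone

end

section

variable {N : ℕ}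

/-! ### Dyadic decomposition of the seminorm -/

/-- The mean square increment of `f` at the scale `ε`, the increments being taken inside `A`. -/
noncomputable def ballIncr (A : Set (Space N)) (f : Space N → ℝ) (ε : ℝ) : ℝ≥0∞ :=
  ∫⁻ z in Metric.closedBall (0 : Space N) 3, incr A f (ε • z) ^ 2

lemma ballIncr_neg (A : Set (Space N)) (f : Space N → ℝ) (ε : ℝ) :
    ballIncr A f (-ε) = ballIncr A f ε := by
  unfold ballIncr
  rw [← lintegral_indicator measurableSet_closedBall, ← lintegral_indicator measurableSet_closedBall,
    ← lintegral_neg_eq_self]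
  congr 1 with z
  simp only [indicator, mem_closedBall_zero_iff, norm_neg, neg_smul, smul_neg, neg_neg]

lemma ballIncr_eq_of_abs (A : Set (Space N)) (f : Space N → ℝ) {s a : ℝ} (hs : |s| = a) (t : ℝ) :
    ballIncr A f (s * t) = ballIncr A f (a * t) := by
  rcases abs_choice s with h | h
  · rw [← hs, h]
  · rw [← hs, h, neg_mul, ballIncr_neg]

lemma ennreal_sum_add_sq_le {ι : Type*} (s : Finset ι) (w a b : ι → ℝ≥0∞) {A B : ℝ≥0∞}
    (hA : ∑ i ∈ s, w i * a i ^ 2 ≤ A) (hB : ∑ i ∈ s, w i * b i ^ 2 ≤ B) :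
    ∑ i ∈ s, w i * (a i + b i) ^ 2 ≤ 2 * (A + B) := by
  calc _ ≤ ∑ i ∈ s, 2 * (w i * a i ^ 2 + w i * b i ^ 2) := by
        refine Finset.sum_le_sum fun i _ ↦
          (mul_le_mul_right (ennreal_add_sq_le _ _) _).trans_eq ?_
        ring
    _ = 2 * (∑ i ∈ s, w i * a i ^ 2 + ∑ i ∈ s, w i * b i ^ 2) := by
        rw [← Finset.mul_sum, Finset.sum_add_distrib]
    _ ≤ _ := by gcongr

/-- Summation of a telescoping series whose terms are products of two sequences which are square
summable with the weights `2^k`. -/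
lemma enorm_sub_sq_le_of_telescoping {I : ℕ → ℝ} {L : ℝ} (hI : Filter.Tendsto I Filter.atTop (nhds L))
    {a b : ℕ → ℝ≥0∞} {D A B : ℝ≥0∞}
    (h : ∀ k, ‖I (k + 1) - I k‖ₑ ≤ D * (2 ^ k * ((a k + a (k + 1)) * (b k + b (k + 1)))))
    (hA : ∀ K, ∑ k ∈ Finset.range K, 2 ^ k * a k ^ 2 ≤ A)
    (hB : ∀ K, ∑ k ∈ Finset.range K, 2 ^ k * b k ^ 2 ≤ B) :
    ‖L - I 0‖ₑ ^ 2 ≤ D ^ 2 * (4 * A * (4 * B)) := by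
  have hpair : ∀ (u : ℕ → ℝ≥0∞) (U : ℝ≥0∞),
      (∀ K, ∑ k ∈ Finset.range K, 2 ^ k * u k ^ 2 ≤ U) →
      ∀ K, ∑ k ∈ Finset.range K, 2 ^ k * (u k + u (k + 1)) ^ 2 ≤ 4 * U := by
    intro u U hU K
    have h1 : ∑ k ∈ Finset.range K, 2 ^ k * u (k + 1) ^ 2 ≤ U := by
      refine le_trans ?_ (hU (K + 1))
      rw [Finset.sum_range_succ' (fun k ↦ 2 ^ k * u k ^ 2)]
      refine le_add_right (Finset.sum_le_sum fun k _ ↦ ?_)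
      gcongr
      · norm_num
      · omega
    refine (ennreal_sum_add_sq_le _ (fun k ↦ 2 ^ k) u (fun k ↦ u (k + 1)) (hU K) h1).trans_eq ?_
    ring
  have hK : ∀ K, ‖I K - I 0‖ₑ ^ 2 ≤ D ^ 2 * (4 * A * (4 * B)) := by
    intro K
    let s : ℝ≥0∞ := ENNReal.ofReal √2
    have hs2 : s * s = 2 := by
      simp only [s]
      rw [← ENNReal.ofReal_mul (by positivity), Real.mul_self_sqrt (by norm_num)]
      simp
    have hsk : ∀ k : ℕ, s ^ k * s ^ k = 2 ^ k := fun k ↦ by rw [← mul_pow, hs2]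
    have h1 : ‖I K - I 0‖ₑ ≤ D * ∑ k ∈ Finset.range K,
        (s ^ k * (a k + a (k + 1))) * (s ^ k * (b k + b (k + 1))) := by
      rw [← Finset.sum_range_sub, Finset.mul_sum]
      refine (enorm_sum_le _ _).trans (Finset.sum_le_sum fun k _ ↦ (h k).trans_eq ?_)
      rw [← hsk k]
      ring
    calc ‖I K - I 0‖ₑ ^ 2 ≤ _ := pow_le_pow_left' h1 2
      _ = D ^ 2 * (∑ k ∈ Finset.range K,
        (s ^ k * (a k + a (k + 1))) * (s ^ k * (b k + b (k + 1)))) ^ 2 := mul_pow _ _ _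
      _ ≤ D ^ 2 * ((∑ k ∈ Finset.range K, (s ^ k * (a k + a (k + 1))) ^ 2) *
          ∑ k ∈ Finset.range K, (s ^ k * (b k + b (k + 1))) ^ 2) := by
          gcongr
          exact ennreal_sum_mul_sq_le _ _ _
      _ ≤ _ := by
          have e : ∀ (k : ℕ) (x : ℝ≥0∞), (s ^ k * x) ^ 2 = 2 ^ k * x ^ 2 := fun k x ↦ by
            rw [mul_pow, sq (s ^ k), hsk]
          simp only [e]
          gcongr
          · exact hpair a A hA K
          · exact hpair b B hB K
  have hlim : Filter.Tendsto (fun K ↦ ‖I K - I 0‖ₑ ^ 2) Filter.atTop (nhds (‖L - I 0‖ₑ ^ 2)) :=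
    (ENNReal.continuous_pow 2).continuousAt.tendsto.comp ((hI.sub_const _).enorm)
  exact le_of_tendsto' hlim hK

/-- Square summability with the weights `2^k` gives convergence to zero at the rate `2^{-k/2}`. -/
lemma tendsto_zero_of_sum_two_pow {a : ℕ → ℝ≥0∞} {A : ℝ≥0∞} (hA : A ≠ ⊤)
    (h : ∀ K, ∑ k ∈ Finset.range K, 2 ^ k * a k ^ 2 ≤ A) :
    Filter.Tendsto a Filter.atTop (nhds 0) := by
  have h1 : ∀ k, a k ^ 2 ≤ A * 2⁻¹ ^ k := by
    intro k
    have h2 : 2 ^ k * a k ^ 2 ≤ A :=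
      (Finset.single_le_sum (f := fun k ↦ 2 ^ k * a k ^ 2)
        (fun _ _ ↦ zero_le) (Finset.self_mem_range_succ k)).trans (h (k + 1))
    have h4 : a k ^ 2 = (2 ^ k * a k ^ 2) * 2⁻¹ ^ k := by
      rw [mul_right_comm, ← mul_pow, ENNReal.mul_inv_cancel (by norm_num) (by norm_num), one_pow,
        one_mul]
    rw [h4]
    gcongr
  have h2 : Filter.Tendsto (fun k : ℕ ↦ A * 2⁻¹ ^ k) Filter.atTop (nhds 0) := by
    have := ENNReal.Tendsto.const_mul (a := A)
      (ENNReal.tendsto_pow_atTop_nhds_zero_of_lt_one (r := 2⁻¹) (by norm_num)) (Or.inr hA)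
    simpa using this
  have h3 : Filter.Tendsto (fun k ↦ a k ^ 2) Filter.atTop (nhds 0) :=
    tendsto_of_tendsto_of_tendsto_of_le_of_le tendsto_const_nhds h2 (fun _ ↦ zero_le) h1
  have h4 := (ENNReal.continuous_rpow_const (y := 1 / 2)).continuousAt.tendsto.comp h3
  have e : (fun x : ℝ≥0∞ ↦ x ^ (1 / 2 : ℝ)) ∘ (fun k ↦ a k ^ 2) = a := by
    ext k
    simp only [Function.comp_apply]
    rw [← ENNReal.rpow_natCast, ← ENNReal.rpow_mul]
    norm_num
  rw [e] at h4
  simpa using h4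

namespace IsConeKernel
variable {θ : Space N → ℝ} {ν : Space N} {c : ℝ} {M : ℝ≥0}

/-- When the averages over points of `A` only involve values in `A`, the error of the average is
bounded by increments inside `A`. -/
lemma lTwo_avg_sub_le_ballIncr (h : IsConeKernel θ ν c M) {A : Set (Space N)}
    {ε : ℝ} (hε : ε ≠ 0) (hA : ∀ x ∈ A, ∀ z ∈ Metric.ball ν c, x + ε • z ∈ A)
    {f : Space N → ℝ} (hf : Measurable f) (hf2 : MemLp f 2) :
    lTwo A (fun x ↦ avg θ ε f x - (∫ z, θ z) * f x) ^ 2 ≤ M ^ 2 * ballVol N * ballIncr A f ε := by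
  have e : ∀ x, avg θ ε f x - (∫ z, θ z) * f x = ∫ z, θ z * (f (x + ε • z) - f x) := by
    intro x
    unfold avg
    rw [← integral_mul_const, ← integral_sub
      (integrable_avg h.contDiff h.hasCompactSupport hε _ hf hf2)
      ((h.contDiff.continuous.integrable_of_hasCompactSupport h.hasCompactSupport).mul_const _)]
    congr 1 with z
    ring
  rw [lTwo_sq]
  simp_rw [e]
  refine (lintegral_sq_integral_mul_le h.measurable h.bound measurableSet_ball
    (fun z hz ↦ h.eq_zero hz) A (g := fun x z ↦ f (x + ε • z) - f x) (by fun_prop)).trans ?_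
  have h3 : Metric.ball ν c ⊆ Metric.closedBall (0 : Space N) 3 :=
    h.ball_subset.trans (Metric.closedBall_subset_closedBall (by norm_num))
  refine mul_le_mul' (mul_le_mul_right h.volume_ball_le _) ?_
  refine le_trans (setLIntegral_mono' measurableSet_ball fun z hz ↦ ?_) (lintegral_mono_set h3)
  rw [incr_sq]
  exact lintegral_mono_set fun x hx ↦ ⟨hx, hA x hx z hz⟩

/-- Littlewood-Paley type bound: for averages which stay in `A`, the errors at the dyadic scales are
square summable with the weights `2ᵏ`, with a sum controlled by the Gagliardo energy over `A`. When
the weight `θ` has mean zero this bounds the averages themselves. -/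
lemma sum_lTwo_avg_sub_le (h : IsConeKernel θ ν c M) (hc : 0 < c) {A : Set (Space N)}
    (hA : MeasurableSet A) {s : ℝ} (hs : |s| = c / 4)
    (hAs : ∀ k : ℕ, ∀ x ∈ A, ∀ z ∈ Metric.ball ν c, x + (s * 2⁻¹ ^ k) • z ∈ A)
    {f : Space N → ℝ} (hf : Measurable f) (hf2 : MemLp f 2) (K : ℕ) :
    ∑ k ∈ Finset.range K, 2 ^ k *
      lTwo A (fun x ↦ avg θ (s * 2⁻¹ ^ k) f x - (∫ z, θ z) * f x) ^ 2 ≤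
      M ^ 2 * ballVol N * ENNReal.ofReal (2 * (c / 4) * 3 ^ (N + 1)) * gag A f := by
  have hs0 : s ≠ 0 := by
    rintro rfl
    rw [abs_zero] at hs
    linarith
  have hi := measurable_incr hA hf
  calc _ ≤ ∑ k ∈ Finset.range K, M ^ 2 * ballVol N * (2 ^ k * ballIncr A f (c / 4 * 2⁻¹ ^ k)) := by
        refine Finset.sum_le_sum fun k _ ↦ ?_
        refine (mul_le_mul_right
          (h.lTwo_avg_sub_le_ballIncr (scale_ne_zero hs0 k) (hAs k) hf hf2) _).trans_eq ?_
        rw [ballIncr_eq_of_abs A f hs]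
        ring
    _ ≤ M ^ 2 * ballVol N * (ENNReal.ofReal (2 * (c / 4) * 3 ^ (N + 1)) * gag A f) := by
        rw [← Finset.mul_sum]
        exact mul_le_mul_right (sum_lintegral_scale_le (g := fun w ↦ incr A f w ^ 2) (by positivity)
          (by norm_num) K (by fun_prop)) _
    _ = _ := by ring

end IsConeKernel

/-! ### Smooth functions -/

lemma enorm_diffQuot_sq (v : Space N → ℝ) (p : Space N × Space N) :
    ‖diffQuot v p‖ₑ ^ 2 = kern (p.1 - p.2) * ‖v p.1 - v p.2‖ₑ ^ 2 := by
  by_cases hp : p.1 = p.2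
  · simp [diffQuot, hp]
  have hn : 0 < ‖p.1 - p.2‖ := norm_pos_iff.2 (sub_ne_zero.2 hp)
  have hpow : (‖p.1 - p.2‖ ^ (((N : ℝ) + 1) / 2)) ^ 2 = ‖p.1 - p.2‖ ^ (N + 1) := by
    rw [← Real.rpow_natCast (_ ^ _) 2, ← Real.rpow_mul hn.le, ← Real.rpow_natCast]
    congr 1
    push_cast
    ring
  rw [diffQuot, ← enorm_pow, div_pow, hpow, div_eq_mul_inv, mul_comm, enorm_mul, enorm_pow, kern,
    enorm_inv (by positivity), enorm_pow, enorm_norm]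

lemma gag_eq_lintegral_diffQuot {A : Set (Space N)} (hA : MeasurableSet A) {f : Space N → ℝ}
    (hf : Measurable f) :
    gag A f = ∫⁻ p, ‖diffQuot f p‖ₑ ^ 2 ∂((volume.restrict A).prod (volume.restrict A)) := by
  have hk := measurable_kern (N := N)
  simp_rw [enorm_diffQuot_sq]
  rw [gag_eq hA hf, lintegral_prod _ (by fun_prop)]

lemma lTwo_univ_lt_top_of_smooth {f : Space N → ℝ} (hf : ContDiff ℝ ∞ f)
    (hc : HasCompactSupport f) : lTwo univ f < ⊤ :=
  (memLp_two_iff_lTwo hf.continuous.measurable).1 (hf.continuous.memLp_of_hasCompactSupport hc)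

lemma hsq_univ_lt_top_of_smooth {f : Space N → ℝ} (hf : ContDiff ℝ ∞ f)
    (hc : HasCompactSupport f) : hsq univ f < ⊤ := by
  refine ENNReal.add_lt_top.2 ⟨ENNReal.pow_lt_top (lTwo_univ_lt_top_of_smooth hf hc), ?_⟩
  have h := memLp_diffQuot ⊤ hf hc
  rw [gag_eq_lintegral_diffQuot MeasurableSet.univ hf.continuous.measurable, ← eLpNorm_two_sq]
  exact ENNReal.pow_lt_top h.eLpNorm_lt_top

lemma enorm_integral_mul_le_of_zero {A : Set (Space N)} {u g : Space N → ℝ}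
    (hu : Measurable u) (hg : Measurable g) (h0 : ∀ x ∉ A, u x = 0) :
    ‖∫ x, u x * g x‖ₑ ≤ lTwo univ u * lTwo A g := by
  have e : ∫ x, u x * g x = ∫ x in A, u x * g x :=
    (setIntegral_eq_integral_of_forall_compl_eq_zero fun x hx ↦ by rw [h0 x hx, zero_mul]).symm
  have h1 := enorm_integral_mul_sq_le (volume.restrict A) hu.aestronglyMeasurable
    hg.aestronglyMeasurable
  rw [← e, ← mul_pow] at h1
  refine ((ENNReal.pow_right_strictMono two_ne_zero).le_iff_le.1 h1).trans ?_
  exact mul_le_mul_left (lTwo_mono (subset_univ A) u) _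

end

section

variable {N : ℕ}

/-! ### The bilinear estimate -/

lemma lTwo_sub_le {A : Set (Space N)} {f g : Space N → ℝ} (hf : Measurable f) (hg : Measurable g) :
    lTwo A (fun x ↦ f x - g x) ≤ lTwo A f + lTwo A g :=
  eLpNorm_sub_le hf.aestronglyMeasurable hg.aestronglyMeasurable (by norm_num)

lemma memLp_fderiv_apply {φ : Space N → ℝ} (hφ : ContDiff ℝ ∞ φ) (hc : HasCompactSupport φ)
    (e : Space N) : MemLp (fun x ↦ fderiv ℝ φ x e) 2 :=
  ((hφ.continuous_fderiv (by simp)).clm_apply continuous_const).memLp_of_hasCompactSupport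
    (hc.fderiv_apply ℝ e)

lemma contDiff_fderiv_apply {φ : Space N → ℝ} (hφ : ContDiff ℝ ∞ φ) (e : Space N) :
    ContDiff ℝ ∞ (fun x ↦ fderiv ℝ φ x e) :=
  (hφ.fderiv_right (m := ∞) (by simp)).clm_apply contDiff_const

lemma measurable_fderiv_apply' {φ : Space N → ℝ} (hφ : ContDiff ℝ ∞ φ) (e : Space N) :
    Measurable (fun x ↦ fderiv ℝ φ x e) := (contDiff_fderiv_apply hφ e).continuous.measurable

namespace IsConeKernel
variable {θ : Space N → ℝ} {ν : Space N} {c : ℝ} {M : ℝ≥0}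

lemma memLp_avg (h : IsConeKernel θ ν c M) (ε : ℝ) {f : Space N → ℝ} (hf : Measurable f)
    (hf2 : MemLp f 2) : MemLp (avg θ ε f) 2 := by
  rw [memLp_two_iff_lTwo (measurable_avg h.measurable _ hf)]
  refine (h.lTwo_avg_le (A := univ) (fun _ _ _ _ ↦ mem_univ _) hf).trans_lt ?_
  exact ENNReal.mul_lt_top (ENNReal.mul_lt_top (by simp) ballVol_ne_top.lt_top)
    ((memLp_two_iff_lTwo hf).1 hf2)

lemma contDiff_avg (h : IsConeKernel θ ν c M) {ε : ℝ} (hε : ε ≠ 0) {f : Space N → ℝ}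
    (hf2 : MemLp f 2) : ContDiff ℝ ∞ (avg θ ε f) :=
  HalfTrace.contDiff_avg h.contDiff h.hasCompactSupport hε hf2

/-- The derivative of an average at the scale `2^{-k}` costs a factor `2ᵏ` and replaces the weight by
its derivative, which has mean zero. -/
lemma lTwo_fderiv_avg (h : IsConeKernel θ ν c M) (hc : 0 < c) {s : ℝ} (hs : |s| = c / 4) (k : ℕ)
    (A : Set (Space N)) {f : Space N → ℝ} (hf2 : MemLp f 2) (e : Space N) :
    lTwo A (fun x ↦ _root_.fderiv ℝ (avg θ (s * 2⁻¹ ^ k) f) x e) =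
      ENNReal.ofReal (c / 4)⁻¹ * 2 ^ k *
        lTwo A (avg (fun z ↦ _root_.fderiv ℝ θ z e) (s * 2⁻¹ ^ k) f) := by
  have hs0 : s ≠ 0 := by
    rintro rfl
    rw [abs_zero] at hs
    linarith
  simp_rw [fderiv_avg h.contDiff h.hasCompactSupport (scale_ne_zero hs0 k) hf2]
  rw [lTwo_const_mul, enorm_neg, mul_inv, enorm_mul]
  congr 2
  · rw [← enorm_norm, Real.enorm_eq_ofReal (norm_nonneg _), norm_inv, Real.norm_eq_abs, hs]
  · rw [← inv_pow, inv_inv, enorm_pow, Real.enorm_eq_ofReal (by norm_num)]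
    simp

end IsConeKernel

/-- Downward averages of a function vanishing outside `G` vanish outside `G`. -/
lemma IsUpCone.avg_down_eq_zero {G : Set (Space N)} {ν : Space N} {c : ℝ} {θ : Space N → ℝ}
    {M : ℝ≥0} (hG : IsUpCone G ν c) (h : IsConeKernel θ ν c M) {f : Space N → ℝ}
    (h0 : ∀ x ∉ G, f x = 0) {ε : ℝ} (hε : 0 < ε) {x : Space N} (hx : x ∉ G) :
    avg θ (-ε) f x = 0 := by
  refine avg_eq_zero fun z hz ↦ h0 _ fun hmem ↦ hx ?_
  have := hG.mem _ (subset_closure hmem) z (h.tsupport_subset hz) ε hε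
  simpa using this

/-- The bilinear form `∫ f ∂_e φ` is bounded by half-order norms on both sides, when the extension
of `f` by zero has half a derivative on the whole space: `f` is mollified downwards and `φ` upwards,
and the derivative is moved from one to the other in the increments between successive dyadic
scales. -/
lemma exists_enorm_integral_mul_fderiv_le {G : Set (Space N)} {ν : Space N} {c : ℝ}
    (hG : IsUpCone G ν c) (e : Space N) :
    ∃ C : ℝ≥0, ∀ f : Space N → ℝ, Measurable f → (∀ x ∉ G, f x = 0) → hsq univ f ≠ ⊤ →
      ∀ φ : Space N → ℝ, ContDiff ℝ ∞ φ → HasCompactSupport φ →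
        ‖∫ x, f x * fderiv ℝ φ x e‖ₑ ^ 2 ≤ C * (hsq univ f * hsq G φ) := by
  obtain ⟨ρ, M, hρ, hρ1⟩ := exists_isConeKernel hG.norm_eq hG.pos hG.le_one
  obtain ⟨M', hρ', hρ'0⟩ := hρ.fderiv e
  have hc := hG.pos
  set ρ' := fun z ↦ fderiv ℝ ρ z e
  let R : ℝ≥0∞ := ENNReal.ofReal (2 * (c / 4) * 3 ^ (N + 1))
  let E : ℝ≥0∞ := 2 * (M ^ 2 * ballVol N * R + M' ^ 2 * ballVol N * R)
  let D₀ : ℝ≥0∞ := ENNReal.ofReal (c / 4)⁻¹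
  let D : ℝ≥0∞ := 3 * D₀
  let C : ℝ≥0∞ := 2 * (D ^ 2 * (4 * E * (4 * E)) + (M * ballVol N * (D₀ * (M' * ballVol N))) ^ 2)
  have hbV := ballVol_ne_top (N := N)
  have hC : C ≠ ⊤ := by finiteness
  refine ⟨C.toNNReal, fun f hf h0 hfin φ hφ hφc ↦ ?_⟩
  rw [ENNReal.coe_toNNReal hC]
  have hs1 : |(-(c / 4))| = c / 4 := by rw [abs_neg, abs_of_pos (by positivity)]
  have hs2 : |c / 4| = c / 4 := abs_of_pos (by positivity)
  have hf2 : MemLp f 2 := memLp_two_of_hsq MeasurableSet.univ hf (by simp) hfin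
  have hφm : Measurable φ := hφ.continuous.measurable
  have hφ2 : MemLp φ 2 := hφ.continuous.memLp_of_hasCompactSupport hφc
  let ε : ℕ → ℝ := fun k ↦ c / 4 * 2⁻¹ ^ k
  have hε : ∀ k, 0 < ε k := fun k ↦ by positivity
  let V : ℕ → Space N → ℝ := fun k ↦ avg ρ (-(c / 4) * 2⁻¹ ^ k) f
  let Φ : ℕ → Space N → ℝ := fun k ↦ avg ρ (c / 4 * 2⁻¹ ^ k) φ
  have hVm : ∀ k, Measurable (V k) := fun k ↦ measurable_avg hρ.measurable _ hf
  have hΦm : ∀ k, Measurable (Φ k) := fun k ↦ measurable_avg hρ.measurable _ hφm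
  have hV2 : ∀ k, MemLp (V k) 2 := fun k ↦ hρ.memLp_avg _ hf hf2
  have hVs : ∀ k, ContDiff ℝ ∞ (V k) := fun k ↦
    hρ.contDiff_avg (scale_ne_zero (by linarith) k) hf2
  have hΦs : ∀ k, ContDiff ℝ ∞ (Φ k) := fun k ↦
    hρ.contDiff_avg (scale_ne_zero (by linarith) k) hφ2
  have hΦc : ∀ k, HasCompactSupport (Φ k) := fun k ↦
    hasCompactSupport_avg hρ.hasCompactSupport hφc fun x hx ↦ image_eq_zero_of_notMem_tsupport hx
  have hΦ2 : ∀ k, MemLp (Φ k) 2 := fun k ↦ (hΦs k).continuous.memLp_of_hasCompactSupport (hΦc k)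
  have hV0 : ∀ k, ∀ x ∉ G, V k x = 0 := fun k x hx ↦ by
    simp only [V, neg_mul]
    exact hG.avg_down_eq_zero hρ h0 (hε k) hx
  have hdVm : ∀ k, Measurable fun x ↦ fderiv ℝ (V k) x e := fun k ↦ measurable_fderiv_apply' (hVs k) e
  have hdΦm : ∀ k, Measurable fun x ↦ fderiv ℝ (Φ k) x e := fun k ↦ measurable_fderiv_apply' (hΦs k) e
  have hdV : ∀ k x, fderiv ℝ (V k) x e = -(-(c / 4) * 2⁻¹ ^ k)⁻¹ * avg ρ' (-(c / 4) * 2⁻¹ ^ k) f x :=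
    fun k x ↦ fderiv_avg hρ.contDiff hρ.hasCompactSupport (scale_ne_zero (by linarith) k) hf2 x e
  have hdV0 : ∀ k, ∀ x ∉ G, fderiv ℝ (V k) x e = 0 := fun k x hx ↦ by
    rw [hdV, neg_mul (c / 4), hG.avg_down_eq_zero hρ' h0 (hε k) hx, mul_zero]
  have hdV2 : ∀ k, MemLp (fun x ↦ fderiv ℝ (V k) x e) 2 := fun k ↦ by
    simp_rw [hdV]
    exact (hρ'.memLp_avg _ hf hf2).const_mul _
  -- the errors of the mollifications, and the sizes of their derivatives at the natural scale
  let a : ℕ → ℝ≥0∞ := fun k ↦ lTwo univ (fun x ↦ V k x - f x) +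
    lTwo univ (avg ρ' (-(c / 4) * 2⁻¹ ^ k) f)
  let b : ℕ → ℝ≥0∞ := fun k ↦ lTwo G (fun x ↦ Φ k x - φ x) + lTwo G (avg ρ' (c / 4 * 2⁻¹ ^ k) φ)
  have hcone : ∀ k : ℕ, ∀ x ∈ G, ∀ z ∈ Metric.ball ν c, x + (c / 4 * 2⁻¹ ^ k) • z ∈ G :=
    fun k x hx z hz ↦ hG.mem x (subset_closure hx) z hz _ (hε k)
  have ha1 : ∀ K, ∑ k ∈ Finset.range K, 2 ^ k * lTwo univ (fun x ↦ V k x - f x) ^ 2 ≤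
      M ^ 2 * ballVol N * R * gag univ f := fun K ↦ by
    have := hρ.sum_lTwo_avg_sub_le hc MeasurableSet.univ hs1 (by simp) hf hf2 K
    simpa only [hρ1, one_mul] using this
  have ha2 : ∀ K, ∑ k ∈ Finset.range K, 2 ^ k * lTwo univ (avg ρ' (-(c / 4) * 2⁻¹ ^ k) f) ^ 2 ≤
      M' ^ 2 * ballVol N * R * gag univ f := fun K ↦ by
    have := hρ'.sum_lTwo_avg_sub_le hc MeasurableSet.univ hs1 (by simp) hf hf2 K
    simpa only [hρ'0, zero_mul, sub_zero] using this
  have hb1 : ∀ K, ∑ k ∈ Finset.range K, 2 ^ k * lTwo G (fun x ↦ Φ k x - φ x) ^ 2 ≤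
      M ^ 2 * ballVol N * R * gag G φ := fun K ↦ by
    have := hρ.sum_lTwo_avg_sub_le hc hG.measurableSet hs2 hcone hφm hφ2 K
    simpa only [hρ1, one_mul] using this
  have hb2 : ∀ K, ∑ k ∈ Finset.range K, 2 ^ k * lTwo G (avg ρ' (c / 4 * 2⁻¹ ^ k) φ) ^ 2 ≤
      M' ^ 2 * ballVol N * R * gag G φ := fun K ↦ by
    have := hρ'.sum_lTwo_avg_sub_le hc hG.measurableSet hs2 hcone hφm hφ2 K
    simpa only [hρ'0, zero_mul, sub_zero] using this
  have haS : ∀ K, ∑ k ∈ Finset.range K, 2 ^ k * a k ^ 2 ≤ E * gag univ f := fun K ↦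
    (ennreal_sum_add_sq_le _ _ _ _ (ha1 K) (ha2 K)).trans_eq (by simp only [E]; ring)
  have hbS : ∀ K, ∑ k ∈ Finset.range K, 2 ^ k * b k ^ 2 ≤ E * gag G φ := fun K ↦
    (ennreal_sum_add_sq_le _ _ _ _ (hb1 K) (hb2 K)).trans_eq (by simp only [E]; ring)
  have hdVa : ∀ k, lTwo univ (fun x ↦ fderiv ℝ (V k) x e) ≤ D₀ * 2 ^ k * a k := fun k ↦ by
    rw [hρ.lTwo_fderiv_avg hc hs1 k univ hf2 e]
    exact mul_le_mul_right le_add_self _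
  have hdΦb : ∀ k, lTwo G (fun x ↦ fderiv ℝ (Φ k) x e) ≤ D₀ * 2 ^ k * b k := fun k ↦ by
    rw [hρ.lTwo_fderiv_avg hc hs2 k G hφ2 e]
    exact mul_le_mul_right le_add_self _
  have hVV : ∀ k, lTwo univ (fun x ↦ V (k + 1) x - V k x) ≤ a k + a (k + 1) := fun k ↦ by
    have h1 := lTwo_sub_le (A := univ) ((hVm (k + 1)).sub hf) ((hVm k).sub hf)
    simp only [Pi.sub_apply, sub_sub_sub_cancel_right] at h1
    refine h1.trans ?_
    rw [add_comm (a k)]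
    exact add_le_add le_self_add le_self_add
  have hΦΦ : ∀ k, lTwo G (fun x ↦ Φ (k + 1) x - Φ k x) ≤ b k + b (k + 1) := fun k ↦ by
    have h1 := lTwo_sub_le (A := G) ((hΦm (k + 1)).sub hφm) ((hΦm k).sub hφm)
    simp only [Pi.sub_apply, sub_sub_sub_cancel_right] at h1
    refine h1.trans ?_
    rw [add_comm (b k)]
    exact add_le_add le_self_add le_self_add
  let I : ℕ → ℝ := fun k ↦ ∫ x, V k x * fderiv ℝ (Φ k) x e
  have hint : ∀ j k, Integrable fun x ↦ V j x * fderiv ℝ (Φ k) x e := fun j k ↦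
    (hV2 j).integrable_mul (memLp_fderiv_apply (hΦs k) (hΦc k) e)
  have hint' : ∀ j k, Integrable fun x ↦ fderiv ℝ (V j) x e * Φ k x := fun j k ↦
    (hdV2 j).integrable_mul (hΦ2 k)
  have hparts : ∀ j k, ∫ x, V j x * fderiv ℝ (Φ k) x e = -∫ x, fderiv ℝ (V j) x e * Φ k x :=
    fun j k ↦ integral_mul_fderiv_eq_neg_fderiv_mul_of_integrable (hint' j k) (hint j k)
      ((hV2 j).integrable_mul (hΦ2 k)) (fun x _ ↦ (hVs j).differentiable (by simp) x)
      (fun x _ ↦ (hΦs k).differentiable (by simp) x)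
  -- the part of the increment in which `V` does not change is integrated by parts, so that the
  -- derivative never falls on a difference of averages
  have hstep : ∀ k, I (k + 1) - I k = (∫ x, (V (k + 1) x - V k x) * fderiv ℝ (Φ (k + 1)) x e) -
      ∫ x, fderiv ℝ (V k) x e * (Φ (k + 1) x - Φ k x) := fun k ↦ by
    simp only [sub_mul, mul_sub]
    rw [integral_sub (hint _ _) (hint _ _), integral_sub (hint' _ _) (hint' _ _), hparts k (k + 1)]
    simp only [I]
    rw [hparts k k]
    ring
  -- the functions `V k` vanish outside `G`, hence only norms of `φ` over `G` occur
  have hIb : ∀ k, ‖I (k + 1) - I k‖ₑ ≤ D * (2 ^ k * ((a k + a (k + 1)) * (b k + b (k + 1)))) := by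
    intro k
    rw [hstep]
    refine (enorm_sub_le).trans ?_
    have h1 := enorm_integral_mul_le_of_zero (A := G) ((hVm (k + 1)).sub (hVm k)) (hdΦm (k + 1))
      fun x hx ↦ by simp [hV0 _ x hx]
    have h2 := enorm_integral_mul_le_of_zero (A := G) (hdVm k) ((hΦm (k + 1)).sub (hΦm k)) (hdV0 k)
    calc _ ≤ (a k + a (k + 1)) * (D₀ * 2 ^ (k + 1) * b (k + 1)) +
          D₀ * 2 ^ k * a k * (b k + b (k + 1)) :=
        add_le_add (h1.trans (mul_le_mul' (hVV k) (hdΦb (k + 1))))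
          (h2.trans (mul_le_mul' (hdVa k) (hΦΦ k)))
      _ ≤ (a k + a (k + 1)) * (D₀ * 2 ^ (k + 1) * (b k + b (k + 1))) +
          D₀ * 2 ^ k * (a k + a (k + 1)) * (b k + b (k + 1)) := by
        gcongr
        · exact le_add_self
        · exact le_self_add
      _ = _ := by
        simp only [D]
        ring
  have hVlim : Filter.Tendsto (fun k ↦ lTwo univ fun x ↦ V k x - f x) Filter.atTop (nhds 0) :=
    tendsto_zero_of_sum_two_pow (ENNReal.mul_ne_top (by finiteness)
      ((gag_le_hsq univ f).trans_lt hfin.lt_top).ne) ha1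
  have hdφ := contDiff_fderiv_apply hφ e
  have hdφc : HasCompactSupport fun x ↦ fderiv ℝ φ x e := hφc.fderiv_apply ℝ e
  have hdφ2 := memLp_fderiv_apply hφ hφc e
  have hdΦ : ∀ k x, fderiv ℝ (Φ k) x e = avg ρ (c / 4 * 2⁻¹ ^ k) (fun y ↦ fderiv ℝ φ y e) x :=
    fun k x ↦ fderiv_avg_of_smooth hρ.contDiff hρ.hasCompactSupport
      (scale_ne_zero (by linarith) k) hφ hφc x e
  have hΦlim : Filter.Tendsto (fun k ↦ lTwo univ fun x ↦ fderiv ℝ (Φ k) x e - fderiv ℝ φ x e)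
      Filter.atTop (nhds 0) := by
    refine tendsto_zero_of_sum_two_pow (A := M ^ 2 * ballVol N * R *
      gag univ fun x ↦ fderiv ℝ φ x e) (ENNReal.mul_ne_top (by finiteness)
      ((gag_le_hsq univ _).trans_lt (hsq_univ_lt_top_of_smooth hdφ hdφc)).ne) fun K ↦ ?_
    have := hρ.sum_lTwo_avg_sub_le hc MeasurableSet.univ hs2 (by simp) hdφ.continuous.measurable
      hdφ2 K
    simpa only [hρ1, one_mul, hdΦ] using this
  -- for fixed `φ` the forms converge, since `∂_e Φ k` is an average of the smooth function `∂_e φ`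
  have hlim : Filter.Tendsto I Filter.atTop (nhds (∫ x, f x * fderiv ℝ φ x e)) := by
    rw [tendsto_iff_edist_tendsto_0]
    have hup : Filter.Tendsto (fun k ↦ lTwo univ (fun x ↦ V k x - f x) *
        (M * ballVol N * lTwo univ fun x ↦ fderiv ℝ φ x e) +
        lTwo univ f * lTwo univ fun x ↦ fderiv ℝ (Φ k) x e - fderiv ℝ φ x e)
        Filter.atTop (nhds 0) := by
      have h1 := ENNReal.Tendsto.mul_const (b := M * ballVol N * lTwo univ fun x ↦ fderiv ℝ φ x e)
        hVlim (Or.inr (ENNReal.mul_ne_top (by finiteness)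
          (lTwo_univ_lt_top_of_smooth hdφ hdφc).ne))
      have h2 := ENNReal.Tendsto.const_mul (a := lTwo univ f)
        hΦlim (Or.inr (lTwo_lt_top_of_hsq hfin).ne)
      simpa using h1.add h2
    refine tendsto_of_tendsto_of_tendsto_of_le_of_le tendsto_const_nhds hup (fun _ ↦ zero_le)
      fun k ↦ ?_
    have hi1 : Integrable fun x ↦ f x * fderiv ℝ (Φ k) x e :=
      hf2.integrable_mul (memLp_fderiv_apply (hΦs k) (hΦc k) e)
    have hi2 : Integrable fun x ↦ f x * fderiv ℝ φ x e := hf2.integrable_mul hdφ2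
    have e1 : I k - ∫ x, f x * fderiv ℝ φ x e = (∫ x, (V k x - f x) * fderiv ℝ (Φ k) x e) +
        ∫ x, f x * (fderiv ℝ (Φ k) x e - fderiv ℝ φ x e) := by
      simp only [sub_mul, mul_sub]
      rw [integral_sub (hint _ _) hi1, integral_sub hi1 hi2]
      simp only [I]
      ring
    rw [edist_eq_enorm_sub, e1]
    refine (enorm_add_le _ _).trans (add_le_add ?_ ?_)
    · refine (enorm_integral_mul_le_of_zero (A := univ) ((hVm k).sub hf) (hdΦm k)
        (by simp)).trans (mul_le_mul_right ?_ _)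
      simp_rw [hdΦ]
      exact hρ.lTwo_avg_le (fun _ _ _ _ ↦ mem_univ _) hdφ.continuous.measurable
    · exact enorm_integral_mul_le_of_zero (A := univ) hf ((hdΦm k).sub hdφ.continuous.measurable)
        (by simp)
  have htel := enorm_sub_sq_le_of_telescoping hlim hIb haS hbS
  -- at the scale `k = 0` the derivative of the average costs a constant only
  have hI0 : ‖I 0‖ₑ ^ 2 ≤ (M * ballVol N * (D₀ * (M' * ballVol N))) ^ 2 *
      (hsq univ f * hsq G φ) := by
    have h1 := enorm_integral_mul_le_of_zero (A := G) (hVm 0) (hdΦm 0) (hV0 0)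
    have h2 : lTwo univ (V 0) ≤ M * ballVol N * lTwo univ f :=
      hρ.lTwo_avg_le (fun _ _ _ _ ↦ mem_univ _) hf
    have h3 : lTwo G (fun x ↦ fderiv ℝ (Φ 0) x e) ≤ D₀ * (M' * ballVol N * lTwo G φ) := by
      rw [hρ.lTwo_fderiv_avg hc hs2 0 G hφ2 e, pow_zero, mul_one]
      exact mul_le_mul_right (hρ'.lTwo_avg_le (hcone 0) hφm) _
    calc ‖I 0‖ₑ ^ 2 ≤ (M * ballVol N * lTwo univ f * (D₀ * (M' * ballVol N * lTwo G φ))) ^ 2 :=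
          pow_le_pow_left' (h1.trans (mul_le_mul' h2 h3)) 2
      _ = (M * ballVol N * (D₀ * (M' * ballVol N))) ^ 2 * (lTwo univ f ^ 2 * lTwo G φ ^ 2) := by
          ring
      _ ≤ _ := by
          gcongr
          · exact lTwo_sq_le_hsq univ f
          · exact lTwo_sq_le_hsq G φ
  set L := ∫ x, f x * fderiv ℝ φ x e
  calc ‖L‖ₑ ^ 2 = ‖(L - I 0) + I 0‖ₑ ^ 2 := by rw [sub_add_cancel]
    _ ≤ 2 * (‖L - I 0‖ₑ ^ 2 + ‖I 0‖ₑ ^ 2) :=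
        (pow_le_pow_left' (enorm_add_le _ _) 2).trans (ennreal_add_sq_le _ _)
    _ ≤ 2 * (D ^ 2 * (4 * (E * hsq univ f) * (4 * (E * hsq G φ))) +
          (M * ballVol N * (D₀ * (M' * ballVol N))) ^ 2 * (hsq univ f * hsq G φ)) := by
        gcongr
        refine htel.trans ?_
        gcongr
        · exact gag_le_hsq univ f
        · exact gag_le_hsq G φ
    _ = _ := by simp only [C]; ring

end

section

variable {N : ℕ}

/-! ### The Hardy inequality for functions with vanishing trace -/

/-- The norm of a finite difference is at most the step times the norm of the derivative. -/
lemma lTwo_sub_comp_sub_le {w : Space N → ℝ} (hw : ContDiff ℝ ∞ w) (t : ℝ) (ν : Space N) :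
    lTwo univ (fun x ↦ w x - w (x - t • ν)) ^ 2 ≤
      ENNReal.ofReal (t ^ 2) * lTwo univ (fun x ↦ fderiv ℝ w x ν) ^ 2 := by
  have hg : Continuous fun x ↦ fderiv ℝ w x ν := (contDiff_fderiv_apply hw ν).continuous
  have hcur : ∀ x : Space N, Continuous fun s : ℝ ↦ fderiv ℝ w (x - (s * t) • ν) ν := fun x ↦
    hg.comp (by fun_prop)
  have hpt : ∀ x, ‖w x - w (x - t • ν)‖ₑ ^ 2 ≤
      ∫⁻ s in Ioc (0 : ℝ) 1, ENNReal.ofReal (t ^ 2) * ‖fderiv ℝ w (x - (s * t) • ν) ν‖ₑ ^ 2 := by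
    intro x
    have hd : ∀ s ∈ uIcc (0 : ℝ) 1, HasDerivAt (fun s : ℝ ↦ w (x - (s * t) • ν))
        (-(t * fderiv ℝ w (x - (s * t) • ν) ν)) s := by
      intro s _
      have h1 : HasDerivAt (fun s : ℝ ↦ x - (s * t) • ν) (-(t • ν)) s := by
        have := ((hasDerivAt_id s).mul_const t).smul_const ν
        simpa using this.const_sub x
      have h2 : HasDerivAt (fun s : ℝ ↦ w (x - (s * t) • ν))
          (fderiv ℝ w (x - (s * t) • ν) (-(t • ν))) s :=
        (hw.differentiable (by simp) (x - (s * t) • ν)).hasFDerivAt.comp_hasDerivAt s h1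
      rwa [map_neg, map_smul, smul_eq_mul] at h2
    have h3 := intervalIntegral.integral_eq_sub_of_hasDerivAt hd
      ((((hcur x).const_smul t).neg).intervalIntegrable 0 1)
    simp only [one_mul, zero_mul, zero_smul, sub_zero] at h3
    have h4 : w x - w (x - t • ν) = ∫ s in Ioc (0 : ℝ) 1, t * fderiv ℝ w (x - (s * t) • ν) ν := by
      rw [intervalIntegral.integral_neg, intervalIntegral.integral_of_le zero_le_one] at h3
      linarith
    rw [h4]
    refine (enorm_integral_mul_sq_le (volume.restrict (Ioc (0 : ℝ) 1)) (f := fun _ ↦ t)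
      (g := fun s ↦ fderiv ℝ w (x - (s * t) • ν) ν) aestronglyMeasurable_const
      (hcur x).aestronglyMeasurable).trans_eq ?_
    rw [eLpNorm_two_sq, eLpNorm_two_sq, setLIntegral_const, lintegral_const_mul _
      (by have := (hcur x).measurable; fun_prop), Real.volume_Ioc, ← enorm_pow,
      Real.enorm_eq_ofReal (sq_nonneg t)]
    simp
  have hgm := hg.measurable
  rw [lTwo_sq, lTwo_sq, Measure.restrict_univ]
  calc _ ≤ ∫⁻ x, ∫⁻ s in Ioc (0 : ℝ) 1,
        ENNReal.ofReal (t ^ 2) * ‖fderiv ℝ w (x - (s * t) • ν) ν‖ₑ ^ 2 := lintegral_mono hpt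
    _ = ∫⁻ s in Ioc (0 : ℝ) 1, ∫⁻ x,
        ENNReal.ofReal (t ^ 2) * ‖fderiv ℝ w (x - (s * t) • ν) ν‖ₑ ^ 2 := by
        rw [lintegral_lintegral_swap]
        refine Measurable.aemeasurable ?_
        have : Measurable fun p : Space N × ℝ ↦ fderiv ℝ w (p.1 - (p.2 * t) • ν) ν :=
          hgm.comp (by fun_prop)
        simp only [Function.uncurry_def]
        fun_prop
    _ = ∫⁻ s in Ioc (0 : ℝ) 1, ENNReal.ofReal (t ^ 2) * ∫⁻ x, ‖fderiv ℝ w x ν‖ₑ ^ 2 := by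
        refine lintegral_congr fun s ↦ ?_
        rw [lintegral_const_mul _ (by
          have : Measurable fun x ↦ fderiv ℝ w (x - (s * t) • ν) ν := hgm.comp (by fun_prop)
          fun_prop), lintegral_sub_right_eq_self (fun x ↦ ‖fderiv ℝ w x ν‖ₑ ^ 2)]
    _ = _ := by simp

namespace IsUpCone
variable {G : Set (Space N)} {ν : Space N} {c : ℝ}

/-- The upward average at the scale `ε` vanishes at depth `2 ε` below `G`. -/
lemma avg_up_eq_zero (hG : IsUpCone G ν c) {θ : Space N → ℝ} {M : ℝ≥0} (h : IsConeKernel θ ν c M)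
    {f : Space N → ℝ} (h0 : ∀ x ∉ G, f x = 0) {ε t : ℝ} (hε : 0 < ε) (ht : 2 * ε ≤ t)
    {x : Space N} (hx : x + t • ν ∉ G) : avg θ ε f x = 0 := by
  refine avg_eq_zero fun z hz ↦ h0 _ fun hmem ↦ hx ?_
  have hz' := h.tsupport_subset hz
  rw [Metric.mem_ball, dist_eq_norm] at hz'
  have := hG.add_mem (subset_closure hmem) (t := t - ε) (by linarith) (w := t • ν - ε • z) (by
    have e : t • ν - ε • z - (t - ε) • ν = -(ε • (z - ν)) := by
      rw [sub_smul, smul_sub]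
      abel
    rw [e, norm_neg, norm_smul, Real.norm_of_nonneg hε.le]
    nlinarith [hG.pos])
  convert this using 1
  abel

/-- If the distributional derivative of `f` in the vertical direction is bounded on half-order
spaces over the whole space, then `f` is small near the boundary. The bound is tested with the
second mollification of `∂_ν f`, weighted so that the test function reproduces the sum of the
squared norms of the first mollifications. -/
lemma sum_strip_le (hN : N ≠ 0) (hG : IsUpCone G ν c) : ∃ C : ℝ≥0, ∀ f : Space N → ℝ, Measurable f →
    (∀ x ∉ G, f x = 0) → MemLp f 2 → (∃ S : Set (Space N), IsCompact S ∧ ∀ x ∉ S, f x = 0) →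
    ∀ M₀ : ℝ≥0, (∀ φ : Space N → ℝ, ContDiff ℝ ∞ φ → HasCompactSupport φ →
      ‖∫ x, f x * fderiv ℝ φ x ν‖ₑ ^ 2 ≤ M₀ * hsq univ φ) →
    ∀ K, ∑ k ∈ Finset.range K, 2 ^ k * lTwo (strip G ν (2⁻¹ ^ k)) f ^ 2 ≤
      C * (M₀ + gag G f) := by
  obtain ⟨ρ, M, hρ, hρ1⟩ := exists_isConeKernel hG.norm_eq hG.pos hG.le_one
  obtain ⟨M', hρ', hρ'0⟩ := hρ.fderiv ν
  have hc := hG.pos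
  set ρ' := fun z ↦ fderiv ℝ ρ z ν
  let R : ℝ≥0∞ := M ^ 2 * ballVol N * ENNReal.ofReal (2 * (c / 4) * 3 ^ (N + 1))
  let D : ℝ≥0∞ := 2 * M * ballVol N * ENNReal.ofReal (c / 4)⁻¹
  let C₁ : ℝ≥0∞ := 2 * (M * ballVol N) ^ 2 + D ^ 2 * (10 * kernConst N)
  let C : ℝ≥0∞ := 2 * (4 * C₁ + R)
  have hC : C ≠ ⊤ := by
    have := kernConst_ne_top hN
    have := ballVol_ne_top (N := N)
    finiteness
  refine ⟨C.toNNReal, fun f hf h0 hf2 hS M₀ hM₀ K ↦ ?_⟩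
  obtain ⟨S, hS, hfS⟩ := hS
  rw [ENNReal.coe_toNNReal hC]
  have hs2 : |c / 4| = c / 4 := abs_of_pos (by positivity)
  have hs1 : |(-(c / 4))| = c / 4 := by rw [abs_neg, hs2]
  have hε : ∀ k : ℕ, 0 < c / 4 * 2⁻¹ ^ k := fun k ↦ by positivity
  -- `g k` is the vertical derivative of the average `w k` of `f`; `ψ k` averages it a second time, with
  -- the transposed operator
  let w : ℕ → Space N → ℝ := fun k ↦ avg ρ (c / 4 * 2⁻¹ ^ k) f
  let g : ℕ → Space N → ℝ := fun k x ↦ fderiv ℝ (w k) x ν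
  have hws : ∀ k, ContDiff ℝ ∞ (w k) := fun k ↦ hρ.contDiff_avg (hε k).ne' hf2
  have hwc : ∀ k, HasCompactSupport (w k) := fun k ↦
    hasCompactSupport_avg hρ.hasCompactSupport hS hfS
  have hw2 : ∀ k, MemLp (w k) 2 := fun k ↦ (hws k).continuous.memLp_of_hasCompactSupport (hwc k)
  have hgs : ∀ k, ContDiff ℝ ∞ (g k) := fun k ↦ contDiff_fderiv_apply (hws k) ν
  have hgc : ∀ k, HasCompactSupport (g k) := fun k ↦ (hwc k).fderiv_apply ℝ ν
  have hg2 : ∀ k, MemLp (g k) 2 := fun k ↦ (hgs k).continuous.memLp_of_hasCompactSupport (hgc k)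
  have hgm : ∀ k, Measurable (g k) := fun k ↦ (hgs k).continuous.measurable
  let n : ℕ → ℝ≥0∞ := fun k ↦ lTwo univ (g k)
  have hn : ∀ k, n k ≠ ⊤ := fun k ↦ ((memLp_two_iff_lTwo (hgm k)).1 (hg2 k)).ne
  let ψ : ℕ → Space N → ℝ := fun k ↦ avg ρ (-(c / 4) * 2⁻¹ ^ k) (g k)
  have hψs : ∀ k, ContDiff ℝ ∞ (ψ k) := fun k ↦
    hρ.contDiff_avg (scale_ne_zero (by linarith) k) (hg2 k)
  have hψc : ∀ k, HasCompactSupport (ψ k) := fun k ↦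
    hasCompactSupport_avg hρ.hasCompactSupport (hgc k) fun x hx ↦ image_eq_zero_of_notMem_tsupport hx
  have hψm : ∀ k, Measurable (ψ k) := fun k ↦ (hψs k).continuous.measurable
  let φ : Space N → ℝ := fun x ↦ ∑ k ∈ Finset.range K, (2⁻¹ : ℝ) ^ k * ψ k x
  have hφs : ContDiff ℝ ∞ φ := ContDiff.sum fun k _ ↦ contDiff_const.mul (hψs k)
  have hφc : HasCompactSupport φ := by
    have h1 : IsCompact (⋃ k ∈ Finset.range K, tsupport (ψ k)) :=
      (Finset.range K).isCompact_biUnion fun k _ ↦ hψc k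
    refine HasCompactSupport.intro h1 fun x hx ↦ ?_
    simp only [mem_iUnion, not_exists] at hx
    exact Finset.sum_eq_zero fun k hk ↦ by
      rw [image_eq_zero_of_notMem_tsupport (hx k hk), mul_zero]
  let X : ℝ := ∑ k ∈ Finset.range K, (2⁻¹ : ℝ) ^ k * ∫ x, g k x * g k x
  -- the average in `ψ k` is moved to `f`, which turns `∂_ν ψ k` tested by `f` into `-‖g k‖²`
  have hX : ∫ x, f x * fderiv ℝ φ x ν = -X := by
    have hd : ∀ k, Differentiable ℝ (ψ k) := fun k ↦ (hψs k).differentiable (by simp)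
    have e1 : ∀ x, fderiv ℝ φ x ν = ∑ k ∈ Finset.range K, (2⁻¹ : ℝ) ^ k * fderiv ℝ (ψ k) x ν := by
      intro x
      simp only [φ]
      rw [fderiv_fun_sum fun k _ ↦ ((hd k) x).const_mul _]
      simp only [sum_apply]
      refine Finset.sum_congr rfl fun k _ ↦ ?_
      rw [fderiv_const_mul ((hd k) x)]
      simp
    have e2 : ∀ k, ∫ x, f x * fderiv ℝ (ψ k) x ν = -∫ x, g k x * g k x := by
      intro k
      have e3 : ∀ x, fderiv ℝ (ψ k) x ν =
          avg ρ (-(c / 4 * 2⁻¹ ^ k)) (fun y ↦ fderiv ℝ (g k) y ν) x := fun x ↦ by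
        rw [← neg_mul]
        exact fderiv_avg_of_smooth hρ.contDiff hρ.hasCompactSupport
          (scale_ne_zero (by linarith) k) (hgs k) (hgc k) x ν
      simp_rw [e3]
      rw [← integral_avg_mul hρ.contDiff hρ.hasCompactSupport _ hf
        (measurable_fderiv_apply' (hgs k) ν) hf2 (memLp_fderiv_apply (hgs k) (hgc k) ν)]
      exact integral_mul_fderiv_eq_neg_fderiv_mul_of_integrable
        ((hg2 k).integrable_mul (hg2 k))
        ((hw2 k).integrable_mul (memLp_fderiv_apply (hgs k) (hgc k) ν))
        ((hw2 k).integrable_mul (hg2 k))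
        (fun x _ ↦ (hws k).differentiable (by simp) x)
        (fun x _ ↦ (hgs k).differentiable (by simp) x)
    have hi : ∀ k, Integrable fun x ↦ f x * fderiv ℝ (ψ k) x ν := fun k ↦
      hf2.integrable_mul (memLp_fderiv_apply (hψs k) (hψc k) ν)
    simp_rw [e1, Finset.mul_sum, mul_left_comm (f _)]
    rw [integral_finsetSum _ fun k _ ↦ (hi k).const_mul _]
    simp only [integral_const_mul, e2, X, mul_neg, Finset.sum_neg_distrib]
  let Y : ℝ≥0∞ := ∑ k ∈ Finset.range K, 2⁻¹ ^ k * n k ^ 2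
  have hYt : Y ≠ ⊤ := by
    refine ENNReal.sum_ne_top.2 fun k _ ↦ ENNReal.mul_ne_top (by finiteness) ?_
    exact ENNReal.pow_ne_top (hn k)
  have hXY : ‖X‖ₑ = Y := by
    have e1 : ∀ k, ENNReal.ofReal (∫ x, g k x * g k x) = n k ^ 2 := by
      intro k
      have hi : Integrable fun x ↦ g k x * g k x := (hg2 k).integrable_mul (hg2 k)
      rw [ofReal_integral_eq_lintegral_ofReal hi
        (Filter.Eventually.of_forall fun x ↦ mul_self_nonneg _), lTwo_sq, Measure.restrict_univ]
      refine lintegral_congr fun x ↦ ?_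
      rw [← enorm_pow, Real.enorm_eq_ofReal (sq_nonneg _), sq]
    have hp : ∀ k, 0 ≤ (2⁻¹ : ℝ) ^ k * ∫ x, g k x * g k x := fun k ↦
      mul_nonneg (by positivity) (integral_nonneg fun x ↦ mul_self_nonneg _)
    rw [Real.enorm_eq_ofReal (Finset.sum_nonneg fun k _ ↦ hp k),
      ENNReal.ofReal_sum_of_nonneg fun k _ ↦ hp k]
    refine Finset.sum_congr rfl fun k _ ↦ ?_
    rw [ENNReal.ofReal_mul (by positivity), e1, ENNReal.ofReal_pow (by norm_num),
      ENNReal.ofReal_inv_of_pos (by norm_num)]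
    simp
  have h2k : ∀ k : ℕ, ‖((2⁻¹ : ℝ) ^ k)‖ₑ = 2⁻¹ ^ k := fun k ↦ by
    rw [enorm_pow, Real.enorm_eq_ofReal (by norm_num), ENNReal.ofReal_inv_of_pos (by norm_num)]
    simp
  -- both parts of the half-order norm of the test function are at most a constant times `√Y`, where
  -- `Y = |∫ f ∂_ν φ|`
  have hφl : lTwo univ φ ^ 2 ≤ 2 * (M * ballVol N) ^ 2 * Y := by
    have h1 : lTwo univ φ ≤ ∑ k ∈ Finset.range K, 2⁻¹ ^ k * (M * ballVol N * n k) := by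
      refine (lTwo_sum_le _ fun k _ ↦ (hψm k).const_mul _).trans (Finset.sum_le_sum fun k _ ↦ ?_)
      rw [lTwo_const_mul, h2k]
      exact mul_le_mul_right (hρ.lTwo_avg_le (fun _ _ _ _ ↦ mem_univ _) (hgm k)) _
    refine (pow_le_pow_left' h1 2).trans ((ennreal_sum_weight_sq_le _ _ _).trans ?_)
    have h2 : ∑ k ∈ Finset.range K, (2⁻¹ : ℝ≥0∞) ^ k ≤ 2 := by
      refine (ENNReal.sum_le_tsum _).trans_eq ?_
      rw [ENNReal.tsum_geometric]
      simp
    refine (mul_le_mul_left h2 _).trans_eq ?_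
    simp only [Y, Finset.mul_sum]
    exact Finset.sum_congr rfl fun k _ ↦ by ring
  have hφg : gag univ φ ≤ D ^ 2 * (10 * kernConst N) * Y := by
    have h1 : ∀ v, incr univ φ v ≤
        D * ∑ k ∈ Finset.range K, min 1 (2 ^ k * ‖v‖ₑ) * (2⁻¹ ^ k * n k) := by
      intro v
      refine (incr_sum_le _ (fun k _ ↦ (hψm k).const_mul _) v).trans ?_
      rw [Finset.mul_sum]
      refine Finset.sum_le_sum fun k _ ↦ ?_
      rw [incr_const_mul, h2k]
      calc _ ≤ 2⁻¹ ^ k * (2 * M * ballVol N * (ENNReal.ofReal (c / 4)⁻¹ *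
            min 1 (2 ^ k * ‖v‖ₑ)) * n k) := by
            refine mul_le_mul_right ((hρ.incr_avg_le_lTwo (scale_ne_zero (by linarith) k) (hgm k)
              (hg2 k) v).trans ?_) _
            exact mul_le_mul_left (mul_le_mul_right (min_one_scale_le hc hG.le_one hs1 k v) _) _
        _ = _ := by simp only [D]; ring
    have hk := measurable_kern (N := N)
    calc gag univ φ ≤ ∫⁻ v, D ^ 2 * (kern v *
          (∑ k ∈ Finset.range K, min 1 (2 ^ k * ‖v‖ₑ) * (2⁻¹ ^ k * n k)) ^ 2) := by
          refine lintegral_mono fun v ↦ ?_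
          refine (mul_le_mul_right (pow_le_pow_left' (h1 v) 2) _).trans_eq ?_
          ring
      _ ≤ D ^ 2 * (10 * kernConst N * ∑ k ∈ Finset.range K, 2 ^ k * (2⁻¹ ^ k * n k) ^ 2) := by
          rw [lintegral_const_mul _ (by fun_prop)]
          gcongr
          exact lintegral_kern_sum_sq_le K _
      _ = D ^ 2 * (10 * kernConst N * Y) := by
          congr 2
          refine Finset.sum_congr rfl fun k _ ↦ ?_
          have : (2 : ℝ≥0∞) ^ k * 2⁻¹ ^ k = 1 := by
            rw [← mul_pow, ENNReal.mul_inv_cancel (by norm_num) (by norm_num), one_pow]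
          calc (2 : ℝ≥0∞) ^ k * (2⁻¹ ^ k * n k) ^ 2 = (2 ^ k * 2⁻¹ ^ k) * (2⁻¹ ^ k * n k ^ 2) := by
                ring
            _ = _ := by rw [this, one_mul]
      _ = _ := by ring
  -- the hypothesis reads `Y² ≤ M₀ ‖φ‖² ≤ C₁ M₀ Y`; division by `Y` is possible because `Y` is finite
  have hY : Y ≤ C₁ * M₀ := by
    have h1 := hM₀ φ hφs hφc
    rw [hX, enorm_neg, hXY] at h1
    have h2 : Y * Y ≤ C₁ * M₀ * Y := by
      rw [← sq]
      refine h1.trans ((mul_le_mul_right (add_le_add hφl hφg) _).trans_eq ?_)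
      simp only [C₁]
      ring
    rcases eq_or_ne Y 0 with hY0 | hY0
    · rw [hY0]
      exact zero_le
    · exact (ENNReal.mul_le_mul_iff_left hY0 hYt).1 h2
  -- below the layer the mollified function vanishes
  have hstrip : ∀ k : ℕ, lTwo (strip G ν (2⁻¹ ^ k)) (w k) ^ 2 ≤
      4 * (2⁻¹ ^ k) ^ 2 * n k ^ 2 := by
    intro k
    have hz : ∀ x ∈ strip G ν (2⁻¹ ^ k), w k x = w k x - w k (x - (2 * 2⁻¹ ^ k : ℝ) • ν) := by
      intro x hx
      have : w k (x - (2 * 2⁻¹ ^ k : ℝ) • ν) = 0 := by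
        refine hG.avg_up_eq_zero hρ h0 (hε k) (t := 2⁻¹ ^ k) ?_ ?_
        · have : (0 : ℝ) < 2⁻¹ ^ k := by positivity
          nlinarith [hG.le_one]
        · have e : x - (2 * 2⁻¹ ^ k : ℝ) • ν + (2⁻¹ ^ k : ℝ) • ν = x - (2⁻¹ ^ k : ℝ) • ν := by
            rw [two_mul, add_smul]
            abel
          rw [e]
          exact hx.2
      rw [this, sub_zero]
    rw [lTwo_congr (hG.measurableSet_strip _) hz]
    refine (pow_le_pow_left' (lTwo_mono (subset_univ _) _) 2).trans
      ((lTwo_sub_comp_sub_le (hws k) _ ν).trans_eq ?_)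
    congr 1
    rw [mul_pow, ENNReal.ofReal_mul (by norm_num), ENNReal.ofReal_pow (by positivity),
      ENNReal.ofReal_pow (by norm_num), ENNReal.ofReal_pow (by norm_num),
      ENNReal.ofReal_inv_of_pos (by norm_num)]
    norm_num
  have hcone : ∀ k : ℕ, ∀ x ∈ G, ∀ z ∈ Metric.ball ν c, x + (c / 4 * 2⁻¹ ^ k) • z ∈ G :=
    fun k x hx z hz ↦ hG.mem x (subset_closure hx) z hz _ (hε k)
  -- in the layer, `f` is the sum of its average and of the error of the average
  have hdiff : ∑ k ∈ Finset.range K, 2 ^ k * lTwo G (fun x ↦ w k x - f x) ^ 2 ≤ R * gag G f := by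
    have := hρ.sum_lTwo_avg_sub_le hc hG.measurableSet hs2 hcone hf hf2 K
    simpa only [hρ1, one_mul] using this
  have hw : ∑ k ∈ Finset.range K, 2 ^ k * lTwo (strip G ν (2⁻¹ ^ k)) (w k) ^ 2 ≤ 4 * Y := by
    rw [Finset.mul_sum]
    refine Finset.sum_le_sum fun k _ ↦ (mul_le_mul_right (hstrip k) _).trans_eq ?_
    have : (2 : ℝ≥0∞) ^ k * 2⁻¹ ^ k = 1 := by
      rw [← mul_pow, ENNReal.mul_inv_cancel (by norm_num) (by norm_num), one_pow]
    calc (2 : ℝ≥0∞) ^ k * (4 * (2⁻¹ ^ k) ^ 2 * n k ^ 2)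
        = (2 ^ k * 2⁻¹ ^ k) * (4 * (2⁻¹ ^ k * n k ^ 2)) := by ring
      _ = _ := by rw [this, one_mul]
  have hwm : ∀ k, Measurable (w k) := fun k ↦ (hws k).continuous.measurable
  calc ∑ k ∈ Finset.range K, 2 ^ k * lTwo (strip G ν (2⁻¹ ^ k)) f ^ 2
      ≤ ∑ k ∈ Finset.range K, 2 ^ k * (lTwo (strip G ν (2⁻¹ ^ k)) (w k) +
          lTwo G (fun x ↦ w k x - f x)) ^ 2 := by
        refine Finset.sum_le_sum fun k _ ↦ mul_le_mul_right (pow_le_pow_left' ?_ 2) _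
        have h1 := lTwo_sub_le (A := strip G ν (2⁻¹ ^ k)) (hwm k) ((hwm k).sub hf)
        simp only [Pi.sub_apply, sub_sub_cancel] at h1
        exact h1.trans (add_le_add le_rfl (lTwo_mono (fun x hx ↦ hx.1) _))
    _ ≤ 2 * (4 * Y + R * gag G f) := ennreal_sum_add_sq_le _ _ _ _ hw hdiff
    _ ≤ 2 * (4 * (C₁ * M₀) + R * gag G f) := by gcongr
    _ = 2 * (4 * C₁) * M₀ + 2 * R * gag G f := by ring
    _ ≤ C * M₀ + C * gag G f := by
        simp only [C]
        gcongr
        · exact le_self_add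
        · exact le_add_self
    _ = _ := by ring

/-- Passage from the layers to the distance to the boundary. -/
lemma lintegral_inv_dist_lt_top (hG : IsUpCone G ν c) {f : Space N → ℝ} (hf : Measurable f)
    (hfin : lTwo G f ≠ ⊤) {A : ℝ≥0∞} (hA : A ≠ ⊤)
    (h : ∀ K, ∑ k ∈ Finset.range K, 2 ^ k * lTwo (strip G ν (2⁻¹ ^ k)) f ^ 2 ≤ A)
    {d : Space N → ℝ} {κ : ℝ} (hκ : 0 < κ)
    (hd : ∀ x ∈ G, f x ≠ 0 → ∀ k : ℕ, x ∉ strip G ν (2⁻¹ ^ k) → κ * 2⁻¹ ^ k ≤ d x) :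
    ∫⁻ x in G, ENNReal.ofReal (d x)⁻¹ * ‖f x‖ₑ ^ 2 < ⊤ := by
  let s : ℕ → Space N → ℝ≥0∞ := fun k ↦ (strip G ν (2⁻¹ ^ k)).indicator fun x ↦ ‖f x‖ₑ ^ 2
  have hsm : ∀ k, Measurable (s k) := fun k ↦
    Measurable.indicator (by fun_prop) (hG.measurableSet_strip _)
  -- a point that leaves the layers at the index `K` has distance at least `κ 2^{-K}`, and belongs to the
  -- layer of index `K - 1`; a point of all layers makes the series infinite
  have hpt : ∀ x ∈ G, ENNReal.ofReal (d x)⁻¹ * ‖f x‖ₑ ^ 2 ≤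
      ENNReal.ofReal (2 / κ) * (‖f x‖ₑ ^ 2 + ∑' k, 2 ^ k * s k x) := by
    intro x hx
    rcases eq_or_ne (f x) 0 with hfx | hfx
    · simp [hfx]
    by_cases hall : ∀ k : ℕ, x ∈ strip G ν (2⁻¹ ^ k)
    · have h1 : ∑' k, 2 ^ k * s k x = ⊤ := by
        have h2 : ∀ k, ‖f x‖ₑ ^ 2 ≤ 2 ^ k * s k x := fun k ↦ by
          simp only [s, indicator_of_mem (hall k)]
          exact le_mul_of_one_le_left zero_le (one_le_pow₀ (by norm_num))
        refine top_le_iff.1 ((ENNReal.tsum_const_eq_top_of_ne_zero (α := ℕ)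
          (c := ‖f x‖ₑ ^ 2) (by simpa using hfx)).symm.trans_le (ENNReal.tsum_le_tsum h2))
      rw [h1, add_top, ENNReal.mul_top (by simpa using hκ)]
      exact le_top
    · push Not at hall
      classical
      let K := Nat.find hall
      have hK : x ∉ strip G ν (2⁻¹ ^ K) := Nat.find_spec hall
      have hdK := hd x hx hfx K hK
      have hd1 : (d x)⁻¹ ≤ κ⁻¹ * 2 ^ K := by
        rw [show κ⁻¹ * 2 ^ K = (κ * 2⁻¹ ^ K)⁻¹ by rw [mul_inv, ← inv_pow, inv_inv]]
        exact inv_anti₀ (by positivity) hdK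
      rcases Nat.eq_zero_or_pos K with hK0 | hKpos
      · rw [hK0, pow_zero, mul_one] at hd1
        refine mul_le_mul' (ENNReal.ofReal_le_ofReal (hd1.trans ?_)) le_self_add
        rw [inv_eq_one_div]
        gcongr
        norm_num
      · have hm : x ∈ strip G ν (2⁻¹ ^ (K - 1)) := by
          by_contra hcon
          exact Nat.find_min hall (show K - 1 < K by omega) hcon
        have h3 : 2 ^ (K - 1) * ‖f x‖ₑ ^ 2 ≤ ∑' k, 2 ^ k * s k x := by
          refine le_trans (le_of_eq ?_) (ENNReal.le_tsum (K - 1))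
          simp only [s, indicator_of_mem hm]
        calc ENNReal.ofReal (d x)⁻¹ * ‖f x‖ₑ ^ 2
            ≤ ENNReal.ofReal (2 / κ * 2 ^ (K - 1)) * ‖f x‖ₑ ^ 2 := by
              gcongr
              refine hd1.trans_eq ?_
              have : (2 : ℝ) ^ K = 2 * 2 ^ (K - 1) := by
                rw [← pow_succ', Nat.sub_add_cancel hKpos]
              rw [this]
              ring
          _ = ENNReal.ofReal (2 / κ) * (2 ^ (K - 1) * ‖f x‖ₑ ^ 2) := by
              rw [ENNReal.ofReal_mul (by positivity), ENNReal.ofReal_pow (by norm_num), mul_assoc]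
              simp
          _ ≤ _ := by
              gcongr
              exact h3.trans le_add_self
  have hlt : ∑' k : ℕ, 2 ^ k * lTwo (strip G ν (2⁻¹ ^ k)) f ^ 2 ≤ A :=
    ENNReal.tsum_le_of_sum_range_le h
  calc _ ≤ ∫⁻ x in G, ENNReal.ofReal (2 / κ) * (‖f x‖ₑ ^ 2 + ∑' k, 2 ^ k * s k x) :=
        setLIntegral_mono' hG.measurableSet hpt
    _ ≤ ENNReal.ofReal (2 / κ) * (lTwo G f ^ 2 +
        ∑' k : ℕ, 2 ^ k * lTwo (strip G ν (2⁻¹ ^ k)) f ^ 2) := by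
        rw [lintegral_const_mul _ (by fun_prop), lintegral_add_left (by fun_prop), ← lTwo_sq,
          lintegral_tsum fun k ↦ ((hsm k).const_mul _).aemeasurable]
        gcongr with k
        rw [lintegral_const_mul _ (hsm k), lTwo_sq, ← lintegral_indicator (hG.measurableSet_strip _)]
        gcongr
        exact Measure.restrict_le_self
    _ ≤ ENNReal.ofReal (2 / κ) * (lTwo G f ^ 2 + A) := by gcongr
    _ < ⊤ := by finiteness

end IsUpCone

end

section

variable {N : ℕ}

/-! ### Localization -/

/-- Smooth partitions of unity subordinate to a finite family of bounded open sets. -/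
lemma exists_smooth_partition {ι : Type} [Fintype ι] {K : Set (Space N)} (hK : IsClosed K)
    {U : ι → Set (Space N)} (hU : ∀ i, IsOpen (U i)) (hb : ∀ i, Bornology.IsBounded (U i))
    (hKU : K ⊆ ⋃ i, U i) : ∃ η : ι → Space N → ℝ, (∀ i, ContDiff ℝ ∞ (η i)) ∧
      (∀ i, HasCompactSupport (η i)) ∧ (∀ i, tsupport (η i) ⊆ U i) ∧ (∀ i x, 0 ≤ η i x) ∧
      ∀ x ∈ K, ∑ i, η i x = 1 := by
  obtain ⟨f, hf⟩ := SmoothPartitionOfUnity.exists_isSubordinate (modelWithCornersSelf ℝ (Space N))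
    hK U hU hKU
  refine ⟨fun i ↦ f i, fun i ↦ (f i).contMDiff.contDiff, fun i ↦ ?_, hf, fun i x ↦ f.nonneg i x,
    fun x hx ↦ ?_⟩
  · exact Metric.isCompact_of_isClosed_isBounded (isClosed_tsupport _) ((hb i).subset (hf i))
  · rw [← finsum_eq_sum_of_fintype]
    exact f.sum_eq_one hx

lemma exists_smooth_cutoff {K U : Set (Space N)} (hK : IsClosed K) (hU : IsOpen U)
    (hb : Bornology.IsBounded U) (hKU : K ⊆ U) : ∃ χ : Space N → ℝ, ContDiff ℝ ∞ χ ∧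
      HasCompactSupport χ ∧ tsupport χ ⊆ U ∧ ∀ x ∈ K, χ x = 1 := by
  obtain ⟨η, h1, h2, h3, -, h4⟩ := exists_smooth_partition (ι := Unit) hK (U := fun _ ↦ U)
    (fun _ ↦ hU) (fun _ ↦ hb) (hKU.trans (subset_iUnion (fun _ : Unit ↦ U) ()))
  exact ⟨η (), h1 (), h2 (), h3 (), fun x hx ↦ by simpa using h4 x hx⟩

/-- The energy of `η f` over `A'` is controlled by that of `f` over `A`, if both sets coincide near the
support of `η`. -/
lemma exists_hsq_localize (hN : N ≠ 0) {p : Space N} {r : ℝ} (hr : 0 < r) {η : Space N → ℝ}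
    (hη : ContDiff ℝ ∞ η) (hc : HasCompactSupport η) (hs : tsupport η ⊆ Metric.ball p (r / 2)) :
    ∃ C : ℝ≥0, ∀ A A' : Set (Space N), MeasurableSet A → MeasurableSet A' →
      A ∩ Metric.ball p r = A' ∩ Metric.ball p r → ∀ f : Space N → ℝ, Measurable f →
        hsq A' (fun x ↦ η x * f x) ≤ C * hsq A f := by
  obtain ⟨C, hC⟩ := exists_hsq_mul_le hN hη hc
  have hk := kernConst_ne_top hN
  let D : ℝ≥0∞ := 1 + 4 * (ENNReal.ofReal (r / 2)⁻¹ * kernConst N)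
  have hD : D ≠ ⊤ := by finiteness
  refine ⟨D.toNNReal * C, fun A A' hA hA' h f hf ↦ ?_⟩
  push_cast
  rw [ENNReal.coe_toNNReal hD, mul_assoc]
  refine (hsq_transfer hA hA' hr h (hη.continuous.measurable.mul hf) fun x hx ↦ ?_).trans
    (mul_le_mul_right (hC A hA f hf) _)
  rw [Pi.mul_apply, image_eq_zero_of_notMem_tsupport fun hx' ↦ hx (hs hx'), zero_mul]

lemma lTwo_localize_le {p : Space N} {r : ℝ} {χ : Space N → ℝ} {M : ℝ≥0} (hM : ∀ x, ‖χ x‖ₑ ≤ M)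
    (hs : tsupport χ ⊆ Metric.ball p r) {A A' : Set (Space N)} (hA : MeasurableSet A)
    (hA' : MeasurableSet A') (h : A ∩ Metric.ball p r = A' ∩ Metric.ball p r) (f : Space N → ℝ) :
    lTwo A' (fun x ↦ χ x * f x) ≤ M * lTwo A f := by
  refine (ENNReal.pow_right_strictMono two_ne_zero).le_iff_le.1 ?_
  rw [mul_pow, lTwo_sq, lTwo_sq, ← lintegral_const_mul' _ _ (by finiteness),
    ← lintegral_indicator hA, ← lintegral_indicator hA']
  refine lintegral_mono fun x ↦ ?_
  by_cases hx : x ∈ Metric.ball p r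
  · have hm : x ∈ A ↔ x ∈ A' := by
      have := Set.ext_iff.1 h x
      simpa [hx] using this
    rw [indicator_congr_mem hm]
    refine indicator_le_indicator ?_
    rw [enorm_mul, mul_pow]
    gcongr
    exact hM x
  · have : χ x = 0 := image_eq_zero_of_notMem_tsupport fun hx' ↦ hx (hs hx')
    have h0 : A'.indicator (fun x ↦ ‖χ x * f x‖ₑ ^ 2) x = 0 := by
      by_cases hxA : x ∈ A'
      · simp [hxA, this]
      · simp [hxA]
    rw [h0]
    exact zero_le

/-- The distributional derivative of `f` in the direction `e` is a bounded functional for the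
half-order norm on the test functions in `A`, the square of its norm being at most `M`. -/
def DualBound (A : Set (Space N)) (f : Space N → ℝ) (e : Space N) (M : ℝ≥0∞) : Prop :=
  ∀ φ : Space N → ℝ, ContDiff ℝ ∞ φ → HasCompactSupport φ → tsupport φ ⊆ A →
    ‖∫ x, f x * fderiv ℝ φ x e‖ₑ ^ 2 ≤ M * hsq A φ

lemma DualBound.mono {A : Set (Space N)} {f : Space N → ℝ} {e : Space N} {M M' : ℝ≥0∞}
    (h : DualBound A f e M) (hM : M ≤ M') : DualBound A f e M' :=
  fun φ h1 h2 h3 ↦ (h φ h1 h2 h3).trans (mul_le_mul_left hM _)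

lemma DualBound.sum {ι : Type} (s : Finset ι) {A : Set (Space N)} {f : ι → Space N → ℝ}
    {e : Space N} {M : ι → ℝ≥0∞} (hf : ∀ i, MemLp (f i) 2) (h : ∀ i, DualBound A (f i) e (M i)) :
    DualBound A (fun x ↦ ∑ i ∈ s, f i x) e (s.card * ∑ i ∈ s, M i) := by
  intro φ h1 h2 h3
  have hi : ∀ i, Integrable fun x ↦ f i x * fderiv ℝ φ x e := fun i ↦
    (hf i).integrable_mul (memLp_fderiv_apply h1 h2 e)
  simp only [Finset.sum_mul]
  rw [integral_finsetSum _ fun i _ ↦ hi i]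
  refine (pow_le_pow_left' (enorm_sum_le _ _) 2).trans ?_
  have := ennreal_sum_weight_sq_le s (fun _ ↦ 1) fun i ↦ ‖∫ x, f i x * fderiv ℝ φ x e‖ₑ
  simp only [one_mul, Finset.sum_const, nsmul_eq_mul, mul_one] at this
  refine this.trans ?_
  rw [mul_assoc, Finset.sum_mul]
  gcongr with i
  exact h i φ h1 h2 h3

lemma fderiv_mul_apply {η φ : Space N → ℝ} (hη : ContDiff ℝ ∞ η) (hφ : ContDiff ℝ ∞ φ)
    (x e : Space N) : fderiv ℝ (fun x ↦ η x * φ x) x e =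
      η x * fderiv ℝ φ x e + fderiv ℝ η x e * φ x := by
  rw [fderiv_fun_mul (hη.differentiable (by simp) x) (hφ.differentiable (by simp) x)]
  simp [mul_comm]

lemma tsupport_fderiv_apply_subset' {η : Space N → ℝ} (e : Space N) :
    tsupport (fun x ↦ fderiv ℝ η x e) ⊆ tsupport η := by
  refine (closure_mono fun x hx ↦ ?_).trans (tsupport_fderiv_subset ℝ (f := η))
  simp only [Function.mem_support, ne_eq] at hx ⊢
  exact fun h ↦ hx (by rw [h]; simp)

lemma tsupport_mul_subset' (η φ : Space N → ℝ) :
    tsupport (fun x ↦ η x * φ x) ⊆ tsupport η ∩ tsupport φ :=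
  subset_inter tsupport_mul_subset_left tsupport_mul_subset_right

/-- The bound for the derivative is local. -/
lemma exists_dualBound_localize (hN : N ≠ 0) {p : Space N} {r : ℝ} (hr : 0 < r) {η : Space N → ℝ}
    (hη : ContDiff ℝ ∞ η) (hc : HasCompactSupport η) (hs : tsupport η ⊆ Metric.ball p (r / 2))
    (e : Space N) :
    ∃ C : ℝ≥0, ∀ A A' : Set (Space N), MeasurableSet A → MeasurableSet A' →
      A ∩ Metric.ball p r = A' ∩ Metric.ball p r → ∀ f : Space N → ℝ, Measurable f → MemLp f 2 →
        ∀ M, DualBound A f e M → DualBound A' (fun x ↦ η x * f x) e (C * (M + lTwo A f ^ 2)) := by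
  have hdη := contDiff_fderiv_apply hη e
  have hdc : HasCompactSupport fun x ↦ fderiv ℝ η x e := hc.fderiv_apply ℝ e
  have hds : tsupport (fun x ↦ fderiv ℝ η x e) ⊆ Metric.ball p (r / 2) :=
    (tsupport_fderiv_apply_subset' e).trans hs
  obtain ⟨C₁, hC₁⟩ := exists_hsq_localize hN hr hη hc hs
  obtain ⟨C₂, hC₂⟩ := exists_hsq_localize hN hr hdη hdc hds
  refine ⟨2 * (C₁ + C₂), fun A A' hA hA' h f hf hf2 M hM φ hφ hφc hφs ↦ ?_⟩
  have hφm := hφ.continuous.measurable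
  have hsub : ∀ {ζ : Space N → ℝ}, tsupport ζ ⊆ Metric.ball p (r / 2) →
      tsupport (fun x ↦ ζ x * φ x) ⊆ A := by
    intro ζ hζ x hx
    obtain ⟨h1, h2⟩ := tsupport_mul_subset' ζ φ hx
    have : x ∈ A' ∩ Metric.ball p r :=
      ⟨hφs h2, Metric.ball_subset_ball (by linarith) (hζ h1)⟩
    rw [← h] at this
    exact this.1
  have hηφ : ContDiff ℝ ∞ fun x ↦ η x * φ x := hη.mul hφ
  have hηφc : HasCompactSupport fun x ↦ η x * φ x := hc.mul_right
  have hdφ : ContDiff ℝ ∞ fun x ↦ fderiv ℝ η x e * φ x := hdη.mul hφ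
  have hdφc : HasCompactSupport fun x ↦ fderiv ℝ η x e * φ x := hdc.mul_right
  have hi1 : Integrable fun x ↦ f x * fderiv ℝ (fun x ↦ η x * φ x) x e :=
    hf2.integrable_mul (memLp_fderiv_apply hηφ hηφc e)
  have hi2 : Integrable fun x ↦ (fderiv ℝ η x e * φ x) * f x :=
    (hdφ.continuous.memLp_of_hasCompactSupport (p := 2) hdφc).integrable_mul hf2
  have e1 : ∫ x, η x * f x * fderiv ℝ φ x e = (∫ x, f x * fderiv ℝ (fun x ↦ η x * φ x) x e) -
      ∫ x, (fderiv ℝ η x e * φ x) * f x := by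
    rw [← integral_sub hi1 hi2]
    refine integral_congr_ae (Filter.Eventually.of_forall fun x ↦ ?_)
    simp only [fderiv_mul_apply hη hφ]
    ring
  have b1 := (hM _ hηφ hηφc (hsub hs)).trans (mul_le_mul_right (hC₁ A' A hA' hA h.symm φ hφm) M)
  have b2 : ‖∫ x, (fderiv ℝ η x e * φ x) * f x‖ₑ ^ 2 ≤ C₂ * hsq A' φ * lTwo A f ^ 2 := by
    have h0 : ∀ x ∉ A, fderiv ℝ η x e * φ x = 0 := fun x hx ↦
      image_eq_zero_of_notMem_tsupport (f := fun x ↦ fderiv ℝ η x e * φ x)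
        fun hx' ↦ hx (hsub hds hx')
    have h1 := enorm_integral_mul_le_of_zero (A := A) hdφ.continuous.measurable hf h0
    rw [lTwo_eq_of_zero hA h0] at h1
    refine (pow_le_pow_left' h1 2).trans ?_
    rw [mul_pow]
    gcongr
    exact (lTwo_sq_le_hsq A _).trans (hC₂ A' A hA' hA h.symm φ hφm)
  rw [e1]
  refine (pow_le_pow_left' enorm_sub_le 2).trans ((ennreal_add_sq_le _ _).trans ?_)
  push_cast
  calc _ ≤ 2 * (M * (C₁ * hsq A' φ) + C₂ * hsq A' φ * lTwo A f ^ 2) := by gcongr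
    _ = 2 * (C₁ * M + C₂ * lTwo A f ^ 2) * hsq A' φ := by ring
    _ ≤ 2 * ((C₁ + C₂) * M + (C₁ + C₂) * lTwo A f ^ 2) * hsq A' φ := by
        gcongr
        · exact le_self_add
        · exact le_add_self
    _ = _ := by ring

/-! ### Approximation near a boundary point -/

/-- The set `A` coincides with the set `G` with the cone property in the ball `B(p, r)`. -/
structure IsChart (A : Set (Space N)) (p : Space N) (r : ℝ) (G : Set (Space N)) (ν : Space N)
    (c : ℝ) : Prop where
  pos : 0 < r
  isUpCone : IsUpCone G ν c
  inter_eq : A ∩ Metric.ball p r = G ∩ Metric.ball p r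

/-- The functions on which approximation operators act: functions of `H^{1/2}(A)`, extended by
zero. -/
structure IsHalf (A : Set (Space N)) (f : Space N → ℝ) : Prop where
  measurable : Measurable f
  zero : ∀ x ∉ A, f x = 0
  hsq_ne_top : hsq A f ≠ ⊤

lemma IsHalf.memLp {A : Set (Space N)} {f : Space N → ℝ} (h : IsHalf A f) (hA : MeasurableSet A) :
    MemLp f 2 := memLp_two_of_hsq hA h.measurable h.zero h.hsq_ne_top

/-- The operators `T K` produce smooth functions, are bounded uniformly in `K` for the norm of
`H^{1/2}(A)`, and converge in `L²(A)` to the multiplication by `η`. -/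
structure IsApprox (A : Set (Space N)) (η : Space N → ℝ)
    (T : ℕ → (Space N → ℝ) → Space N → ℝ) : Prop where
  contDiff : ∀ K f, IsHalf A f → ContDiff ℝ ∞ (T K f)
  hasCompactSupport : ∀ K f, IsHalf A f → HasCompactSupport (T K f)
  bound : ∃ C : ℝ≥0, ∀ K f, IsHalf A f → hsq A (T K f) ≤ C * hsq A f
  tendsto : ∀ f, IsHalf A f →
    Filter.Tendsto (fun K ↦ lTwo A fun x ↦ T K f x - η x * f x) Filter.atTop (nhds 0)

/-- The cut-off logarithmic averages of `η f`. -/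
noncomputable def localAvg (χ η ρ : Space N → ℝ) (s : ℝ) (K : ℕ) (f : Space N → ℝ) (x : Space N) :
    ℝ := χ x * logAvg ρ s (K + 1) (fun y ↦ η y * f y) x

section Local

variable {A : Set (Space N)} {p : Space N} {r : ℝ} {G : Set (Space N)} {ν : Space N} {c : ℝ}
  {η χ ρ : Space N → ℝ} {M : ℝ≥0}

/-- The functions entering the approximation near a point: a member `η` of a partition of unity, a
cut-off `χ` equal to one on its support, and the weight `ρ` of the averages. -/
structure IsLocalData (A : Set (Space N)) (p : Space N) (r : ℝ) (G : Set (Space N)) (ν : Space N)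
    (c : ℝ) (η χ ρ : Space N → ℝ) (M : ℝ≥0) : Prop where
  measurableSet : MeasurableSet A
  chart : IsChart A p r G ν c
  kernel : IsConeKernel ρ ν c M
  integral_eq : ∫ z, ρ z = 1
  contDiff_left : ContDiff ℝ ∞ η
  hasCompactSupport_left : HasCompactSupport η
  tsupport_left : tsupport η ⊆ Metric.ball p (r / 2)
  contDiff_right : ContDiff ℝ ∞ χ
  hasCompactSupport_right : HasCompactSupport χ
  tsupport_right : tsupport χ ⊆ Metric.ball p (r / 2)
  eq_one : ∀ x ∈ tsupport η, χ x = 1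

namespace IsLocalData

lemma mem_iff (h : IsLocalData A p r G ν c η χ ρ M) {x : Space N}
    (hx : x ∈ Metric.ball p (r / 2)) : x ∈ A ↔ x ∈ G := by
  have h1 : x ∈ Metric.ball p r :=
    Metric.ball_subset_ball (by linarith [h.chart.pos]) hx
  have := Set.ext_iff.1 h.chart.inter_eq x
  simpa [h1] using this

/-- Localization by `η` transfers a function of `H^{1/2}(A)` to the model set `G` of the chart. -/
lemma isHalf_mul (hN : N ≠ 0) (h : IsLocalData A p r G ν c η χ ρ M) : ∃ C : ℝ≥0, ∀ f,
    IsHalf A f → IsHalf G (fun x ↦ η x * f x) ∧ hsq G (fun x ↦ η x * f x) ≤ C * hsq A f := by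
  obtain ⟨C, hC⟩ := exists_hsq_localize hN h.chart.pos h.contDiff_left h.hasCompactSupport_left
    h.tsupport_left
  refine ⟨C, fun f hf ↦ ?_⟩
  have h1 := hC A G h.measurableSet h.chart.isUpCone.measurableSet h.chart.inter_eq f hf.measurable
  refine ⟨⟨h.contDiff_left.continuous.measurable.mul hf.measurable, fun x hx ↦ ?_, ?_⟩, h1⟩
  · by_cases hx' : x ∈ tsupport η
    · rw [hf.zero x fun hxA ↦ hx ((h.mem_iff (h.tsupport_left hx')).1 hxA), mul_zero]
    · rw [image_eq_zero_of_notMem_tsupport hx', zero_mul]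
  · exact (h1.trans_lt (ENNReal.mul_lt_top (by simp) hf.hsq_ne_top.lt_top)).ne

/-- The approximation property of cut-off averages in one chart, given that the averages are bounded on
`H^{1/2}(G)`. The cut-off `χ` is one near the support of `η`, so that it does not change the limit. -/
lemma isApprox (hN : N ≠ 0) (h : IsLocalData A p r G ν c η χ ρ M) {s : ℝ} (hs : |s| = c / 4)
    (hb : ∃ C : ℝ≥0, ∀ f, IsHalf G f → ∀ K, hsq G (logAvg ρ s K f) ≤ C * hsq G f) :
    IsApprox A η (localAvg χ η ρ s) := by
  have hG := h.chart.isUpCone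
  have hc := hG.pos
  have hs0 : s ≠ 0 := by
    rintro rfl
    rw [abs_zero] at hs
    linarith
  obtain ⟨C₁, hC₁⟩ := h.isHalf_mul hN
  obtain ⟨C₂, hC₂⟩ := hb
  obtain ⟨C₃, hC₃⟩ := exists_hsq_localize hN h.chart.pos h.contDiff_right h.hasCompactSupport_right
    h.tsupport_right
  refine ⟨fun K f hf ↦ ?_, fun K f hf ↦ h.hasCompactSupport_right.mul_right,
    ⟨C₃ * (C₂ * C₁), fun K f hf ↦ ?_⟩, fun f hf ↦ ?_⟩
  · have h1 := (hC₁ f hf).1.memLp hG.measurableSet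
    exact h.contDiff_right.mul
      (contDiff_logAvg h.kernel.contDiff h.kernel.hasCompactSupport hs0 _ h1)
  · have h1 := (hC₁ f hf).1
    refine (hC₃ G A hG.measurableSet h.measurableSet h.chart.inter_eq.symm _
      (measurable_logAvg h.kernel.measurable _ _ h1.measurable)).trans ?_
    push_cast
    rw [mul_assoc, mul_assoc]
    gcongr
    exact (hC₂ _ h1 _).trans (mul_le_mul_right (hC₁ f hf).2 _)
  · have h1 := (hC₁ f hf).1
    obtain ⟨C₄, hC₄⟩ := hG.exists_lTwo_logAvg_sub_le h.kernel h.integral_eq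
    obtain ⟨M', hM', -⟩ := exists_bound_of_smooth h.contDiff_right h.hasCompactSupport_right
    have e1 : ∀ K, (fun x ↦ localAvg χ η ρ s K f x - η x * f x) =
        fun x ↦ χ x * (logAvg ρ s (K + 1) (fun y ↦ η y * f y) x - η x * f x) := by
      intro K
      ext x
      have : χ x * (η x * f x) = η x * f x := by
        by_cases hx : x ∈ tsupport η
        · rw [h.eq_one x hx, one_mul]
        · rw [image_eq_zero_of_notMem_tsupport hx, zero_mul, mul_zero]
      rw [mul_sub, this, localAvg]
    simp_rw [e1]
    set H : ℝ≥0∞ := hsq G fun x ↦ η x * f x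
    -- the rate `1/K` of the logarithmic averages, after extraction of square roots
    have hle : ∀ K : ℕ, lTwo A (fun x ↦ χ x *
        (logAvg ρ s (K + 1) (fun y ↦ η y * f y) x - η x * f x)) ≤
        M' * (‖(((K + 1 : ℕ) : ℝ)⁻¹)‖ₑ * (C₄ * H) ^ (1 / 2 : ℝ)) := by
      intro K
      refine (lTwo_localize_le hM' (h.tsupport_right.trans (Metric.ball_subset_ball
        (by linarith [h.chart.pos]))) hG.measurableSet h.measurableSet h.chart.inter_eq.symm
        _).trans (mul_le_mul_right ?_ _)
      refine (ENNReal.pow_right_strictMono two_ne_zero).le_iff_le.1 ?_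
      refine (hC₄ s hs _ h1.measurable h1.zero (h1.memLp hG.measurableSet) (K + 1)
        (Nat.succ_ne_zero K)).trans_eq ?_
      rw [mul_pow, ← ENNReal.rpow_natCast ((C₄ * H) ^ (1 / 2 : ℝ)), ← ENNReal.rpow_mul]
      norm_num
      rfl
    have hlim : Filter.Tendsto (fun K : ℕ ↦
        M' * (‖(((K + 1 : ℕ) : ℝ)⁻¹)‖ₑ * (C₄ * H) ^ (1 / 2 : ℝ))) Filter.atTop (nhds 0) := by
      have h2 : Filter.Tendsto (fun K : ℕ ↦ ‖(((K + 1 : ℕ) : ℝ)⁻¹)‖ₑ) Filter.atTop (nhds 0) := by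
        have := ((Filter.tendsto_add_atTop_iff_nat 1).2
          (tendsto_inv_atTop_nhds_zero_nat (𝕜 := ℝ))).enorm
        simpa using this
      have h3 : (C₄ * H) ^ (1 / 2 : ℝ) ≠ ⊤ := ENNReal.rpow_ne_top_of_nonneg (by norm_num)
        (ENNReal.mul_ne_top (by simp) h1.hsq_ne_top)
      have h4 := ENNReal.Tendsto.const_mul (a := M')
        (ENNReal.Tendsto.mul_const (b := (C₄ * H) ^ (1 / 2 : ℝ)) h2 (Or.inr h3)) (Or.inr (by simp))
      simpa using h4
    exact tendsto_of_tendsto_of_tendsto_of_le_of_le tendsto_const_nhds hlim (fun _ ↦ zero_le) hle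

lemma isApprox_down (hN : N ≠ 0) (h : IsLocalData A p r G ν c η χ ρ M) :
    IsApprox A η (localAvg χ η ρ (-(c / 4))) := by
  have hG := h.chart.isUpCone
  obtain ⟨C, hC⟩ := hG.exists_hsq_logAvg_down_le hN h.kernel h.integral_eq
  refine h.isApprox hN (by rw [abs_neg, abs_of_pos (by linarith [hG.pos])])
    ⟨C, fun f hf K ↦ hC f hf.measurable hf.zero (hf.memLp hG.measurableSet) K⟩

lemma isApprox_up (hN : N ≠ 0) (h : IsLocalData A p r G ν c η χ ρ M) :
    IsApprox A η (localAvg χ η ρ (c / 4)) := by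
  have hG := h.chart.isUpCone
  refine h.isApprox hN (abs_of_pos (by linarith [hG.pos]))
    ⟨(M * (ballVol N).toNNReal) ^ 2, fun f hf K ↦ ?_⟩
  push_cast
  rw [ENNReal.coe_toNNReal ballVol_ne_top]
  exact hG.hsq_logAvg_up_le h.kernel K hf.measurable (hf.memLp hG.measurableSet)

/-- Downward averages have their supports inside `A`. -/
lemma tsupport_down_subset (h : IsLocalData A p r G ν c η χ ρ M) {f : Space N → ℝ}
    (h0 : ∀ x ∉ A, f x = 0) (K : ℕ) : tsupport (localAvg χ η ρ (-(c / 4)) K f) ⊆ A := by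
  have hG := h.chart.isUpCone
  have hc := hG.pos
  intro x hx
  obtain ⟨h1, h2⟩ := tsupport_mul_subset' _ _ hx
  refine (h.mem_iff (h.tsupport_right h1)).2 ?_
  have hS : IsCompact (tsupport η ∩ closure A) :=
    IsCompact.inter_right h.hasCompactSupport_left isClosed_closure
  have hS0 : ∀ y ∉ tsupport η ∩ closure A, η y * f y = 0 := by
    intro y hy
    by_cases hy1 : y ∈ tsupport η
    · rw [h0 y fun hyA ↦ hy ⟨hy1, subset_closure hyA⟩, mul_zero]
    · rw [image_eq_zero_of_notMem_tsupport hy1, zero_mul]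
  obtain ⟨k, z, hz, hy1, hy2⟩ :=
    tsupport_logAvg_subset h.kernel.hasCompactSupport (K + 1) hS hS0 h2
  have hcl : x + (-(c / 4) * 2⁻¹ ^ k) • z ∈ closure G := by
    have hb := h.tsupport_left hy1
    have h3 := Metric.isOpen_ball.inter_closure ⟨hb, hy2⟩
    refine closure_mono (fun y hy ↦ ?_) h3
    exact (h.mem_iff hy.1).1 hy.2
  have := hG.mem _ hcl z (h.kernel.tsupport_subset hz) (c / 4 * 2⁻¹ ^ k) (by positivity)
  rwa [neg_mul, neg_smul, neg_add_cancel_right] at this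

/-- If the extension of `f` by zero has half a derivative on the whole space, the derivatives of
the downward averages are bounded in the dual space. -/
lemma exists_dualBound_down (hN : N ≠ 0) (h : IsLocalData A p r G ν c η χ ρ M) (e : Space N) :
    ∃ C : ℝ≥0, ∀ f, IsHalf A f → hsq univ f ≠ ⊤ → ∀ K,
      DualBound A (localAvg χ η ρ (-(c / 4)) K f) e (C * hsq univ f) := by
  have hG := h.chart.isUpCone
  have hc := hG.pos
  obtain ⟨C₁, hC₁⟩ := h.isHalf_mul hN
  obtain ⟨C₂, hC₂⟩ := exists_enorm_integral_mul_fderiv_le hG e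
  obtain ⟨C₃, hC₃⟩ := exists_dualBound_localize hN h.chart.pos h.contDiff_right
    h.hasCompactSupport_right h.tsupport_right e
  obtain ⟨C₄, hC₄⟩ := exists_hsq_mul_le hN h.contDiff_left h.hasCompactSupport_left
  let D : ℝ≥0 := (M * (ballVol N).toNNReal) ^ 2 * C₄
  refine ⟨C₃ * (C₂ * D + D), fun f hf hfin K ↦ ?_⟩
  have h1 := (hC₁ f hf).1
  set g : Space N → ℝ := fun x ↦ η x * f x
  have hg2 := h1.memLp hG.measurableSet
  have hLm := measurable_logAvg h.kernel.measurable (-(c / 4)) (K + 1) h1.measurable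
  have hL : hsq univ (logAvg ρ (-(c / 4)) (K + 1) g) ≤ D * hsq univ f := by
    have hl : lTwo univ (logAvg ρ (-(c / 4)) (K + 1) g) ≤ M * ballVol N * lTwo univ g :=
      lTwo_logAvg_le h.kernel.measurable _ h1.measurable fun k ↦
        h.kernel.lTwo_avg_le (fun _ _ _ _ ↦ mem_univ _) h1.measurable
    have hi : ∀ w, incr univ (logAvg ρ (-(c / 4)) (K + 1) g) w ≤
        M * ballVol N * incr univ g w := fun w ↦ by
      have := incr_logAvg_le h.kernel.measurable (K + 1) h1.measurable (B := univ) (w := w)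
        (b := M * ballVol N * incr univ g w) (C := fun _ ↦ 0) (a := -(c / 4)) fun k ↦ by
          rw [add_zero]
          exact h.kernel.incr_avg_le (scale_ne_zero (by linarith) k) (fun _ _ _ _ ↦ mem_univ _)
            h1.measurable hg2 w
      simpa using this
    have := hsq_le_of_incr_le MeasurableSet.univ h1.measurable hl hi
    refine this.trans ((mul_le_mul_right (hC₄ univ MeasurableSet.univ f hf.measurable) _).trans_eq ?_)
    simp only [D]
    push_cast
    rw [ENNReal.coe_toNNReal ballVol_ne_top]
    ring
  have hLfin : hsq univ (logAvg ρ (-(c / 4)) (K + 1) g) ≠ ⊤ :=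
    (hL.trans_lt (ENNReal.mul_lt_top (by simp) hfin.lt_top)).ne
  have hL0 : ∀ x ∉ G, logAvg ρ (-(c / 4)) (K + 1) g x = 0 := by
    intro x hx
    rw [logAvg, Finset.sum_eq_zero, mul_zero]
    intro k _
    rw [neg_mul]
    exact hG.avg_down_eq_zero h.kernel h1.zero (by positivity) hx
  -- the bilinear estimate, for the average in place of `f`
  have hDB : DualBound G (logAvg ρ (-(c / 4)) (K + 1) g) e (C₂ * (D * hsq univ f)) := by
    intro φ hφ hφc _
    refine (hC₂ _ hLm hL0 hLfin φ hφ hφc).trans ?_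
    rw [← mul_assoc]
    gcongr
  have hL2 := memLp_two_of_hsq MeasurableSet.univ hLm (by simp) hLfin
  refine (hC₃ G A hG.measurableSet h.measurableSet h.chart.inter_eq.symm _ hLm hL2 _ hDB).mono ?_
  push_cast
  rw [mul_assoc, add_mul, mul_assoc]
  gcongr
  exact (lTwo_sq_le_hsq _ _).trans ((hsq_mono (subset_univ _) _).trans hL)

/-- The derivative of an upward average is tested by the downward average of the test function. -/
lemma exists_dualBound_up (hN : N ≠ 0) (h : IsLocalData A p r G ν c η χ ρ M) (e : Space N) :
    ∃ C : ℝ≥0, ∀ f, IsHalf A f → ∀ B, DualBound A f e B → ∀ K,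
      DualBound A (localAvg χ η ρ (c / 4) K f) e (C * (B + hsq A f)) := by
  have hG := h.chart.isUpCone
  have hc := hG.pos
  obtain ⟨C₁, hC₁⟩ := h.isHalf_mul hN
  obtain ⟨C₂, hC₂⟩ := exists_dualBound_localize hN h.chart.pos h.contDiff_left
    h.hasCompactSupport_left h.tsupport_left e
  obtain ⟨C₃, hC₃⟩ := exists_dualBound_localize hN h.chart.pos h.contDiff_right
    h.hasCompactSupport_right h.tsupport_right e
  obtain ⟨C₄, hC₄⟩ := hG.exists_hsq_logAvg_down_le hN h.kernel h.integral_eq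
  let D : ℝ≥0 := (M * (ballVol N).toNNReal) ^ 2 * C₁
  refine ⟨C₃ * (C₂ * C₄ + D), fun f hf B hB K ↦ ?_⟩
  have h1 := (hC₁ f hf).1
  have hDg := hC₂ A G h.measurableSet hG.measurableSet h.chart.inter_eq f hf.measurable
    (hf.memLp h.measurableSet) B hB
  set g : Space N → ℝ := fun x ↦ η x * f x
  have hg2 := h1.memLp hG.measurableSet
  have hLm := measurable_logAvg h.kernel.measurable (c / 4) (K + 1) h1.measurable
  have hL2 : MemLp (logAvg ρ (c / 4) (K + 1) g) 2 := by
    rw [memLp_two_iff_lTwo hLm]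
    refine (lTwo_logAvg_le h.kernel.measurable _ h1.measurable fun k ↦
        h.kernel.lTwo_avg_le (fun _ _ _ _ ↦ mem_univ _) h1.measurable).trans_lt ?_
    exact ENNReal.mul_lt_top (ENNReal.mul_lt_top (by simp) ballVol_ne_top.lt_top)
      ((memLp_two_iff_lTwo h1.measurable).1 hg2)
  -- the average and the derivative are transferred to the test function; the downward average of a test
  -- function in `G` is a test function in `G`, bounded in `H^{1/2}(G)`
  have hDB : DualBound G (logAvg ρ (c / 4) (K + 1) g) e (C₂ * (B + lTwo A f ^ 2) * C₄) := by
    intro φ hφ hφc hφs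
    have hφ2 := hφ.continuous.memLp_of_hasCompactSupport hφc (μ := volume) (p := 2)
    have hφ0 : ∀ x ∉ tsupport φ, φ x = 0 := fun x hx ↦ image_eq_zero_of_notMem_tsupport hx
    have hn0 : -(c / 4) ≠ 0 := by linarith
    rw [integral_logAvg_mul h.kernel (K + 1) h1.measurable (measurable_fderiv_apply' hφ e) hg2
      (memLp_fderiv_apply hφ hφc e)]
    simp_rw [← fderiv_logAvg_of_smooth h.kernel.contDiff h.kernel.hasCompactSupport hn0 (K + 1)
      hφ hφc]
    refine (hDg _ (contDiff_logAvg h.kernel.contDiff h.kernel.hasCompactSupport hn0 _ hφ2)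
      (hasCompactSupport_logAvg h.kernel.hasCompactSupport _ _ hφc hφ0) fun x hx ↦ ?_).trans ?_
    · obtain ⟨k, z, hz, hy⟩ :=
        tsupport_logAvg_subset h.kernel.hasCompactSupport (K + 1) hφc hφ0 hx
      have := hG.mem _ (subset_closure (hφs hy)) z (h.kernel.tsupport_subset hz)
        (c / 4 * 2⁻¹ ^ k) (by positivity)
      rwa [neg_mul, neg_smul, neg_add_cancel_right] at this
    · rw [mul_assoc (C₂ * (B + lTwo A f ^ 2))]
      exact mul_le_mul_right (hC₄ φ hφ.continuous.measurable
        (fun x hx ↦ hφ0 x fun hx' ↦ hx (hφs hx')) hφ2 _) _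
  refine (hC₃ G A hG.measurableSet h.measurableSet h.chart.inter_eq.symm _ hLm hL2 _ hDB).mono ?_
  have hu : lTwo G (logAvg ρ (c / 4) (K + 1) g) ^ 2 ≤ D * hsq A f := by
    refine (lTwo_sq_le_hsq _ _).trans ((hG.hsq_logAvg_up_le h.kernel (K + 1) h1.measurable
      hg2).trans ((mul_le_mul_right (hC₁ f hf).2 _).trans_eq ?_))
    simp only [D]
    push_cast
    rw [ENNReal.coe_toNNReal ballVol_ne_top]
    ring
  push_cast
  rw [mul_assoc (C₃ : ℝ≥0∞)]
  refine mul_le_mul_right ?_ _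
  calc _ ≤ C₂ * (B + hsq A f) * C₄ + D * hsq A f := by
        refine add_le_add ?_ hu
        gcongr
        exact lTwo_sq_le_hsq A f
    _ ≤ C₂ * (B + hsq A f) * C₄ + D * (B + hsq A f) := by
        gcongr
        exact le_add_self
    _ = _ := by ring

end IsLocalData

end Local

end

section

variable {N : ℕ}

/-! ### Charts of a Lipschitz domain -/

/-- The region above the graph of `ψ`, the vertical direction being `ν`. -/
def aboveGraph (ν : Space N) (ψ : (Submodule.span ℝ {ν})ᗮ → ℝ) : Set (Space N) :=
  {x | ψ ((Submodule.span ℝ {ν})ᗮ.orthogonalProjectionOnto x) < inner ℝ ν x}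

lemma closure_aboveGraph_subset {ν : Space N} {ψ : (Submodule.span ℝ {ν})ᗮ → ℝ}
    (hψ : Continuous ψ) : closure (aboveGraph ν ψ) ⊆
      {x | ψ ((Submodule.span ℝ {ν})ᗮ.orthogonalProjectionOnto x) ≤ inner ℝ ν x} := by
  refine closure_minimal (fun x hx ↦ ?_) (isClosed_le ?_ ?_)
  · have h : ψ ((Submodule.span ℝ {ν})ᗮ.orthogonalProjectionOnto x) < inner ℝ ν x := hx
    exact h.le
  · exact hψ.comp (ContinuousLinearMap.continuous _)
  · fun_prop

/-- The opening of the cone is determined by the Lipschitz constant of the graph. -/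
lemma isUpCone_aboveGraph {ν : Space N} (hν : ‖ν‖ = 1) {ψ : (Submodule.span ℝ {ν})ᗮ → ℝ}
    {K : ℝ≥0} (hψ : LipschitzWith K ψ) : IsUpCone (aboveGraph ν ψ) ν (K + 1)⁻¹ := by
  refine ⟨isOpen_lt (hψ.continuous.comp (ContinuousLinearMap.continuous _)) (by fun_prop), hν,
    by positivity, inv_le_one_of_one_le₀ (by simp), fun x hx z hz t ht ↦ ?_⟩
  have hx' : ψ ((Submodule.span ℝ {ν})ᗮ.orthogonalProjectionOnto x) ≤ inner ℝ ν x :=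
    closure_aboveGraph_subset hψ.continuous hx
  change ψ ((Submodule.span ℝ {ν})ᗮ.orthogonalProjectionOnto (x + t • z)) < inner ℝ ν (x + t • z)
  set P := (Submodule.span ℝ {ν})ᗮ.orthogonalProjectionOnto
  rw [Metric.mem_ball, dist_eq_norm] at hz
  have hz' : (K + 1) * ‖z - ν‖ < 1 := by
    rcases (norm_nonneg (z - ν)).eq_or_lt with h | h
    · rw [← h, mul_zero]
      exact one_pos
    · rwa [← one_div, lt_div_iff₀' (by positivity)] at hz
  have hPν : P ν = 0 := by
    rw [Submodule.orthogonalProjectionOnto_eq_zero_iff, Submodule.orthogonal_orthogonal]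
    exact Submodule.mem_span_singleton_self ν
  have hPz : ‖P z‖ ≤ ‖z - ν‖ := by
    have : P z = P (z - ν) := by rw [map_sub, hPν, sub_zero]
    rw [this]
    exact Submodule.norm_orthogonalProjectionOnto_apply_le _ _
  have h1 : ψ (P (x + t • z)) ≤ ψ (P x) + K * (t * ‖z - ν‖) := by
    have h2 := hψ.dist_le_mul (P (x + t • z)) (P x)
    rw [map_add, dist_eq_norm (P x + P (t • z)), add_sub_cancel_left, map_smul, norm_smul,
      Real.norm_of_nonneg ht.le, Real.dist_eq, ← map_smul, ← map_add] at h2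
    have h3 := (le_abs_self _).trans h2
    have h4 : (K : ℝ) * (t * ‖P z‖) ≤ K * (t * ‖z - ν‖) := by gcongr
    linarith
  have h2 : 1 - ‖z - ν‖ ≤ inner ℝ ν z := by
    have h3 : inner ℝ ν z = 1 + inner ℝ ν (z - ν) := by
      rw [inner_sub_right, real_inner_self_eq_norm_sq, hν]
      ring
    have h4 := abs_real_inner_le_norm ν (z - ν)
    rw [hν, one_mul] at h4
    linarith [neg_abs_le (inner ℝ ν (z - ν))]
  rw [inner_add_right, inner_smul_right]
  nlinarith [mul_le_mul_of_nonneg_left h2 ht.le, mul_lt_mul_of_pos_left hz' ht]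

/-- Near a boundary point the domain is the region above a Lipschitz graph. The radius of the chart and
the vertical direction are those of the definition of a Lipschitz domain. -/
lemma IsBoundedLipschitzDomain.exists_boundary_chart {Ω : Opens (Space N)}
    (hΩ : IsBoundedLipschitzDomain Ω) {p : Space N} (hp : p ∈ frontier (Ω : Set (Space N))) :
    ∃ r : ℝ, ∃ ν : Space N, ∃ ψ : (Submodule.span ℝ {ν})ᗮ → ℝ, ∃ K : ℝ≥0, LipschitzWith K ψ ∧
      IsChart (Ω : Set (Space N)) p r (aboveGraph ν ψ) ν (K + 1)⁻¹ := by
  obtain ⟨r, hr, ν, hν, ψ, ⟨K, hψ⟩, h⟩ := hΩ.2 p hp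
  refine ⟨r, ν, ψ, K, hψ, hr, isUpCone_aboveGraph hν hψ, ?_⟩
  ext x
  constructor
  · rintro ⟨hx, hxb⟩
    exact ⟨(h x hxb).1 hx, hxb⟩
  · rintro ⟨hx, hxb⟩
    exact ⟨(h x hxb).2 hx, hxb⟩

lemma exists_unit_vector (hN : N ≠ 0) : ∃ ν : Space N, ‖ν‖ = 1 :=
  ⟨EuclideanSpace.single ⟨0, Nat.pos_of_ne_zero hN⟩ 1, by simp⟩

/-- Near an interior point the model set is the whole space, with an arbitrary vertical direction. -/
lemma IsBoundedLipschitzDomain.exists_chart (hN : N ≠ 0) {Ω : Opens (Space N)}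
    (hΩ : IsBoundedLipschitzDomain Ω) (p : Space N) (hp : p ∈ closure (Ω : Set (Space N))) :
    ∃ r : ℝ, ∃ G : Set (Space N), ∃ ν : Space N, ∃ c : ℝ,
      IsChart (Ω : Set (Space N)) p r G ν c := by
  by_cases hpΩ : p ∈ (Ω : Set (Space N))
  · obtain ⟨ν, hν⟩ := exists_unit_vector hN
    obtain ⟨r, hr, hball⟩ := Metric.isOpen_iff.1 Ω.isOpen p hpΩ
    exact ⟨r, univ, ν, 1, hr, isUpCone_univ hν, by rw [univ_inter, inter_eq_right.2 hball]⟩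
  · obtain ⟨r, ν, ψ, K, -, h⟩ := hΩ.exists_boundary_chart
      (p := p) (by rw [frontier, Ω.isOpen.interior_eq]; exact ⟨hp, hpΩ⟩)
    exact ⟨r, _, ν, _, h⟩

/-! ### Global approximation -/

lemma incr_sum_sq_le {ι : Type} (s : Finset ι) {A : Set (Space N)} {f : ι → Space N → ℝ}
    (hf : ∀ i, Measurable (f i)) (w : Space N) :
    incr A (fun x ↦ ∑ i ∈ s, f i x) w ^ 2 ≤ s.card * ∑ i ∈ s, incr A (f i) w ^ 2 := by
  refine (pow_le_pow_left' (incr_sum_le s (fun i _ ↦ hf i) w) 2).trans ?_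
  have := ennreal_sum_weight_sq_le s (fun _ ↦ 1) fun i ↦ incr A (f i) w
  simpa only [one_mul, Finset.sum_const, nsmul_eq_mul, mul_one] using this

lemma hsq_sum_le {ι : Type} (s : Finset ι) {A : Set (Space N)} (hA : MeasurableSet A)
    {f : ι → Space N → ℝ} (hf : ∀ i, Measurable (f i)) :
    hsq A (fun x ↦ ∑ i ∈ s, f i x) ≤ s.card * ∑ i ∈ s, hsq A (f i) := by
  have h1 : lTwo A (fun x ↦ ∑ i ∈ s, f i x) ^ 2 ≤ s.card * ∑ i ∈ s, lTwo A (f i) ^ 2 := by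
    refine (pow_le_pow_left' (lTwo_sum_le s fun i _ ↦ hf i) 2).trans ?_
    have := ennreal_sum_weight_sq_le s (fun _ ↦ 1) fun i ↦ lTwo A (f i)
    simpa only [one_mul, Finset.sum_const, nsmul_eq_mul, mul_one] using this
  have hk := measurable_kern (N := N)
  have hi : ∀ i, Measurable (incr A (f i)) := fun i ↦ measurable_incr hA (hf i)
  have h2 : gag A (fun x ↦ ∑ i ∈ s, f i x) ≤ s.card * ∑ i ∈ s, gag A (f i) := by
    calc gag A (fun x ↦ ∑ i ∈ s, f i x)
        ≤ ∫⁻ w, s.card * ∑ i ∈ s, kern w * incr A (f i) w ^ 2 := by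
          refine lintegral_mono fun w ↦ ?_
          refine (mul_le_mul_right (incr_sum_sq_le s hf w) _).trans_eq ?_
          rw [mul_left_comm, Finset.mul_sum]
      _ = _ := by
          rw [lintegral_const_mul _ (by fun_prop), lintegral_finsetSum _ fun i _ ↦ by
            have := hi i
            fun_prop]
          rfl
  unfold hsq
  rw [Finset.sum_add_distrib, mul_add]
  exact add_le_add h1 h2

lemma IsApprox.sum {ι : Type} (s : Finset ι) {A : Set (Space N)} (hA : MeasurableSet A)
    {η : ι → Space N → ℝ} {T : ι → ℕ → (Space N → ℝ) → Space N → ℝ}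
    (hη : ∀ i, Measurable (η i)) (h : ∀ i, IsApprox A (η i) (T i)) :
    IsApprox A (fun x ↦ ∑ i ∈ s, η i x) (fun K f x ↦ ∑ i ∈ s, T i K f x) := by
  have hm : ∀ i K f, IsHalf A f → Measurable (T i K f) := fun i K f hf ↦
    ((h i).contDiff K f hf).continuous.measurable
  refine ⟨fun K f hf ↦ ContDiff.sum fun i _ ↦ (h i).contDiff K f hf, fun K f hf ↦ ?_, ?_,
    fun f hf ↦ ?_⟩
  · have h1 : IsCompact (⋃ i ∈ s, tsupport (T i K f)) :=
      s.isCompact_biUnion fun i _ ↦ (h i).hasCompactSupport K f hf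
    refine HasCompactSupport.intro h1 fun x hx ↦ ?_
    simp only [mem_iUnion, not_exists] at hx
    exact Finset.sum_eq_zero fun i hi ↦ image_eq_zero_of_notMem_tsupport (hx i hi)
  · choose C hC using fun i ↦ (h i).bound
    refine ⟨s.card * ∑ i ∈ s, C i, fun K f hf ↦ ?_⟩
    by_cases hcard : s = ∅
    · subst hcard
      simp only [Finset.sum_empty, Finset.card_empty]
      refine le_of_eq_of_le ?_ zero_le
      simp [hsq, lTwo, gag, incr]
    refine (hsq_sum_le s hA fun i ↦ hm i K f hf).trans ?_
    push_cast
    rw [mul_assoc, Finset.sum_mul]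
    gcongr with i
    exact hC i K f hf
  · have hlim : Filter.Tendsto (fun K ↦ ∑ i ∈ s, lTwo A fun x ↦ T i K f x - η i x * f x)
        Filter.atTop (nhds 0) := by
      have := tendsto_finsetSum s fun i (_ : i ∈ s) ↦ (h i).tendsto f hf
      simpa using this
    refine tendsto_of_tendsto_of_tendsto_of_le_of_le tendsto_const_nhds hlim (fun _ ↦ zero_le)
      fun K ↦ ?_
    have e : (fun x ↦ (∑ i ∈ s, T i K f x) - (∑ i ∈ s, η i x) * f x) =
        fun x ↦ ∑ i ∈ s, (T i K f x - η i x * f x) := by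
      ext x
      rw [Finset.sum_sub_distrib, Finset.sum_mul]
    simp only [e]
    exact lTwo_sum_le s fun i _ ↦ (hm i K f hf).sub ((hη i).mul hf.measurable)

/-- A finite family of local data whose partition functions sum up to one on the closure. -/
lemma IsBoundedLipschitzDomain.exists_localData (hN : N ≠ 0) {Ω : Opens (Space N)}
    (hΩ : IsBoundedLipschitzDomain Ω) : ∃ ι : Type, ∃ _ : Fintype ι,
      ∃ (p : ι → Space N) (r : ι → ℝ) (G : ι → Set (Space N)) (ν : ι → Space N) (c : ι → ℝ)
        (η χ ρ : ι → Space N → ℝ) (M : ι → ℝ≥0),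
      (∀ i, IsLocalData (Ω : Set (Space N)) (p i) (r i) (G i) (ν i) (c i) (η i) (χ i) (ρ i) (M i)) ∧
      ∀ x ∈ (Ω : Set (Space N)), ∑ i, η i x = 1 := by
  have hcpt : IsCompact (closure (Ω : Set (Space N))) := hΩ.1.isCompact_closure
  choose! r G ν c h using hΩ.exists_chart hN
  obtain ⟨t, ht, hcov⟩ := hcpt.elim_nhds_subcover (fun p ↦ Metric.ball p (r p / 2))
    fun p hp ↦ Metric.ball_mem_nhds _ (by linarith [(h p hp).pos])
  obtain ⟨η, hη1, hη2, hη3, -, hη5⟩ := exists_smooth_partition (ι := t) hcpt.isClosed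
    (U := fun p ↦ Metric.ball (p : Space N) (r p / 2)) (fun _ ↦ Metric.isOpen_ball)
    (fun _ ↦ Metric.isBounded_ball) (by
      intro x hx
      obtain ⟨p, hp, hxp⟩ := mem_iUnion₂.1 (hcov hx)
      exact mem_iUnion.2 ⟨⟨p, hp⟩, hxp⟩)
  have hχ : ∀ p : t, ∃ χ : Space N → ℝ, ContDiff ℝ ∞ χ ∧ HasCompactSupport χ ∧
      tsupport χ ⊆ Metric.ball (p : Space N) (r p / 2) ∧ ∀ x ∈ tsupport (η p), χ x = 1 := fun p ↦
    exists_smooth_cutoff (isClosed_tsupport _) Metric.isOpen_ball Metric.isBounded_ball (hη3 p)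
  choose χ hχ1 hχ2 hχ3 hχ4 using hχ
  have hρ : ∀ p : t, ∃ ρ : Space N → ℝ, ∃ M, IsConeKernel ρ (ν p) (c p) M ∧ ∫ z, ρ z = 1 := by
    intro p
    have hG := (h p (ht p p.2)).isUpCone
    exact exists_isConeKernel hG.norm_eq hG.pos hG.le_one
  choose ρ M hρ1 hρ2 using hρ
  exact ⟨t, inferInstance, fun p ↦ p, fun p ↦ r p, fun p ↦ G p, fun p ↦ ν p, fun p ↦ c p, η, χ, ρ, M,
    fun p ↦ ⟨Ω.isOpen.measurableSet, h p (ht p p.2), hρ1 p, hρ2 p, hη1 p, hη2 p, hη3 p, hχ1 p,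
      hχ2 p, hχ3 p, hχ4 p⟩, fun x hx ↦ hη5 x (subset_closure hx)⟩

lemma IsApprox.of_eq_one {A : Set (Space N)} (hA : MeasurableSet A) {η : Space N → ℝ}
    {T : ℕ → (Space N → ℝ) → Space N → ℝ} (h : IsApprox A η T) (h1 : ∀ x ∈ A, η x = 1) :
    IsApprox A (fun _ ↦ 1) T := by
  refine ⟨h.contDiff, h.hasCompactSupport, h.bound, fun f hf ↦ (h.tendsto f hf).congr fun K ↦ ?_⟩
  exact lTwo_congr hA fun x hx ↦ by rw [h1 x hx]

lemma IsApprox.memLp {A : Set (Space N)} {η : Space N → ℝ}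
    {T : ℕ → (Space N → ℝ) → Space N → ℝ} (h : IsApprox A η T) {f : Space N → ℝ} (hf : IsHalf A f)
    (K : ℕ) : MemLp (T K f) 2 :=
  (h.contDiff K f hf).continuous.memLp_of_hasCompactSupport (h.hasCompactSupport K f hf)

/-- Approximation by test functions in `Ω`. -/
lemma IsBoundedLipschitzDomain.exists_approx_down (hN : N ≠ 0) {Ω : Opens (Space N)}
    (hΩ : IsBoundedLipschitzDomain Ω) : ∃ T : ℕ → (Space N → ℝ) → Space N → ℝ,
      IsApprox (Ω : Set (Space N)) (fun _ ↦ 1) T ∧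
      (∀ f, IsHalf (Ω : Set (Space N)) f → ∀ K, tsupport (T K f) ⊆ Ω) ∧
      ∀ e, ∃ C : ℝ≥0, ∀ f, IsHalf (Ω : Set (Space N)) f → hsq univ f ≠ ⊤ → ∀ K,
        DualBound (Ω : Set (Space N)) (T K f) e (C * hsq univ f) := by
  obtain ⟨ι, _, p, r, G, ν, c, η, χ, ρ, M, h, h1⟩ := hΩ.exists_localData hN
  have hA := fun i ↦ (h i).isApprox_down hN
  refine ⟨fun K f x ↦ ∑ i, localAvg (χ i) (η i) (ρ i) (-(c i / 4)) K f x,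
    (IsApprox.sum Finset.univ Ω.isOpen.measurableSet
      (fun i ↦ (h i).contDiff_left.continuous.measurable) hA).of_eq_one Ω.isOpen.measurableSet h1,
    fun f hf K x hx ↦ ?_, fun e ↦ ?_⟩
  · have hcl : IsClosed (⋃ i ∈ Finset.univ, tsupport (localAvg (χ i) (η i) (ρ i) (-(c i / 4)) K f)) :=
      isClosed_biUnion_finset fun _ _ ↦ isClosed_tsupport _
    have hsub : tsupport (fun x ↦ ∑ i, localAvg (χ i) (η i) (ρ i) (-(c i / 4)) K f x) ⊆
        ⋃ i ∈ Finset.univ, tsupport (localAvg (χ i) (η i) (ρ i) (-(c i / 4)) K f) := by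
      refine closure_minimal (fun y hy ↦ ?_) hcl
      by_contra hy'
      simp only [mem_iUnion, not_exists] at hy'
      exact hy (Finset.sum_eq_zero fun k hk ↦ image_eq_zero_of_notMem_tsupport (hy' k hk))
    obtain ⟨i, -, hi⟩ := mem_iUnion₂.1 (hsub hx)
    exact (h i).tsupport_down_subset hf.zero K hi
  · choose C hC using fun i ↦ (h i).exists_dualBound_down hN e
    refine ⟨Fintype.card ι * ∑ i, C i, fun f hf hfin K ↦ ?_⟩
    have := DualBound.sum Finset.univ (fun i ↦ (hA i).memLp hf K) fun i ↦ hC i f hf hfin K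
    rw [← Finset.sum_mul, ← mul_assoc] at this
    simpa using this

/-- Approximation by functions which are smooth up to the boundary. -/
lemma IsBoundedLipschitzDomain.exists_approx_up (hN : N ≠ 0) {Ω : Opens (Space N)}
    (hΩ : IsBoundedLipschitzDomain Ω) : ∃ T : ℕ → (Space N → ℝ) → Space N → ℝ,
      IsApprox (Ω : Set (Space N)) (fun _ ↦ 1) T ∧
      ∀ e, ∃ C : ℝ≥0, ∀ f, IsHalf (Ω : Set (Space N)) f → ∀ B,
        DualBound (Ω : Set (Space N)) f e B → ∀ K,
        DualBound (Ω : Set (Space N)) (T K f) e (C * (B + hsq Ω f)) := by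
  obtain ⟨ι, _, p, r, G, ν, c, η, χ, ρ, M, h, h1⟩ := hΩ.exists_localData hN
  have hA := fun i ↦ (h i).isApprox_up hN
  refine ⟨fun K f x ↦ ∑ i, localAvg (χ i) (η i) (ρ i) (c i / 4) K f x,
    (IsApprox.sum Finset.univ Ω.isOpen.measurableSet
      (fun i ↦ (h i).contDiff_left.continuous.measurable) hA).of_eq_one Ω.isOpen.measurableSet h1,
    fun e ↦ ?_⟩
  choose C hC using fun i ↦ (h i).exists_dualBound_up hN e
  refine ⟨Fintype.card ι * ∑ i, C i, fun f hf B hB K ↦ ?_⟩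
  have := DualBound.sum Finset.univ (fun i ↦ (hA i).memLp hf K) fun i ↦ hC i f hf B hB K
  rw [← Finset.sum_mul, ← mul_assoc] at this
  simpa using this

/-! ### The space `H^{1/2}(Ω)` in terms of functions -/

lemma measurable_toL2 {Ω : Opens (Space N)} (v : HHalf Ω) : Measurable (toL2 v) :=
  (Lp.stronglyMeasurable (toL2 v)).measurable

lemma enorm_sq_eq_hsq_toL2 {Ω : Opens (Space N)} (v : HHalf Ω) : ‖v‖ₑ ^ 2 = hsq Ω (toL2 v) := by
  have h1 : ‖v‖ ^ 2 = ‖toL2 v‖ ^ 2 + ‖(v : WithLp 2 (Lp ℝ 2 (vol Ω) ×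
      Lp ℝ 2 ((vol Ω).prod (vol Ω)))).snd‖ ^ 2 := WithLp.prod_norm_sq_eq_of_L2 _
  have h2 : ‖v‖ₑ ^ 2 = ‖toL2 v‖ₑ ^ 2 + ‖(v : WithLp 2 (Lp ℝ 2 (vol Ω) ×
      Lp ℝ 2 ((vol Ω).prod (vol Ω)))).snd‖ₑ ^ 2 := by
    simp only [← ofReal_norm]
    rw [← ENNReal.ofReal_pow (norm_nonneg _), ← ENNReal.ofReal_pow (norm_nonneg _),
      ← ENNReal.ofReal_pow (norm_nonneg _), h1, ENNReal.ofReal_add (by positivity) (by positivity)]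
  rw [h2, hsq, Lp.enorm_def, Lp.enorm_def, gag_eq_lintegral_diffQuot Ω.isOpen.measurableSet
    (measurable_toL2 v), ← eLpNorm_two_sq, eLpNorm_congr_ae v.2]
  rfl

lemma hsq_congr_ae {Ω : Opens (Space N)} {f g : Space N → ℝ} (hf : Measurable f)
    (hg : Measurable g) (h : f =ᵐ[vol Ω] g) : hsq Ω f = hsq Ω g := by
  have hΩ := Ω.isOpen.measurableSet
  rw [hsq, hsq, gag_eq_lintegral_diffQuot hΩ hf, gag_eq_lintegral_diffQuot hΩ hg, lTwo, lTwo,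
    eLpNorm_congr_ae h]
  congr 1
  refine lintegral_congr_ae ?_
  filter_upwards [diffQuot_congr Ω h] with p hp
  rw [hp]

/-- A representative of an element of `H^{1/2}(Ω)`, extended by zero outside `Ω`. -/
noncomputable def fn {Ω : Opens (Space N)} (v : HHalf Ω) : Space N → ℝ :=
  (Ω : Set (Space N)).indicator (toL2 v)

lemma fn_ae_eq {Ω : Opens (Space N)} (v : HHalf Ω) : fn v =ᵐ[vol Ω] toL2 v :=
  indicator_ae_eq_restrict Ω.isOpen.measurableSet

lemma measurable_fn {Ω : Opens (Space N)} (v : HHalf Ω) : Measurable (fn v) :=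
  (measurable_toL2 v).indicator Ω.isOpen.measurableSet

lemma fn_eq_zero {Ω : Opens (Space N)} (v : HHalf Ω) {x : Space N} (hx : x ∉ (Ω : Set (Space N))) :
    fn v x = 0 := indicator_of_notMem hx _

lemma enorm_sq_eq_hsq {Ω : Opens (Space N)} (v : HHalf Ω) : ‖v‖ₑ ^ 2 = hsq Ω (fn v) := by
  rw [enorm_sq_eq_hsq_toL2, hsq_congr_ae (measurable_toL2 v) (measurable_fn v) (fn_ae_eq v).symm]

lemma isHalf_fn {Ω : Opens (Space N)} (v : HHalf Ω) : IsHalf (Ω : Set (Space N)) (fn v) := by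
  refine ⟨measurable_fn v, fun x hx ↦ fn_eq_zero v hx, ?_⟩
  rw [← enorm_sq_eq_hsq]
  exact ENNReal.pow_ne_top (by simp)

lemma enorm_sq_eq_hsq_of_ae {Ω : Opens (Space N)} {v : HHalf Ω} {f : Space N → ℝ}
    (hf : Measurable f) (h : toL2 v =ᵐ[vol Ω] f) : ‖v‖ₑ ^ 2 = hsq Ω f := by
  rw [enorm_sq_eq_hsq_toL2, hsq_congr_ae (measurable_toL2 v) hf h]

lemma toL2_smooth {Ω : Opens (Space N)} {f : Space N → ℝ} (hf : ContDiff ℝ ∞ f)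
    (hc : HasCompactSupport f) : toL2 (smoothHHalf Ω f hf hc) =ᵐ[vol Ω] f := toL2_mkHHalf _ _ _ _

lemma enorm_smooth_sq {Ω : Opens (Space N)} {f : Space N → ℝ} (hf : ContDiff ℝ ∞ f)
    (hc : HasCompactSupport f) : ‖smoothHHalf Ω f hf hc‖ₑ ^ 2 = hsq Ω f :=
  enorm_sq_eq_hsq_of_ae hf.continuous.measurable (toL2_smooth hf hc)

lemma setIntegral_toL2_mul {Ω : Opens (Space N)} (v : HHalf Ω) (g : Space N → ℝ) :
    ∫ x in (Ω : Set (Space N)), toL2 v x * g x = ∫ x, fn v x * g x := by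
  rw [← integral_indicator Ω.isOpen.measurableSet]
  congr 1 with x
  by_cases hx : x ∈ (Ω : Set (Space N))
  · simp only [fn, indicator_of_mem hx]
  · rw [fn_eq_zero v hx, indicator_of_notMem hx, zero_mul]

end

section

variable {N : ℕ}

/-! ### Weak limits in Hilbert spaces -/

/-- If a bounded sequence in a subspace `D` of a Hilbert space `H` converges to `v` after applying
an injective operator, then it converges weakly to `v`, so `v` is in the closure of `D`. -/
lemma mem_topologicalClosure_of_bounded {H F : Type*} [NormedAddCommGroup H]
    [InnerProductSpace ℝ H] [CompleteSpace H] [NormedAddCommGroup F] [InnerProductSpace ℝ F]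
    [CompleteSpace F] (T : H →L[ℝ] F) (hT : Function.Injective T) (D : Submodule ℝ H) {x : ℕ → H}
    {v : H} (hx : ∀ n, x n ∈ D) {C : ℝ} (hC : ∀ n, ‖x n‖ ≤ C)
    (hlim : Filter.Tendsto (fun n ↦ T (x n)) Filter.atTop (nhds (T v))) :
    v ∈ D.topologicalClosure := by
  rw [← Submodule.orthogonal_orthogonal_eq_closure, Submodule.mem_orthogonal]
  intro y hy
  have hC0 : 0 ≤ C := (norm_nonneg _).trans (hC 0)
  -- as `T` is injective, its adjoint has dense range, and vectors of that range test convergence by `T`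
  have hdense : (T.adjoint.range).topologicalClosure = ⊤ := by
    rw [Submodule.topologicalClosure_eq_top_iff, ContinuousLinearMap.orthogonal_range,
      ContinuousLinearMap.adjoint_adjoint, LinearMap.ker_eq_bot]
    exact hT
  have hyc : y ∈ closure (T.adjoint.range : Set H) := by
    rw [← Submodule.topologicalClosure_coe, hdense]
    trivial
  -- `y` is orthogonal to all `x n`, and is within `ε` of a vector which tests the convergence
  have key : ∀ ε > 0, |inner ℝ y v| ≤ (‖v‖ + C) * ε := by
    intro ε hε
    obtain ⟨_, ⟨w, rfl⟩, hw⟩ := Metric.mem_closure_iff.1 hyc ε hε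
    rw [dist_eq_norm] at hw
    have hz : ‖T.adjoint w - y‖ ≤ ε := by
      rw [norm_sub_rev]
      exact hw.le
    have h1 : ∀ n, |inner ℝ (T.adjoint w) (x n)| ≤ C * ε := by
      intro n
      have h0 : inner ℝ y (x n) = 0 := by
        rw [real_inner_comm]
        exact (Submodule.mem_orthogonal D y).1 hy _ (hx n)
      have h2 : inner ℝ (T.adjoint w) (x n) = inner ℝ (T.adjoint w - y) (x n) := by
        rw [inner_sub_left, h0, sub_zero]
      rw [h2]
      refine (abs_real_inner_le_norm _ _).trans ?_
      rw [mul_comm]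
      exact mul_le_mul (hC n) hz (norm_nonneg _) hC0
    have h2 : Filter.Tendsto (fun n ↦ inner ℝ (T.adjoint w) (x n)) Filter.atTop
        (nhds (inner ℝ (T.adjoint w) v)) := by
      simp only [ContinuousLinearMap.adjoint_inner_left]
      exact Filter.Tendsto.inner tendsto_const_nhds hlim
    have h3 : |inner ℝ (T.adjoint w) v| ≤ C * ε :=
      le_of_tendsto h2.abs (Filter.Eventually.of_forall h1)
    have h4 : inner ℝ y v = inner ℝ (T.adjoint w) v - inner ℝ (T.adjoint w - y) v := by
      rw [inner_sub_left, sub_sub_cancel]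
    have h5 : |inner ℝ (T.adjoint w - y) v| ≤ ‖v‖ * ε := by
      refine (abs_real_inner_le_norm _ _).trans ?_
      rw [mul_comm]
      exact mul_le_mul_of_nonneg_left hz (norm_nonneg _)
    rw [h4]
    refine (abs_sub _ _).trans ?_
    linarith
  by_contra hne
  have hpos : 0 < |inner ℝ y v| := abs_pos.2 hne
  have hD : 0 < ‖v‖ + C + 1 := by positivity
  have h6 := key (|inner ℝ y v| / (2 * (‖v‖ + C + 1))) (by positivity)
  rw [mul_div_assoc', le_div_iff₀ (by positivity)] at h6
  nlinarith [norm_nonneg v]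

/-! ### `H^{1/2}(Ω)` as a Hilbert space -/

variable {Ω : Opens (Space N)}

variable (Ω) in
lemma isClosed_HHalf : IsClosed (HHalf Ω : Set (WithLp 2 (Lp ℝ 2 (vol Ω) ×
    Lp ℝ 2 ((vol Ω).prod (vol Ω))))) := by
  refine IsSeqClosed.isClosed fun w w₀ hw hlim ↦ ?_
  change w₀.snd =ᵐ[(vol Ω).prod (vol Ω)] diffQuot w₀.fst
  have h1 : Filter.Tendsto (fun n ↦ (w n).fst) Filter.atTop (nhds w₀.fst) :=
    ((WithLp.fstL 2 ℝ _ _).continuous.tendsto w₀).comp hlim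
  have h2 : Filter.Tendsto (fun n ↦ (w n).snd) Filter.atTop (nhds w₀.snd) :=
    ((WithLp.sndL 2 ℝ _ _).continuous.tendsto w₀).comp hlim
  obtain ⟨a, ha, ha'⟩ := (tendstoInMeasure_of_tendsto_Lp h1).exists_seq_tendsto_ae
  obtain ⟨b, hb, hb'⟩ := (tendstoInMeasure_of_tendsto_Lp
    (h2.comp ha.tendsto_atTop)).exists_seq_tendsto_ae
  have h3 : ∀ᵐ p ∂((vol Ω).prod (vol Ω)), ∀ n, (w n).snd p = diffQuot (w n).fst p :=
    ae_all_iff.2 fun n ↦ hw n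
  filter_upwards [hb', h3, Measure.quasiMeasurePreserving_fst.ae ha',
    Measure.quasiMeasurePreserving_snd.ae ha'] with p hp hp3 hp1 hp2
  refine tendsto_nhds_unique hp ?_
  have h4 := ((hp1.sub hp2).div_const (‖p.1 - p.2‖ ^ (((N : ℝ) + 1) / 2))).comp hb.tendsto_atTop
  refine h4.congr fun n ↦ ?_
  simp only [Function.comp_apply, hp3, diffQuot]

instance : CompleteSpace (HHalf Ω) := (isClosed_HHalf Ω).completeSpace_coe

variable (Ω) in
/-- The inclusion of `H^{1/2}(Ω)` in `L²(Ω)`, as a continuous linear map. -/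
noncomputable def toL2L : HHalf Ω →L[ℝ] Lp ℝ 2 (vol Ω) :=
  (WithLp.fstL 2 ℝ _ _).comp (HHalf Ω).subtypeL

lemma toL2L_injective : Function.Injective (toL2L Ω) := toL2_injective

/-- The functional `v ↦ ∫_Ω g v` on `H^{1/2}(Ω)`, for `g` in `L²(Ω)`. -/
noncomputable def dualOfLp {g : Space N → ℝ} (hg : MemLp g 2 (vol Ω)) : StrongDual ℝ (HHalf Ω) :=
  (innerSL ℝ (hg.toLp g)).comp (toL2L Ω)

lemma dualOfLp_apply {g : Space N → ℝ} (hg : MemLp g 2 (vol Ω)) (v : HHalf Ω) :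
    dualOfLp hg v = ∫ x in (Ω : Set (Space N)), toL2 v x * g x := by
  change inner ℝ (hg.toLp g) (toL2 v) = _
  rw [L2.inner_def]
  refine integral_congr_ae ?_
  filter_upwards [hg.coeFn_toLp] with x hx
  rw [hx]
  rfl

lemma memLp_two_of_smooth {f : Space N → ℝ} (hf : ContDiff ℝ ∞ f) (hc : HasCompactSupport f) :
    MemLp f 2 (vol Ω) := (hf.continuous.memLp_of_hasCompactSupport hc).restrict _

lemma memLp_fderiv_vol {f : Space N → ℝ} (hf : ContDiff ℝ ∞ f) (hc : HasCompactSupport f)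
    (e : Space N) : MemLp (fun x ↦ fderiv ℝ f x e) 2 (vol Ω) := (memLp_fderiv_apply hf hc e).restrict _

variable (Ω) in
/-- The inclusion of `𝓓(Ω)` in `H^{1/2}(Ω)`, as a linear map. -/
noncomputable def testLin : 𝓓(Ω, ℝ) →ₗ[ℝ] HHalf Ω where
  toFun := testHHalf
  map_add' φ ψ := by
    apply toL2_injective
    apply Lp.ext
    have h : toL2 (testHHalf φ + testHHalf ψ) =ᵐ[vol Ω] toL2 (testHHalf φ) + toL2 (testHHalf ψ) :=
      Lp.coeFn_add _ _
    filter_upwards [h, toL2_smooth φ.contDiff φ.hasCompactSupport,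
      toL2_smooth ψ.contDiff ψ.hasCompactSupport,
      toL2_smooth (φ + ψ).contDiff (φ + ψ).hasCompactSupport] with x h0 h1 h2 h3
    rw [h0, Pi.add_apply]
    exact h3.trans (congrArg₂ (· + ·) h1 h2).symm
  map_smul' a φ := by
    apply toL2_injective
    apply Lp.ext
    have h : toL2 (a • testHHalf φ) =ᵐ[vol Ω] a • toL2 (testHHalf φ) := Lp.coeFn_smul _ _
    filter_upwards [h, toL2_smooth φ.contDiff φ.hasCompactSupport,
      toL2_smooth (a • φ).contDiff (a • φ).hasCompactSupport] with x h0 h1 h3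
    rw [RingHom.id_apply, h0, Pi.smul_apply]
    exact h3.trans (congrArg (a • ·) h1).symm

/-- A smooth function with compact support in `Ω`, as a test function. -/
def mkTest {f : Space N → ℝ} (hf : ContDiff ℝ ∞ f) (hc : HasCompactSupport f)
    (hs : tsupport f ⊆ Ω) : 𝓓(Ω, ℝ) := ⟨f, hf, hc, hs⟩

lemma norm_le_of_enorm_sq_le {E : Type*} [SeminormedAddCommGroup E] {x : E} {M : ℝ≥0∞} (hM : M ≠ ⊤)
    (h : ‖x‖ₑ ^ 2 ≤ M) : ‖x‖ ≤ √M.toReal := by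
  apply Real.le_sqrt_of_sq_le
  have := ENNReal.toReal_mono hM h
  rwa [ENNReal.toReal_pow, toReal_enorm] at this

lemma IsApprox.tendsto_toL2 {T : ℕ → (Space N → ℝ) → Space N → ℝ}
    (h : IsApprox (Ω : Set (Space N)) (fun _ ↦ 1) T) (v : HHalf Ω) :
    Filter.Tendsto (fun K ↦ toL2 (smoothHHalf Ω (T K (fn v)) (h.contDiff K _ (isHalf_fn v))
      (h.hasCompactSupport K _ (isHalf_fn v)))) Filter.atTop (nhds (toL2 v)) := by
  rw [Lp.tendsto_Lp_iff_tendsto_eLpNorm']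
  refine (h.tendsto _ (isHalf_fn v)).congr fun K ↦ ?_
  refine eLpNorm_congr_ae ?_
  filter_upwards [toL2_smooth (Ω := Ω) (h.contDiff K _ (isHalf_fn v))
    (h.hasCompactSupport K _ (isHalf_fn v)), fn_ae_eq v] with x h1 h2
  rw [Pi.sub_apply, h1, h2, one_mul]

lemma IsApprox.exists_norm_le {T : ℕ → (Space N → ℝ) → Space N → ℝ}
    (h : IsApprox (Ω : Set (Space N)) (fun _ ↦ 1) T) (v : HHalf Ω) :
    ∃ C : ℝ, ∀ K, ‖smoothHHalf Ω (T K (fn v)) (h.contDiff K _ (isHalf_fn v))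
      (h.hasCompactSupport K _ (isHalf_fn v))‖ ≤ C := by
  obtain ⟨C, hC⟩ := h.bound
  refine ⟨_, fun K ↦ norm_le_of_enorm_sq_le (M := C * hsq Ω (fn v))
    (ENNReal.mul_ne_top ENNReal.coe_ne_top (isHalf_fn v).hsq_ne_top) ?_⟩
  rw [enorm_smooth_sq]
  exact hC K _ (isHalf_fn v)

/-- `𝓓(Ω)` is dense in `H^{1/2}(Ω)`. -/
lemma IsBoundedLipschitzDomain.denseRange_testLin (hN : N ≠ 0) (hΩ : IsBoundedLipschitzDomain Ω) :
    DenseRange (testLin Ω) := by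
  obtain ⟨T, hT, hs, -⟩ := hΩ.exists_approx_down hN
  intro v
  obtain ⟨C, hC⟩ := hT.exists_norm_le v
  have := mem_topologicalClosure_of_bounded (toL2L Ω) toL2L_injective (testLin Ω).range
    (fun K ↦ ⟨mkTest (hT.contDiff K _ (isHalf_fn v)) (hT.hasCompactSupport K _ (isHalf_fn v))
      (hs _ (isHalf_fn v) K), rfl⟩) hC (hT.tendsto_toL2 v)
  exact this

/-! ### Dual bounds and the derivatives in the dual space -/

/-- By density of `𝓓(Ω)`, a derivative in the dual space is determined by its values on test functions. -/
lemma IsDualDeriv.unique (hd : DenseRange (testLin Ω)) {v : HHalf Ω} {i : Fin N}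
    {F F' : StrongDual ℝ (HHalf Ω)} (hF : IsDualDeriv v i F) (hF' : IsDualDeriv v i F') :
    F = F' := by
  apply DFunLike.coe_injective
  refine hd.equalizer F.continuous F'.continuous (funext fun φ ↦ ?_)
  exact (hF φ).trans (hF' φ).symm

lemma IsDualDeriv.dualBound {v : HHalf Ω} {i : Fin N} {F : StrongDual ℝ (HHalf Ω)}
    (hF : IsDualDeriv v i F) :
    DualBound (Ω : Set (Space N)) (fn v) (EuclideanSpace.single i 1) (‖F‖ₑ ^ 2) := by
  intro φ hφ hc hs
  have h := hF (mkTest hφ hc hs)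
  have h1 : F (testHHalf (mkTest hφ hc hs)) =
      -∫ x, fn v x * fderiv ℝ φ x (EuclideanSpace.single i 1) := by
    rw [h, ← setIntegral_toL2_mul]
    rfl
  rw [← enorm_neg, ← h1, ← enorm_smooth_sq hφ hc, ← mul_pow]
  gcongr
  exact F.le_opENorm _

/-- A functional which is bounded on test functions for the norm of `H^{1/2}(Ω)` extends to the whole
space, because `𝓓(Ω)` is dense. -/
lemma DualBound.exists_isDualDeriv (hd : DenseRange (testLin Ω)) {v : HHalf Ω} {i : Fin N}
    {M : ℝ≥0∞} (hM : M ≠ ⊤)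
    (h : DualBound (Ω : Set (Space N)) (fn v) (EuclideanSpace.single i 1) M) :
    ∃ F : StrongDual ℝ (HHalf Ω), IsDualDeriv v i F ∧ ‖F‖ ≤ √M.toReal := by
  let e : Space N := EuclideanSpace.single i 1
  let L : 𝓓(Ω, ℝ) →ₗ[ℝ] ℝ :=
    { toFun := fun φ ↦ -∫ x in (Ω : Set (Space N)), toL2 v x * fderiv ℝ φ x e
      map_add' := fun φ ψ ↦ by
        rw [← neg_add, ← integral_add (integrable_mul_fderiv v i φ) (integrable_mul_fderiv v i ψ)]
        congr 2
        ext x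
        have : fderiv ℝ (φ + ψ : 𝓓(Ω, ℝ)) x e = fderiv ℝ φ x e + fderiv ℝ ψ x e := by
          rw [FunLike.coe_add, fderiv_add (φ.contDiff.differentiable (by simp) x)
            (ψ.contDiff.differentiable (by simp) x)]
          rfl
        rw [this, mul_add]
      map_smul' := fun a φ ↦ by
        rw [RingHom.id_apply, smul_neg, smul_eq_mul, ← integral_const_mul]
        congr 2
        ext x
        have : fderiv ℝ (a • φ : 𝓓(Ω, ℝ)) x e = a * fderiv ℝ φ x e := by
          rw [FunLike.coe_smul, fderiv_const_smul (φ.contDiff.differentiable (by simp) x)]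
          rfl
        rw [this]
        ring }
  have hL : ∀ φ, ‖L φ‖ ≤ √M.toReal * ‖testLin Ω φ‖ := by
    intro φ
    have h1 := h φ φ.contDiff φ.hasCompactSupport φ.tsupport_subset
    rw [← enorm_smooth_sq φ.contDiff φ.hasCompactSupport, ← setIntegral_toL2_mul, ← enorm_neg] at h1
    have h2 : ‖L φ‖ₑ ^ 2 ≤ M * ‖testLin Ω φ‖ₑ ^ 2 := h1
    have h3 := norm_le_of_enorm_sq_le (ENNReal.mul_ne_top hM (by simp)) h2
    rwa [ENNReal.toReal_mul, Real.sqrt_mul ENNReal.toReal_nonneg, ENNReal.toReal_pow, toReal_enorm,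
      Real.sqrt_sq (norm_nonneg _)] at h3
  refine ⟨L.extendOfNorm (testLin Ω), fun φ ↦ ?_,
    LinearMap.opNorm_extendOfNorm_le hd (Real.sqrt_nonneg _) hL⟩
  exact LinearMap.extendOfNorm_eq hd ⟨_, hL⟩ φ

/-! ### Density in `E(∇; Ω)` -/

/-- The version of `mem_topologicalClosure_of_bounded` for subspaces of a closed subspace of a
product of Hilbert spaces, on which the first component determines the others. -/
lemma mem_closure_of_bounded_pair {H F ι : Type*} [Fintype ι] [NormedAddCommGroup H]
    [InnerProductSpace ℝ H] [CompleteSpace H] [NormedAddCommGroup F] [InnerProductSpace ℝ F]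
    [CompleteSpace F] (T : H →L[ℝ] F) (hT : Function.Injective T)
    (R D : Submodule ℝ (H × (ι → H))) (hR : IsClosed (R : Set (H × (ι → H)))) (hD : D ≤ R)
    (hu : ∀ a ∈ R, a.1 = 0 → a = 0) {x : ℕ → H × (ι → H)} {v : H × (ι → H)} (hx : ∀ n, x n ∈ D)
    (hv : v ∈ R) {C : ℝ} (h1 : ∀ n, ‖(x n).1‖ ≤ C) (h2 : ∀ n i, ‖(x n).2 i‖ ≤ C)
    (hlim : Filter.Tendsto (fun n ↦ T (x n).1) Filter.atTop (nhds (T v.1))) :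
    v ∈ closure (D : Set (H × (ι → H))) := by
  let W := WithLp 2 (H × PiLp 2 fun _ : ι ↦ H)
  let e : W →L[ℝ] H × (ι → H) := (WithLp.fstL 2 ℝ _ _).prod
    ((PiLp.continuousLinearEquiv 2 ℝ fun _ : ι ↦ H).toContinuousLinearMap.comp
      (WithLp.sndL 2 ℝ _ _))
  let s : H × (ι → H) → W := fun y ↦ WithLp.toLp 2 (y.1, WithLp.toLp 2 y.2)
  have hes : ∀ y, e (s y) = y := fun y ↦ rfl
  let R' : Submodule ℝ W := R.comap e.toLinearMap
  have hR' : IsClosed (R' : Set W) := hR.preimage e.continuous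
  have : CompleteSpace R' := hR'.completeSpace_coe
  let T' : R' →L[ℝ] F := T.comp ((WithLp.fstL 2 ℝ _ _).comp R'.subtypeL)
  have hT' : Function.Injective T' := by
    rw [injective_iff_map_eq_zero]
    intro a ha
    have ha1 : a.1.fst = 0 := by
      apply hT
      rw [map_zero]
      exact ha
    have ha2 := hu (e a.1) a.2 ha1
    apply Subtype.ext
    apply WithLp.ofLp_injective
    refine Prod.ext ha1 (PiLp.ext fun i ↦ ?_)
    exact congrFun (congrArg Prod.snd ha2) i
  have hs : ∀ n, ‖s (x n)‖ ≤ C + Fintype.card ι * C := by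
    intro n
    have hC : 0 ≤ C := (norm_nonneg _).trans (h1 n)
    have h3 : ‖(WithLp.toLp 2 (x n).2 : PiLp 2 fun _ : ι ↦ H)‖ ≤ Fintype.card ι * C := by
      have h5 : ‖(WithLp.toLp 2 (x n).2 : PiLp 2 fun _ : ι ↦ H)‖ ≤ ∑ i, ‖(x n).2 i‖ := by
        refine le_of_sq_le_sq ?_ (Finset.sum_nonneg fun _ _ ↦ norm_nonneg _)
        rw [PiLp.norm_sq_eq_of_L2]
        exact Finset.sum_sq_le_sq_sum_of_nonneg fun _ _ ↦ norm_nonneg _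
      refine h5.trans ((Finset.sum_le_sum fun i _ ↦ h2 n i).trans ?_)
      rw [Finset.sum_const, Finset.card_univ, nsmul_eq_mul]
    refine le_of_sq_le_sq ?_ (by positivity)
    have h4 := WithLp.prod_norm_sq_eq_of_L2 (s (x n))
    have h5 : ‖(s (x n)).fst‖ ≤ C := h1 n
    have h6 : ‖(s (x n)).snd‖ ≤ Fintype.card ι * C := h3
    rw [h4]
    nlinarith [norm_nonneg (s (x n)).fst, norm_nonneg (s (x n)).snd,
      mul_nonneg hC (mul_nonneg (Nat.cast_nonneg (α := ℝ) (Fintype.card ι)) hC)]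
  let e' : R' →L[ℝ] H × (ι → H) := e.comp R'.subtypeL
  let D' : Submodule ℝ R' := D.comap (e' : R' →ₗ[ℝ] H × (ι → H))
  have hmem := mem_topologicalClosure_of_bounded T' hT' D'
    (x := fun n ↦ (⟨s (x n), hD (hx n)⟩ : R')) (v := (⟨s v, hv⟩ : R')) (fun n ↦ hx n) hs hlim
  have h3 := map_mem_closure e'.continuous hmem
    (t := (D : Set (H × (ι → H)))) fun a ha ↦ ha
  exact h3

variable (Ω) in
/-- The graph of the gradient: the tuples of `v ∈ H^{1/2}(Ω)` and of the Riesz representatives of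
its derivatives. -/
noncomputable def gradGraph : Submodule ℝ (HHalf Ω × (Fin N → HHalf Ω)) where
  carrier := {w | ∀ i, IsDualDeriv w.1 i (innerSL ℝ (w.2 i))}
  zero_mem' := fun i ↦ by
    have : innerSL ℝ ((0 : HHalf Ω × (Fin N → HHalf Ω)).2 i) = (0 : StrongDual ℝ (HHalf Ω)) :=
      map_zero _
    rw [this]
    exact .zero i
  add_mem' := fun {a b} ha hb i ↦ by
    have : innerSL ℝ ((a + b).2 i) = innerSL ℝ (a.2 i) + innerSL ℝ (b.2 i) := map_add _ _ _
    rw [this]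
    exact (ha i).add (hb i)
  smul_mem' := fun c {a} ha i ↦ by
    have : innerSL ℝ ((c • a).2 i) = c • innerSL ℝ (a.2 i) :=
      ContinuousLinearMap.ext fun x ↦ real_inner_smul_left (a.2 i) x c
    rw [this]
    exact (ha i).smul c

variable (Ω) in
lemma isClosed_gradGraph : IsClosed (gradGraph Ω : Set (HHalf Ω × (Fin N → HHalf Ω))) := by
  have : (gradGraph Ω : Set (HHalf Ω × (Fin N → HHalf Ω))) =
      ⋂ (i : Fin N) (φ : 𝓓(Ω, ℝ)), {w | inner ℝ (w.2 i) (testHHalf φ) =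
        -dualOfLp (memLp_fderiv_vol φ.contDiff φ.hasCompactSupport (EuclideanSpace.single i 1))
          w.1} := by
    ext w
    simp only [mem_iInter, dualOfLp_apply]
    rfl
  rw [this]
  refine isClosed_iInter fun i ↦ isClosed_iInter fun φ ↦ isClosed_eq ?_ ?_
  · have h1 : Continuous fun w : HHalf Ω × (Fin N → HHalf Ω) ↦ w.2 i := by fun_prop
    exact h1.inner continuous_const
  · exact ((ContinuousLinearMap.continuous _).comp continuous_fst).neg

lemma EGrad.norm_le_of_isDualDeriv (w : EGrad Ω) {F : Fin N → StrongDual ℝ (HHalf Ω)}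
    (h : ∀ i, IsDualDeriv (EGrad.incl Ω w) i (F i)) :
    ‖w‖ ≤ ‖EGrad.incl Ω w‖ + ∑ i, ‖F i‖ := by
  rw [EGrad.norm_def]
  gcongr with i
  exact dualDerivNorm_le (h i)

lemma norm_innerSL (y : HHalf Ω) : ‖(innerSL ℝ y : StrongDual ℝ (HHalf Ω))‖ = ‖y‖ :=
  innerSL_apply_norm ℝ y

/-- The norm of `E(∇; Ω)` involves the infimum of the norms of the functionals representing a
derivative; the summand `1` allows for a functional which does not attain it. -/
lemma exists_mem_gradGraph (v : EGrad Ω) : ∃ y : Fin N → HHalf Ω,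
    (EGrad.incl Ω v, y) ∈ gradGraph Ω ∧ ∀ i, ‖y i‖ ≤ ‖v‖ + 1 := by
  choose F hF hF' using fun i ↦ exists_lt_dualDerivNorm v.incl_mem i one_pos
  let y : Fin N → HHalf Ω := fun i ↦ (InnerProductSpace.toDual ℝ (HHalf Ω)).symm (F i)
  have hy : ∀ i, innerSL ℝ (y i) = F i := fun i ↦
    (InnerProductSpace.toDual ℝ (HHalf Ω)).apply_symm_apply (F i)
  refine ⟨y, fun i ↦ ?_, fun i ↦ ?_⟩
  · change IsDualDeriv (EGrad.incl Ω v) i (innerSL ℝ (y i))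
    rw [hy]
    exact hF i
  · rw [← norm_innerSL, hy, EGrad.norm_def]
    have h1 := Finset.single_le_sum (f := fun i ↦ dualDerivNorm (EGrad.incl Ω v) i)
      (fun i _ ↦ dualDerivNorm_nonneg _ i) (Finset.mem_univ i)
    have h2 : 0 ≤ ‖EGrad.incl Ω v‖ := norm_nonneg _
    linarith [hF' i]

lemma norm_add_sum_le {H : Type*} [NormedAddCommGroup H] (d : H × (Fin N → H)) :
    ‖d.1‖ + ∑ i, ‖d.2 i‖ ≤ (N + 1) * ‖d‖ := by
  have h4 := Finset.sum_le_sum fun i (_ : i ∈ Finset.univ) ↦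
    (norm_le_pi_norm d.2 i).trans (norm_snd_le d)
  rw [Finset.sum_const, Finset.card_univ, Fintype.card_fin, nsmul_eq_mul] at h4
  linarith [norm_fst_le d]

lemma EGrad.norm_le_of_mem_gradGraph {d : HHalf Ω × (Fin N → HHalf Ω)} (hd : d ∈ gradGraph Ω)
    {w : EGrad Ω} (hw : EGrad.incl Ω w = d.1) : ‖w‖ ≤ (N + 1) * ‖d‖ := by
  have h1 := EGrad.norm_le_of_isDualDeriv w (F := fun i ↦ innerSL ℝ (d.2 i)) fun i ↦ by
    rw [hw]
    exact hd i
  simp only [hw, norm_innerSL] at h1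
  exact h1.trans (norm_add_sum_le d)

/-- An element of `E(∇; Ω)` is in the closure of the subspace `P` if it is a limit in `L²(Ω)` of a
sequence in `P` which is bounded in `E(∇; Ω)`. -/
lemma EGrad.mem_closure_of_bounded (hd : DenseRange (testLin Ω)) (P : Submodule ℝ (EGrad Ω))
    {x : ℕ → EGrad Ω} {v : EGrad Ω} (hx : ∀ n, x n ∈ P) {C : ℝ} (hC : ∀ n, ‖x n‖ ≤ C)
    (hlim : Filter.Tendsto (fun n ↦ toL2 (EGrad.incl Ω (x n))) Filter.atTop
      (nhds (toL2 (EGrad.incl Ω v)))) : v ∈ closure (P : Set (EGrad Ω)) := by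
  choose y hy hy' using fun n ↦ exists_mem_gradGraph (x n)
  obtain ⟨y₀, hy₀, -⟩ := exists_mem_gradGraph v
  let D : Submodule ℝ (HHalf Ω × (Fin N → HHalf Ω)) :=
    gradGraph Ω ⊓ (P.map (EGrad.incl Ω)).comap (LinearMap.fst ℝ _ _)
  have hmem := mem_closure_of_bounded_pair (toL2L Ω) toL2L_injective (gradGraph Ω) D
    (isClosed_gradGraph Ω) inf_le_left (fun a ha ha1 ↦ by
      refine Prod.ext ha1 (funext fun i ↦ ?_)
      have h1 := ha i
      rw [ha1] at h1
      have h2 := h1.unique hd (.zero i)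
      exact inner_self_eq_zero (𝕜 := ℝ).1 (DFunLike.congr_fun h2 (a.2 i)))
    (x := fun n ↦ (EGrad.incl Ω (x n), y n)) (v := (EGrad.incl Ω v, y₀))
    (fun n ↦ ⟨hy n, x n, hx n, rfl⟩) hy₀ (C := C + 1) (fun n ↦ by
      have h1 := Finset.sum_nonneg fun i (_ : i ∈ Finset.univ) ↦
        dualDerivNorm_nonneg (EGrad.incl Ω (x n)) i
      have h2 := hC n
      rw [EGrad.norm_def] at h2
      change ‖EGrad.incl Ω (x n)‖ ≤ _
      linarith) (fun n i ↦ (hy' n i).trans (by linarith [hC n])) hlim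
  rw [Metric.mem_closure_iff] at hmem ⊢
  intro ε hε
  have hN : (0 : ℝ) < N + 1 := by positivity
  obtain ⟨d, ⟨hd1, p, hp, hpd⟩, hdist⟩ := hmem (ε / (N + 1)) (by positivity)
  refine ⟨p, hp, ?_⟩
  have hpd' : EGrad.incl Ω p = d.1 := hpd
  rw [dist_eq_norm] at hdist ⊢
  have hsub := (gradGraph Ω).sub_mem hy₀ hd1
  have hvp : EGrad.incl Ω (v - p) = ((EGrad.incl Ω v, y₀) - d).1 := by
    rw [map_sub, hpd']
    rfl
  have h1 := EGrad.norm_le_of_mem_gradGraph hsub hvp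
  have h5 := (lt_div_iff₀ hN).1 hdist
  linarith

end

section

variable {N : ℕ} {Ω : Opens (Space N)}

/-! ### The inclusions of `𝓓(Ω̄)` and of `H^{1/2}_{00}(Ω)` in `E(∇; Ω)` -/

lemma setIntegral_toL2_smooth_mul {f : Space N → ℝ} (hf : ContDiff ℝ ∞ f)
    (hc : HasCompactSupport f) (g : Space N → ℝ) :
    ∫ x in (Ω : Set (Space N)), toL2 (smoothHHalf Ω f hf hc) x * g x =
      ∫ x in (Ω : Set (Space N)), f x * g x := by
  refine integral_congr_ae ?_
  filter_upwards [toL2_smooth (Ω := Ω) hf hc] with x hx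
  rw [hx]

lemma integral_mul_fderiv_eq_neg {f g : Space N → ℝ} (hf : ContDiff ℝ ∞ f)
    (hcf : HasCompactSupport f) (hg : ContDiff ℝ ∞ g) (hcg : HasCompactSupport g) (e : Space N) :
    ∫ x, f x * fderiv ℝ g x e = -∫ x, g x * fderiv ℝ f x e := by
  have m1 := hf.continuous.memLp_of_hasCompactSupport (p := 2) (μ := volume) hcf
  have m2 := hg.continuous.memLp_of_hasCompactSupport (p := 2) (μ := volume) hcg
  rw [integral_mul_fderiv_eq_neg_fderiv_mul_of_integrable]
  · simp only [mul_comm]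
  · exact (memLp_fderiv_apply hf hcf e).integrable_mul m2
  · exact m1.integrable_mul (memLp_fderiv_apply hg hcg e)
  · exact m1.integrable_mul m2
  · exact fun x _ ↦ hf.differentiable (by simp) x
  · exact fun x _ ↦ hg.differentiable (by simp) x

/-- The derivative of a smooth function is given by the functional `w ↦ ∫_Ω w ∂ᵢf`. -/
lemma isDualDeriv_smooth {f : Space N → ℝ} (hf : ContDiff ℝ ∞ f) (hc : HasCompactSupport f)
    (i : Fin N) : IsDualDeriv (smoothHHalf Ω f hf hc) i
      (dualOfLp (memLp_fderiv_vol hf hc (EuclideanSpace.single i 1))) := by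
  intro φ
  rw [dualOfLp_apply]
  have h1 := setIntegral_toL2_smooth_mul (Ω := Ω) φ.contDiff φ.hasCompactSupport
    fun x ↦ fderiv ℝ f x (EuclideanSpace.single i 1)
  have h0 : ∀ x ∉ (Ω : Set (Space N)), φ x = 0 := fun x hx ↦
    image_eq_zero_of_notMem_tsupport fun h ↦ hx (φ.tsupport_subset h)
  have h0' : ∀ x ∉ (Ω : Set (Space N)), fderiv ℝ φ x (EuclideanSpace.single i 1) = 0 := fun x hx ↦
    image_eq_zero_of_notMem_tsupport (f := fun x ↦ fderiv ℝ φ x (EuclideanSpace.single i 1))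
      fun h ↦ hx (φ.tsupport_subset (tsupport_fderiv_apply_subset' _ h))
  refine h1.trans ?_
  rw [setIntegral_toL2_smooth_mul,
    setIntegral_eq_integral_of_forall_compl_eq_zero fun x hx ↦ by rw [h0 x hx, zero_mul],
    setIntegral_eq_integral_of_forall_compl_eq_zero fun x hx ↦ by rw [h0' x hx, mul_zero],
    integral_mul_fderiv_eq_neg hf hc φ.contDiff φ.hasCompactSupport, neg_neg]

lemma smoothHHalf_mem_EGradSub {f : Space N → ℝ} (hf : ContDiff ℝ ∞ f) (hc : HasCompactSupport f) :
    smoothHHalf Ω f hf hc ∈ EGradSub Ω := fun i ↦ ⟨_, isDualDeriv_smooth hf hc i⟩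

variable (Ω) in
/-- The restriction to `Ω` of a smooth compactly supported function, in `E(∇; Ω)`. -/
noncomputable def smoothEGrad {f : Space N → ℝ} (hf : ContDiff ℝ ∞ f) (hc : HasCompactSupport f) :
    EGrad Ω := (⟨smoothHHalf Ω f hf hc, smoothHHalf_mem_EGradSub hf hc⟩ : EGradSub Ω)

lemma EGrad.incl_injective : Function.Injective (EGrad.incl Ω) := Subtype.val_injective

lemma EGrad.ext_ae {v w : EGrad Ω} (h : toL2 (EGrad.incl Ω v) =ᵐ[vol Ω] toL2 (EGrad.incl Ω w)) :
    v = w := EGrad.incl_injective (toL2_injective (Lp.ext h))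

lemma toL2_smoothEGrad {f : Space N → ℝ} (hf : ContDiff ℝ ∞ f) (hc : HasCompactSupport f) :
    toL2 (EGrad.incl Ω (smoothEGrad Ω hf hc)) =ᵐ[vol Ω] f := toL2_smooth hf hc

lemma toL2_add (v w : HHalf Ω) : toL2 (v + w) =ᵐ[vol Ω] fun x ↦ toL2 v x + toL2 w x :=
  Lp.coeFn_add _ _

lemma toL2_smul (a : ℝ) (v : HHalf Ω) : toL2 (a • v) =ᵐ[vol Ω] fun x ↦ a * toL2 v x :=
  Lp.coeFn_smul _ _

lemma smoothEGrad_add {f g : Space N → ℝ} (hf : ContDiff ℝ ∞ f) (hc : HasCompactSupport f)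
    (hg : ContDiff ℝ ∞ g) (hcg : HasCompactSupport g) :
    smoothEGrad Ω hf hc + smoothEGrad Ω hg hcg = smoothEGrad Ω (hf.add hg) (hc.add hcg) := by
  apply EGrad.ext_ae
  rw [map_add]
  filter_upwards [toL2_add (EGrad.incl Ω (smoothEGrad Ω hf hc)) (EGrad.incl Ω (smoothEGrad Ω hg hcg)),
    toL2_smoothEGrad (Ω := Ω) hf hc, toL2_smoothEGrad (Ω := Ω) hg hcg,
    toL2_smoothEGrad (Ω := Ω) (hf.add hg) (hc.add hcg)] with x h h1 h2 h3
  rw [h, h1, h2, h3]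

lemma smoothEGrad_smul (a : ℝ) {f : Space N → ℝ} (hf : ContDiff ℝ ∞ f) (hc : HasCompactSupport f) :
    a • smoothEGrad Ω hf hc = smoothEGrad Ω (hf.const_smul a) (hc.smul_left (f := fun _ ↦ a)) := by
  apply EGrad.ext_ae
  rw [map_smul]
  filter_upwards [toL2_smul a (EGrad.incl Ω (smoothEGrad Ω hf hc)),
    toL2_smoothEGrad (Ω := Ω) hf hc,
    toL2_smoothEGrad (Ω := Ω) (hf.const_smul a) (hc.smul_left (f := fun _ ↦ a))] with x h h1 h3
  rw [h, h1, h3]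
  rfl

variable (Ω) in
/-- The inclusion of `𝓓(Ω̄)` in `E(∇; Ω)`, as a linear map on `𝓓(ℝ^N)`. -/
noncomputable def restrictLin : 𝓓((⊤ : Opens (Space N)), ℝ) →ₗ[ℝ] EGrad Ω where
  toFun u := smoothEGrad Ω u.contDiff u.hasCompactSupport
  map_add' u w := (smoothEGrad_add u.contDiff u.hasCompactSupport w.contDiff
    w.hasCompactSupport).symm
  map_smul' a u := (smoothEGrad_smul a u.contDiff u.hasCompactSupport).symm

lemma smoothEGrad_eq_restrictLin {f : Space N → ℝ} (hf : ContDiff ℝ ∞ f)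
    (hc : HasCompactSupport f) : smoothEGrad Ω hf hc =
      restrictLin Ω (mkTest hf hc (fun _ _ ↦ trivial)) := rfl

variable (Ω) in
/-- The subspace `𝓓(Ω)` of `E(∇; Ω)`. -/
noncomputable def testEGrad : Submodule ℝ (EGrad Ω) where
  carrier := {w | ∃ (f : Space N → ℝ) (hf : ContDiff ℝ ∞ f) (hc : HasCompactSupport f),
    tsupport f ⊆ Ω ∧ w = smoothEGrad Ω hf hc}
  zero_mem' := ⟨_, contDiff_const (c := 0), HasCompactSupport.zero, by simp [tsupport], by
    apply EGrad.ext_ae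
    rw [map_zero]
    have h : toL2 (0 : HHalf Ω) =ᵐ[vol Ω] 0 := Lp.coeFn_zero _ _ _
    filter_upwards [h, toL2_smoothEGrad (Ω := Ω) (contDiff_const (c := 0)) HasCompactSupport.zero]
      with x h1 h2
    rw [h1, h2]
    rfl⟩
  add_mem' := by
    rintro _ _ ⟨f, hf, hc, hs, rfl⟩ ⟨g, hg, hcg, hsg, rfl⟩
    exact ⟨_, hf.add hg, hc.add hcg, (tsupport_add f g).trans (union_subset hs hsg),
      smoothEGrad_add hf hc hg hcg⟩
  smul_mem' := by
    rintro a _ ⟨f, hf, hc, hs, rfl⟩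
    exact ⟨_, hf.const_smul a, (hc.smul_left (f := fun _ ↦ a)),
      (closure_mono (Function.support_const_smul_subset a f)).trans hs, smoothEGrad_smul a hf hc⟩

/-! ### Density by averages -/

lemma integral_fn_mul_of_ae {v : HHalf Ω} {f : Space N → ℝ} (h : toL2 v =ᵐ[vol Ω] f)
    {g : Space N → ℝ} (hg : ∀ x ∉ (Ω : Set (Space N)), g x = 0) :
    ∫ x, fn v x * g x = ∫ x, f x * g x := by
  rw [← setIntegral_toL2_mul,
    ← setIntegral_eq_integral_of_forall_compl_eq_zero (s := (Ω : Set (Space N)))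
      (f := fun x ↦ f x * g x) fun x hx ↦ by rw [hg x hx, mul_zero]]
  refine integral_congr_ae ?_
  filter_upwards [h] with x hx
  rw [hx]

lemma fderiv_apply_eq_zero_of_notMem {φ : Space N → ℝ} {A : Set (Space N)} (hs : tsupport φ ⊆ A)
    (e : Space N) {x : Space N} (hx : x ∉ A) : fderiv ℝ φ x e = 0 :=
  image_eq_zero_of_notMem_tsupport (f := fun x ↦ fderiv ℝ φ x e)
    fun h ↦ hx (hs (tsupport_fderiv_apply_subset' _ h))

lemma DualBound.fn_of_ae {v : HHalf Ω} {f : Space N → ℝ} (h : toL2 v =ᵐ[vol Ω] f) {e : Space N}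
    {M : ℝ≥0∞} (hf : DualBound (Ω : Set (Space N)) f e M) :
    DualBound (Ω : Set (Space N)) (fn v) e M := by
  intro φ hφ hc hs
  rw [integral_fn_mul_of_ae h fun x hx ↦ fderiv_apply_eq_zero_of_notMem hs e hx]
  exact hf φ hφ hc hs

lemma tendsto_setIntegral_toL2_mul {x : ℕ → HHalf Ω} {v : HHalf Ω}
    (h : Filter.Tendsto (fun n ↦ toL2 (x n)) Filter.atTop (nhds (toL2 v))) {g : Space N → ℝ}
    (hg : MemLp g 2 (vol Ω)) :
    Filter.Tendsto (fun n ↦ ∫ y in (Ω : Set (Space N)), toL2 (x n) y * g y) Filter.atTop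
      (nhds (∫ y in (Ω : Set (Space N)), toL2 v y * g y)) := by
  simp only [← dualOfLp_apply hg]
  exact Filter.Tendsto.inner tendsto_const_nhds h

/-- A bound on the derivatives in the dual space is preserved by limits in `L²(Ω)`. -/
lemma DualBound.of_tendsto {x : ℕ → HHalf Ω} {v : HHalf Ω}
    (h : Filter.Tendsto (fun n ↦ toL2 (x n)) Filter.atTop (nhds (toL2 v))) {e : Space N}
    {M : ℝ≥0∞} (hx : ∀ n, DualBound (Ω : Set (Space N)) (fn (x n)) e M) :
    DualBound (Ω : Set (Space N)) (fn v) e M := by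
  intro φ hφ hc hs
  have h1 := tendsto_setIntegral_toL2_mul h (memLp_fderiv_vol hφ hc e)
  simp only [setIntegral_toL2_mul] at h1
  have h2 := ((ENNReal.continuous_pow 2).tendsto _).comp h1.enorm
  exact le_of_tendsto h2 (Filter.Eventually.of_forall fun n ↦ hx n φ hφ hc hs)

/-- Averages with uniformly bounded derivatives in the dual space approximate an element of
`E(∇; Ω)` in the closure of any subspace that contains them. -/
lemma IsApprox.mem_closure {T : ℕ → (Space N → ℝ) → Space N → ℝ}
    (hT : IsApprox (Ω : Set (Space N)) (fun _ ↦ 1) T) (hd : DenseRange (testLin Ω)) {v : EGrad Ω}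
    {M : Fin N → ℝ≥0∞} (hM : ∀ i, M i ≠ ⊤)
    (h : ∀ K i, DualBound (Ω : Set (Space N)) (T K (fn (EGrad.incl Ω v)))
      (EuclideanSpace.single i 1) (M i)) (P : Submodule ℝ (EGrad Ω))
    (hP : ∀ K, smoothEGrad Ω (hT.contDiff K _ (isHalf_fn (EGrad.incl Ω v)))
      (hT.hasCompactSupport K _ (isHalf_fn (EGrad.incl Ω v))) ∈ P) :
    v ∈ closure (P : Set (EGrad Ω)) := by
  obtain ⟨C, hC⟩ := hT.exists_norm_le (EGrad.incl Ω v)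
  refine EGrad.mem_closure_of_bounded hd P hP (C := C + ∑ i, √(M i).toReal) (fun K ↦ ?_)
    (hT.tendsto_toL2 _)
  choose F hF hF' using fun i ↦ ((h K i).fn_of_ae (toL2_smooth
    (hT.contDiff K _ (isHalf_fn (EGrad.incl Ω v)))
    (hT.hasCompactSupport K _ (isHalf_fn (EGrad.incl Ω v))))).exists_isDualDeriv hd (hM i)
  refine (EGrad.norm_le_of_isDualDeriv _ hF).trans ?_
  exact add_le_add (hC K) (Finset.sum_le_sum fun i _ ↦ hF' i)

/-- `𝓓(Ω̄)` is dense in `E(∇; Ω)`. -/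
lemma IsBoundedLipschitzDomain.denseRange_restrictLin (hN : N ≠ 0)
    (hΩ : IsBoundedLipschitzDomain Ω) : DenseRange (restrictLin Ω) := by
  obtain ⟨T, hT, hb⟩ := hΩ.exists_approx_up hN
  intro v
  choose C hC using hb
  choose F hF using v.incl_mem
  refine hT.mem_closure (hΩ.denseRange_testLin hN) (fun i ↦ ?_)
    (fun K i ↦ hC (EuclideanSpace.single i 1) _ (isHalf_fn (EGrad.incl Ω v)) _
      (hF i).dualBound K) (restrictLin Ω).range (fun K ↦ ⟨_, (smoothEGrad_eq_restrictLin _ _).symm⟩)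
  exact ENNReal.mul_ne_top ENNReal.coe_ne_top (ENNReal.add_ne_top.2
    ⟨by simp, (isHalf_fn _).hsq_ne_top⟩)

/-- If the extension of `v` by zero is in `H^{1/2}(ℝ^N)`, then `v` is in the closure of `𝓓(Ω)` in
`E(∇; Ω)`. -/
lemma IsBoundedLipschitzDomain.exists_mem_closure_testEGrad (hN : N ≠ 0)
    (hΩ : IsBoundedLipschitzDomain Ω) {v : HHalf Ω} (hv : hsq univ (fn v) ≠ ⊤) :
    ∃ w : EGrad Ω, EGrad.incl Ω w = v ∧ w ∈ closure (testEGrad Ω : Set (EGrad Ω)) := by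
  obtain ⟨T, hT, hs, hb⟩ := hΩ.exists_approx_down hN
  have hd := hΩ.denseRange_testLin hN
  choose C hC using hb
  -- the derivatives of the averages are uniformly bounded in the dual space, hence so are those of the limit
  have hv' : v ∈ EGradSub Ω := by
    intro i
    have h1 : DualBound (Ω : Set (Space N)) (fn v) (EuclideanSpace.single i 1) _ :=
      DualBound.of_tendsto (hT.tendsto_toL2 v) fun K ↦
        (hC (EuclideanSpace.single i 1) _ (isHalf_fn v) hv K).fn_of_ae (toL2_smooth _ _)
    obtain ⟨F, hF, -⟩ := h1.exists_isDualDeriv hd (ENNReal.mul_ne_top ENNReal.coe_ne_top hv)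
    exact ⟨F, hF⟩
  let w : EGrad Ω := (⟨v, hv'⟩ : EGradSub Ω)
  refine ⟨w, rfl, ?_⟩
  exact hT.mem_closure (v := w) hd (fun i ↦ ENNReal.mul_ne_top ENNReal.coe_ne_top hv)
    (fun K i ↦ hC (EuclideanSpace.single i 1) _ (isHalf_fn v) hv K) (testEGrad Ω)
    fun K ↦ ⟨_, _, _, hs _ (isHalf_fn v) K, rfl⟩

/-! ### The distance to the boundary -/

lemma IsBoundedLipschitzDomain.ne_univ (hN : N ≠ 0) (hΩ : IsBoundedLipschitzDomain Ω) :
    (Ω : Set (Space N)) ≠ univ := by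
  intro h
  have : Nonempty (Fin N) := ⟨⟨0, Nat.pos_of_ne_zero hN⟩⟩
  have : Nontrivial (Space N) := inferInstance
  exact NormedSpace.unbounded_univ ℝ (Space N) (h ▸ hΩ.1)

/-- For points of `Ω`, the distance to the boundary is the distance to the complement. -/
lemma infDist_frontier_eq (h : (Ω : Set (Space N)) ≠ univ) {x : Space N} (hx : x ∈ Ω) :
    Metric.infDist x (frontier (Ω : Set (Space N))) = Metric.infDist x (Ω : Set (Space N))ᶜ := by
  obtain ⟨y, hy, hxy⟩ := exists_mem_frontier_infDist_compl_eq_dist (s := (Ω : Set (Space N))) hx h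
  refine le_antisymm (hxy ▸ Metric.infDist_le_dist_of_mem hy) ?_
  refine Metric.infDist_le_infDist_of_subset ?_ ⟨y, hy⟩
  rw [Ω.isOpen.frontier_eq]
  exact fun z hz ↦ hz.2

lemma infDist_compl_pos (h : (Ω : Set (Space N)) ≠ univ) {x : Space N} (hx : x ∈ Ω) :
    0 < Metric.infDist x (Ω : Set (Space N))ᶜ := by
  rw [← Ω.isOpen.isClosed_compl.notMem_iff_infDist_pos (nonempty_compl.2 h)]
  exact fun h ↦ h hx

/-- Membership in `H^{1/2}_{00}(Ω)` as the finiteness of an integral against the inverse distance to the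
complement. -/
lemma mem_HHalf00_iff (h : (Ω : Set (Space N)) ≠ univ) (v : HHalf Ω) : v ∈ HHalf00 Ω ↔
    ∫⁻ x in (Ω : Set (Space N)), ENNReal.ofReal (Metric.infDist x (Ω : Set (Space N))ᶜ)⁻¹ *
      ‖fn v x‖ₑ ^ 2 < ⊤ := by
  change MemLp (fun x ↦ toL2 v x / √(Metric.infDist x (frontier (Ω : Set (Space N))))) 2
    (vol Ω) ↔ _
  have hm : Measurable fun x ↦ toL2 v x / √(Metric.infDist x (frontier (Ω : Set (Space N)))) :=
    (measurable_toL2 v).div (Metric.continuous_infDist_pt _).measurable.sqrt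
  have h1 : (lTwo Ω fun x ↦ toL2 v x / √(Metric.infDist x (frontier (Ω : Set (Space N))))) ^ 2 =
      ∫⁻ x in (Ω : Set (Space N)), ENNReal.ofReal (Metric.infDist x (Ω : Set (Space N))ᶜ)⁻¹ *
      ‖fn v x‖ₑ ^ 2 := by
    rw [lTwo_sq]
    refine lintegral_congr_ae ?_
    filter_upwards [fn_ae_eq v, ae_restrict_mem Ω.isOpen.measurableSet] with x hx hxΩ
    rw [hx, infDist_frontier_eq h hxΩ, div_eq_mul_inv, enorm_mul, mul_pow, mul_comm]
    congr 1
    rw [← Real.sqrt_inv, Real.enorm_of_nonneg (Real.sqrt_nonneg _), ← ENNReal.ofReal_pow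
      (Real.sqrt_nonneg _), Real.sq_sqrt (inv_nonneg.2 Metric.infDist_nonneg)]
  rw [← h1, ENNReal.pow_lt_top_iff]
  exact ⟨fun h ↦ Or.inl h.2, fun h ↦ ⟨hm.aestronglyMeasurable, h.resolve_right (by simp)⟩⟩

/-- The extension by zero of a function of `H^{1/2}_{00}(Ω)` belongs to `H^{1/2}(ℝ^N)`. -/
lemma IsBoundedLipschitzDomain.hsq_univ_ne_top (hN : N ≠ 0) (hΩ : IsBoundedLipschitzDomain Ω)
    {v : HHalf Ω} (hv : v ∈ HHalf00 Ω) : hsq univ (fn v) ≠ ⊤ := by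
  have hne := hΩ.ne_univ hN
  have h1 := (mem_HHalf00_iff hne v).1 hv
  have h2 := gag_univ_le Ω.isOpen.measurableSet (measurable_fn v) (fun x hx ↦ fn_eq_zero v hx)
    (d := fun x ↦ Metric.infDist x (Ω : Set (Space N))ᶜ)
    (Metric.continuous_infDist_pt _).measurable (fun x hx ↦ infDist_compl_pos hne hx)
    (fun x hx y hy ↦ by
      rw [← dist_eq_norm]
      exact Metric.infDist_le_dist_of_mem hy)
  have h3 := (isHalf_fn v).memLp Ω.isOpen.measurableSet
  have h4 : lTwo univ (fn v) ≠ ⊤ := by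
    unfold lTwo
    rw [Measure.restrict_univ]
    exact h3.2.ne
  have h5 : gag Ω (fn v) ≠ ⊤ := ((gag_le_hsq _ _).trans_lt (isHalf_fn v).hsq_ne_top.lt_top).ne
  refine ENNReal.add_ne_top.2 ⟨ENNReal.pow_ne_top h4, (h2.trans_lt ?_).ne⟩
  exact ENNReal.add_lt_top.2 ⟨h5.lt_top, ENNReal.mul_lt_top (by
    exact ENNReal.mul_lt_top (by simp) (kernConst_ne_top hN).lt_top) h1⟩

end

section

variable {N : ℕ}

/-! ### Surface measure on a Lipschitz graph -/

lemma euclideanHausdorffMeasure_image_le {X Y : Type*} [EMetricSpace X] [MeasurableSpace X]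
    [BorelSpace X] [EMetricSpace Y] [MeasurableSpace Y] [BorelSpace Y] {K : ℝ≥0} {f : X → Y}
    (hf : LipschitzWith K f) (d : ℕ) (s : Set X) :
    (Measure.euclideanHausdorffMeasure d : Measure Y) (f '' s) ≤
      (K : ℝ≥0∞) ^ d * (Measure.euclideanHausdorffMeasure d : Measure X) s := by
  rw [Measure.euclideanHausdorffMeasure_def, Measure.euclideanHausdorffMeasure_def,
    Measure.smul_apply, Measure.smul_apply, ENNReal.smul_def, ENNReal.smul_def, smul_eq_mul,
    smul_eq_mul, mul_left_comm]
  have h := hf.hausdorffMeasure_image_le (Nat.cast_nonneg d) s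
  rw [ENNReal.rpow_natCast] at h
  gcongr

/-- The area measure on the hyperplane orthogonal to `ν`. -/
noncomputable abbrev baseMeasure (ν : Space N) : Measure (Submodule.span ℝ {ν})ᗮ :=
  Measure.euclideanHausdorffMeasure (N - 1)

/-- The parametrisation of the graph of `ψ`, the vertical direction being `ν`. -/
noncomputable def graphMap (ν : Space N) (ψ : (Submodule.span ℝ {ν})ᗮ → ℝ)
    (y : (Submodule.span ℝ {ν})ᗮ) : Space N := (y : Space N) + ψ y • ν

section Graph
variable {ν : Space N} {ψ : (Submodule.span ℝ {ν})ᗮ → ℝ} {K : ℝ≥0}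

lemma finrank_perp (hν : ‖ν‖ = 1) : Module.finrank ℝ (Submodule.span ℝ {ν})ᗮ = N - 1 := by
  have hν0 : ν ≠ 0 := by
    rintro rfl
    simp at hν
  have h := (Submodule.span ℝ {ν}).finrank_add_finrank_orthogonal
  rw [finrank_span_singleton hν0, finrank_euclideanSpace, Fintype.card_fin] at h
  omega

lemma orthogonalProjectionOnto_add_smul (y : (Submodule.span ℝ {ν})ᗮ) (t : ℝ) :
    (Submodule.span ℝ {ν})ᗮ.orthogonalProjectionOnto ((y : Space N) + t • ν) = y := by
  have hPν : (Submodule.span ℝ {ν})ᗮ.orthogonalProjectionOnto ν = 0 := by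
    rw [Submodule.orthogonalProjectionOnto_eq_zero_iff, Submodule.orthogonal_orthogonal]
    exact Submodule.mem_span_singleton_self ν
  rw [map_add, map_smul, hPν, smul_zero, add_zero,
    Submodule.orthogonalProjectionOnto_mem_subspace_eq_self]

lemma inner_add_smul (hν : ‖ν‖ = 1) (y : (Submodule.span ℝ {ν})ᗮ) (t : ℝ) :
    inner ℝ ν ((y : Space N) + t • ν) = t := by
  have h : inner ℝ ν (y : Space N) = 0 :=
    (Submodule.mem_orthogonal _ _).1 y.2 ν (Submodule.mem_span_singleton_self ν)
  rw [inner_add_right, h, inner_smul_right, real_inner_self_eq_norm_sq, hν]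
  ring

lemma add_smul_mem_aboveGraph (hν : ‖ν‖ = 1) (y : (Submodule.span ℝ {ν})ᗮ) (t : ℝ) :
    (y : Space N) + t • ν ∈ aboveGraph ν ψ ↔ ψ y < t := by
  change ψ _ < inner ℝ ν _ ↔ _
  rw [orthogonalProjectionOnto_add_smul, inner_add_smul hν]

lemma exists_eq_add_smul (hν : ‖ν‖ = 1) (x : Space N) :
    (((Submodule.span ℝ {ν})ᗮ.orthogonalProjectionOnto x : (Submodule.span ℝ {ν})ᗮ) : Space N) +
      inner ℝ ν x • ν = x := by
  have h := (Submodule.span ℝ {ν}).starProjection_add_starProjection_orthogonal x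
  rw [Submodule.starProjection_unit_singleton ℝ hν] at h
  rw [add_comm]
  exact h

lemma lipschitzWith_graphMap (hν : ‖ν‖ = 1) (hψ : LipschitzWith K ψ) :
    LipschitzWith (1 + K) (graphMap ν ψ) := by
  have h : LipschitzWith K fun y ↦ ψ y • ν := by
    refine LipschitzWith.of_dist_le_mul fun a b ↦ ?_
    rw [dist_eq_norm, ← sub_smul, norm_smul, hν, mul_one, ← dist_eq_norm]
    exact hψ.dist_le_mul a b
  exact LipschitzWith.subtype_val _ |>.add h

lemma range_graphMap (hν : ‖ν‖ = 1) : range (graphMap ν ψ) =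
    {x | ψ ((Submodule.span ℝ {ν})ᗮ.orthogonalProjectionOnto x) = inner ℝ ν x} := by
  ext x
  constructor
  · rintro ⟨y, rfl⟩
    change ψ _ = inner ℝ ν _
    rw [graphMap, orthogonalProjectionOnto_add_smul, inner_add_smul hν]
  · intro hx
    have hx' : ψ ((Submodule.span ℝ {ν})ᗮ.orthogonalProjectionOnto x) = inner ℝ ν x := hx
    refine ⟨(Submodule.span ℝ {ν})ᗮ.orthogonalProjectionOnto x, ?_⟩
    rw [graphMap, hx', exists_eq_add_smul hν]

lemma isClosed_range_graphMap (hν : ‖ν‖ = 1) (hψ : LipschitzWith K ψ) :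
    IsClosed (range (graphMap ν ψ)) := by
  rw [range_graphMap hν]
  exact isClosed_eq (hψ.continuous.comp (ContinuousLinearMap.continuous _)) (by fun_prop)

lemma frontier_aboveGraph (hν : ‖ν‖ = 1) (hψ : LipschitzWith K ψ) :
    frontier (aboveGraph ν ψ) = range (graphMap ν ψ) := by
  have hG := isUpCone_aboveGraph hν hψ
  rw [range_graphMap hν, hG.isOpen.frontier_eq]
  ext x
  constructor
  · rintro ⟨h1, h2⟩
    have h4 : ψ ((Submodule.span ℝ {ν})ᗮ.orthogonalProjectionOnto x) ≤ inner ℝ ν x :=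
      closure_aboveGraph_subset hψ.continuous h1
    have h5 : ¬ψ ((Submodule.span ℝ {ν})ᗮ.orthogonalProjectionOnto x) < inner ℝ ν x := h2
    exact le_antisymm h4 (not_lt.1 h5)
  · intro hx
    have hx' : ψ ((Submodule.span ℝ {ν})ᗮ.orthogonalProjectionOnto x) = inner ℝ ν x := hx
    refine ⟨Metric.mem_closure_iff.2 fun ε hε ↦ ?_, fun h ↦ ?_⟩
    · refine ⟨x + (ε / 2) • ν, ?_, ?_⟩
      · have h := exists_eq_add_smul hν x
        rw [← h, add_assoc, ← add_smul, add_smul_mem_aboveGraph hν, hx']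
        linarith
      · rw [dist_eq_norm, sub_add_cancel_left, norm_neg, norm_smul, hν, mul_one,
          Real.norm_of_nonneg (by positivity)]
        linarith
    · have h5 : ψ ((Submodule.span ℝ {ν})ᗮ.orthogonalProjectionOnto x) < inner ℝ ν x := h
      exact h5.ne hx'

/-- The parametrisation of the graph is Lipschitz, so that it increases the area at most by a constant
factor. -/
lemma restrict_range_graphMap_le (hν : ‖ν‖ = 1) (hψ : LipschitzWith K ψ) :
    (Measure.euclideanHausdorffMeasure (N - 1)).restrict (range (graphMap ν ψ)) ≤
      ((1 + K : ℝ≥0) : ℝ≥0∞) ^ (N - 1) • (baseMeasure ν).map (graphMap ν ψ) := by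
  have hL := lipschitzWith_graphMap hν hψ
  refine Measure.le_iff.2 fun A hA ↦ ?_
  rw [Measure.restrict_apply hA, Measure.smul_apply, Measure.map_apply hL.continuous.measurable hA,
    ← image_preimage_eq_inter_range, smul_eq_mul]
  exact euclideanHausdorffMeasure_image_le hL _ _

/-- The projection to the hyperplane is a left inverse of the parametrisation of the graph and does not
increase areas. -/
lemma map_graphMap_le (hν : ‖ν‖ = 1) (hψ : LipschitzWith K ψ) :
    (baseMeasure ν).map (graphMap ν ψ) ≤
      (Measure.euclideanHausdorffMeasure (N - 1)).restrict (range (graphMap ν ψ)) := by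
  have hL := lipschitzWith_graphMap hν hψ
  have hP : LipschitzWith 1 fun x : Space N ↦
      (Submodule.span ℝ {ν})ᗮ.orthogonalProjectionOnto x := by
    refine LipschitzWith.of_dist_le_mul fun a b ↦ ?_
    rw [dist_eq_norm, ← map_sub, NNReal.coe_one, one_mul, dist_eq_norm]
    exact Submodule.norm_orthogonalProjectionOnto_apply_le _ _
  refine Measure.le_iff.2 fun A hA ↦ ?_
  rw [Measure.restrict_apply hA, Measure.map_apply hL.continuous.measurable hA,
    ← image_preimage_eq_inter_range]
  have h := euclideanHausdorffMeasure_image_le hP (N - 1)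
    (graphMap ν ψ '' (graphMap ν ψ ⁻¹' A))
  rw [image_image, ENNReal.coe_one, one_pow, one_mul] at h
  simpa only [graphMap, orthogonalProjectionOnto_add_smul, image_id'] using h

/-- The normalised Hausdorff measure on the hyperplane is its Lebesgue measure, which makes Fubini's
theorem available. -/
lemma baseMeasure_eq_volume (hν : ‖ν‖ = 1) :
    (baseMeasure ν) = @volume (Submodule.span ℝ {ν})ᗮ measureSpaceOfInnerProductSpace := by
  rw [← InnerProductSpace.euclideanHausdorffMeasure_eq_volume, finrank_perp hν]

lemma sigmaFinite_baseMeasure (hν : ‖ν‖ = 1) : SigmaFinite (baseMeasure ν) := by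
  rw [baseMeasure_eq_volume hν]
  infer_instance

/-- Lebesgue measure is the product of the area of a hyperplane and of the length on a line
orthogonal to it. -/
lemma measurePreserving_add_smul (hν : ‖ν‖ = 1) : MeasurePreserving
    (fun q : (Submodule.span ℝ {ν})ᗮ × ℝ ↦ (q.1 : Space N) + q.2 • ν)
    ((baseMeasure ν).prod volume) volume := by
  have := sigmaFinite_baseMeasure hν
  have h1 := ((Submodule.span ℝ {ν}).measurePreserving_measurableEquivProd (0 : Space N)).symm
  have h2 := (LinearIsometryEquiv.toSpanUnitSingleton (𝕜 := ℝ) ν hν).measurePreserving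
  rw [InnerProductSpace.euclideanHausdorffMeasure_eq_volume] at h1
  have h3 := h2.prod (MeasurePreserving.id (baseMeasure ν))
  have h4 : MeasurePreserving (Prod.swap : (Submodule.span ℝ {ν})ᗮ × ℝ → _)
    ((baseMeasure ν).prod volume) (volume.prod (baseMeasure ν)) := Measure.measurePreserving_swap
  have h5 := h3.comp h4
  rw [baseMeasure_eq_volume hν] at h5 ⊢
  have h6 := h1.comp h5
  convert! h6 using 1
  ext1 q
  simp [add_comm]

lemma integrable_comp_graphMap (hν : ‖ν‖ = 1) (hψ : LipschitzWith K ψ) {g : Space N → ℝ}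
    (hg : Continuous g) (hc : HasCompactSupport g) :
    Integrable (fun y ↦ g (graphMap ν ψ y)) (baseMeasure ν) := by
  have hcs : HasCompactSupport fun y ↦ g (graphMap ν ψ y) := by
    refine HasCompactSupport.intro (hc.isCompact.image
      (Submodule.span ℝ {ν})ᗮ.orthogonalProjectionOnto.continuous) fun y hy ↦ ?_
    refine image_eq_zero_of_notMem_tsupport fun h ↦ hy ⟨_, h, ?_⟩
    exact orthogonalProjectionOnto_add_smul y _
  have : IsFiniteMeasureOnCompacts (baseMeasure ν) := by
    rw [baseMeasure_eq_volume hν]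
    infer_instance
  exact (hg.comp (lipschitzWith_graphMap hν hψ).continuous).integrable_of_hasCompactSupport hcs

/-- The integral of a vertical derivative on the region above a graph is an integral on the
graph. -/
lemma setIntegral_aboveGraph_fderiv (hν : ‖ν‖ = 1) (hψ : LipschitzWith K ψ) {g : Space N → ℝ}
    (hg : ContDiff ℝ ∞ g) (hc : HasCompactSupport g) :
    ∫ x in aboveGraph ν ψ, fderiv ℝ g x ν = -∫ y, g (graphMap ν ψ y) ∂(baseMeasure ν) := by
  have := sigmaFinite_baseMeasure hν
  have hmp := measurePreserving_add_smul hν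
  have hG := (isUpCone_aboveGraph hν hψ).isOpen.measurableSet
  let h : Space N → ℝ := fun x ↦ fderiv ℝ g x ν
  have hh : Continuous h := (hg.continuous_fderiv (by simp)).clm_apply continuous_const
  have hhi : Integrable h := hh.integrable_of_hasCompactSupport (hc.fderiv_apply ℝ _)
  have hi : Integrable ((aboveGraph ν ψ).indicator h) := hhi.indicator hG
  rw [← integral_indicator hG, ← hmp.map_eq, integral_map hmp.measurable.aemeasurable
    (hmp.map_eq ▸ hi.aestronglyMeasurable),
    integral_prod (fun q : (Submodule.span ℝ {ν})ᗮ × ℝ ↦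
      (aboveGraph ν ψ).indicator h ((q.1 : Space N) + q.2 • ν))
      (hmp.integrable_comp_of_integrable hi), ← integral_neg]
  congr 1
  ext y
  have h1 : ∀ t : ℝ, (aboveGraph ν ψ).indicator h ((y : Space N) + t • ν) =
      (Ioi (ψ y)).indicator (fun t : ℝ ↦ h ((y : Space N) + t • ν)) t := by
    intro t
    by_cases ht : ψ y < t
    · rw [indicator_of_mem ((add_smul_mem_aboveGraph hν y t).2 ht), indicator_of_mem (mem_Ioi.2 ht)]
    · rw [indicator_of_notMem (fun h ↦ ht ((add_smul_mem_aboveGraph hν y t).1 h)),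
        indicator_of_notMem (s := Ioi (ψ y)) (notMem_Ioi.2 (not_lt.1 ht))]
  have hemb : Topology.IsClosedEmbedding fun t : ℝ ↦ (y : Space N) + t • ν := by
    refine Isometry.isClosedEmbedding (Isometry.of_dist_eq fun a b ↦ ?_)
    rw [dist_eq_norm, add_sub_add_left_eq_sub, ← sub_smul, norm_smul, hν, mul_one, dist_eq_norm]
  have hcg : HasCompactSupport fun t : ℝ ↦ g ((y : Space N) + t • ν) :=
    hc.comp_isClosedEmbedding hemb
  have hch : HasCompactSupport fun t : ℝ ↦ h ((y : Space N) + t • ν) :=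
    (hc.fderiv_apply ℝ ν).comp_isClosedEmbedding hemb
  have hd : ∀ t ∈ Ici (ψ y), HasDerivAt (fun t : ℝ ↦ g ((y : Space N) + t • ν))
      (h ((y : Space N) + t • ν)) t := by
    intro t _
    have h2 : HasDerivAt (fun t : ℝ ↦ (y : Space N) + t • ν) ν t := by
      simpa using ((hasDerivAt_id t).smul_const ν).const_add (y : Space N)
    exact ((hg.differentiable (by simp) _).hasFDerivAt).comp_hasDerivAt t h2
  simp only [h1]
  rw [integral_indicator measurableSet_Ioi, integral_Ioi_of_hasDerivAt_of_tendsto' hd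
    ((hh.comp hemb.continuous).integrable_of_hasCompactSupport hch).integrableOn
    (hcg.is_zero_at_infty.mono_left atTop_le_cocompact), zero_sub]
  rfl

end Graph

/-! ### Surface integrals in a chart -/

/-- A chart at a boundary point in which surface integrals are comparable to integrals of vertical
derivatives on the domain: the latter are bounded by the former, and conversely for nonnegative
functions, for which no cancellation occurs on the boundary. -/
structure IsTraceChart (Ω : Opens (Space N)) (p : Space N) (r : ℝ) (G : Set (Space N))
    (ν : Space N) (c : ℝ) (L : ℝ≥0) : Prop where
  isChart : IsChart (Ω : Set (Space N)) p r G ν c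
  lintegral_surface_le : ∀ g : Space N → ℝ, ContDiff ℝ ∞ g → HasCompactSupport g →
    tsupport g ⊆ Metric.ball p r → (∀ x, 0 ≤ g x) →
    ∫⁻ x, ENNReal.ofReal (g x) ∂(surface Ω) ≤
      L * ‖∫ x in (Ω : Set (Space N)), fderiv ℝ g x ν‖ₑ
  enorm_integral_le : ∀ g : Space N → ℝ, ContDiff ℝ ∞ g → HasCompactSupport g →
    tsupport g ⊆ Metric.ball p r →
    ‖∫ x in (Ω : Set (Space N)), fderiv ℝ g x ν‖ₑ ≤ ∫⁻ x, ‖g x‖ₑ ∂(surface Ω)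

lemma frontier_inter_ball {A G : Set (Space N)} {p : Space N} {r : ℝ}
    (h : A ∩ Metric.ball p r = G ∩ Metric.ball p r) :
    frontier A ∩ Metric.ball p r = frontier G ∩ Metric.ball p r := by
  rw [← frontier_inter_open_inter Metric.isOpen_ball, h,
    frontier_inter_open_inter Metric.isOpen_ball]

/-- In a chart, the surface measure is comparable to the area of the hyperplane, over which the
fundamental theorem of calculus gives the integral of the vertical derivative. -/
lemma IsBoundedLipschitzDomain.exists_traceChart {Ω : Opens (Space N)}
    (hΩ : IsBoundedLipschitzDomain Ω) {p : Space N} (hp : p ∈ frontier (Ω : Set (Space N))) :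
    ∃ r G ν c L, IsTraceChart Ω p r G ν c L := by
  obtain ⟨r, ν, ψ, K, hψ, hch⟩ := hΩ.exists_boundary_chart hp
  have hν := hch.isUpCone.norm_eq
  have hfr := frontier_inter_ball hch.inter_eq
  rw [frontier_aboveGraph hν hψ] at hfr
  have hΦ := (lipschitzWith_graphMap hν hψ).continuous
  have hR := (isClosed_range_graphMap hν hψ).measurableSet
  have hΓ : MeasurableSet (frontier (Ω : Set (Space N))) := isClosed_frontier.measurableSet
  set μ : Measure (Space N) := Measure.euclideanHausdorffMeasure (N - 1)
  set L : ℝ≥0 := (1 + K) ^ (N - 1)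
  -- both surfaces agree on the support of functions that vanish off the ball
  have hsurf : ∀ f : Space N → ℝ≥0∞, (∀ x ∉ Metric.ball p r, f x = 0) →
      ∫⁻ x, f x ∂(surface Ω) = ∫⁻ x in range (graphMap ν ψ), f x ∂μ := by
    intro f hf
    rw [surface, ← lintegral_indicator hΓ, ← lintegral_indicator hR]
    congr 1
    ext x
    by_cases hx : x ∈ Metric.ball p r
    · have h1 : x ∈ frontier (Ω : Set (Space N)) ↔ x ∈ range (graphMap ν ψ) :=
        ⟨fun h ↦ (hfr.subset ⟨h, hx⟩).1, fun h ↦ (hfr.superset ⟨h, hx⟩).1⟩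
      by_cases h2 : x ∈ range (graphMap ν ψ)
      · rw [indicator_of_mem h2, indicator_of_mem (h1.2 h2)]
      · rw [indicator_of_notMem h2, indicator_of_notMem fun h ↦ h2 (h1.1 h)]
    · simp [indicator, hf x hx]
  have hint : ∀ g : Space N → ℝ, ContDiff ℝ ∞ g → HasCompactSupport g →
      tsupport g ⊆ Metric.ball p r → ∫ x in (Ω : Set (Space N)), fderiv ℝ g x ν =
        -∫ y, g (graphMap ν ψ y) ∂(baseMeasure ν) := by
    intro g hg hc hs
    rw [← setIntegral_aboveGraph_fderiv hν hψ hg hc, ← integral_indicator Ω.isOpen.measurableSet,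
      ← integral_indicator hch.isUpCone.isOpen.measurableSet]
    congr 1
    ext x
    by_cases hx : x ∈ Metric.ball p r
    · have h1 : x ∈ (Ω : Set (Space N)) ↔ x ∈ aboveGraph ν ψ :=
        ⟨fun h ↦ (hch.inter_eq.subset ⟨h, hx⟩).1, fun h ↦ (hch.inter_eq.superset ⟨h, hx⟩).1⟩
      by_cases h2 : x ∈ aboveGraph ν ψ
      · rw [indicator_of_mem h2, indicator_of_mem (h1.2 h2)]
      · rw [indicator_of_notMem h2, indicator_of_notMem fun h ↦ h2 (h1.1 h)]
    · simp [indicator, fderiv_apply_eq_zero_of_notMem hs ν hx]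
  have hzero : ∀ g : Space N → ℝ, tsupport g ⊆ Metric.ball p r → ∀ x ∉ Metric.ball p r, g x = 0 :=
    fun g hs x hx ↦ image_eq_zero_of_notMem_tsupport fun h ↦ hx (hs h)
  refine ⟨r, _, ν, _, L, hch, fun g hg hc hs h0 ↦ ?_, fun g hg hc hs ↦ ?_⟩
  · rw [hint g hg hc hs, enorm_neg, hsurf _ fun x hx ↦ by rw [hzero g hs x hx, ENNReal.ofReal_zero]]
    refine (lintegral_mono' (restrict_range_graphMap_le hν hψ) le_rfl).trans ?_
    have hgm : Measurable fun x ↦ ENNReal.ofReal (g x) := hg.continuous.measurable.ennreal_ofReal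
    rw [lintegral_smul_measure, lintegral_map hgm hΦ.measurable, smul_eq_mul]
    have hi : Integrable (fun y ↦ g (graphMap ν ψ y)) (baseMeasure ν) :=
      integrable_comp_graphMap hν hψ hg.continuous hc
    rw [Real.enorm_of_nonneg (integral_nonneg fun y ↦ h0 _),
      ofReal_integral_eq_lintegral_ofReal hi (Filter.Eventually.of_forall fun y ↦ h0 _)]
    simp [L]
  · rw [hint g hg hc hs, enorm_neg, hsurf _ fun x hx ↦ by rw [hzero g hs x hx, enorm_zero]]
    refine (enorm_integral_le_lintegral_enorm _).trans ?_
    have hgm : Measurable fun x ↦ ‖g x‖ₑ := hg.continuous.measurable.enorm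
    rw [← lintegral_map hgm hΦ.measurable]
    exact lintegral_mono' (map_graphMap_le hν hψ) le_rfl

end

section

variable {N : ℕ} {Ω : Opens (Space N)}

/-! ### The trace estimate -/

lemma exists_norm_smoothHHalf_mul_le (hN : N ≠ 0) {η : Space N → ℝ} (hη : ContDiff ℝ ∞ η)
    (hc : HasCompactSupport η) : ∃ C : ℝ, 0 ≤ C ∧ ∀ (u : Space N → ℝ) (hu : ContDiff ℝ ∞ u)
      (hcu : HasCompactSupport u), ‖smoothHHalf Ω (fun x ↦ η x * u x) (hη.mul hu) hcu.mul_left‖ ≤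
        C * ‖smoothHHalf Ω u hu hcu‖ := by
  obtain ⟨C, hC⟩ := exists_hsq_mul_le hN hη hc
  refine ⟨√C, Real.sqrt_nonneg _, fun u hu hcu ↦ ?_⟩
  have h := hC Ω Ω.isOpen.measurableSet u hu.continuous.measurable
  rw [← enorm_smooth_sq (Ω := Ω) (hη.mul hu) hcu.mul_left, ← enorm_smooth_sq hu hcu] at h
  have h1 := norm_le_of_enorm_sq_le (ENNReal.mul_ne_top ENNReal.coe_ne_top (by simp)) h
  rwa [ENNReal.toReal_mul, Real.sqrt_mul ENNReal.toReal_nonneg, ENNReal.toReal_pow, toReal_enorm,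
    Real.sqrt_sq (norm_nonneg _)] at h1

lemma norm_toL2_le (w : HHalf Ω) : ‖toL2 w‖ ≤ ‖w‖ := WithLp.norm_fst_le _ w.1

lemma abs_setIntegral_toL2_mul_le (w : HHalf Ω) {g : Space N → ℝ} (hg : ContDiff ℝ ∞ g)
    (hcg : HasCompactSupport g) :
    |∫ x in (Ω : Set (Space N)), toL2 w x * g x| ≤ ‖w‖ * ‖smoothHHalf Ω g hg hcg‖ := by
  have h1 : ∫ x in (Ω : Set (Space N)), toL2 w x * g x =
      inner ℝ (toL2 (smoothHHalf Ω g hg hcg)) (toL2 w) := by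
    rw [L2.inner_def]
    refine integral_congr_ae ?_
    filter_upwards [toL2_smooth (Ω := Ω) hg hcg] with x hx
    rw [hx]
    rfl
  rw [h1]
  refine (abs_real_inner_le_norm _ _).trans ?_
  rw [mul_comm]
  exact mul_le_mul (norm_toL2_le w) (norm_toL2_le _) (norm_nonneg _) (norm_nonneg _)

/-- The derivative of `u ∈ 𝓓(Ω̄)` has a single representing functional, so that the norm of
`w ↦ ∫_Ω w ∂ᵢu` is the one that enters the norm of `E(∇; Ω)`. -/
lemma norm_dualOfLp_fderiv_le (hd : DenseRange (testLin Ω)) {u : Space N → ℝ}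
    (hu : ContDiff ℝ ∞ u) (hcu : HasCompactSupport u) (i : Fin N) :
    ‖dualOfLp (memLp_fderiv_vol (Ω := Ω) hu hcu (EuclideanSpace.single i 1))‖ ≤
      ‖smoothEGrad Ω hu hcu‖ := by
  refine le_of_forall_pos_le_add fun ε hε ↦ ?_
  obtain ⟨F, hF, hlt⟩ := exists_lt_dualDerivNorm (smoothEGrad Ω hu hcu).incl_mem i hε
  rw [(isDualDeriv_smooth hu hcu i).unique hd hF, EGrad.norm_def]
  have h1 := Finset.single_le_sum (f := fun i ↦ dualDerivNorm (EGrad.incl Ω (smoothEGrad Ω hu hcu)) i)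
    (fun i _ ↦ dualDerivNorm_nonneg _ i) (Finset.mem_univ i)
  have h2 : 0 ≤ ‖EGrad.incl Ω (smoothEGrad Ω hu hcu)‖ := norm_nonneg _
  linarith

lemma fderiv_apply_eq_sum (u : Space N → ℝ) (x e : Space N) :
    fderiv ℝ u x e = ∑ i, e i * fderiv ℝ u x (EuclideanSpace.single i 1) := by
  have h : e = ∑ i, e i • EuclideanSpace.single i (1 : ℝ) := by
    simpa using ((EuclideanSpace.basisFun (Fin N) ℝ).sum_repr e).symm
  conv_lhs => rw [h]
  rw [map_sum]
  simp only [map_smul, smul_eq_mul]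

/-- For `u ∈ 𝓓(Ω̄)`, the functional `w ↦ ∫_Ω w ∂_e u` on `H^{1/2}(Ω)` is controlled by the norm of `u`
in `E(∇; Ω)`. -/
lemma abs_setIntegral_mul_fderiv_le (hd : DenseRange (testLin Ω)) {e : Space N} (he : ‖e‖ = 1)
    (w : HHalf Ω) {u : Space N → ℝ} (hu : ContDiff ℝ ∞ u) (hcu : HasCompactSupport u) :
    |∫ x in (Ω : Set (Space N)), toL2 w x * fderiv ℝ u x e| ≤
      N * (‖w‖ * ‖smoothEGrad Ω hu hcu‖) := by
  have hi : ∀ i : Fin N, Integrable (fun x ↦ toL2 w x *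
      (e i * fderiv ℝ u x (EuclideanSpace.single i 1))) (vol Ω) := fun i ↦
    (Lp.memLp (toL2 w)).integrable_mul
      ((memLp_fderiv_vol hu hcu (EuclideanSpace.single i 1)).const_mul (e i))
  have h1 : ∫ x in (Ω : Set (Space N)), toL2 w x * fderiv ℝ u x e =
      ∑ i, e i * dualOfLp (memLp_fderiv_vol (Ω := Ω) hu hcu (EuclideanSpace.single i 1)) w := by
    simp only [fderiv_apply_eq_sum u _ e, Finset.mul_sum, dualOfLp_apply]
    rw [integral_finsetSum _ fun i _ ↦ hi i]
    refine Finset.sum_congr rfl fun i _ ↦ ?_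
    rw [← integral_const_mul]
    congr 1
    ext x
    ring
  rw [h1]
  refine (Finset.abs_sum_le_sum_abs _ _).trans ?_
  have h2 : ∀ i : Fin N, |e i * dualOfLp (memLp_fderiv_vol (Ω := Ω) hu hcu
      (EuclideanSpace.single i 1)) w| ≤ ‖w‖ * ‖smoothEGrad Ω hu hcu‖ := by
    intro i
    have h3 : |e i| ≤ 1 := he ▸ PiLp.norm_apply_le e i
    have h4 := (dualOfLp (memLp_fderiv_vol (Ω := Ω) hu hcu (EuclideanSpace.single i 1))).le_opNorm w
    have h5 := norm_dualOfLp_fderiv_le hd hu hcu i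
    rw [Real.norm_eq_abs] at h4
    rw [abs_mul]
    have h6 := mul_le_mul_of_nonneg_right h5 (norm_nonneg w)
    nlinarith [abs_nonneg (dualOfLp (memLp_fderiv_vol (Ω := Ω) hu hcu
      (EuclideanSpace.single i 1)) w)]
  refine (Finset.sum_le_sum fun i _ ↦ h2 i).trans ?_
  rw [Finset.sum_const, Finset.card_univ, Fintype.card_fin, nsmul_eq_mul]

lemma integrable_mul_of_smooth {f g : Space N → ℝ} (hf : ContDiff ℝ ∞ f) (hc : HasCompactSupport f)
    (hg : MemLp g 2 (vol Ω)) : Integrable (fun x ↦ f x * g x) (vol Ω) :=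
  (memLp_two_of_smooth hf hc).integrable_mul hg

lemma norm_incl_le (w : EGrad Ω) : ‖EGrad.incl Ω w‖ ≤ ‖w‖ := by
  rw [EGrad.norm_def]
  linarith [Finset.sum_nonneg fun i (_ : i ∈ Finset.univ) ↦
    dualDerivNorm_nonneg (EGrad.incl Ω w) i]

/-- The trace estimate in a chart: the integral of `η u²` over the boundary is the integral over
`Ω` of `∂_ν(η u²) = 2 η u ∂_ν u + (∂_ν η) u²`. -/
lemma IsTraceChart.exists_lintegral_le (hN : N ≠ 0) (hd : DenseRange (testLin Ω)) {p : Space N}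
    {r : ℝ} {G : Set (Space N)} {ν : Space N} {c : ℝ} {L : ℝ≥0} (h : IsTraceChart Ω p r G ν c L)
    {η : Space N → ℝ} (hη : ContDiff ℝ ∞ η) (hc : HasCompactSupport η)
    (hs : tsupport η ⊆ Metric.ball p r) (h0 : ∀ x, 0 ≤ η x) :
    ∃ C : ℝ≥0, ∀ (u : Space N → ℝ) (hu : ContDiff ℝ ∞ u) (hcu : HasCompactSupport u),
      ∫⁻ x, ENNReal.ofReal (η x * u x ^ 2) ∂(surface Ω) ≤ C * ‖smoothEGrad Ω hu hcu‖ₑ ^ 2 := by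
  have hν := h.isChart.isUpCone.norm_eq
  have hη' : ContDiff ℝ ∞ fun x ↦ fderiv ℝ η x ν := contDiff_fderiv_apply hη ν
  have hc' : HasCompactSupport fun x ↦ fderiv ℝ η x ν := hc.fderiv_apply ℝ ν
  obtain ⟨C₁, hC₁, h1⟩ := exists_norm_smoothHHalf_mul_le (Ω := Ω) hN hη hc
  obtain ⟨C₂, hC₂, h2⟩ := exists_norm_smoothHHalf_mul_le (Ω := Ω) hN hη' hc'
  refine ⟨L * (2 * (N * C₁) + C₂).toNNReal, fun u hu hcu ↦ ?_⟩
  set E := ‖smoothEGrad Ω hu hcu‖ with hE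
  have hE0 : 0 ≤ E := norm_nonneg _
  have hUE : ‖smoothHHalf Ω u hu hcu‖ ≤ E := norm_incl_le (smoothEGrad Ω hu hcu)
  have hηu := hη.mul hu
  have hg : ContDiff ℝ ∞ fun x ↦ (η x * u x) * u x := hηu.mul hu
  have hcg : HasCompactSupport fun x ↦ (η x * u x) * u x := hcu.mul_left
  have hcηu : HasCompactSupport fun x ↦ η x * u x := hcu.mul_left
  -- the product rule for `∂_ν (η u²)`
  have e1 : ∫ x in (Ω : Set (Space N)), fderiv ℝ (fun x ↦ (η x * u x) * u x) x ν =
      2 * (∫ x in (Ω : Set (Space N)), toL2 (smoothHHalf Ω _ hηu hcηu) x * fderiv ℝ u x ν) +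
      ∫ x in (Ω : Set (Space N)),
        toL2 (smoothHHalf Ω (fun x ↦ fderiv ℝ η x ν * u x) (hη'.mul hu) hcu.mul_left) x * u x := by
    rw [setIntegral_toL2_smooth_mul, setIntegral_toL2_smooth_mul, ← integral_const_mul,
      ← integral_add ((integrable_mul_of_smooth hηu hcηu (memLp_fderiv_vol hu hcu ν)).const_mul 2)
      (integrable_mul_of_smooth (hη'.mul hu) hcu.mul_left (memLp_two_of_smooth hu hcu))]
    congr 1
    ext x
    rw [fderiv_mul_apply hηu hu, fderiv_mul_apply hη hu]
    ring
  -- `η u` is in `H^{1/2}(Ω)` with norm at most that of `u`, up to a constant, and is paired with `∂_ν u`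
  have e2 : |∫ x in (Ω : Set (Space N)), fderiv ℝ (fun x ↦ (η x * u x) * u x) x ν| ≤
      (2 * (N * C₁) + C₂) * E ^ 2 := by
    rw [e1]
    have a1 := abs_setIntegral_mul_fderiv_le hd hν (smoothHHalf Ω _ hηu hcηu) hu hcu
    have a2 := abs_setIntegral_toL2_mul_le (smoothHHalf Ω (fun x ↦ fderiv ℝ η x ν * u x)
      (hη'.mul hu) hcu.mul_left) hu hcu
    have a3 : ‖smoothHHalf Ω _ hηu hcηu‖ ≤ C₁ * E :=
      (h1 u hu hcu).trans (mul_le_mul_of_nonneg_left hUE hC₁)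
    have a4 : ‖smoothHHalf Ω (fun x ↦ fderiv ℝ η x ν * u x) (hη'.mul hu) hcu.mul_left‖ ≤ C₂ * E :=
      (h2 u hu hcu).trans (mul_le_mul_of_nonneg_left hUE hC₂)
    refine (abs_add_le _ _).trans ?_
    rw [abs_mul, abs_two]
    have a5 : (N : ℝ) * (‖smoothHHalf Ω _ hηu hcηu‖ * ‖smoothEGrad Ω hu hcu‖) ≤
        N * ((C₁ * E) * E) := by gcongr
    have a6 := mul_le_mul a4 hUE (norm_nonneg _) (mul_nonneg hC₂ hE0)
    nlinarith
  have e3 := h.lintegral_surface_le (fun x ↦ (η x * u x) * u x) hg hcg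
    (((tsupport_mul_subset' _ _).trans inter_subset_left).trans
      (((tsupport_mul_subset' _ _).trans inter_subset_left).trans hs))
    fun x ↦ by nlinarith [mul_nonneg (h0 x) (sq_nonneg (u x))]
  have e4 : ‖∫ x in (Ω : Set (Space N)), fderiv ℝ (fun x ↦ (η x * u x) * u x) x ν‖ₑ ≤
      (2 * (N * C₁) + C₂).toNNReal * ‖smoothEGrad Ω hu hcu‖ₑ ^ 2 := by
    rw [Real.enorm_eq_ofReal_abs]
    refine (ENNReal.ofReal_le_ofReal e2).trans ?_
    rw [ENNReal.ofReal_mul (by positivity), ENNReal.ofReal_pow hE0, hE, ofReal_norm]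
    rfl
  have e5 : ∀ x, η x * u x ^ 2 = (η x * u x) * u x := fun x ↦ by ring
  simp only [e5]
  refine e3.trans ?_
  rw [ENNReal.coe_mul, mul_assoc]
  gcongr

/-- The trace estimate: for `u ∈ 𝓓(Ω̄)`, the norm of `u` in `L²(Γ)` is controlled by its norm in
`E(∇; Ω)`. -/
lemma IsBoundedLipschitzDomain.exists_trace_bound (hN : N ≠ 0) (hΩ : IsBoundedLipschitzDomain Ω) :
    ∃ C : ℝ≥0, ∀ (u : Space N → ℝ) (hu : ContDiff ℝ ∞ u) (hcu : HasCompactSupport u),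
      ∫⁻ x, ‖u x‖ₑ ^ 2 ∂(surface Ω) ≤ C * ‖smoothEGrad Ω hu hcu‖ₑ ^ 2 := by
  have hd := hΩ.denseRange_testLin hN
  choose! r G ν c L hch using fun p (hp : p ∈ frontier (Ω : Set (Space N))) ↦
    hΩ.exists_traceChart hp
  have hcomp : IsCompact (frontier (Ω : Set (Space N))) :=
    Metric.isCompact_of_isClosed_isBounded isClosed_frontier
      ((Metric.isBounded_closure_iff.2 hΩ.1).subset frontier_subset_closure)
  obtain ⟨t, ht, htc⟩ := hcomp.elim_nhds_subcover (fun p ↦ Metric.ball p (r p))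
    fun p hp ↦ Metric.ball_mem_nhds p (hch p hp).isChart.pos
  obtain ⟨e⟩ : Nonempty (Fin t.card ≃ t) := ⟨t.equivFin.symm⟩
  obtain ⟨η, hη, hc, hs, h0, h1⟩ := exists_smooth_partition (ι := Fin t.card) isClosed_frontier
    (U := fun i ↦ Metric.ball (e i : Space N) (r (e i))) (fun i ↦ Metric.isOpen_ball)
    (fun i ↦ Metric.isBounded_ball) (K := frontier (Ω : Set (Space N))) (by
      intro x hx
      obtain ⟨p, hp, hxp⟩ := mem_iUnion₂.1 (htc hx)
      refine mem_iUnion.2 ⟨e.symm ⟨p, hp⟩, ?_⟩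
      simpa using hxp)
  choose C hC using fun i ↦ (hch _ (ht _ (e i).2)).exists_lintegral_le hN hd (hη i) (hc i) (hs i)
    (h0 i)
  refine ⟨∑ i, C i, fun u hu hcu ↦ ?_⟩
  have h2 : ∫⁻ x, ‖u x‖ₑ ^ 2 ∂(surface Ω) =
      ∫⁻ x, ∑ i, ENNReal.ofReal (η i x * u x ^ 2) ∂(surface Ω) := by
    refine setLIntegral_congr_fun isClosed_frontier.measurableSet fun x hx ↦ ?_
    rw [← ENNReal.ofReal_sum_of_nonneg fun i _ ↦ mul_nonneg (h0 i x) (sq_nonneg _),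
      ← Finset.sum_mul, h1 x hx, one_mul, ← enorm_pow, Real.enorm_of_nonneg (sq_nonneg _)]
  rw [h2, lintegral_finsetSum _ fun i _ ↦ by
    have := (hη i).continuous.measurable
    have := hu.continuous.measurable
    fun_prop]
  refine (Finset.sum_le_sum fun i _ ↦ hC i u hu hcu).trans ?_
  rw [← Finset.sum_mul, ENNReal.ofNNReal_finsetSum]

/-! ### The trace operator -/

lemma memLp_surface_of_bound {C : ℝ≥0}
    (hC : ∀ (u : Space N → ℝ) (hu : ContDiff ℝ ∞ u) (hcu : HasCompactSupport u),
      ∫⁻ x, ‖u x‖ₑ ^ 2 ∂(surface Ω) ≤ C * ‖smoothEGrad Ω hu hcu‖ₑ ^ 2) {u : Space N → ℝ}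
    (hu : ContDiff ℝ ∞ u) (hcu : HasCompactSupport u) : MemLp u 2 (surface Ω) := by
  refine ⟨hu.continuous.measurable.aestronglyMeasurable, ?_⟩
  have h1 : eLpNorm u 2 (surface Ω) ^ 2 < ⊤ := by
    rw [eLpNorm_two_sq]
    exact (hC u hu hcu).trans_lt (ENNReal.mul_lt_top ENNReal.coe_lt_top (by simp))
  exact (ENNReal.pow_lt_top_iff.1 h1).resolve_right (by simp)

/-- The restriction to the boundary, from `𝓓(ℝ^N)` to `L²(Γ)`. -/
noncomputable def boundaryLin (h : ∀ u : 𝓓((⊤ : Opens (Space N)), ℝ), MemLp u 2 (surface Ω)) :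
    𝓓((⊤ : Opens (Space N)), ℝ) →ₗ[ℝ] L2Boundary Ω where
  toFun u := (h u).toLp u
  map_add' u w := (h u).toLp_add (h w)
  map_smul' a u := (h u).toLp_const_smul a

/-- `γ` is a trace operator: it extends the restriction of smooth functions to the boundary. -/
def IsTrace (γ : EGrad Ω →L[ℝ] L2Boundary Ω) : Prop :=
  ∀ (u : Space N → ℝ) (hu : ContDiff ℝ ∞ u) (hcu : HasCompactSupport u),
    γ (smoothEGrad Ω hu hcu) =ᵐ[surface Ω] u

/-- The restriction to the boundary is continuous for the norm of `E(∇; Ω)` and is defined on a dense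
subspace, hence it extends. -/
lemma IsBoundedLipschitzDomain.exists_trace (hN : N ≠ 0) (hΩ : IsBoundedLipschitzDomain Ω) :
    ∃ γ : EGrad Ω →L[ℝ] L2Boundary Ω, IsTrace γ := by
  obtain ⟨C, hC⟩ := hΩ.exists_trace_bound hN
  have hm : ∀ u : 𝓓((⊤ : Opens (Space N)), ℝ), MemLp u 2 (surface Ω) := fun u ↦
    memLp_surface_of_bound hC u.contDiff u.hasCompactSupport
  have hb : ∀ u, ‖boundaryLin hm u‖ ≤ √C * ‖restrictLin Ω u‖ := by
    intro u
    have h1 := hC u u.contDiff u.hasCompactSupport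
    have h2 : ‖boundaryLin hm u‖ₑ ^ 2 ≤ C * ‖restrictLin Ω u‖ₑ ^ 2 := by
      rw [← eLpNorm_two_sq] at h1
      have h3 : ‖boundaryLin hm u‖ₑ = eLpNorm u 2 (surface Ω) := Lp.enorm_toLp (hm u)
      rw [h3]
      exact h1
    have h3 := norm_le_of_enorm_sq_le (ENNReal.mul_ne_top ENNReal.coe_ne_top (by simp)) h2
    rwa [ENNReal.toReal_mul, Real.sqrt_mul ENNReal.toReal_nonneg, ENNReal.toReal_pow, toReal_enorm,
      Real.sqrt_sq (norm_nonneg _)] at h3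
  refine ⟨(boundaryLin hm).extendOfNorm (restrictLin Ω), fun u hu hcu ↦ ?_⟩
  rw [smoothEGrad_eq_restrictLin, LinearMap.extendOfNorm_eq (hΩ.denseRange_restrictLin hN) ⟨_, hb⟩]
  exact (hm _).coeFn_toLp

end

section

variable {N : ℕ} {Ω : Opens (Space N)}

/-! ### Functions with vanishing trace -/

/-- Green's formula for a function with vanishing trace: in a chart, its vertical derivative is
represented by a functional on `H^{1/2}(Ω)` also against test functions that do not vanish at the
boundary. It follows by density from the formula `∫_Ω u ∂_νφ + ∫_Ω φ ∂_νu = ∫_Ω ∂_ν(u φ)`,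
the right-hand side being controlled by the integral of `|u φ|` over the boundary. -/
lemma IsTraceChart.abs_setIntegral_mul_fderiv_le_of_trace_eq_zero (hN : N ≠ 0)
    (hΩ : IsBoundedLipschitzDomain Ω) {p : Space N} {r : ℝ} {G : Set (Space N)} {ν : Space N}
    {c : ℝ} {L : ℝ≥0} (h : IsTraceChart Ω p r G ν c L) {γ : EGrad Ω →L[ℝ] L2Boundary Ω}
    (hγ : IsTrace γ) {v : EGrad Ω} (hv : γ v = 0) {φ : Space N → ℝ} (hφ : ContDiff ℝ ∞ φ)
    (hc : HasCompactSupport φ) (hs : tsupport φ ⊆ Metric.ball p r) :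
    |∫ x in (Ω : Set (Space N)), toL2 (EGrad.incl Ω v) x * fderiv ℝ φ x ν| ≤
      N * (‖smoothHHalf Ω φ hφ hc‖ * ‖v‖) := by
  have hd := hΩ.denseRange_testLin hN
  have hν := h.isChart.isUpCone.norm_eq
  let A : ℝ := ‖γ (smoothEGrad Ω hφ hc)‖
  -- an inequality with an additional trace term, which holds on the dense subspace `𝓓(Ω̄)` and is closed
  have key : ∀ w : EGrad Ω,
      |dualOfLp (memLp_fderiv_vol hφ hc ν) (EGrad.incl Ω w)| ≤
        N * (‖smoothHHalf Ω φ hφ hc‖ * ‖w‖) + A * ‖γ w‖ := by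
    intro w
    have hcont : Continuous (EGrad.incl Ω) :=
      (LinearMap.mkContinuous (EGrad.incl Ω) 1 fun w ↦ by
        rw [one_mul]
        exact norm_incl_le w).continuous
    refine (hΩ.denseRange_restrictLin hN).induction_on (p := fun w ↦
      |dualOfLp (memLp_fderiv_vol hφ hc ν) (EGrad.incl Ω w)| ≤
        N * (‖smoothHHalf Ω φ hφ hc‖ * ‖w‖) + A * ‖γ w‖) w (isClosed_le ?_ ?_) fun u ↦ ?_
    · exact ((ContinuousLinearMap.continuous _).comp hcont).abs
    · exact (continuous_const.mul (continuous_const.mul continuous_norm)).add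
        (continuous_const.mul γ.continuous.norm)
    · have hu := u.contDiff
      have hcu := u.hasCompactSupport
      change |dualOfLp (memLp_fderiv_vol hφ hc ν) (smoothHHalf Ω u hu hcu)| ≤
        N * (‖smoothHHalf Ω φ hφ hc‖ * ‖smoothEGrad Ω hu hcu‖) + A * ‖γ (smoothEGrad Ω hu hcu)‖
      rw [dualOfLp_apply]
      have e1 : ∫ x in (Ω : Set (Space N)), toL2 (smoothHHalf Ω u hu hcu) x * fderiv ℝ φ x ν =
          (∫ x in (Ω : Set (Space N)), fderiv ℝ (fun x ↦ φ x * u x) x ν) -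
          ∫ x in (Ω : Set (Space N)), toL2 (smoothHHalf Ω φ hφ hc) x * fderiv ℝ u x ν := by
        have i1 := integrable_mul_of_smooth (Ω := Ω) hu hcu (memLp_fderiv_vol hφ hc ν)
        have i2 := integrable_mul_of_smooth (Ω := Ω) hφ hc (memLp_fderiv_vol hu hcu ν)
        have e2 : ∀ x, fderiv ℝ (fun x ↦ φ x * u x) x ν =
            φ x * fderiv ℝ u x ν + u x * fderiv ℝ φ x ν := fun x ↦ by
          rw [fderiv_mul_apply hφ hu]
          ring
        rw [setIntegral_toL2_smooth_mul, setIntegral_toL2_smooth_mul]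
        simp only [e2]
        rw [integral_add i2 i1]
        ring
      have e3 : |∫ x in (Ω : Set (Space N)), fderiv ℝ (fun x ↦ φ x * u x) x ν| ≤
          A * ‖γ (smoothEGrad Ω hu hcu)‖ := by
        have e4 := h.enorm_integral_le (fun x ↦ φ x * u x) (hφ.mul hu) hcu.mul_left
          (((tsupport_mul_subset' _ _).trans inter_subset_left).trans hs)
        have e5 : ∫⁻ x, ‖φ x * u x‖ₑ ∂(surface Ω) ≤
            ‖γ (smoothEGrad Ω hφ hc)‖ₑ * ‖γ (smoothEGrad Ω hu hcu)‖ₑ := by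
          have e6 : ‖γ (smoothEGrad Ω hφ hc)‖ₑ = eLpNorm φ 2 (surface Ω) := by
            rw [Lp.enorm_def, eLpNorm_congr_ae (hγ φ hφ hc)]
          have e7 : ‖γ (smoothEGrad Ω hu hcu)‖ₑ = eLpNorm u 2 (surface Ω) := by
            rw [Lp.enorm_def, eLpNorm_congr_ae (hγ u hu hcu)]
          rw [e6, e7]
          have e8 := eLpNorm_smul_le_mul_eLpNorm (p := 2) (q := 2) (r := 1) (μ := surface Ω)
            hu.continuous.measurable.aestronglyMeasurable
            hφ.continuous.measurable.aestronglyMeasurable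
          rwa [eLpNorm_one_eq_lintegral_enorm] at e8
        have e9 := e4.trans e5
        rw [← enorm_norm, ← enorm_norm (γ _), ← enorm_norm (γ (smoothEGrad Ω hu hcu)),
          ← enorm_mul, Real.enorm_of_nonneg (norm_nonneg _),
          Real.enorm_of_nonneg (by positivity)] at e9
        exact (ENNReal.ofReal_le_ofReal_iff (by positivity)).1 e9
      rw [e1]
      have e10 := abs_setIntegral_mul_fderiv_le hd hν (smoothHHalf Ω φ hφ hc) hu hcu
      refine (abs_sub _ _).trans ?_
      linarith
  have h1 := key v
  rw [hv, norm_zero, mul_zero, add_zero, dualOfLp_apply] at h1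
  exact h1

/-- For a function with vanishing trace, a localisation `η v` extended by zero has a vertical
derivative bounded on `H^{1/2}(ℝ^N)`. -/
lemma IsTraceChart.exists_enorm_integral_sq_le (hN : N ≠ 0)
    (hΩ : IsBoundedLipschitzDomain Ω) {p : Space N} {r : ℝ} {G : Set (Space N)} {ν : Space N}
    {c : ℝ} {L : ℝ≥0} (h : IsTraceChart Ω p r G ν c L) {γ : EGrad Ω →L[ℝ] L2Boundary Ω}
    (hγ : IsTrace γ) {v : EGrad Ω} (hv : γ v = 0) {η : Space N → ℝ} (hη : ContDiff ℝ ∞ η)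
    (hc : HasCompactSupport η) (hs : tsupport η ⊆ Metric.ball p r) :
    ∃ M : ℝ≥0, ∀ φ : Space N → ℝ, ContDiff ℝ ∞ φ → HasCompactSupport φ →
      ‖∫ x, (η x * fn (EGrad.incl Ω v) x) * fderiv ℝ φ x ν‖ₑ ^ 2 ≤ M * hsq univ φ := by
  have hη' : ContDiff ℝ ∞ fun x ↦ fderiv ℝ η x ν := contDiff_fderiv_apply hη ν
  have hc' : HasCompactSupport fun x ↦ fderiv ℝ η x ν := hc.fderiv_apply ℝ ν
  obtain ⟨C₁, hC₁, h1⟩ := exists_norm_smoothHHalf_mul_le (Ω := Ω) hN hη hc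
  obtain ⟨C₂, hC₂, h2⟩ := exists_norm_smoothHHalf_mul_le (Ω := Ω) hN hη' hc'
  set w := EGrad.incl Ω v with hw
  let C : ℝ := N * (C₁ * ‖v‖) + ‖w‖ * C₂
  have hC0 : 0 ≤ C := by positivity
  refine ⟨(C ^ 2).toNNReal, fun φ hφ hcφ ↦ ?_⟩
  have e1 : ∫ x, (η x * fn w x) * fderiv ℝ φ x ν =
      (∫ x in (Ω : Set (Space N)), toL2 w x * fderiv ℝ (fun x ↦ η x * φ x) x ν) -
      ∫ x in (Ω : Set (Space N)), toL2 w x * (fderiv ℝ η x ν * φ x) := by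
    have i1 : Integrable (fun x ↦ toL2 w x * fderiv ℝ (fun x ↦ η x * φ x) x ν) (vol Ω) :=
      (Lp.memLp (toL2 w)).integrable_mul (memLp_fderiv_vol (hη.mul hφ) hcφ.mul_left ν)
    have i2 : Integrable (fun x ↦ toL2 w x * (fderiv ℝ η x ν * φ x)) (vol Ω) :=
      (Lp.memLp (toL2 w)).integrable_mul (memLp_two_of_smooth (hη'.mul hφ) hcφ.mul_left)
    have e2 : ∀ x, (η x * fn w x) * fderiv ℝ φ x ν = fn w x * (η x * fderiv ℝ φ x ν) :=
      fun x ↦ by ring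
    simp only [e2]
    rw [← setIntegral_toL2_mul, ← integral_sub i1 i2]
    congr 1
    ext x
    rw [fderiv_mul_apply hη hφ]
    ring
  have e3 : |∫ x, (η x * fn w x) * fderiv ℝ φ x ν| ≤ C * ‖smoothHHalf Ω φ hφ hcφ‖ := by
    rw [e1]
    have a1 := h.abs_setIntegral_mul_fderiv_le_of_trace_eq_zero hN hΩ hγ hv (hη.mul hφ)
      hcφ.mul_left (((tsupport_mul_subset' _ _).trans inter_subset_left).trans hs)
    have a2 := abs_setIntegral_toL2_mul_le w (hη'.mul hφ) (hcφ.mul_left (f := fun x ↦ fderiv ℝ η x ν))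
    have a3 : (N : ℝ) * (‖smoothHHalf Ω (fun x ↦ η x * φ x) (hη.mul hφ) hcφ.mul_left‖ * ‖v‖) ≤
        N * ((C₁ * ‖smoothHHalf Ω φ hφ hcφ‖) * ‖v‖) := by
      gcongr
      exact h1 φ hφ hcφ
    have a4 := mul_le_mul_of_nonneg_left (h2 φ hφ hcφ) (norm_nonneg w)
    refine (abs_sub _ _).trans ((add_le_add (a1.trans a3) (a2.trans a4)).trans_eq ?_)
    ring
  have e4 : ‖∫ x, (η x * fn w x) * fderiv ℝ φ x ν‖ₑ ≤
      ENNReal.ofReal C * ‖smoothHHalf Ω φ hφ hcφ‖ₑ := by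
    rw [Real.enorm_eq_ofReal_abs, ← ofReal_norm, ← ENNReal.ofReal_mul hC0]
    exact ENNReal.ofReal_le_ofReal e3
  calc _ ≤ (ENNReal.ofReal C * ‖smoothHHalf Ω φ hφ hcφ‖ₑ) ^ 2 := by gcongr
    _ = ENNReal.ofReal (C ^ 2) * hsq Ω φ := by
      rw [mul_pow, enorm_smooth_sq, ENNReal.ofReal_pow hC0]
    _ ≤ _ := mul_le_mul_right (hsq_mono (subset_univ _) φ) _

/-- Near the boundary, a function with vanishing trace satisfies Hardy's inequality. -/
lemma IsTraceChart.lintegral_inv_dist_lt_top (hN : N ≠ 0)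
    (hΩ : IsBoundedLipschitzDomain Ω) {p : Space N} {r : ℝ} {G : Set (Space N)} {ν : Space N}
    {c : ℝ} {L : ℝ≥0} (h : IsTraceChart Ω p r G ν c L) {γ : EGrad Ω →L[ℝ] L2Boundary Ω}
    (hγ : IsTrace γ) {v : EGrad Ω} (hv : γ v = 0) {η : Space N → ℝ} (hη : ContDiff ℝ ∞ η)
    (hc : HasCompactSupport η) (hs : tsupport η ⊆ Metric.ball p (r / 2)) :
    ∫⁻ x in (Ω : Set (Space N)), ENNReal.ofReal (Metric.infDist x (Ω : Set (Space N))ᶜ)⁻¹ *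
      ‖η x * fn (EGrad.incl Ω v) x‖ₑ ^ 2 < ⊤ := by
  have hr := h.isChart.pos
  have hG := h.isChart.isUpCone
  have hsub : Metric.ball p (r / 2) ⊆ Metric.ball p r := Metric.ball_subset_ball (by linarith)
  set w := EGrad.incl Ω v with hw
  have hfw := isHalf_fn w
  let f : Space N → ℝ := fun x ↦ η x * fn w x
  have hfm : Measurable f := hη.continuous.measurable.mul (measurable_fn w)
  have hη0 : ∀ x ∉ Metric.ball p (r / 2), η x = 0 := fun x hx ↦
    image_eq_zero_of_notMem_tsupport fun h ↦ hx (hs h)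
  have hfΩ : ∀ x ∉ (Ω : Set (Space N)), f x = 0 := fun x hx ↦ by
    change η x * fn w x = 0
    rw [fn_eq_zero w hx, mul_zero]
  have hfb : ∀ x, f x ≠ 0 → x ∈ Metric.ball p (r / 2) := fun x hx ↦ by
    by_contra hxb
    exact hx (by change η x * fn w x = 0; rw [hη0 x hxb, zero_mul])
  have hfG : ∀ x ∉ G, f x = 0 := fun x hx ↦ by
    by_contra hne
    have hxb := hsub (hfb x hne)
    have hxΩ : x ∈ (Ω : Set (Space N)) := by
      by_contra hxΩ
      exact hne (hfΩ x hxΩ)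
    exact hx (h.isChart.inter_eq.subset ⟨hxΩ, hxb⟩).1
  obtain ⟨C, hC⟩ := exists_hsq_localize hN hr hη hc hs
  have hGf : hsq G f ≠ ⊤ := ((hC Ω G Ω.isOpen.measurableSet hG.measurableSet h.isChart.inter_eq _
    hfw.measurable).trans_lt (ENNReal.mul_lt_top ENNReal.coe_lt_top hfw.hsq_ne_top.lt_top)).ne
  have hfH : IsHalf G f := ⟨hfm, hfG, hGf⟩
  obtain ⟨M, hM⟩ := h.exists_enorm_integral_sq_le hN hΩ hγ hv hη hc (hs.trans hsub)
  obtain ⟨B, hB⟩ := hG.sum_strip_le hN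
  have hsum := hB f hfm hfG (hfH.memLp hG.measurableSet) ⟨tsupport η, hc.isCompact, fun x hx ↦ by
    change η x * fn w x = 0
    rw [image_eq_zero_of_notMem_tsupport hx, zero_mul]⟩ M hM
  have hgag : gag G f ≠ ⊤ := ((gag_le_hsq _ _).trans_lt hGf.lt_top).ne
  -- a point of the support at distance less than `min(c, r/2) 2^{-k}` from the complement of `Ω` is within
  -- reach, in the chart, of a point outside `G`, hence in the layer of height `2^{-k}`
  have hmain := hG.lintegral_inv_dist_lt_top hfm (lTwo_lt_top_of_hsq hGf).ne
    (ENNReal.mul_ne_top ENNReal.coe_ne_top (ENNReal.add_ne_top.2 ⟨ENNReal.coe_ne_top, hgag⟩)) hsum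
    (d := fun x ↦ Metric.infDist x (Ω : Set (Space N))ᶜ) (κ := min c (r / 2))
    (lt_min hG.pos (by linarith)) (fun x hx hfx k hk ↦ by
      have hxb := hfb x hfx
      have hk0 : (0 : ℝ) < 2⁻¹ ^ k := by positivity
      have hk1 : (2⁻¹ : ℝ) ^ k ≤ 1 := pow_le_one₀ (by norm_num) (by norm_num)
      have hne : ((Ω : Set (Space N))ᶜ).Nonempty := nonempty_compl.2 (hΩ.ne_univ hN)
      refine (Metric.le_infDist hne).2 fun y hy ↦ ?_
      by_contra hlt
      rw [not_le, dist_comm, dist_eq_norm] at hlt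
      have h1 : ‖y - x‖ < c * 2⁻¹ ^ k :=
        hlt.trans_le (mul_le_mul_of_nonneg_right (min_le_left _ _) hk0.le)
      have h2 : ‖y - x‖ < r / 2 := by
        refine hlt.trans_le ((mul_le_mul_of_nonneg_right (min_le_right _ _) hk0.le).trans ?_)
        nlinarith
      have hyb : y ∈ Metric.ball p r := by
        rw [Metric.mem_ball] at hxb ⊢
        have h3 := dist_triangle y x p
        rw [dist_eq_norm y x] at h3
        linarith
      have hyG : y ∈ G := by
        by_contra hyG
        exact hk (hG.mem_strip hk0 hx h1 (by rwa [add_sub_cancel]))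
      exact hy (h.isChart.inter_eq.superset ⟨hyG, hyb⟩).1)
  have hz : ∀ A : Set (Space N), MeasurableSet A → (∀ x ∉ A, f x = 0) →
      ∫⁻ x in A, ENNReal.ofReal (Metric.infDist x (Ω : Set (Space N))ᶜ)⁻¹ * ‖f x‖ₑ ^ 2 =
      ∫⁻ x, ENNReal.ofReal (Metric.infDist x (Ω : Set (Space N))ᶜ)⁻¹ * ‖f x‖ₑ ^ 2 := by
    intro A hA h0
    refine setLIntegral_eq_of_support_subset fun x hx ↦ ?_
    by_contra hxA
    exact hx (by simp [h0 x hxA])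
  change ∫⁻ x in (Ω : Set (Space N)), ENNReal.ofReal (Metric.infDist x (Ω : Set (Space N))ᶜ)⁻¹ *
      ‖f x‖ₑ ^ 2 < ⊤
  rw [hz Ω Ω.isOpen.measurableSet hfΩ, ← hz G hG.measurableSet hfG]
  exact hmain

/-- A function with vanishing trace belongs to `H^{1/2}_{00}(Ω)`. -/
lemma IsBoundedLipschitzDomain.mem_HHalf00_of_trace_eq_zero (hN : N ≠ 0)
    (hΩ : IsBoundedLipschitzDomain Ω) {γ : EGrad Ω →L[ℝ] L2Boundary Ω} (hγ : IsTrace γ)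
    {v : EGrad Ω} (hv : γ v = 0) : EGrad.incl Ω v ∈ HHalf00 Ω := by
  have hne := hΩ.ne_univ hN
  set w := EGrad.incl Ω v with hw
  have hfw := isHalf_fn w
  let d : Space N → ℝ≥0∞ := fun x ↦
    ENNReal.ofReal (Metric.infDist x (Ω : Set (Space N))ᶜ)⁻¹
  have hdm : Measurable d := (Metric.continuous_infDist_pt _).measurable.inv.ennreal_ofReal
  rw [mem_HHalf00_iff hne]
  -- at interior points the weight is bounded, at boundary points a chart is used
  have hloc : ∀ p ∈ closure (Ω : Set (Space N)), ∃ r : ℝ, 0 < r ∧ ∀ η : Space N → ℝ,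
      ContDiff ℝ ∞ η → HasCompactSupport η → tsupport η ⊆ Metric.ball p r →
      ∫⁻ x in (Ω : Set (Space N)), d x * ‖η x * fn w x‖ₑ ^ 2 < ⊤ := by
    intro p hp
    by_cases hpΩ : p ∈ (Ω : Set (Space N))
    · obtain ⟨r, hr, hball⟩ := Metric.isOpen_iff.1 Ω.isOpen p hpΩ
      refine ⟨r / 2, by positivity, fun η hη hc hs ↦ ?_⟩
      obtain ⟨M, hM⟩ := hη.continuous.bounded_above_of_compact_support hc
      have h1 : ∀ x, d x * ‖η x * fn w x‖ₑ ^ 2 ≤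
          ENNReal.ofReal (r / 2)⁻¹ * ENNReal.ofReal M ^ 2 * ‖fn w x‖ₑ ^ 2 := by
        intro x
        rw [enorm_mul, mul_pow, mul_assoc]
        by_cases hx : x ∈ Metric.ball p (r / 2)
        · have h2 : r / 2 ≤ Metric.infDist x (Ω : Set (Space N))ᶜ := by
            refine (Metric.le_infDist (nonempty_compl.2 hne)).2 fun y hy ↦ ?_
            by_contra hlt
            refine hy (hball ?_)
            rw [Metric.mem_ball] at hx ⊢
            rw [not_le, dist_comm] at hlt
            linarith [dist_triangle y x p]
          have h3 : ‖η x‖ₑ ≤ ENNReal.ofReal M := by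
            rw [← ofReal_norm]
            exact ENNReal.ofReal_le_ofReal (hM x)
          have h4 : d x ≤ ENNReal.ofReal (r / 2)⁻¹ :=
            ENNReal.ofReal_le_ofReal (inv_anti₀ (by positivity) h2)
          gcongr
        · have h2 : η x = 0 := image_eq_zero_of_notMem_tsupport fun h ↦ hx (hs h)
          simp [h2]
      refine (lintegral_mono h1).trans_lt ?_
      rw [lintegral_const_mul _ (hfw.measurable.enorm.pow_const 2), ← lTwo_sq]
      exact ENNReal.mul_lt_top (ENNReal.mul_lt_top ENNReal.ofReal_lt_top (by simp))
        (ENNReal.pow_lt_top (lTwo_lt_top_of_hsq hfw.hsq_ne_top))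
    · have hpf : p ∈ frontier (Ω : Set (Space N)) := by
        rw [Ω.isOpen.frontier_eq]
        exact ⟨hp, hpΩ⟩
      obtain ⟨r, G, ν, c, L, h⟩ := hΩ.exists_traceChart hpf
      exact ⟨r / 2, by linarith [h.isChart.pos], fun η hη hc hs ↦
        h.lintegral_inv_dist_lt_top hN hΩ hγ hv hη hc hs⟩
  choose! r hr hloc using hloc
  have hcomp : IsCompact (closure (Ω : Set (Space N))) := hΩ.1.isCompact_closure
  obtain ⟨t, ht, htc⟩ := hcomp.elim_nhds_subcover (fun p ↦ Metric.ball p (r p))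
    fun p hp ↦ Metric.ball_mem_nhds p (hr p hp)
  obtain ⟨e⟩ : Nonempty (Fin t.card ≃ t) := ⟨t.equivFin.symm⟩
  obtain ⟨η, hη, hc, hs, -, h1⟩ := exists_smooth_partition (ι := Fin t.card) isClosed_closure
    (U := fun i ↦ Metric.ball (e i : Space N) (r (e i))) (fun i ↦ Metric.isOpen_ball)
    (fun i ↦ Metric.isBounded_ball) (K := closure (Ω : Set (Space N))) (by
      intro x hx
      obtain ⟨p, hp, hxp⟩ := mem_iUnion₂.1 (htc hx)
      refine mem_iUnion.2 ⟨e.symm ⟨p, hp⟩, ?_⟩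
      simpa using hxp)
  have h2 : ∀ x ∈ (Ω : Set (Space N)), d x * ‖fn w x‖ₑ ^ 2 ≤
      t.card * ∑ i, d x * ‖η i x * fn w x‖ₑ ^ 2 := by
    intro x hx
    have h3 : fn w x = ∑ i, η i x * fn w x := by
      rw [← Finset.sum_mul, h1 x (subset_closure hx), one_mul]
    have h4 : ‖fn w x‖ₑ ^ 2 ≤ t.card * ∑ i, ‖η i x * fn w x‖ₑ ^ 2 := by
      conv_lhs => rw [h3]
      have h5 : ‖∑ i, η i x * fn w x‖ₑ ≤ ∑ i, ‖η i x * fn w x‖ₑ := enorm_sum_le _ _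
      refine (pow_le_pow_left' h5 2).trans ?_
      have h6 := ennreal_sum_weight_sq_le Finset.univ (fun _ ↦ 1) fun i ↦ ‖η i x * fn w x‖ₑ
      simpa only [one_mul, Finset.sum_const, Finset.card_univ, Fintype.card_fin, nsmul_eq_mul,
        mul_one] using h6
    rw [← Finset.mul_sum, mul_left_comm]
    exact mul_le_mul_right h4 _
  refine (setLIntegral_mono' Ω.isOpen.measurableSet h2).trans_lt ?_
  have hmeas : ∀ i, Measurable fun x ↦ d x * ‖η i x * fn w x‖ₑ ^ 2 := fun i ↦ by
    have := (hη i).continuous.measurable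
    have := measurable_fn w
    fun_prop
  rw [lintegral_const_mul _ (Finset.measurable_sum _ fun i _ ↦ hmeas i),
    lintegral_finsetSum _ fun i _ ↦ hmeas i]
  exact ENNReal.mul_lt_top (by simp) (ENNReal.sum_lt_top.2 fun i _ ↦
    hloc _ (ht _ (e i).2) (η i) (hη i) (hc i) (hs i))

/-- The trace vanishes on the closure of `𝓓(Ω)`. -/
lemma IsTrace.eq_zero_of_mem_closure {γ : EGrad Ω →L[ℝ] L2Boundary Ω} (hγ : IsTrace γ)
    {w : EGrad Ω} (hw : w ∈ closure (testEGrad Ω : Set (EGrad Ω))) : γ w = 0 := by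
  have h : (testEGrad Ω : Set (EGrad Ω)) ⊆ γ ⁻¹' {0} := by
    rintro _ ⟨f, hf, hc, hs, rfl⟩
    refine Lp.ext ((hγ f hf hc).trans ?_)
    have h0 : f =ᵐ[surface Ω] 0 := by
      filter_upwards [ae_restrict_mem (μ := Measure.euclideanHausdorffMeasure (N - 1))
        (s := frontier (Ω : Set (Space N))) isClosed_frontier.measurableSet] with x hx
      refine image_eq_zero_of_notMem_tsupport fun h ↦ ?_
      rw [Ω.isOpen.frontier_eq] at hx
      exact hx.2 (hs h)
    exact h0.trans (Lp.coeFn_zero _ _ _).symm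
  exact closure_minimal h (isClosed_singleton.preimage γ.continuous) hw

end

end HalfTrace

theorem mainTheorem1 (N : ℕ) (hN : 2 ≤ N)
    (Ω : TopologicalSpace.Opens (EuclideanSpace ℝ (Fin N)))
    (hΩ : HalfTrace.IsBoundedLipschitzDomain Ω) :
    ∃ γ₀ : HalfTrace.EGrad Ω →L[ℝ] HalfTrace.L2Boundary Ω,
      (HalfTrace.ExtendsRestriction γ₀ ∧
        ∀ γ : HalfTrace.EGrad Ω →L[ℝ] HalfTrace.L2Boundary Ω,
          HalfTrace.ExtendsRestriction γ → γ = γ₀) ∧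
      (γ₀ : HalfTrace.EGrad Ω →ₗ[ℝ] HalfTrace.L2Boundary Ω).ker.map (HalfTrace.EGrad.incl Ω) =
        HalfTrace.HHalf00 Ω ∧
      ∀ v ∈ HalfTrace.HHalf00 Ω, ∃ w : HalfTrace.EGrad Ω,
        HalfTrace.EGrad.incl Ω w = v ∧ γ₀ w = 0 := by
  have hN0 : N ≠ 0 := by omega
  obtain ⟨γ₀, hγ₀⟩ := hΩ.exists_trace hN0
  have h00 : ∀ v ∈ HalfTrace.HHalf00 Ω, ∃ w : HalfTrace.EGrad Ω,
      HalfTrace.EGrad.incl Ω w = v ∧ γ₀ w = 0 := by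
    intro v hv
    obtain ⟨w, hw, hw'⟩ := hΩ.exists_mem_closure_testEGrad hN0 (hΩ.hsq_univ_ne_top hN0 hv)
    exact ⟨w, hw, HalfTrace.IsTrace.eq_zero_of_mem_closure hγ₀ hw'⟩
  refine ⟨γ₀, ⟨fun u ↦ ⟨HalfTrace.restrictLin Ω u, rfl,
    hγ₀ u u.contDiff u.hasCompactSupport⟩, fun γ hγ ↦ ?_⟩, ?_, h00⟩
  · apply DFunLike.coe_injective
    refine (hΩ.denseRange_restrictLin hN0).equalizer γ.continuous γ₀.continuous
      (funext fun u ↦ ?_)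
    obtain ⟨w, hw, hw'⟩ := hγ u
    obtain rfl : w = HalfTrace.restrictLin Ω u := HalfTrace.EGrad.incl_injective hw
    exact MeasureTheory.Lp.ext (hw'.trans (hγ₀ u u.contDiff u.hasCompactSupport).symm)
  · ext v
    rw [Submodule.mem_map]
    constructor
    · rintro ⟨w, hw, rfl⟩
      exact hΩ.mem_HHalf00_of_trace_eq_zero hN0 hγ₀ hw
    · intro hv
      obtain ⟨w, hw, hw'⟩ := h00 v hv
      exact ⟨w, hw', hw⟩
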